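/- Let $G=(V,E)$ be a finite directed acyclic graph (DAG) with $n$ vertices and $m$ edges. All paths are directed and have at least one edge. A \emph{$d$-dimensional weak dominance drawing} of $G$ consists of $d$ topological orders of $G$ (the dimensions): each dimension $D$ gives the vertices pairwise distinct natural-number coordinates, with $D(u)<D(v)$ for every edge $(u,v)$. A \emph{falsely implied path (fip)} of the drawing is a pair $(u,v)$ such that $D(u)<D(v)$ for every dimension $D$ but there is no path from $u$ to $v$. The drawing is a \emph{dominance drawing} if, for all $u,v$, one has $D(u)<D(v)$ for every dimension $D$ if and only if there is a path from $u$ to $v$. The \emph{dominance dimension} of $G$ is the least $d$ such that $G$ has a $d$-dimensional dominance drawing. A \emph{(path-based) module} of $G$ is a non-empty $M\subseteq V$ such that for all $v_1,v_2\in M$ and $u\in V\setminus M$: there is a path from $v_1$ to $u$ iff there is one from $v_2$ to $u$, and there is a path from $u$ to $v_1$ iff there is one from $u$ to $v_2$. The nodes of the \emph{modular decomposition tree} of $G$ are the strong modules, that is, the modules $M$ such that every module contains $M$, is contained in $M$, or is disjoint from $M$; the children of $M$ are the maximal strong modules properly contained in $M$. Let $k$ be the maximum number of children of a node of this tree. Algorithms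 are programs for the word RAM (unit-cost assignments, additions, subtractions, multiplications, indirect memory accesses and comparisons, on words of $O(\log(n+m+2))$ bits, where the implied factor may depend on the program). The input consists of $n$, $m$ and a list of the edges in any order, on vertices $0,\dots,n-1$; memory is otherwise zero. \textbf{Corollary.} (1) There is a constant $C$ such that for every constant $d\in\mathbb N$ there is an algorithm that, for every DAG $G$, tests whether the dominance dimension of $G$ is $d$ in at most $C\,(nm+n\,d\,k^2(k!)^d+1)$ steps; that is, in $O(nm+n\,d\,k^2(k!)^d)$ time, the summand $1$ being needed only when that expression is $0$. (2) In particular, there is an algorithm that decides whether a DAG $G$ has dominance dimension $3$ in $O(nm+n\,k^2(k!)^3+1)$ time. (3) For every DAG $G$ and every $d\ge 1$, the dominance dimension of $G$ is $d$ if and only if the minimum number of fips of a weak dominance drawing of $G$ is $0$ in $d$ dimensions but is not $0$ in $d-1$ dimensions. -/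

import Mathlib

namespace DomDim

/-! ### Directed acyclic graphs, drawings, dominance dimension -/

/-- There is a directed path (with at least one edge) from `u` to `v`. -/
def Reaches {V : Type*} (G : Digraph V) (u v : V) : Prop :=
  Relation.TransGen G.Adj u v

/-- `G` has no directed cycle (in particular no loop). -/
def IsDAG {V : Type*} (G : Digraph V) : Prop :=
  ∀ v, ¬ Reaches G v v

/-- A `d`-dimensional weak dominance drawing of `G`: each of the `d` dimensions is a topological
order of the vertices, given by pairwise distinct coordinates that increase along every edge. -/
structure WeakDrawing {V : Type*} (G : Digraph V) (d : ℕ) where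
  /-- `coord D v` is the coordinate of the vertex `v` in the dimension `D`. -/
  coord : Fin d → V → ℕ
  injective : ∀ D, Function.Injective (coord D)
  topological : ∀ D u v, G.Adj u v → coord D u < coord D v

/-- `u` is below `v` in every dimension of the drawing. -/
def WeakDrawing.Below {V : Type*} {G : Digraph V} {d : ℕ} (Γ : WeakDrawing G d) (u v : V) : Prop :=
  ∀ D, Γ.coord D u < Γ.coord D v

/-- A dominance drawing: `u` is below `v` in every dimension if and only if there is a path
from `u` to `v`. -/
def WeakDrawing.IsDominance {V : Type*} {G : Digraph V} {d : ℕ} (Γ : WeakDrawing G d) : Prop :=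
  ∀ u v, Γ.Below u v ↔ Reaches G u v

/-- The falsely implied paths (fips) of a drawing: the pairs `(u, v)` with `u` below `v` in every
dimension but without a path from `u` to `v`. (If `d ≥ 1` there is no path from `v` to `u` either,
since every dimension is a topological order.) -/
def WeakDrawing.fips {V : Type*} {G : Digraph V} {d : ℕ} (Γ : WeakDrawing G d) : Set (V × V) :=
  {p | Γ.Below p.1 p.2 ∧ ¬ Reaches G p.1 p.2}

/-- The minimum number of fips of a `d`-dimensional weak dominance drawing of `G`. -/
noncomputable def minFips {V : Type*} (G : Digraph V) (d : ℕ) : ℕ :=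
  sInf (Set.range fun Γ : WeakDrawing G d => Γ.fips.ncard)

/-- `d` is the dominance dimension of `G`: the least number of dimensions of a dominance drawing. -/
def HasDominanceDimension {V : Type*} (G : Digraph V) (d : ℕ) : Prop :=
  IsLeast {e : ℕ | ∃ Γ : WeakDrawing G e, Γ.IsDominance} d

/-! ### The (path-based) modular decomposition tree -/

/-- A (path-based) module: a non-empty vertex set whose members are reached from the same vertices
outside the set, and reach the same vertices outside the set. -/
def IsModule {V : Type*} (G : Digraph V) (M : Finset V) : Prop :=
  M.Nonempty ∧ ∀ v₁ ∈ M, ∀ v₂ ∈ M, ∀ u ∉ M,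
    (Reaches G v₁ u ↔ Reaches G v₂ u) ∧ (Reaches G u v₁ ↔ Reaches G u v₂)

/-- The nodes of the modular decomposition tree are the strong modules: the modules that overlap
no other module. The root is the set of all vertices, the leaves are the singletons. -/
def IsTreeNode {V : Type*} (G : Digraph V) (M : Finset V) : Prop :=
  IsModule G M ∧ ∀ N, IsModule G N → M ⊆ N ∨ N ⊆ M ∨ Disjoint M N

/-- `N` is a child of `M` in the modular decomposition tree: a maximal node properly inside `M`. -/
def IsChild {V : Type*} (G : Digraph V) (M N : Finset V) : Prop :=
  Maximal (fun N => IsTreeNode G N ∧ N ⊂ M) N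

open Classical in
/-- The maximum degree (number of children) of a node of the modular decomposition tree. -/
noncomputable def maxDegree {V : Type*} [Fintype V] (G : Digraph V) : ℕ :=
  (Finset.univ.filter (IsTreeNode G)).sup fun M => (Finset.univ.filter (IsChild G M)).card

/-! ### The word RAM, with structured control flow -/

/-- The arithmetical operations on words; `sub` is truncated subtraction. -/
inductive Op
  | add
  | sub
  | mul

/-- The value of an operation. -/
def Op.eval : Op → ℕ → ℕ → ℕ
  | .add, a, b => a + b
  | .sub, a, b => a - b
  | .mul, a, b => a * b

/-- Programs. Registers and arrays are numbered; a program mentions finitely many of them. -/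
inductive Prog
  /-- register `x` := the constant `v` -/
  | const (x v : ℕ)
  /-- register `x` := (register `y`) `o` (register `z`) -/
  | arith (o : Op) (x y z : ℕ)
  /-- register `x` := entry of array `a` at the index held in register `y` -/
  | load (x a y : ℕ)
  /-- entry of array `a` at the index held in register `x` := register `y` -/
  | store (a x y : ℕ)
  /-- `p`, then `q` -/
  | seq (p q : Prog)
  /-- if register `x` < register `y` then `p` else `q` -/
  | ite (x y : ℕ) (p q : Prog)
  /-- while register `x` < register `y` do `p` -/
  | loop (x y : ℕ) (p : Prog)

/-- The contents of the registers and of the arrays. -/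
structure Store where
  reg : ℕ → ℕ
  arr : ℕ → ℕ → ℕ

/-- Write `v` to register `x`. -/
def Store.setReg (s : Store) (x v : ℕ) : Store :=
  { s with reg := Function.update s.reg x v }

/-- Write `v` to array `a` at index `i`. -/
def Store.setArr (s : Store) (a i v : ℕ) : Store :=
  { s with arr := Function.update s.arr a (Function.update (s.arr a) i v) }

/-- `Exec W p s s' t`: started on the contents `s`, the program `p` halts after exactly `t` steps
with the contents `s'`, and every computed value is less than `W`. Each assignment and each
test of a branch or loop is one step. An execution that would produce a value of at least `W` is
stuck, so a word holds `log W` bits. -/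
inductive Exec (W : ℕ) : Prog → Store → Store → ℕ → Prop
  | const {s : Store} {x v : ℕ} (h : v < W) : Exec W (.const x v) s (s.setReg x v) 1
  | arith {s : Store} {o : Op} {x y z : ℕ} (h : o.eval (s.reg y) (s.reg z) < W) :
      Exec W (.arith o x y z) s (s.setReg x (o.eval (s.reg y) (s.reg z))) 1
  | load {s : Store} {x a y : ℕ} :
      Exec W (.load x a y) s (s.setReg x (s.arr a (s.reg y))) 1
  | store {s : Store} {a x y : ℕ} :
      Exec W (.store a x y) s (s.setArr a (s.reg x) (s.reg y)) 1
  | seq {s s' s'' : Store} {p q : Prog} {t t' : ℕ} (hp : Exec W p s s' t)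
      (hq : Exec W q s' s'' t') : Exec W (.seq p q) s s'' (t + t')
  | ite_true {s s' : Store} {x y : ℕ} {p q : Prog} {t : ℕ} (h : s.reg x < s.reg y)
      (hp : Exec W p s s' t) : Exec W (.ite x y p q) s s' (t + 1)
  | ite_false {s s' : Store} {x y : ℕ} {p q : Prog} {t : ℕ} (h : ¬ s.reg x < s.reg y)
      (hq : Exec W q s s' t) : Exec W (.ite x y p q) s s' (t + 1)
  | loop_done {s : Store} {x y : ℕ} {p : Prog} (h : ¬ s.reg x < s.reg y) :
      Exec W (.loop x y p) s s 1
  | loop_step {s s' s'' : Store} {x y : ℕ} {p : Prog} {t t' : ℕ} (h : s.reg x < s.reg y)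
      (hp : Exec W p s s' t) (hl : Exec W (.loop x y p) s' s'' t') :
      Exec W (.loop x y p) s s'' (t + t' + 1)

/-- The list `es` contains each edge of `G` exactly once (in any order). -/
def ListsEdges {n : ℕ} (G : Digraph (Fin n)) (es : List (Fin n × Fin n)) : Prop :=
  es.Nodup ∧ ∀ u v, (u, v) ∈ es ↔ G.Adj u v

/-- The input: register 0 holds the number of vertices, register 1 the number of edges, array 0
the tails and array 1 the heads of the edges. Everything else is zero. -/
def inputStore (n : ℕ) (es : List (Fin n × Fin n)) : Store where
  reg
    | 0 => n
    | 1 => es.length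
    | _ => 0
  arr
    | 0 => fun i => (es.map fun e => (e.1 : ℕ)).getD i 0
    | 1 => fun i => (es.map fun e => (e.2 : ℕ)).getD i 0
    | _ => fun _ => 0

/-- The program `P` decides the property `Q` of DAGs in time `T n m k`, on words of
`O(log (n + m + 2))` bits (with `c` as the implied factor), where `n` is the number of vertices,
`m` the number of edges and `k` the maximum degree of the modular decomposition tree. The answer is
left in register 0. -/
def Decides (P : Prog) (c : ℕ) (Q : ∀ {n : ℕ}, Digraph (Fin n) → Prop) (T : ℕ → ℕ → ℕ → ℕ) :
    Prop :=
  ∀ (n : ℕ) (G : Digraph (Fin n)), IsDAG G → ∀ es : List (Fin n × Fin n), ListsEdges G es →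
    ∃ (s : Store) (t : ℕ),
      Exec ((n + es.length + 2) ^ c) P (inputStore n es) s t ∧
      t ≤ T n es.length (maxDegree G) ∧
      (Q G → s.reg 0 = 1) ∧ (¬ Q G → s.reg 0 = 0)

end DomDim

/-! A dominance drawing in `d` dimensions is the same thing as a way of writing the reachability
order `R` as the intersection of `d` linear orders, and for `d ≥ 1` such drawings persist when a
dimension is repeated. Hence the dimension is `d` if and only if `R` is realizable in `d` but not in
`d - 1` dimensions. Part (3) is this equivalence together with the remark that a weak drawing
without fips is a dominance drawing.

For the algorithms, realizability in `e ≥ 1` dimensions is compatible with modules: lexicographic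
composition shows that an order is realizable if and only if a quotient by modules and each of the
modules are (`realizable_iff_fibers`, `realizable_iff_of_mod`). So it suffices to cut the order into
at most `2 n` small pieces and to search each piece exhaustively; a piece with `r` elements has
`(r!) ^ e` tuples of linear orders, each checked in `O(e r ^ 2)` steps. The pieces have at most `k`
elements because they are tight: a module with two elements of a piece contains the whole piece. In
the smallest strong module that contains a tight set, no child contains two of its elements, so the
elements lie in different children (`card_le_maxDegree`).

The modular decomposition tree is never built. The algorithm maintains a partition of the vertices
into modules. It takes a class `X`, separates a minimal vertex `v` of `X` and refines the partition
until the classes inside `X` are the maximal modules that avoid `v`. Representatives of these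
classes form a quotient `S` rooted at `v`: modules of `S` that avoid `v` are trivial. In `S` take an
element `u` that is maximal above `v` (if there is none, `S` has only two elements), and let `B` be
the set of those `z` for which every module with `v` and `z` contains `u`. Then `S \ B` is a module,
so `S` splits into the piece `B ∪ {v}` and the set `S \ B`, which is again rooted at `v` and is
treated in the same way. A module with two elements of `B ∪ {v}` contains `v` and `u`, and its
complement in `S` is empty or one isolated element (`IsLevel.isolated`). If such an element belongs
to the piece, it is split off as a piece with two elements; what remains is tight.

Computing the transitive closure takes `O(n m + n ^ 2)` steps and the decomposition, by amortization
over ranges and over new classes, `O(n ^ 2)`. Finally `n ≤ 2 m + k`, since isolated vertices are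
children of the root (`card_le_edges_add_maxDegree`); this bounds `n ^ 2` by `2 n m + n k`.

The programs are written in a language with expressions and `while`, are verified there by rules for
total correctness with time, and are translated to the word RAM with a constant factor
(`Cmd.code_correct`). -/

set_option linter.unusedSimpArgs false

namespace DomDim

/-! ### A small imperative language with expressions, compiled to the word RAM -/

/-- Expressions over registers and arrays. -/
inductive Ex
  | lit (v : ℕ)
  | var (x : ℕ)
  | get (a : ℕ) (i : Ex)
  | bin (o : Op) (e f : Ex)

namespace Ex

instance : Add Ex := ⟨Ex.bin .add⟩
instance : Sub Ex := ⟨Ex.bin .sub⟩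
instance : Mul Ex := ⟨Ex.bin .mul⟩

/-- The value of an expression. -/
def eval (s : Store) : Ex → ℕ
  | lit v => v
  | var x => s.reg x
  | get a i => s.arr a (i.eval s)
  | bin o e f => o.eval (e.eval s) (f.eval s)

/-- Every literal and every intermediate result of the expression is less than `W`. -/
def Fits (W : ℕ) (s : Store) : Ex → Prop
  | lit v => v < W
  | var _ => True
  | get _ i => i.Fits W s
  | bin o e f => e.Fits W s ∧ f.Fits W s ∧ o.eval (e.eval s) (f.eval s) < W

/-- The number of instructions of the compiled expression. -/
def size : Ex → ℕ
  | lit _ => 1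
  | var _ => 1
  | get _ i => i.size + 1
  | bin _ e f => e.size + f.size + 1

/-- The expression uses only registers below `60`. -/
def wf : Ex → Bool
  | lit _ => true
  | var x => Nat.blt x 60
  | get _ i => i.wf
  | bin _ e f => e.wf && f.wf

/-- Code that computes the expression into register `b`, with scratch registers from `b` on;
register `60` holds zero. -/
def code : Ex → ℕ → Prog
  | lit v, b => .const b v
  | var x, b => .arith .add b x 60
  | get a i, b => .seq (i.code b) (.load b a b)
  | bin o e f, b => .seq (e.code b) (.seq (f.code (b + 1)) (.arith o b b (b + 1)))

section
variable (s : Store) (W : ℕ) (e f : Ex)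
@[simp] theorem eval_lit (v : ℕ) : (lit v).eval s = v := rfl
@[simp] theorem eval_var (x : ℕ) : (var x).eval s = s.reg x := rfl
@[simp] theorem eval_get (a : ℕ) : (get a e).eval s = s.arr a (e.eval s) := rfl
@[simp] theorem eval_add : (e + f).eval s = e.eval s + f.eval s := rfl
@[simp] theorem eval_sub : (e - f).eval s = e.eval s - f.eval s := rfl
@[simp] theorem eval_mul : (e * f).eval s = e.eval s * f.eval s := rfl
@[simp] theorem fits_lit (v : ℕ) : (lit v).Fits W s ↔ v < W := Iff.rfl
@[simp] theorem fits_var (x : ℕ) : (var x).Fits W s ↔ True := Iff.rfl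
@[simp] theorem fits_get (a : ℕ) : (get a e).Fits W s ↔ e.Fits W s := Iff.rfl
@[simp] theorem fits_add :
    (e + f).Fits W s ↔ e.Fits W s ∧ f.Fits W s ∧ e.eval s + f.eval s < W := Iff.rfl
@[simp] theorem fits_sub :
    (e - f).Fits W s ↔ e.Fits W s ∧ f.Fits W s ∧ e.eval s - f.eval s < W := Iff.rfl
@[simp] theorem fits_mul :
    (e * f).Fits W s ↔ e.Fits W s ∧ f.Fits W s ∧ e.eval s * f.eval s < W := Iff.rfl
end

end Ex

/-- Structured commands over expressions. -/
inductive Cmd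
  | skip
  | set (x : ℕ) (e : Ex)
  | put (a : ℕ) (i e : Ex)
  | seq (p q : Cmd)
  | ite (e f : Ex) (p q : Cmd)
  | whl (e f : Ex) (p : Cmd)

/-- Sequential composition of commands. -/
infixr:60 " ;; " => Cmd.seq

/-- Execution of commands; every assignment and every test counts one step. -/
inductive CExec (W : ℕ) : Cmd → Store → Store → ℕ → Prop
  | skip {s : Store} : CExec W .skip s s 1
  | set {s : Store} {x : ℕ} {e : Ex} (h : e.Fits W s) :
      CExec W (.set x e) s (s.setReg x (e.eval s)) 1
  | put {s : Store} {a : ℕ} {i e : Ex} (hi : i.Fits W s) (he : e.Fits W s) :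
      CExec W (.put a i e) s (s.setArr a (i.eval s) (e.eval s)) 1
  | seq {s s' s'' : Store} {p q : Cmd} {t t' : ℕ} (hp : CExec W p s s' t)
      (hq : CExec W q s' s'' t') : CExec W (.seq p q) s s'' (t + t')
  | ite_true {s s' : Store} {e f : Ex} {p q : Cmd} {t : ℕ} (he : e.Fits W s) (hf : f.Fits W s)
      (h : e.eval s < f.eval s) (hp : CExec W p s s' t) : CExec W (.ite e f p q) s s' (t + 1)
  | ite_false {s s' : Store} {e f : Ex} {p q : Cmd} {t : ℕ} (he : e.Fits W s) (hf : f.Fits W s)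
      (h : ¬ e.eval s < f.eval s) (hq : CExec W q s s' t) : CExec W (.ite e f p q) s s' (t + 1)
  | whl_done {s : Store} {e f : Ex} {p : Cmd} (he : e.Fits W s) (hf : f.Fits W s)
      (h : ¬ e.eval s < f.eval s) : CExec W (.whl e f p) s s 1
  | whl_step {s s' s'' : Store} {e f : Ex} {p : Cmd} {t t' : ℕ} (he : e.Fits W s)
      (hf : f.Fits W s) (h : e.eval s < f.eval s) (hp : CExec W p s s' t)
      (hl : CExec W (.whl e f p) s' s'' t') : CExec W (.whl e f p) s s'' (t + t' + 1)

namespace Cmd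

/-- Registers below `60` and expressions of size at most `20` only. -/
def wf : Cmd → Bool
  | skip => true
  | set x e => Nat.blt x 60 && (e.wf && Nat.ble e.size 20)
  | put _ i e => (i.wf && Nat.ble i.size 20) && (e.wf && Nat.ble e.size 20)
  | seq p q => p.wf && q.wf
  | ite e f p q =>
      ((e.wf && Nat.ble e.size 20) && (f.wf && Nat.ble f.size 20)) && (p.wf && q.wf)
  | whl e f p => ((e.wf && Nat.ble e.size 20) && (f.wf && Nat.ble f.size 20)) && p.wf

/-- Compilation to the word RAM. -/
def code : Cmd → Prog
  | skip => .const 61 0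
  | set x e => .seq (e.code 61) (.arith .add x 61 60)
  | put a i e => .seq (i.code 61) (.seq (e.code 62) (.store a 61 62))
  | seq p q => .seq p.code q.code
  | ite e f p q => .seq (e.code 61) (.seq (f.code 62) (.ite 61 62 p.code q.code))
  | whl e f p => .seq (.seq (e.code 61) (f.code 62))
      (.loop 61 62 (.seq p.code (.seq (e.code 61) (f.code 62))))

/-- The command may assign register `x`. -/
def writes : Cmd → ℕ → Bool
  | skip, _ => false
  | set y _, x => Nat.beq y x
  | put _ _ _, _ => false
  | seq p q, x => p.writes x || q.writes x
  | ite _ _ p q, x => p.writes x || q.writes x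
  | whl _ _ p, x => p.writes x

/-- The command may assign entries of array `a`. -/
def stores : Cmd → ℕ → Bool
  | skip, _ => false
  | set _ _, _ => false
  | put b _ _, a => Nat.beq b a
  | seq p q, a => p.stores a || q.stores a
  | ite _ _ p q, a => p.stores a || q.stores a
  | whl _ _ p, a => p.stores a

end Cmd

@[simp] theorem Store.reg_setReg (s : Store) (x v y : ℕ) :
    (s.setReg x v).reg y = if y = x then v else s.reg y := by
  simp [Store.setReg, Function.update_apply]

@[simp] theorem Store.arr_setReg (s : Store) (x v : ℕ) : (s.setReg x v).arr = s.arr := rfl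

@[simp] theorem Store.reg_setArr (s : Store) (a i v : ℕ) : (s.setArr a i v).reg = s.reg := rfl

@[simp] theorem Store.arr_setArr (s : Store) (a i v b : ℕ) :
    (s.setArr a i v).arr b = if b = a then Function.update (s.arr a) i v else s.arr b := by
  simp only [Store.setArr, Function.update_apply]

/-- The store `s₀` of the compiled program represents the store `s`, all of whose values are
less than `W`. -/
structure Sim (W : ℕ) (s s₀ : Store) : Prop where
  reg : ∀ x < 60, s₀.reg x = s.reg x
  zero : s₀.reg 60 = 0
  arr : s₀.arr = s.arr
  regLt : ∀ x, s.reg x < W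
  arrLt : ∀ a i, s.arr a i < W

theorem Sim.scratch {W : ℕ} {s s₀ : Store} (h : Sim W s s₀) {b : ℕ} (hb : 61 ≤ b) (v : ℕ) :
    Sim W s (s₀.setReg b v) :=
  ⟨fun x hx => by simp [show x ≠ b by omega, h.reg x hx],
    by simp [show (60 : ℕ) ≠ b by omega, h.zero], h.arr, h.regLt, h.arrLt⟩

/-- The last conclusion, that registers below `b` are untouched, is what makes binary operations
work: the first operand waits in `b` while the second is evaluated from `b + 1` on. -/
theorem Ex.code_correct {W : ℕ} {s : Store} (e : Ex) : ∀ {s₀ : Store} {b : ℕ}, e.wf → e.Fits W s →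
    Sim W s s₀ → 61 ≤ b → ∃ s₁, Exec W (e.code b) s₀ s₁ e.size ∧ Sim W s s₁ ∧
      s₁.reg b = e.eval s ∧ e.eval s < W ∧ ∀ x < b, s₁.reg x = s₀.reg x := by
  induction e with
  | lit v =>
    intro s₀ b _ hf hs hb
    refine ⟨_, Exec.const hf, hs.scratch hb v, by simp, hf, fun x hx => ?_⟩
    simp [show x ≠ b by omega]
  | var x =>
    intro s₀ b hw _ hs hb
    have hx : x < 60 := by simpa [Ex.wf] using hw
    have h : (Op.add).eval (s₀.reg x) (s₀.reg 60) = s.reg x := by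
      simp [Op.eval, hs.zero, hs.reg x hx]
    refine ⟨_, Exec.arith (by rw [h]; exact hs.regLt x), hs.scratch hb _, by simp [h],
      hs.regLt x, fun y hy => ?_⟩
    simp [show y ≠ b by omega]
  | get a i ih =>
    intro s₀ b hw hf hs hb
    obtain ⟨s₁, h1, h2, h3, _, h4⟩ := ih hw hf hs hb
    refine ⟨_, Exec.seq h1 Exec.load, h2.scratch hb _, ?_, hs.arrLt _ _, fun y hy => ?_⟩
    · simp [h3, h2.arr]
    · simp [show y ≠ b by omega, h4 y hy]
  | bin o e f ihe ihf =>
    intro s₀ b hw hf hs hb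
    simp only [Ex.wf, Bool.and_eq_true] at hw
    obtain ⟨s₁, h1, h2, h3, _, h4⟩ := ihe hw.1 hf.1 hs hb
    obtain ⟨s₂, k1, k2, k3, _, k4⟩ := ihf (b := b + 1) hw.2 hf.2.1 h2 (by omega)
    have h : o.eval (s₂.reg b) (s₂.reg (b + 1)) = o.eval (e.eval s) (f.eval s) := by
      rw [k3, k4 b (by omega), h3]
    have hx := Exec.seq h1 (Exec.seq k1 (Exec.arith (x := b) (by rw [h]; exact hf.2.2)))
    rw [← add_assoc] at hx
    refine ⟨_, hx, k2.scratch hb _, by simp [h, Ex.eval], hf.2.2, fun y hy => ?_⟩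
    simp [show y ≠ b by omega, k4 y (by omega), h4 y hy]

theorem Ex.code_pair_correct {W : ℕ} {s s₀ : Store} (e f : Ex)
    (hw : (e.wf && Nat.ble e.size 20) && (f.wf && Nat.ble f.size 20))
    (he : e.Fits W s) (hf : f.Fits W s) (hs : Sim W s s₀) :
    ∃ s₁ t, Exec W (.seq (e.code 61) (f.code 62)) s₀ s₁ t ∧ Sim W s s₁ ∧
      s₁.reg 61 = e.eval s ∧ s₁.reg 62 = f.eval s ∧ t ≤ 40 := by
  simp only [Bool.and_eq_true, Nat.ble_eq] at hw
  obtain ⟨s₁, h1, h2, h3, _, h4⟩ := e.code_correct hw.1.1 he hs (le_refl 61)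
  obtain ⟨s₂, k1, k2, k3, _, k4⟩ := f.code_correct hw.2.1 hf h2 (show 61 ≤ 62 by omega)
  exact ⟨s₂, _, Exec.seq h1 k1, k2, by rw [k4 61 (by omega), h3], k3, by omega⟩

/-- One step evaluates at most two expressions of size at most `20` and adds a few instructions, so
a factor of `50` suffices. -/
theorem Cmd.code_correct {W : ℕ} {c : Cmd} {s s' : Store} {t : ℕ} (h : CExec W c s s' t) :
    ∀ {s₀ : Store}, c.wf → Sim W s s₀ →
      ∃ s₁ t₁, Exec W c.code s₀ s₁ t₁ ∧ Sim W s' s₁ ∧ t₁ ≤ 50 * t := by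
  induction h with
  | skip =>
    intro s₀ _ hs
    exact ⟨_, _, Exec.const ((Nat.zero_le _).trans_lt (hs.regLt 0)),
      hs.scratch (le_refl 61) 0, by omega⟩
  | @set s x e hf =>
    intro s₀ hw hs
    simp only [Cmd.wf, Bool.and_eq_true, Nat.ble_eq, Nat.blt_eq] at hw
    obtain ⟨s₁, h1, h2, h3, h4, _⟩ := e.code_correct hw.2.1 hf hs (le_refl 61)
    have h : (Op.add).eval (s₁.reg 61) (s₁.reg 60) = e.eval s := by simp [Op.eval, h2.zero, h3]
    refine ⟨_, _, Exec.seq h1 (Exec.arith (x := x) (by rw [h]; exact h4)), ?_, by omega⟩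
    rw [h]
    refine ⟨fun y hy => ?_, by simp [show 60 ≠ x by omega, h2.zero], h2.arr, fun y => ?_, h2.arrLt⟩
    · simp [h2.reg y hy]
    · simp only [Store.reg_setReg]; split_ifs; exacts [h4, h2.regLt y]
  | @put s a i e hi he =>
    intro s₀ hw hs
    simp only [Cmd.wf, Bool.and_eq_true, Nat.ble_eq] at hw
    obtain ⟨s₁, h1, h2, h3, _, h4⟩ := i.code_correct hw.1.1 hi hs (le_refl 61)
    obtain ⟨s₂, k1, k2, k3, kE, k4⟩ := e.code_correct hw.2.1 he h2 (show 61 ≤ 62 by omega)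
    refine ⟨_, _, Exec.seq h1 (Exec.seq k1 (Exec.store (a := a))), ?_, by omega⟩
    rw [k3, k4 61 (by omega), h3]
    refine ⟨fun y hy => by simpa using k2.reg y hy, by simpa using k2.zero, ?_, k2.regLt, ?_⟩
    · simp [Store.setArr, k2.arr]
    · intro b j
      rw [Store.arr_setArr]
      split_ifs
      · rw [Function.update_apply]
        split_ifs
        exacts [kE, k2.arrLt _ _]
      · exact k2.arrLt _ _
  | seq _ _ ihp ihq =>
    intro s₀ hw hs
    simp only [Cmd.wf, Bool.and_eq_true] at hw
    obtain ⟨s₁, t₁, h1, h2, h3⟩ := ihp hw.1 hs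
    obtain ⟨s₂, t₂, k1, k2, k3⟩ := ihq hw.2 h2
    exact ⟨s₂, _, Exec.seq h1 k1, k2, by omega⟩
  | @ite_true s s' e f p q t he hf h _ ih =>
    intro s₀ hw hs
    simp only [Cmd.wf, Bool.and_eq_true (_ && _) (Cmd.wf _ && _)] at hw
    obtain ⟨s₁, t₁, h1, h2, h3, h4, h5⟩ := Ex.code_pair_correct e f (by simpa using hw.1) he hf hs
    cases h1 with
    | seq a b =>
    obtain ⟨s₂, t₂, k1, k2, k3⟩ := ih (Bool.and_eq_true_iff.1 hw.2).1 h2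
    exact ⟨s₂, _, Exec.seq a (Exec.seq b (Exec.ite_true (by rw [h3, h4]; exact h) k1)), k2,
      by omega⟩
  | @ite_false s s' e f p q t he hf h _ ih =>
    intro s₀ hw hs
    simp only [Cmd.wf, Bool.and_eq_true (_ && _) (Cmd.wf _ && _)] at hw
    obtain ⟨s₁, t₁, h1, h2, h3, h4, h5⟩ := Ex.code_pair_correct e f (by simpa using hw.1) he hf hs
    cases h1 with
    | seq a b =>
    obtain ⟨s₂, t₂, k1, k2, k3⟩ := ih (Bool.and_eq_true_iff.1 hw.2).2 h2
    exact ⟨s₂, _, Exec.seq a (Exec.seq b (Exec.ite_false (by rw [h3, h4]; exact h) k1)), k2,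
      by omega⟩
  | @whl_done s e f p he hf h =>
    intro s₀ hw hs
    simp only [Cmd.wf, Bool.and_eq_true (_ && _) (_)] at hw
    obtain ⟨s₁, t₁, h1, h2, h3, h4, h5⟩ := Ex.code_pair_correct e f (by simpa using hw.1) he hf hs
    exact ⟨s₁, _, Exec.seq h1 (Exec.loop_done (by rw [h3, h4]; exact h)), h2, by omega⟩
  | @whl_step s s' s'' e f p t t' he hf h _ _ ihp ihl =>
    intro s₀ hw hs
    have hw' := hw
    simp only [Cmd.wf, Bool.and_eq_true (_ && _) (_)] at hw'
    obtain ⟨s₁, t₁, h1, h2, h3, h4, h5⟩ := Ex.code_pair_correct e f (by simpa using hw'.1) he hf hs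
    obtain ⟨s₂, t₂, k1, k2, k3⟩ := ihp hw'.2 h2
    obtain ⟨s₃, t₃, l1, l2, l3⟩ := ihl hw k2
    -- The translated loop evaluates its guard once in front and then at the end of each round. So
    -- the guard evaluation with which the remaining execution begins is moved to the end of the
    -- present round.
    cases l1 with
    | seq a b =>
    exact ⟨s₃, _, Exec.seq h1 (Exec.loop_step (by rw [h3, h4]; exact h) (Exec.seq k1 a) b), l2,
      by omega⟩

/-! ### Total correctness with time -/

/-- Started on `s`, the command `c` halts, and the final store and the time satisfy `Q`. -/
def Tot (W : ℕ) (c : Cmd) (s : Store) (Q : Store → ℕ → Prop) : Prop :=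
  ∃ s' t, CExec W c s s' t ∧ Q s' t

section
variable {W : ℕ} {s : Store} {Q : Store → ℕ → Prop}

theorem Tot.mono {c : Cmd} {Q' : Store → ℕ → Prop} (h : Tot W c s Q')
    (hQ : ∀ s' t, Q' s' t → Q s' t) : Tot W c s Q :=
  let ⟨s', t, h1, h2⟩ := h
  ⟨s', t, h1, hQ _ _ h2⟩

@[simp] theorem tot_skip : Tot W .skip s Q ↔ Q s 1 :=
  ⟨fun ⟨_, _, h, hQ⟩ => by cases h; exact hQ, fun h => ⟨_, _, .skip, h⟩⟩

@[simp] theorem tot_set {x : ℕ} {e : Ex} :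
    Tot W (.set x e) s Q ↔ e.Fits W s ∧ Q (s.setReg x (e.eval s)) 1 :=
  ⟨fun ⟨_, _, h, hQ⟩ => by cases h with | set h => exact ⟨h, hQ⟩, fun h => ⟨_, _, .set h.1, h.2⟩⟩

@[simp] theorem tot_put {a : ℕ} {i e : Ex} : Tot W (.put a i e) s Q ↔
    i.Fits W s ∧ e.Fits W s ∧ Q (s.setArr a (i.eval s) (e.eval s)) 1 :=
  ⟨fun ⟨_, _, h, hQ⟩ => by cases h with | put h h' => exact ⟨h, h', hQ⟩,
    fun h => ⟨_, _, .put h.1 h.2.1, h.2.2⟩⟩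

@[simp] theorem tot_seq {p q : Cmd} : Tot W (.seq p q) s Q ↔
    Tot W p s fun s₁ t₁ => Tot W q s₁ fun s₂ t₂ => Q s₂ (t₁ + t₂) :=
  ⟨fun ⟨_, _, h, hQ⟩ => by cases h with | seq h h' => exact ⟨_, _, h, _, _, h', hQ⟩,
    fun ⟨_, _, h, _, _, h', hQ⟩ => ⟨_, _, .seq h h', hQ⟩⟩

@[simp] theorem tot_ite {e f : Ex} {p q : Cmd} : Tot W (.ite e f p q) s Q ↔
    e.Fits W s ∧ f.Fits W s ∧
      (e.eval s < f.eval s → Tot W p s fun s' t => Q s' (t + 1)) ∧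
      (¬ e.eval s < f.eval s → Tot W q s fun s' t => Q s' (t + 1)) := by
  constructor
  · rintro ⟨_, _, h, hQ⟩
    cases h with
    | ite_true he hf h hp => exact ⟨he, hf, fun _ => ⟨_, _, hp, hQ⟩, fun h' => (h' h).elim⟩
    | ite_false he hf h hp => exact ⟨he, hf, fun h' => (h h').elim, fun _ => ⟨_, _, hp, hQ⟩⟩
  · rintro ⟨he, hf, h1, h2⟩
    by_cases h : e.eval s < f.eval s
    · obtain ⟨_, _, hp, hQ⟩ := h1 h
      exact ⟨_, _, .ite_true he hf h hp, hQ⟩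
    · obtain ⟨_, _, hp, hQ⟩ := h2 h
      exact ⟨_, _, .ite_false he hf h hp, hQ⟩

/-- Registers and arrays that `c` does not write agree in `s` and `s'`. -/
structure Cmd.Keeps (c : Cmd) (s s' : Store) : Prop where
  reg : ∀ x, c.writes x = false → s'.reg x = s.reg x
  arr : ∀ a, c.stores a = false → s'.arr a = s.arr a

theorem Cmd.Keeps.trans {c : Cmd} {s s' s'' : Store} (h : c.Keeps s s') (h' : c.Keeps s' s'') :
    c.Keeps s s'' :=
  ⟨fun x hx => (h'.reg x hx).trans (h.reg x hx), fun x hx => (h'.arr x hx).trans (h.arr x hx)⟩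

/-- `writes` and `stores` are computable, so for a concrete program the premise that a register or
an array is not written holds by `rfl`. Every later specification uses this to carry over what a
subprogram does not touch. -/
theorem CExec.frame {c : Cmd} {s s' : Store} {t : ℕ} (h : CExec W c s s' t) :
    c.Keeps s s' := by
  suffices h : (∀ x, c.writes x = false → s'.reg x = s.reg x) ∧
      ∀ a, c.stores a = false → s'.arr a = s.arr a from ⟨h.1, h.2⟩
  induction h with
  | skip => simp
  | set =>
    refine ⟨fun y hy => ?_, fun _ _ => rfl⟩
    simp [Ne.symm (Nat.ne_of_beq_eq_false hy)]
  | put =>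
    refine ⟨fun _ _ => rfl, fun b hb => ?_⟩
    simp [Ne.symm (Nat.ne_of_beq_eq_false hb)]
  | seq _ _ ih1 ih2 =>
    simp only [Cmd.writes, Cmd.stores, Bool.or_eq_false_iff]
    exact ⟨fun x hx => (ih2.1 x hx.2).trans (ih1.1 x hx.1),
      fun x hx => (ih2.2 x hx.2).trans (ih1.2 x hx.1)⟩
  | ite_true _ _ _ _ ih =>
    simp only [Cmd.writes, Cmd.stores, Bool.or_eq_false_iff]
    exact ⟨fun x hx => ih.1 x hx.1, fun x hx => ih.2 x hx.1⟩
  | ite_false _ _ _ _ ih =>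
    simp only [Cmd.writes, Cmd.stores, Bool.or_eq_false_iff]
    exact ⟨fun x hx => ih.1 x hx.2, fun x hx => ih.2 x hx.2⟩
  | whl_done => simp
  | whl_step _ _ _ _ _ ih1 ih2 =>
    exact ⟨fun x hx => (ih2.1 x hx).trans (ih1.1 x hx),
      fun x hx => (ih2.2 x hx).trans (ih1.2 x hx)⟩

theorem Tot.frame {c : Cmd} (h : Tot W c s Q) : Tot W c s fun s' t => Q s' t ∧ c.Keeps s s' :=
  let ⟨s', t, h1, h2⟩ := h
  ⟨s', t, h1, h2, h1.frame⟩

/-- The loop rule: `φ` is a potential that pays for the iterations. -/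
theorem Tot.whl {e f : Ex} {p : Cmd} (I : Store → Prop) (φ : Store → ℕ)
    (hfit : ∀ s', I s' → (Cmd.whl e f p).Keeps s s' → e.Fits W s' ∧ f.Fits W s')
    (h : ∀ s', I s' → (Cmd.whl e f p).Keeps s s' → e.eval s' < f.eval s' →
      Tot W p s' fun s'' t => I s'' ∧ t + 1 + φ s'' ≤ φ s')
    (hs : I s) : Tot W (.whl e f p) s fun s' t =>
      I s' ∧ (Cmd.whl e f p).Keeps s s' ∧ ¬ e.eval s' < f.eval s' ∧ t + φ s' ≤ φ s + 1 := by
  suffices H : ∀ n s₁, φ s₁ = n → I s₁ → (Cmd.whl e f p).Keeps s s₁ →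
      Tot W (.whl e f p) s₁ fun s' t =>
      I s' ∧ ¬ e.eval s' < f.eval s' ∧ t + φ s' ≤ φ s₁ + 1 from
    (H _ s rfl hs ⟨fun _ _ => rfl, fun _ _ => rfl⟩).frame.mono
      fun s' t h => ⟨h.1.1, h.2, h.1.2⟩
  intro n
  -- Each iteration lowers the potential by at least one, so termination follows by induction on its
  -- value.
  induction n using Nat.strong_induction_on with
  | _ n ih =>
  intro s₁ hn hs₁ hk
  by_cases hc : e.eval s₁ < f.eval s₁
  · obtain ⟨s₂, t₁, h1, h2, h3⟩ := h s₁ hs₁ hk hc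
    obtain ⟨s₃, t₂, k1, k2, k3, k4⟩ := ih (φ s₂) (by omega) s₂ rfl h2
      (hk.trans ⟨h1.frame.reg, h1.frame.arr⟩)
    exact ⟨s₃, _, .whl_step (hfit s₁ hs₁ hk).1 (hfit s₁ hs₁ hk).2 hc h1 k1, k2, k3, by omega⟩
  · exact ⟨s₁, 1, .whl_done (hfit s₁ hs₁ hk).1 (hfit s₁ hs₁ hk).2 hc, hs₁, hc, by omega⟩

/-- `for x := (current value) to h - 1 do p`, where `h` is a register. -/
def Cmd.upto (x h : ℕ) (p : Cmd) : Cmd :=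
  .whl (.var x) (.var h) (p ;; .set x (.var x + .lit 1))

/-- The rule for counting loops, with an invariant that depends on the counter and a cost for each
iteration. -/
theorem Tot.upto {x h N i₀ : ℕ} {p : Cmd} (I : ℕ → Store → Prop) (C : ℕ → ℕ)
    (hx : p.writes x = false) (hh : (Cmd.upto x h p).writes h = false)
    (hreg : s.reg x = i₀) (hN : s.reg h = N) (hi : i₀ ≤ N) (hW : N < W)
    (hbody : ∀ i s₁, i₀ ≤ i → i < N → I i s₁ → (Cmd.upto x h p).Keeps s s₁ → s₁.reg x = i →
      s₁.reg h = N → Tot W p s₁ fun s' t => I (i + 1) (s'.setReg x (i + 1)) ∧ t ≤ C i)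
    (h0 : I i₀ s) : Tot W (.upto x h p) s fun s' t =>
      I N s' ∧ (Cmd.upto x h p).Keeps s s' ∧ s'.reg x = N ∧ t ≤ ∑ i ∈ Finset.Ico i₀ N, (C i + 2) + 1 := by
  -- The potential is the cost of the iterations still to come; the summand `2` pays for the test
  -- and for the increment of the counter.
  have key := Tot.whl (W := W) (e := .var x) (f := .var h) (p := p ;; .set x (.var x + .lit 1)) (s := s)
    (fun s => i₀ ≤ s.reg x ∧ s.reg x ≤ N ∧ s.reg h = N ∧ I (s.reg x) s)
    (fun s => ∑ i ∈ Finset.Ico (s.reg x) N, (C i + 2)) (fun _ _ _ => by simp) ?_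
    ⟨hreg.ge, hreg ▸ hi, hN, hreg ▸ h0⟩
  · refine key.mono fun s' t ⟨⟨h1, h2, h3, h4⟩, hk, h5, h6⟩ => ?_
    simp only [Ex.eval_var, not_lt, h3] at h5
    have : s'.reg x = N := le_antisymm h2 h5
    rw [this] at h4
    rw [hreg] at h6
    exact ⟨h4, hk, this, by omega⟩
  · rintro s ⟨h1, h2, h3, h4⟩ hk hlt
    simp only [Ex.eval_var, h3] at hlt
    rw [tot_seq]
    refine (hbody _ s h1 hlt h4 hk rfl h3).frame.mono fun s' t ⟨⟨h5, h6⟩, h7⟩ => ?_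
    have hh' : p.writes h = false ∧ Nat.beq x h = false := by
      simpa [Cmd.upto, Cmd.writes] using hh
    have hxh := Nat.ne_of_beq_eq_false hh'.2
    have e1 := h7.reg x hx
    have e2 := h7.reg h hh'.1
    have e3 : Finset.Ico (s.reg x) N = insert (s.reg x) (Finset.Ico (s.reg x + 1) N) := by
      ext a; simp only [Finset.mem_Ico, Finset.mem_insert]; omega
    simp only [tot_set, Ex.fits_add, Ex.fits_var, Ex.eval_add, Ex.eval_var, Store.reg_setReg, e1,
      Ex.fits_lit, Ex.eval_lit, true_and, if_true, e3]
    refine ⟨⟨by omega, by omega⟩, ⟨by omega, by omega, ?_, h5⟩, ?_⟩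
    · simp [Ne.symm hxh, e2, h3]
    · rw [Finset.sum_insert (by simp)]
      omega

theorem Tot.upto_const {x h N i₀ : ℕ} {p : Cmd} (I : ℕ → Store → Prop) (C : ℕ)
    (hx : p.writes x = false) (hh : (Cmd.upto x h p).writes h = false)
    (hreg : s.reg x = i₀) (hN : s.reg h = N) (hi : i₀ ≤ N) (hW : N < W)
    (hbody : ∀ i s₁, i₀ ≤ i → i < N → I i s₁ → (Cmd.upto x h p).Keeps s s₁ → s₁.reg x = i →
      s₁.reg h = N → Tot W p s₁ fun s' t => I (i + 1) (s'.setReg x (i + 1)) ∧ t ≤ C)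
    (h0 : I i₀ s) : Tot W (.upto x h p) s fun s' t =>
      I N s' ∧ (Cmd.upto x h p).Keeps s s' ∧ s'.reg x = N ∧ t ≤ (N - i₀) * (C + 2) + 1 :=
  (Tot.upto I (fun _ => C) hx hh hreg hN hi hW hbody h0).mono fun s' t h => by
    simpa using h

/-- Counting loops whose iterations are paid for by a potential `φ` and a constant. -/
theorem Tot.upto_pot {x h N i₀ : ℕ} {p : Cmd} (I : ℕ → Store → Prop) (φ : Store → ℕ) (C : ℕ)
    (hφ : ∀ s v, φ (s.setReg x v) = φ s)
    (hx : p.writes x = false) (hh : (Cmd.upto x h p).writes h = false)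
    (hreg : s.reg x = i₀) (hN : s.reg h = N) (hi : i₀ ≤ N) (hW : N < W)
    (hbody : ∀ i s₁, i₀ ≤ i → i < N → I i s₁ → (Cmd.upto x h p).Keeps s s₁ → s₁.reg x = i →
      s₁.reg h = N → Tot W p s₁ fun s' t =>
        I (i + 1) (s'.setReg x (i + 1)) ∧ t + φ s' ≤ φ s₁ + C)
    (h0 : I i₀ s) : Tot W (.upto x h p) s fun s' t =>
      I N s' ∧ (Cmd.upto x h p).Keeps s s' ∧ s'.reg x = N ∧
        t + φ s' ≤ φ s + (N - i₀) * (C + 2) + 1 := by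
  have hh' : p.writes h = false ∧ Nat.beq x h = false := by
    simpa [Cmd.upto, Cmd.writes] using hh
  have hxh := Nat.ne_of_beq_eq_false hh'.2
  have key := Tot.whl (W := W) (e := .var x) (f := .var h) (p := p ;; .set x (.var x + .lit 1))
    (s := s) (fun s => i₀ ≤ s.reg x ∧ s.reg x ≤ N ∧ s.reg h = N ∧ I (s.reg x) s)
    (fun s => φ s + (N - s.reg x) * (C + 2)) (fun _ _ _ => by simp) ?_
    ⟨hreg.ge, hreg ▸ hi, hN, hreg ▸ h0⟩
  · refine key.mono fun s' t ⟨⟨h1, h2, h3, h4⟩, hk, h5, h6⟩ => ?_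
    simp only [Ex.eval_var, not_lt, h3] at h5
    have : s'.reg x = N := le_antisymm h2 h5
    rw [this] at h4 h6
    rw [hreg] at h6
    exact ⟨h4, hk, this, by omega⟩
  · rintro s ⟨h1, h2, h3, h4⟩ hk hlt
    simp only [Ex.eval_var, h3] at hlt
    rw [tot_seq]
    refine (hbody _ s h1 hlt h4 hk rfl h3).frame.mono fun s' t ⟨⟨h5, h6⟩, h7⟩ => ?_
    have e1 := h7.reg x hx
    have e2 := h7.reg h hh'.1
    simp only [tot_set, Ex.fits_add, Ex.fits_var, Ex.eval_add, Ex.eval_var, Store.reg_setReg, e1,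
      Ex.fits_lit, Ex.eval_lit, true_and, if_true, hφ]
    refine ⟨⟨by omega, by omega⟩, ⟨by omega, by omega, ?_, h5⟩, ?_⟩
    · simp [Ne.symm hxh, e2, h3]
    · have : N - s.reg x = (N - (s.reg x + 1)) + 1 := by omega
      rw [this, add_mul]
      omega

end

open Ex Cmd

/-! ### In-place partition of an array segment -/

/-- Registers: `0` the side length of the matrix in array `2`, `20` the scan position, `21` the end
of the segment, `22` the boundary, `23` the row, `24` and `25` the range of the entries to keep.
The entries `y` of the segment with `reg 24 ≤ matrix (reg 23, y) < reg 25` are moved to its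
front. -/
def partitionCmd (a : ℕ) : Cmd :=
  upto 20 21 (
    set 26 (get a (var 20)) ;;
    ite (get 2 (var 23 * var 0 + var 26)) (var 24) skip
      (ite (get 2 (var 23 * var 0 + var 26)) (var 25)
        (put a (var 20) (get a (var 22)) ;; put a (var 22) (var 26) ;; set 22 (var 22 + lit 1))
        skip))

theorem comp_swap_eq (f : ℕ → ℕ) (i j : ℕ) :
    f ∘ Equiv.swap i j = Function.update (Function.update f i (f j)) j (f i) := by
  ext k
  simp only [Function.comp, Equiv.swap_apply_def, Function.update_apply]
  split_ifs <;> simp_all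

theorem mul_add_lt_mul {x y n : ℕ} (hx : x < n) (hy : y < n) : x * n + y < n * n := by
  nlinarith

theorem mem_segment_of_fixes {π : Equiv.Perm ℕ} {lo hi : ℕ}
    (h : ∀ j, j < lo ∨ hi ≤ j → π j = j) {j : ℕ} (hj : lo ≤ j) (hj' : j < hi) :
    lo ≤ π j ∧ π j < hi := by
  by_contra hc
  have h1 : π (π j) = π j := h _ (by omega)
  have := π.injective h1
  omega

/-- Invariant of the scan: entries before the boundary pass the test, entries between the boundary
and the scan position fail it. The result is given as a permutation that fixes all positions outside
the segment, since a caller only has to know that the segment keeps its set of entries. -/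
theorem partitionCmd_spec {W n lo hi w : ℕ} {s : Store} {a : ℕ} (ha : (2 == a) = false)
    (h0 : s.reg 0 = n) (h20 : s.reg 20 = lo) (h22 : s.reg 22 = lo) (h21 : s.reg 21 = hi)
    (h23 : s.reg 23 = w) (hlo : lo ≤ hi) (hhi : hi < W) (hw : w < n) (hnW : n * n < W)
    (harr : ∀ j, lo ≤ j → j < hi → s.arr a j < n) :
    Tot W (partitionCmd a) s fun s' t => ∃ π : Equiv.Perm ℕ,
      (∀ j, j < lo ∨ hi ≤ j → π j = j) ∧ s'.arr a = s.arr a ∘ π ∧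
      lo ≤ s'.reg 22 ∧ s'.reg 22 ≤ hi ∧
      (∀ j, lo ≤ j → j < s'.reg 22 → s.reg 24 ≤ s.arr 2 (w * n + s'.arr a j) ∧
        s.arr 2 (w * n + s'.arr a j) < s.reg 25) ∧
      (∀ j, s'.reg 22 ≤ j → j < hi → ¬ (s.reg 24 ≤ s.arr 2 (w * n + s'.arr a j) ∧
        s.arr 2 (w * n + s'.arr a j) < s.reg 25)) ∧ t ≤ (hi - lo) * 8 + 1 := by
  have ha' : 2 ≠ a := by simpa using ha
  refine (Tot.upto_const (N := hi) (i₀ := lo) (fun i s' => ∃ π : Equiv.Perm ℕ,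
      (∀ j, j < lo ∨ hi ≤ j → π j = j) ∧ s'.arr a = s.arr a ∘ π ∧
      lo ≤ s'.reg 22 ∧ s'.reg 22 ≤ i ∧
      (∀ j, lo ≤ j → j < s'.reg 22 → s.reg 24 ≤ s.arr 2 (w * n + s'.arr a j) ∧
        s.arr 2 (w * n + s'.arr a j) < s.reg 25) ∧
      (∀ j, s'.reg 22 ≤ j → j < i → ¬ (s.reg 24 ≤ s.arr 2 (w * n + s'.arr a j) ∧
        s.arr 2 (w * n + s'.arr a j) < s.reg 25))) 6 rfl rfl h20 h21 hlo hhi ?_ ?_).mono ?_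
  · rintro i s' hi1 hi2 ⟨π, hπ, harr', hq1, hq2, hk1, hk2⟩ hk hi3 -
    have e0 : s'.reg 0 = n := (hk.reg 0 rfl).trans h0
    have e23 : s'.reg 23 = w := (hk.reg 23 rfl).trans h23
    have e24 : s'.reg 24 = s.reg 24 := hk.reg 24 rfl
    have e25 : s'.reg 25 = s.reg 25 := hk.reg 25 rfl
    have eK : s'.arr 2 = s.arr 2 := hk.arr 2 (by
      have : Nat.beq a 2 = false := by
        rw [Bool.eq_false_iff, ne_eq, Nat.beq_eq]
        exact Ne.symm ha'
      simp [stores, this, upto])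
    have hy : s'.arr a i < n := by
      have := mem_segment_of_fixes hπ hi1 hi2
      rw [harr']; exact harr _ this.1 this.2
    have hidx := mul_add_lt_mul hw hy
    have hwn : w * n < n * n := by nlinarith
    set y := s'.arr a i with hydef
    simp only [tot_seq, tot_set, tot_ite, tot_skip, tot_put, fits_get, fits_add, fits_mul, fits_var,
      eval_get, eval_add, eval_mul, eval_var, eval_lit, fits_lit, Store.reg_setReg, Store.arr_setReg,
      Store.reg_setArr, Store.arr_setArr, e0, e23, e24, e25, eK, hi3, ← hydef, if_true, true_and,
      OfNat.ofNat_eq_ofNat, Nat.reduceEqDiff, if_false, and_true, ha', one_ne_zero]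
    have fits1 : w * n + y < W := by omega
    refine ⟨⟨by omega, by omega⟩, ?_, fun hge => ⟨⟨by omega, by omega⟩, fun hlt => ?_, ?_⟩⟩
    · intro hlt
      refine ⟨⟨π, hπ, harr', hq1, by omega, hk1, fun j h1 h2 => ?_⟩, by omega⟩
      rcases Nat.lt_succ_iff_lt_or_eq.1 h2 with h3 | h3
      · exact hk2 j h1 h3
      · rw [h3, ← hydef]; omega
    · refine ⟨⟨by omega, by omega⟩, ⟨π * Equiv.swap i (s'.reg 22), fun j hj => ?_, ?_, ?_, ?_, ?_, ?_⟩, by omega⟩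
      · rw [Equiv.Perm.mul_apply, Equiv.swap_apply_of_ne_of_ne (by omega) (by omega), hπ j hj]
      · have : s.arr a ∘ (π * Equiv.swap i (s'.reg 22)) = s'.arr a ∘ Equiv.swap i (s'.reg 22) := by
          rw [harr']; rfl
        rw [this, comp_swap_eq, hydef]
      · omega
      · omega
      · intro j h1 h2
        simp only [Function.update_apply]
        split_ifs with h3 h4
        · omega
        · omega
        · exact hk1 j h1 (by omega)
      · intro j h1 h2
        simp only [Function.update_apply]
        split_ifs with h3 h4
        · omega
        · by_cases h5 : s'.reg 22 = i
          · omega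
          · exact hk2 _ le_rfl (by omega)
        · exact hk2 j (by omega) (by omega)
    · intro hlt
      refine ⟨⟨π, hπ, harr', hq1, by omega, hk1, fun j h1 h2 => ?_⟩, by omega⟩
      rcases Nat.lt_succ_iff_lt_or_eq.1 h2 with h3 | h3
      · exact hk2 j h1 h3
      · rw [h3, ← hydef]; omega
  · exact ⟨1, by simp, by simp, by omega, by omega, fun j _ _ => by omega, fun j _ _ => by omega⟩
  · rintro s' t ⟨⟨π, h1, h2, h3, h4, h5, h6⟩, -, -, h7⟩
    exact ⟨π, h1, h2, h3, h4, h5, h6, h7⟩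

/-! ### Modules and realizers of strict orders -/

open Classical in
/-- The relation between `x` and `y`: `2` if `x` is below `y`, `1` if `y` is below `x`, and `0` if
they are incomparable. -/
noncomputable def cmp (R : ℕ → ℕ → Prop) (x y : ℕ) : ℕ :=
  if R x y then 2 else if R y x then 1 else 0

/-- `N` is a module of the restriction of `R` to `X` (or empty). -/
def Mod (R : ℕ → ℕ → Prop) (X N : Set ℕ) : Prop :=
  N ⊆ X ∧ ∀ a ∈ N, ∀ b ∈ N, ∀ z ∈ X, z ∉ N → cmp R z a = cmp R z b

/-- The restriction of `R` to `A` is the intersection of `e` linear orders. -/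
def Realizable (R : ℕ → ℕ → Prop) (e : ℕ) (A : Set ℕ) : Prop :=
  ∃ c : Fin e → ℕ → ℕ, (∀ D, Set.InjOn (c D) A) ∧
    ∀ x ∈ A, ∀ y ∈ A, (R x y ↔ ∀ D, c D x < c D y)

/-- A module of `R` on `U` with two elements of `L` contains `L`. -/
def Tight (R : ℕ → ℕ → Prop) (U L : Set ℕ) : Prop :=
  ∀ N, Mod R U N → ∀ a ∈ L, ∀ b ∈ L, a ∈ N → b ∈ N → a ≠ b → L ⊆ N

/-- Modules that avoid `v` have at most one element. -/
def Rooted (R : ℕ → ℕ → Prop) (v : ℕ) (S : Set ℕ) : Prop :=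
  ∀ N, Mod R S N → v ∉ N → N.Subsingleton

section
variable {R : ℕ → ℕ → Prop}

theorem cmp_le_two (R : ℕ → ℕ → Prop) (x y : ℕ) : cmp R x y ≤ 2 := by
  unfold cmp; split_ifs <;> omega

theorem cmp_eq_two {x y : ℕ} : cmp R x y = 2 ↔ R x y := by
  unfold cmp; split_ifs <;> simp_all

theorem cmp_eq_one [IsStrictOrder ℕ R] {x y : ℕ} : cmp R x y = 1 ↔ R y x := by
  unfold cmp
  split_ifs with h1 h2
  · simpa using asymm_of R h1
  · simpa
  · simpa

theorem cmp_eq_zero {x y : ℕ} : cmp R x y = 0 ↔ ¬ R x y ∧ ¬ R y x := by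
  unfold cmp; split_ifs <;> simp_all

theorem cmp_self [IsStrictOrder ℕ R] (x : ℕ) : cmp R x x = 0 := by
  simp [cmp_eq_zero, irrefl_of R x]

theorem cmp_comm [IsStrictOrder ℕ R] {x y x' y' : ℕ} (h : cmp R x y = cmp R x' y') : cmp R y x = cmp R y' x' := by
  have h1 := @cmp_eq_two R x' y'
  have h2 := @cmp_eq_one R _ x' y'
  have h3 := @cmp_eq_zero R x' y'
  have h4 := cmp_le_two R x' y'
  rw [← h] at h1 h2 h3
  rcases (by omega : cmp R x' y' = 0 ∨ cmp R x' y' = 1 ∨ cmp R x' y' = 2) with h' | h' | h' <;>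
    rw [← h] at h'
  · have := h3.1 h'
    rw [cmp_eq_zero.2 (cmp_eq_zero.1 h').symm, cmp_eq_zero.2 this.symm]
  · rw [cmp_eq_two.2 (cmp_eq_one.1 h'), cmp_eq_two.2 (h2.1 h')]
  · rw [cmp_eq_one.2 (cmp_eq_two.1 h'), cmp_eq_one.2 (h1.1 h')]

theorem Mod.restrict {X Y N : Set ℕ} (h : Mod R X N) (hY : Y ⊆ X) : Mod R Y (N ∩ Y) :=
  ⟨Set.inter_subset_right, fun a ha b hb z hz hzN =>
    h.2 a ha.1 b hb.1 z (hY hz) fun hz' => hzN ⟨hz', hz⟩⟩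

theorem Mod.trans {X Y N : Set ℕ} (hY : Mod R X Y) (hN : Mod R Y N) : Mod R X N :=
  ⟨hN.1.trans hY.1, fun a ha b hb z hz hzN => by
    by_cases h : z ∈ Y
    · exact hN.2 a ha b hb z h hzN
    · exact hY.2 a (hN.1 ha) b (hN.1 hb) z hz h⟩

theorem Rooted.subset {v : ℕ} {S S' : Set ℕ} (h : Rooted R v S) (hS' : Mod R S S') :
    Rooted R v S' := fun N hN hv => h N (hS'.trans hN) hv

theorem Realizable.mono {e : ℕ} {A B : Set ℕ} (h : Realizable R e B) (hAB : A ⊆ B) :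
    Realizable R e A :=
  let ⟨c, h1, h2⟩ := h
  ⟨c, fun D => (h1 D).mono hAB, fun x hx y hy => h2 x (hAB hx) y (hAB hy)⟩

theorem realizable_singleton [IsStrictOrder ℕ R] {e : ℕ} (he : 1 ≤ e) (x : ℕ) : Realizable R e {x} := by
  refine ⟨fun _ _ => 0, by simp, ?_⟩
  rintro _ rfl _ rfl
  have : Nonempty (Fin e) := ⟨⟨0, he⟩⟩
  simp [irrefl_of R]

/-- Lexicographic composition: the coordinates of a realizer of the quotient are the leading digits,
those of realizers of the fibres the trailing digits. Conversely, realizers restrict to subsets, and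
the quotient is realized inside `X` as the image of `f`. -/
theorem realizable_iff_fibers {e : ℕ} {X : Set ℕ} (hX : X.Finite) (f : ℕ → ℕ)
    (hf : ∀ x ∈ X, f x ∈ X)
    (hR : ∀ x ∈ X, ∀ y ∈ X, f x ≠ f y → (R x y ↔ R (f x) (f y))) :
    Realizable R e X ↔ Realizable R e (f '' X) ∧ ∀ q ∈ f '' X, Realizable R e {x ∈ X | f x = q} := by
  constructor
  · exact fun h => ⟨h.mono (by rintro _ ⟨x, hx, rfl⟩; exact hf x hx),
      fun q _ => h.mono fun x hx => hx.1⟩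
  · rintro ⟨⟨c, hc1, hc2⟩, h⟩
    unfold Realizable at h
    choose! g hg1 hg2 using h
    -- `K` exceeds all coordinates used inside the fibres, so that it can serve as the base.
    have hK : ∃ K, ∀ D : Fin e, ∀ x ∈ X, g (f x) D x < K := by
      refine ⟨(Finset.univ ×ˢ hX.toFinset).sup (fun p => g (f p.2) p.1 p.2) + 1, fun D x hx => ?_⟩
      refine Nat.lt_succ_of_le (Finset.le_sup
        (f := fun p : Fin e × ℕ => g (f p.2) p.1 p.2) (b := (D, x)) ?_)
      simpa using hx
    obtain ⟨K, hK⟩ := hK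
    have hlt : ∀ D : Fin e, ∀ x ∈ X, ∀ y ∈ X, c D (f x) < c D (f y) →
        c D (f x) * K + g (f x) D x < c D (f y) * K + g (f y) D y := fun D x hx y hy h => by
      have h1 := hK D x hx
      have : (c D (f x) + 1) * K ≤ c D (f y) * K := Nat.mul_le_mul_right _ h
      rw [add_mul] at this
      omega
    refine ⟨fun D x => c D (f x) * K + g (f x) D x, fun D x hx y hy hxy => ?_,
      fun x hx y hy => ?_⟩
    · simp only at hxy
      rcases lt_trichotomy (c D (f x)) (c D (f y)) with h1 | h1 | h1
      · have := hlt D x hx y hy h1; omega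
      · have hfxy := hc1 D ⟨x, hx, rfl⟩ ⟨y, hy, rfl⟩ h1
        refine hg1 (f x) ⟨x, hx, rfl⟩ D ⟨hx, rfl⟩ ⟨hy, hfxy.symm⟩ ?_
        rw [hfxy] at hxy
        rw [hfxy]
        omega
      · have := hlt D y hy x hx h1; omega
    · by_cases hfxy : f x = f y
      · simp only [hg2 (f x) ⟨x, hx, rfl⟩ x ⟨hx, rfl⟩ y ⟨hy, hfxy.symm⟩, hfxy,
          add_lt_add_iff_left]
      · rw [hR x hx y hy hfxy, hc2 _ ⟨x, hx, rfl⟩ _ ⟨y, hy, rfl⟩]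
        refine forall_congr' fun D => ⟨hlt D x hx y hy, fun h => ?_⟩
        by_contra hn
        change c D (f x) * K + g (f x) D x < c D (f y) * K + g (f y) D y at h
        rcases (not_lt.1 hn).lt_or_eq with h1 | h1
        · have := hlt D y hy x hx h1; omega
        · exact hfxy (hc1 D ⟨x, hx, rfl⟩ ⟨y, hy, rfl⟩ h1.symm)

/-- Collapse `T` to `v`: the fibres are `T` and single points, and single points are realizable
because `e ≥ 1`. (With no dimension every pair would have to be related, including a point with
itself.) -/
theorem realizable_iff_of_mod [IsStrictOrder ℕ R] {e : ℕ} (he : 1 ≤ e) {S T : Set ℕ} (hS : S.Finite) (hT : Mod R S T)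
    {v : ℕ} (hv : v ∈ T) :
    Realizable R e S ↔ Realizable R e (insert v (S \ T)) ∧ Realizable R e T := by
  classical
  have himg : (fun x => if x ∈ T then v else x) '' S = insert v (S \ T) := by
    ext x
    simp only [Set.mem_image, Set.mem_insert_iff, Set.mem_sdiff]
    constructor
    · rintro ⟨y, hy, rfl⟩
      by_cases h : y ∈ T <;> simp [h, hy]
    · rintro (rfl | h)
      · exact ⟨x, hT.1 hv, by simp [hv]⟩
      · exact ⟨x, h.1, by simp [h.2]⟩
  rw [realizable_iff_fibers hS (fun x => if x ∈ T then v else x), himg]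
  · refine and_congr_right fun _ => ⟨fun h => ?_, fun h q hq => ?_⟩
    · refine (h v (by simp)).mono fun x hx => ⟨hT.1 hx, by simp [hx]⟩
    · rcases hq with rfl | hq
      · refine h.mono fun x hx => ?_
        by_contra hxT
        have := hx.2
        simp only [hxT, if_false] at this
        exact hxT (this ▸ hv)
      · refine (realizable_singleton he q).mono fun x hx => ?_
        have := hx.2
        split_ifs at this with hx'
        · exact absurd (this ▸ hv) hq.2
        · exact this
  · intro x hx
    split_ifs
    exacts [hT.1 hv, hx]
  · intro x hx y hy hxy
    split_ifs at hxy ⊢ with h1 h2 h2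
    · exact absurd rfl hxy
    · rw [← cmp_eq_two (R := R), ← cmp_eq_two (R := R), cmp_comm (hT.2 x h1 v hv y hy h2)]
    · rw [← cmp_eq_two (R := R), ← cmp_eq_two (R := R), hT.2 y h2 v hv x hx h1]
    · rfl

/-- The representatives of a partition of `X` into the maximal modules that avoid `v`. -/
theorem rooted_image [IsStrictOrder ℕ R] {U X : Set ℕ} (hX : Mod R U X) {rep : ℕ → ℕ} {v : ℕ}
    (hrep : ∀ x ∈ X, rep x ∈ X) (hrr : ∀ x ∈ X, rep (rep x) = rep x)
    (hv : rep v = v)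
    (hmod : ∀ x ∈ X, ∀ z ∈ U, ¬ (z ∈ X ∧ rep z = rep x) → cmp R z x = cmp R z (rep x))
    (hmax : ∀ N, Mod R U N → N ⊆ X → v ∉ N → ∀ a ∈ N, ∀ b ∈ N, rep a = rep b) :
    Rooted R v (rep '' X) := by
  intro N hN hvN
  have hNX : ∀ q ∈ N, q ∈ X ∧ rep q = q := by
    intro q hq
    obtain ⟨x, hx, rfl⟩ := hN.1 hq
    exact ⟨hrep x hx, hrr x hx⟩
  -- The union of the classes represented in a module of the quotient is a module of `U`, so the
  -- maximality of the classes applies to it.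
  have key : Mod R U {x ∈ X | rep x ∈ N} := by
    refine ⟨fun x hx => hX.1 hx.1, fun a ha b hb z hz hzN => ?_⟩
    by_cases hzX : z ∈ X
    · have hzN' : rep z ∉ N := fun h => hzN ⟨hzX, h⟩
      have hstep : ∀ c, c ∈ X → rep c ∈ N → cmp R z c = cmp R (rep z) (rep c) := by
        intro c hc hcN
        rw [hmod c hc z hz fun h => hzN' (h.2 ▸ hcN)]
        refine cmp_comm (hmod z hzX (rep c) (hX.1 (hrep c hc)) fun h => ?_)
        rw [hrr c hc] at h
        exact hzN' (h.2 ▸ hcN)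
      rw [hstep a ha.1 ha.2, hstep b hb.1 hb.2]
      exact hN.2 _ ha.2 _ hb.2 _ ⟨z, hzX, rfl⟩ hzN'
    · exact hX.2 a ha.1 b hb.1 z hz hzX
  intro a ha b hb
  have := hmax _ key (fun x hx => hx.1) (fun h => hvN (hv ▸ h.2)) a
    ⟨(hNX a ha).1, by rwa [(hNX a ha).2]⟩ b ⟨(hNX b hb).1, by rwa [(hNX b hb).2]⟩
  rw [(hNX a ha).2, (hNX b hb).2] at this
  exact this

/-! ### Levels of a rooted quotient and their tightness -/

/-- A level of the decomposition of `S` with root `v`: the set `B` of the elements that force `u`. -/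
structure IsLevel (R : ℕ → ℕ → Prop) (S : Set ℕ) (v u : ℕ) (B : Set ℕ) : Prop where
  rooted : Rooted R v S
  minimal : ∀ x ∈ S, ¬ R x v
  root_mem : v ∈ S
  top : S = {v, u} ∨ R v u ∧ ∀ z ∈ S, ¬ R u z
  subset : B ⊆ S
  top_mem : u ∈ B
  root_not_mem : v ∉ B
  closed : ∀ z ∈ B, ∀ x ∈ S, x ∉ B → cmp R z x = cmp R z v
  forces : ∀ z ∈ B, ∀ N, Mod R S N → v ∈ N → z ∈ N → u ∈ N

section
variable {S B : Set ℕ} {v u : ℕ} 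

/-- Every element outside `S \ B` lies in `B` and is related to all of `S \ B` as it is to the root.
-/
theorem IsLevel.mod_diff (h : IsLevel R S v u B) : Mod R S (S \ B) :=
  ⟨Set.sdiff_subset, fun a ha b hb z hz hzN => by
    have hzB : z ∈ B := by
      by_contra hzB
      exact hzN ⟨hz, hzB⟩
    rw [h.closed z hzB a ha.1 ha.2, h.closed z hzB b hb.1 hb.2]⟩

/-- The complement of a module that contains the root and the top is an isolated element. -/
theorem IsLevel.isolated [IsStrictOrder ℕ R] (h : IsLevel R S v u B) {N : Set ℕ} (hN : Mod R S N)
    (hv : v ∈ N) (hu : u ∈ N) {z : ℕ} (hz : z ∈ S) (hzN : z ∉ N) :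
    ∀ y ∈ S, cmp R z y = 0 := by
  -- An element outside `N` is related to the root as to the top. It is not below the root, which is
  -- minimal, and not above the top, which is maximal; hence it is incomparable to both.
  have h0 : ∀ x ∈ S, x ∉ N → cmp R x v = 0 := by
    intro x hx hxN
    have h1 := hN.2 v hv u hu x hx hxN
    rcases h.top with h2 | ⟨-, h2⟩
    · rw [h2] at hx
      rcases hx with rfl | rfl <;> contradiction
    · rw [cmp_eq_zero]
      refine ⟨h.minimal x hx, fun h3 => h2 x hx ?_⟩
      rw [← cmp_eq_one (R := R)] at h3 ⊢
      rw [← h1, h3]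
  have h1 : ∀ x ∈ S, x ∉ N → ∀ y ∈ N, cmp R x y = 0 := fun x hx hxN y hy => by
    rw [hN.2 y hy v hv x hx hxN, h0 x hx hxN]
  -- Thus the complement of `N` is a module that avoids the root. It has only one element, which is
  -- incomparable to everything.
  have h2 : Mod R S (S \ N) := by
    refine ⟨Set.sdiff_subset, fun a ha b hb y hy hyN => ?_⟩
    have hyN' : y ∈ N := by
      by_contra hyN'
      exact hyN ⟨hy, hyN'⟩
    refine cmp_comm ?_
    rw [h1 a ha.1 ha.2 y hyN', h1 b hb.1 hb.2 y hyN']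
  intro y hy
  by_cases hyN : y ∈ N
  · exact h1 z hz hzN y hyN
  · rw [h.rooted _ h2 (fun h => h.2 hv) ⟨hy, hyN⟩ ⟨hz, hzN⟩, cmp_self]

/-- A module with two elements of the level contains the root and the top. -/
theorem IsLevel.mem_of_mem (h : IsLevel R S v u B) {N : Set ℕ} (hN : Mod R S N) {a b : ℕ}
    (ha : a ∈ insert v B) (hb : b ∈ insert v B) (haN : a ∈ N) (hbN : b ∈ N) (hab : a ≠ b) :
    v ∈ N ∧ u ∈ N := by
  have hv : v ∈ N := by
    by_contra hv
    exact hab (h.rooted N hN hv haN hbN)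
  refine ⟨hv, ?_⟩
  rcases ha with rfl | ha
  · rcases hb with rfl | hb
    · exact absurd rfl hab
    · exact h.forces b hb N hN hv hbN
  · exact h.forces a ha N hN hv haN

/-- A module with two elements of the level contains the root and the top, so anything in `S` that
it misses is isolated in `S`; the hypothesis `hiso` rules this out for elements of the level. -/
theorem IsLevel.tight [IsStrictOrder ℕ R] (h : IsLevel R S v u B) {U : Set ℕ} (hSU : S ⊆ U)
    (hiso : ∀ b ∈ B, ∃ y ∈ insert v B, cmp R b y ≠ 0) : Tight R U (insert v B) := by
  intro N hN a ha b hb haN hbN hab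
  have hL : insert v B ⊆ S := Set.insert_subset h.root_mem h.subset
  have hN' := hN.restrict hSU
  obtain ⟨hv, hu⟩ := h.mem_of_mem hN' ha hb ⟨haN, hL ha⟩ ⟨hbN, hL hb⟩ hab
  intro z hz
  by_contra hzN
  have hiz := h.isolated hN' hv hu (hL hz) fun h => hzN h.1
  rcases hz with rfl | hz
  · exact hzN hv.1
  · obtain ⟨y, hy, hy'⟩ := hiso z hz
    exact hy' (hiz y (hL hy))

/-- There is at most one isolated element besides the root, because two of them would form a module
that avoids the root. Once `b₀` is removed, a module with two elements of the rest can miss nothing.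
-/
theorem IsLevel.tight_diff [IsStrictOrder ℕ R] (h : IsLevel R S v u B) {U : Set ℕ} (hSU : S ⊆ U)
    {b₀ : ℕ} (hb₀ : b₀ ∈ B) (hiso : ∀ y ∈ insert v B, cmp R b₀ y = 0) :
    Tight R U (insert v (B \ {b₀})) := by
  intro N hN a ha b hb haN hbN hab
  have hL : insert v B ⊆ S := Set.insert_subset h.root_mem h.subset
  have hL' : insert v (B \ {b₀}) ⊆ insert v B := Set.insert_subset_insert Set.sdiff_subset
  have hN' := hN.restrict hSU
  obtain ⟨hv, hu⟩ := h.mem_of_mem hN' (hL' ha) (hL' hb) ⟨haN, hL (hL' ha)⟩ ⟨hbN, hL (hL' hb)⟩ hab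
  intro z hz
  by_contra hzN
  have hiz := h.isolated hN' hv hu (hL (hL' hz)) fun h => hzN h.1
  -- Elements of `S` outside the level are related to `b₀` as the root is, so being isolated in the
  -- level implies being isolated in `S`.
  have hib : ∀ y ∈ S, cmp R b₀ y = 0 := by
    intro y hy
    by_cases hyB : y ∈ insert v B
    · exact hiso y hyB
    · rw [h.closed b₀ hb₀ y hy fun h => hyB (Or.inr h), hiso v (Or.inl rfl)]
  rcases hz with rfl | ⟨hz, hzb⟩
  · exact hzN hv.1
  · refine hzb (h.rooted {z, b₀} ⟨?_, ?_⟩ ?_ (by simp) (by simp))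
    · rintro x (rfl | rfl)
      exacts [h.subset hz, h.subset hb₀]
    · intro a ha b hb y hy _
      have : ∀ c ∈ ({z, b₀} : Set ℕ), cmp R c y = 0 := by
        rintro x (rfl | rfl)
        exacts [hiz y hy, hib y hy]
      exact cmp_comm ((this a ha).trans (this b hb).symm)
    · rintro (rfl | rfl)
      exacts [h.root_not_mem hz, h.root_not_mem hb₀]

theorem tight_pair (R : ℕ → ℕ → Prop) (U : Set ℕ) (v b : ℕ) : Tight R U {v, b} := by
  rintro N - x hx y hy hxN hyN hxy z hz
  simp only [Set.mem_insert_iff, Set.mem_singleton_iff] at hx hy hz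
  rcases hx with rfl | rfl <;> rcases hy with rfl | rfl <;> rcases hz with rfl | rfl <;>
    first | assumption | contradiction

/-- The module `S \ B` is collapsed to the root, which leaves `insert v B`. -/
theorem IsLevel.realizable_iff [IsStrictOrder ℕ R] (h : IsLevel R S v u B) (hS : S.Finite) {e : ℕ}
    (he : 1 ≤ e) :
    Realizable R e S ↔ Realizable R e (insert v B) ∧ Realizable R e (S \ B) := by
  rw [realizable_iff_of_mod he hS h.mod_diff (v := v) ⟨h.root_mem, h.root_not_mem⟩,
    Set.sdiff_sdiff_cancel_left h.subset]

/-- The rest of the level is a module because the only element outside it is isolated; collapsing it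
to the root leaves the pair `{v, b₀}`. -/
theorem IsLevel.realizable_insert_iff [IsStrictOrder ℕ R] (h : IsLevel R S v u B) (hS : S.Finite)
    {e : ℕ} (he : 1 ≤ e) {b₀ : ℕ} (hb₀ : b₀ ∈ B) (hiso : ∀ y ∈ insert v B, cmp R b₀ y = 0) :
    Realizable R e (insert v B) ↔
      Realizable R e {v, b₀} ∧ Realizable R e (insert v (B \ {b₀})) := by
  have hvb : v ≠ b₀ := fun h' => h.root_not_mem (h' ▸ hb₀)
  have hfin : (insert v B).Finite := hS.subset (Set.insert_subset h.root_mem h.subset)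
  have hmod : Mod R (insert v B) (insert v (B \ {b₀})) := by
    refine ⟨Set.insert_subset_insert Set.sdiff_subset, fun a ha b hb z hz hzN => ?_⟩
    have hzb : z = b₀ := by
      by_contra hne
      rcases hz with hz | hz
      · exact hzN (Or.inl hz)
      · exact hzN (Or.inr ⟨hz, hne⟩)
    have hsub : insert v (B \ {b₀}) ⊆ insert v B := Set.insert_subset_insert Set.sdiff_subset
    rw [hzb, hiso a (hsub ha), hiso b (hsub hb)]
  rw [realizable_iff_of_mod he hfin hmod (v := v) (Or.inl rfl)]
  have : insert v (insert v B \ insert v (B \ {b₀})) = {v, b₀} := by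
    ext x
    by_cases hx : x = v
    · simp [hx]
    · by_cases hx' : x = b₀
      · simp [hx', hb₀, hvb.symm]
      · simp [hx, hx']
  rw [this]

end

end

/-! ### Partitions into array segments -/

/-- `σ` lists the numbers below `n`, and the segment from `cs x` to `ce x` is the class of `x`. -/
structure IsPart (n : ℕ) (σ cs ce : ℕ → ℕ) : Prop where
  lt : ∀ i < n, σ i < n
  inj : ∀ i < n, ∀ j < n, σ i = σ j → i = j
  surj : ∀ x < n, ∃ i < n, σ i = x
  start_le : ∀ i < n, cs (σ i) ≤ i
  lt_end : ∀ i < n, i < ce (σ i)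
  end_le : ∀ i < n, ce (σ i) ≤ n
  start_eq : ∀ i < n, ∀ j, cs (σ i) ≤ j → j < ce (σ i) → cs (σ j) = cs (σ i)
  end_eq : ∀ i < n, ∀ j, cs (σ i) ≤ j → j < ce (σ i) → ce (σ j) = ce (σ i)

/-- The number of classes. -/
def numClasses (n : ℕ) (σ cs : ℕ → ℕ) : ℕ :=
  ((Finset.range n).filter fun i => cs (σ i) = i).card

theorem numClasses_le (n : ℕ) (σ cs : ℕ → ℕ) : numClasses n σ cs ≤ n :=
  (Finset.card_filter_le _ _).trans (by simp)

namespace IsPart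
variable {n : ℕ} {σ cs ce : ℕ → ℕ} 

theorem start_start (h : IsPart n σ cs ce) {i : ℕ} (hi : i < n) :
    cs (σ (cs (σ i))) = cs (σ i) ∧ ce (σ (cs (σ i))) = ce (σ i) := by
  have h1 := h.start_le i hi
  have h2 := h.lt_end i hi
  exact ⟨h.start_eq i hi _ le_rfl (by omega), h.end_eq i hi _ le_rfl (by omega)⟩

theorem end_eq_of_start_eq (h : IsPart n σ cs ce) {x y : ℕ} (hx : x < n) (hy : y < n)
    (hxy : cs x = cs y) : ce x = ce y := by
  obtain ⟨i, hi, rfl⟩ := h.surj x hx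
  obtain ⟨j, hj, rfl⟩ := h.surj y hy
  rw [← (h.start_start hi).2, ← (h.start_start hj).2, hxy]

theorem start_lt_end (h : IsPart n σ cs ce) {x : ℕ} (hx : x < n) : cs x < ce x := by
  obtain ⟨i, hi, rfl⟩ := h.surj x hx
  have h1 := h.start_le i hi
  have h2 := h.lt_end i hi
  omega

theorem start_eq_iff (h : IsPart n σ cs ce) {i j : ℕ} (hi : i < n) (hj : j < n) :
    cs (σ j) = cs (σ i) ↔ cs (σ i) ≤ j ∧ j < ce (σ i) := by
  refine ⟨fun h' => ?_, fun h' => h.start_eq i hi j h'.1 h'.2⟩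
  have h1 := h.start_le j hj
  have h2 := h.lt_end j hj
  rw [h.end_eq_of_start_eq (h.lt j hj) (h.lt i hi) h'] at h2
  omega

/-- All positions of a segment carry the same start and end, so permuting the entries inside one
segment does not change what is recorded at any position. -/
theorem permute (h : IsPart n σ cs ce) {i : ℕ} (hi : i < n) {π : Equiv.Perm ℕ}
    (hπ : ∀ j, j < cs (σ i) ∨ ce (σ i) ≤ j → π j = j) :
    IsPart n (σ ∘ π) cs ce ∧ ∀ j < n, cs (σ (π j)) = cs (σ j) ∧ ce (σ (π j)) = ce (σ j) := by
  have hen := h.end_le i hi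
  have key : ∀ j < n, π j < n ∧ cs (σ (π j)) = cs (σ j) ∧ ce (σ (π j)) = ce (σ j) := by
    intro j hj
    by_cases hc : cs (σ i) ≤ j ∧ j < ce (σ i)
    · obtain ⟨h1, h2⟩ := mem_segment_of_fixes hπ hc.1 hc.2
      refine ⟨by omega, ?_, ?_⟩
      · rw [h.start_eq i hi _ h1 h2, h.start_eq i hi _ hc.1 hc.2]
      · rw [h.end_eq i hi _ h1 h2, h.end_eq i hi _ hc.1 hc.2]
    · rw [hπ j (by omega)]
      exact ⟨hj, rfl, rfl⟩
  refine ⟨⟨fun j hj => h.lt _ (key j hj).1, fun j hj k hk hjk =>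
    π.injective (h.inj _ (key j hj).1 _ (key k hk).1 hjk), fun x hx => ?_, fun j hj => ?_,
    fun j hj => ?_, fun j hj => ?_, fun j hj k h1 h2 => ?_, fun j hj k h1 h2 => ?_⟩,
    fun j hj => (key j hj).2⟩
  · obtain ⟨j, hj, rfl⟩ := h.surj x hx
    refine ⟨π.symm j, ?_, by simp⟩
    by_contra hc
    have := hπ (π.symm j) (by omega)
    simp only [Equiv.apply_symm_apply] at this
    omega
  · simpa [(key j hj).2] using h.start_le j hj
  · simpa [(key j hj).2] using h.lt_end j hj
  · simpa [(key j hj).2] using h.end_le j hj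
  · simp only [Function.comp_apply, (key j hj).2] at h1 h2 ⊢
    have := h.end_le j hj
    rw [(key k (by omega)).2.1]
    exact h.start_eq j hj k h1 h2
  · simp only [Function.comp_apply, (key j hj).2] at h1 h2 ⊢
    have := h.end_le j hj
    rw [(key k (by omega)).2.2]
    exact h.end_eq j hj k h1 h2

/-- The degenerate cuts at `q = i` and at the end of the class are included and leave the partition
as it is. Hence a split needs no case distinction, and the number of classes tells whether anything
has changed. -/
theorem cut (h : IsPart n σ cs ce) {i q : ℕ} (hi : i < n) (hci : cs (σ i) = i) (hiq : i ≤ q)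
    (hqe : q ≤ ce (σ i)) {cs' ce' : ℕ → ℕ}
    (hcs : ∀ j < n, cs' (σ j) = if q ≤ j ∧ j < ce (σ i) then q else cs (σ j))
    (hce : ∀ j < n, ce' (σ j) = if i ≤ j ∧ j < q then q else ce (σ j)) :
    IsPart n σ cs' ce' ∧ numClasses n σ cs' =
      numClasses n σ cs + if i < q ∧ q < ce (σ i) then 1 else 0 := by
  have hen := h.end_le i hi
  have hcl : ∀ j, i ≤ j → j < ce (σ i) → cs (σ j) = i ∧ ce (σ j) = ce (σ i) := fun j h1 h2 => by
    rw [h.start_eq i hi j (by omega) h2, h.end_eq i hi j (by omega) h2, hci]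
    exact ⟨rfl, rfl⟩
  -- The segments of positions outside the class do not meet the class.
  have hout : ∀ j < n, j < i ∨ ce (σ i) ≤ j →
      (ce (σ j) ≤ i ∨ ce (σ i) ≤ cs (σ j)) := by
    intro j hj hji
    by_contra hc
    have h1 := h.start_le j hj
    have h2 := h.lt_end j hj
    rcases hji with h3 | h3
    · have h4 := h.start_eq j hj i (by omega) (by omega)
      omega
    · by_cases h5 : i ≤ cs (σ j)
      · have h4 := (h.start_start hj).2
        rw [(hcl (cs (σ j)) h5 (by omega)).2] at h4
        omega
      · have h4 := h.start_eq j hj i (by omega) (by omega)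
        omega
  have hbd : ∀ j < n, cs (σ j) ≤ j ∧ j < ce (σ j) ∧ ce (σ j) ≤ n := fun j hj =>
    ⟨h.start_le j hj, h.lt_end j hj, h.end_le j hj⟩
  constructor
  · refine ⟨h.lt, h.inj, h.surj, fun j hj => ?_, fun j hj => ?_, fun j hj => ?_,
      fun j hj k h1 h2 => ?_, fun j hj k h1 h2 => ?_⟩
    · rw [hcs j hj]; have := hbd j hj; split_ifs <;> omega
    · rw [hce j hj]; have := hbd j hj; split_ifs <;> omega
    · rw [hce j hj]; have := hbd j hj; split_ifs <;> omega
    all_goals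
      rw [hcs j hj] at h1
      rw [hce j hj] at h2
      have hj1 := hbd j hj
      have hk : k < n := by split_ifs at h2 <;> omega
      first | rw [hcs j hj, hcs k hk] | rw [hce j hj, hce k hk]
      by_cases hjc : i ≤ j ∧ j < ce (σ i)
      · have hj2 := hcl j hjc.1 hjc.2
        simp only [hj2] at h1 h2 ⊢
        have hk2 := hcl k (by split_ifs at h1 <;> omega) (by split_ifs at h2 <;> omega)
        simp only [hk2]
        split_ifs at h1 h2 ⊢ <;> omega
      · have hj2 := hout j hj (by omega)
        have h3 : ¬ (q ≤ j ∧ j < ce (σ i)) := by omega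
        have h4 : ¬ (i ≤ j ∧ j < q) := by omega
        rw [if_neg h3] at h1
        rw [if_neg h4] at h2
        have h5 := h.start_eq j hj k h1 h2
        have h6 := h.end_eq j hj k h1 h2
        rw [if_neg (by omega), if_neg (by omega)]
        assumption
  · unfold numClasses
    split_ifs with hq
    · have : ((Finset.range n).filter fun i => cs' (σ i) = i) =
          insert q ((Finset.range n).filter fun i => cs (σ i) = i) := by
        ext j
        simp only [Finset.mem_filter, Finset.mem_range, Finset.mem_insert]
        constructor
        · rintro ⟨hj, hj'⟩
          rw [hcs j hj] at hj'
          split_ifs at hj' with hc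
          · exact Or.inl hj'.symm
          · exact Or.inr ⟨hj, hj'⟩
        · rintro (rfl | ⟨hj, hj'⟩)
          · refine ⟨by omega, ?_⟩
            rw [hcs _ (by omega), if_pos ⟨le_rfl, hq.2⟩]
          · refine ⟨hj, ?_⟩
            rw [hcs j hj]
            split_ifs with hc
            · have := (hcl j (by omega) hc.2).1
              omega
            · exact hj'
      rw [this, Finset.card_insert_of_notMem]
      simp only [Finset.mem_filter, Finset.mem_range, not_and]
      intro hqn hqq
      have := (hcl q hq.1.le hq.2).1
      omega
    · rw [add_zero]
      congr 1
      refine Finset.filter_congr fun j hj => ?_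
      rw [hcs j (Finset.mem_range.1 hj)]
      split_ifs with hc
      · rw [(hcl j (by omega) hc.2).1]; omega
      · rfl

end IsPart

/-- Store register `22` at the indices listed in array `5` between the position in register `20`
and the position in register `h`. -/
def fillCmd (a h : ℕ) : Cmd :=
  upto 20 h (put a (get 5 (var 20)) (var 22))

theorem fillCmd_spec {W n lo hi : ℕ} {s : Store} {a h : ℕ} (ha : Nat.beq a 5 = false)
    (hh : Nat.beq 20 h = false)
    (h20 : s.reg 20 = lo) (hh' : s.reg h = hi) (hlo : lo ≤ hi) (hhi : hi ≤ n) (hnW : n < W)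
    (hinj : ∀ i < n, ∀ j < n, s.arr 5 i = s.arr 5 j → i = j) :
    Tot W (fillCmd a h) s fun s' t => (∀ j < n, s'.arr a (s.arr 5 j) =
      if lo ≤ j ∧ j < hi then s.reg 22 else s.arr a (s.arr 5 j)) ∧ t ≤ (hi - lo) * 3 + 1 := by
  have ha' : 5 ≠ a := Ne.symm (Nat.ne_of_beq_eq_false ha)
  refine (Tot.upto_const (N := hi) (i₀ := lo) (fun i s' => ∀ j < n, s'.arr a (s.arr 5 j) =
      if lo ≤ j ∧ j < i then s.reg 22 else s.arr a (s.arr 5 j)) 1 rfl ?_ h20 hh' hlo (by omega)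
      ?_ ?_).mono ?_
  · simpa [upto, writes] using hh
  · rintro i s' hi1 hi2 hI hk hi3 -
    have e22 : s'.reg 22 = s.reg 22 := hk.reg 22 rfl
    have e5 : s'.arr 5 = s.arr 5 := hk.arr 5 (by
      simp only [stores, upto, Bool.or_false]
      exact ha)
    simp only [tot_put, fits_get, fits_var, eval_get, eval_var, true_and, hi3, e22, e5,
      Store.arr_setReg, Store.arr_setArr, if_true, le_refl, and_true]
    intro j hj
    rw [Function.update_apply]
    split_ifs with h1 h2 h2
    · rfl
    · have := hinj _ hj _ (by omega) h1
      omega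
    · rw [hI j hj, if_pos]
      refine ⟨h2.1, lt_of_le_of_ne (by omega) fun h3 => h1 (by rw [h3])⟩
    · rw [hI j hj, if_neg (by omega)]
  · intro j _
    rw [if_neg (by omega)]
  · rintro s' t ⟨h1, -, -, h2⟩
    exact ⟨h1, by omega⟩

/-- Cut the class that starts at position `reg 30` and ends at position `reg 21` at position
`reg 22`; register `4` counts the classes. -/
def cutCmd : Cmd :=
  set 20 (var 30) ;; fillCmd 7 22 ;; set 20 (var 22) ;; fillCmd 6 21 ;;
  ite (var 30) (var 22) (ite (var 22) (var 21) (set 4 (var 4 + lit 1)) skip) skip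

theorem cutCmd_spec {W n i q : ℕ} {s : Store} (hP : IsPart n (s.arr 5) (s.arr 6) (s.arr 7))
    (hi : i < n) (hci : s.arr 6 (s.arr 5 i) = i) (hiq : i ≤ q) (hqe : q ≤ s.arr 7 (s.arr 5 i))
    (h30 : s.reg 30 = i) (h22 : s.reg 22 = q) (h21 : s.reg 21 = s.arr 7 (s.arr 5 i))
    (hnW : n < W) (h4 : s.reg 4 = numClasses n (s.arr 5) (s.arr 6)) :
    Tot W cutCmd s fun s' t => IsPart n (s.arr 5) (s'.arr 6) (s'.arr 7) ∧
      (∀ j < n, s'.arr 6 (s.arr 5 j) =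
        if q ≤ j ∧ j < s.arr 7 (s.arr 5 i) then q else s.arr 6 (s.arr 5 j)) ∧
      (∀ j < n, s'.arr 7 (s.arr 5 j) = if i ≤ j ∧ j < q then q else s.arr 7 (s.arr 5 j)) ∧
      s'.reg 4 = numClasses n (s.arr 5) (s'.arr 6) ∧
      s'.reg 4 = s.reg 4 + (if i < q ∧ q < s.arr 7 (s.arr 5 i) then 1 else 0) ∧
      t ≤ (s.arr 7 (s.arr 5 i) - i) * 3 + 7 := by
  have hen := hP.end_le i hi
  generalize hedef : s.arr 7 (s.arr 5 i) = e at *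
  simp only [cutCmd, tot_seq, tot_set, fits_var, true_and, eval_var]
  refine (fillCmd_spec (n := n) (lo := i) (hi := q) rfl rfl (by simp [h30]) (by simp [h22]) hiq
    (by omega) hnW (by simpa using hP.inj)).frame.mono ?_
  rintro s1 t1 ⟨⟨hA, hT1⟩, hk⟩
  have a5 : s1.arr 5 = s.arr 5 := hk.arr 5 rfl
  have a6 : s1.arr 6 = s.arr 6 := hk.arr 6 rfl
  have r22 : s1.reg 22 = q := (hk.reg 22 rfl).trans (by simp [h22])
  have r21 : s1.reg 21 = e := (hk.reg 21 rfl).trans (by simp [h21])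
  have r30 : s1.reg 30 = i := (hk.reg 30 rfl).trans (by simp [h30])
  have r4 : s1.reg 4 = s.reg 4 := (hk.reg 4 rfl).trans (by simp)
  refine (fillCmd_spec (n := n) (lo := q) (hi := e) rfl rfl (by simp [r22]) (by simp [r21]) hqe
    (by omega) hnW (by simpa [a5] using hP.inj)).frame.mono ?_
  rintro s2 t2 ⟨⟨hB, hT2⟩, hk2⟩
  have b7 : s2.arr 7 = s1.arr 7 := hk2.arr 7 rfl
  have q22 : s2.reg 22 = q := (hk2.reg 22 rfl).trans (by simp [r22])
  have q21 : s2.reg 21 = e := (hk2.reg 21 rfl).trans (by simp [r21])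
  have q30 : s2.reg 30 = i := (hk2.reg 30 rfl).trans (by simp [r30])
  have q4 : s2.reg 4 = s.reg 4 := (hk2.reg 4 rfl).trans (by simp [r4])
  simp only [Store.arr_setReg, Store.reg_setReg, a5, a6, h22, r22, Nat.reduceEqDiff,
    if_false] at hA hB
  obtain ⟨hP', hN⟩ := hP.cut hi hci hiq (cs' := s2.arr 6) (ce' := s2.arr 7) (by rw [hedef]; exact hqe)
    (by rw [hedef]; exact hB) (by rw [b7]; exact hA)
  rw [hedef] at hN
  have hle := numClasses_le n (s.arr 5) (s2.arr 6)
  simp only [tot_ite, tot_set, tot_skip, fits_var, fits_add, fits_lit, eval_var, eval_add, eval_lit,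
    true_and, q30, q22, q21, q4, Store.arr_setReg, Store.reg_setReg, if_true]
  refine ⟨fun h1 => ⟨fun h2 => ?_, fun h2 => ?_⟩, fun h1 => ?_⟩
  · rw [if_pos ⟨h1, h2⟩] at hN ⊢
    exact ⟨⟨by omega, by omega⟩, hP', hB, by rw [b7]; exact hA, by omega, rfl, by omega⟩
  · rw [if_neg (by omega)] at hN ⊢
    exact ⟨hP', hB, by rw [b7]; exact hA, by omega, rfl, by omega⟩
  · rw [if_neg (by omega)] at hN ⊢
    exact ⟨hP', hB, by rw [b7]; exact hA, by omega, rfl, by omega⟩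

/-! ### Partition refinement -/

/-- The matrix in array `2` holds the relation between the numbers below `n`, and register `0`
holds `n`. -/
structure HasMatrix (R : ℕ → ℕ → Prop) (n : ℕ) (s : Store) : Prop where
  n_eq : s.reg 0 = n
  mat : ∀ x < n, ∀ y < n, s.arr 2 (x * n + y) = cmp R x y

theorem HasMatrix.congr {R : ℕ → ℕ → Prop} {n : ℕ} {s s' : Store} (h : HasMatrix R n s)
    (h0 : s'.reg 0 = s.reg 0) (h2 : s'.arr 2 = s.arr 2) : HasMatrix R n s' :=
  ⟨h0.trans h.n_eq, fun x hx y hy => by rw [h2, h.mat x hx y hy]⟩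

/-- The partition stored in arrays `5`, `6`, `7`, with the number of classes in register `4`. -/
structure HasPart (n : ℕ) (s : Store) : Prop where
  part : IsPart n (s.arr 5) (s.arr 6) (s.arr 7)
  count : s.reg 4 = numClasses n (s.arr 5) (s.arr 6)

/-- The partition of `s'` refines the partition of `s`. -/
structure Refines (n : ℕ) (s s' : Store) : Prop where
  start_le : ∀ x < n, s.arr 6 x ≤ s'.arr 6 x
  end_le : ∀ x < n, s'.arr 7 x ≤ s.arr 7 x
  start_eq : ∀ x < n, ∀ y < n, s'.arr 6 x = s'.arr 6 y → s.arr 6 x = s.arr 6 y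
  count_le : s.reg 4 ≤ s'.reg 4
  same : s'.reg 4 = s.reg 4 → ∀ x < n, s'.arr 6 x = s.arr 6 x ∧ s'.arr 7 x = s.arr 7 x

theorem Refines.refl (n : ℕ) (s : Store) : Refines n s s :=
  ⟨fun _ _ => le_rfl, fun _ _ => le_rfl, fun _ _ _ _ h => h, le_rfl, fun _ _ _ => ⟨rfl, rfl⟩⟩

theorem Refines.trans {n : ℕ} {s s' s'' : Store} (h : Refines n s s') (h' : Refines n s' s'') :
    Refines n s s'' :=
  ⟨fun x hx => (h.start_le x hx).trans (h'.start_le x hx),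
    fun x hx => (h'.end_le x hx).trans (h.end_le x hx),
    fun x hx y hy hxy => h.start_eq x hx y hy (h'.start_eq x hx y hy hxy),
    h.count_le.trans h'.count_le, fun he x hx => by
      have h1 := h.count_le
      have h2 := h'.count_le
      have h3 := h.same (by omega) x hx
      have h4 := h'.same (by omega) x hx
      exact ⟨h4.1.trans h3.1, h4.2.trans h3.2⟩⟩

theorem Refines.congr {n : ℕ} {s s' s'' : Store} (h : Refines n s s') (h4 : s''.reg 4 = s'.reg 4)
    (h6 : s''.arr 6 = s'.arr 6) (h7 : s''.arr 7 = s'.arr 7) : Refines n s s'' := by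
  obtain ⟨a, b, c, d, e⟩ := h
  constructor <;> simp only [h4, h6, h7] <;> assumption

/-- Splitting the class that starts at `i` by the entries below `θ` of row `w`. -/
structure SplitAt (R : ℕ → ℕ → Prop) (n w θ i : ℕ) (s s' : Store) : Prop where
  out : ∀ x < n, s.arr 6 x ≠ i → s'.arr 6 x = s.arr 6 x ∧ s'.arr 7 x = s.arr 7 x
  out_order : ∀ j < n, s.arr 6 (s.arr 5 j) ≠ i → s'.arr 5 j = s.arr 5 j
  iff : ∀ x < n, ∀ y < n, s.arr 6 x = i → s.arr 6 y = i →
    (s'.arr 6 x = s'.arr 6 y ↔ (cmp R w x < θ ↔ cmp R w y < θ))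

/-- Split the class from `reg 30` to `reg 32` by the entries below `reg 25` of row `reg 23`. -/
def splitCmd : Cmd :=
  set 24 (lit 0) ;; set 20 (var 30) ;; set 21 (var 32) ;; set 22 (var 30) ;; partitionCmd 5 ;;
  cutCmd

/-- Sorting the segment by the test only permutes it and leaves the classes as sets unchanged; the
cut at the boundary then separates the two outcomes of the test. -/
theorem splitCmd_spec {R : ℕ → ℕ → Prop} {W n i w θ : ℕ} {s : Store} (hM : HasMatrix R n s)
    (hP : HasPart n s) (hi : i < n) (hci : s.arr 6 (s.arr 5 i) = i)
    (h30 : s.reg 30 = i) (h32 : s.reg 32 = s.arr 7 (s.arr 5 i)) (h23 : s.reg 23 = w) (hw : w < n)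
    (h25 : s.reg 25 = θ) (hnW : n * n < W) :
    Tot W splitCmd s fun s' t => HasPart n s' ∧ Refines n s s' ∧ SplitAt R n w θ i s s' ∧
      t ≤ (s.arr 7 (s.arr 5 i) - i) * 11 + 12 := by
  have hnW' : n < W := lt_of_le_of_lt (Nat.le_mul_self n) hnW
  have hen := hP.part.end_le i hi
  have hie := hP.part.lt_end i hi
  generalize hedef : s.arr 7 (s.arr 5 i) = e at *
  simp only [splitCmd, tot_seq, tot_set, fits_var, fits_lit, true_and, eval_var, eval_lit,
    Store.reg_setReg, Nat.reduceEqDiff, if_false, h30, h32]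
  refine ⟨by omega, (partitionCmd_spec (n := n) (lo := i) (hi := e) (w := w) rfl (by simp [hM.n_eq])
    (by simp) (by simp) (by simp) (by simp [h23]) hie.le (by omega) hw hnW
    (fun j h1 h2 => by simpa using hP.part.lt j (by omega))).frame.mono ?_⟩
  rintro s1 t1 ⟨⟨π, hπ, harr, hq1, hq2, hk1, hk2, hT⟩, hk⟩
  have a6 : s1.arr 6 = s.arr 6 := hk.arr 6 rfl
  have a7 : s1.arr 7 = s.arr 7 := hk.arr 7 rfl
  have r4 : s1.reg 4 = s.reg 4 := hk.reg 4 rfl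
  have r30 : s1.reg 30 = i := (hk.reg 30 rfl).trans (by simp [h30])
  have r21 : s1.reg 21 = e := (hk.reg 21 rfl).trans (by simp)
  simp only [Store.arr_setReg, Store.reg_setReg, if_true, Nat.reduceEqDiff, if_false, h25, zero_le,
    true_and] at harr hk1 hk2
  generalize hqdef : s1.reg 22 = q at *
  obtain ⟨hP1, hperm⟩ := hP.part.permute hi (π := π) (by rw [hci, hedef]; exact hπ)
  rw [← harr, ← a6, ← a7] at hP1
  have hperm' : ∀ j < n, s1.arr 6 (s1.arr 5 j) = s.arr 6 (s.arr 5 j) ∧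
      s1.arr 7 (s1.arr 5 j) = s.arr 7 (s.arr 5 j) := by
    rw [harr, a6, a7]; exact hperm
  have hcl : ∀ j < n, s.arr 6 (s.arr 5 j) = i ↔ i ≤ j ∧ j < e := fun j hj => by
    have := hP.part.start_eq_iff hi hj
    rwa [hci, hedef] at this
  have hc1 : s1.arr 6 (s1.arr 5 i) = i := by rw [(hperm' i hi).1, hci]
  have hc2 : s1.arr 7 (s1.arr 5 i) = e := by rw [(hperm' i hi).2, hedef]
  have hcount : numClasses n (s1.arr 5) (s1.arr 6) = numClasses n (s.arr 5) (s.arr 6) := by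
    unfold numClasses
    congr 1
    refine Finset.filter_congr fun j hj => ?_
    rw [(hperm' j (Finset.mem_range.1 hj)).1]
  refine (cutCmd_spec hP1 hi hc1 hq1 (by rw [hc2]; exact hq2) r30 hqdef (by rw [r21, hc2]) hnW'
    (by rw [r4, hcount, hP.count])).frame.mono ?_
  rintro s2 t2 ⟨⟨hP2, hcs, hce, h4, h4', hT2⟩, hk'⟩
  have b5 : s2.arr 5 = s1.arr 5 := hk'.arr 5 rfl
  rw [hc2] at hcs h4' hT2
  have hcl1 : ∀ j < n, s1.arr 6 (s1.arr 5 j) = i ↔ i ≤ j ∧ j < e := fun j hj => by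
    rw [(hperm' j hj).1, hcl j hj]
  have he1 : ∀ j < n, s1.arr 6 (s1.arr 5 j) = i → s1.arr 7 (s1.arr 5 j) = e := fun j hj h => by
    rw [hP1.end_eq_of_start_eq (hP1.lt j hj) (hP1.lt i hi) (h.trans hc1.symm), hc2]
  have hmat : ∀ j < n, s.arr 2 (w * n + s1.arr 5 j) = cmp R w (s1.arr 5 j) := fun j hj =>
    hM.mat w hw _ (hP1.lt j hj)
  refine ⟨⟨by rw [b5]; exact hP2, by rw [b5]; exact h4⟩, ⟨fun x hx => ?_, fun x hx => ?_,
    fun x hx y hy hxy => ?_, by omega, fun h x hx => ?_⟩, ⟨fun x hx h => ?_, fun j hj h => ?_,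
    fun x hx y hy h1 h2 => ?_⟩, by omega⟩
  · obtain ⟨j, hj, rfl⟩ := hP1.surj x hx
    rw [← a6, hcs j hj]
    split_ifs with h
    · rw [(hcl1 j hj).2 (by omega)]; exact hq1
    · exact le_rfl
  · obtain ⟨j, hj, rfl⟩ := hP1.surj x hx
    rw [← a7, hce j hj]
    split_ifs with h
    · rw [he1 j hj ((hcl1 j hj).2 (by omega))]; exact hq2
    · exact le_rfl
  · obtain ⟨j, hj, rfl⟩ := hP1.surj x hx
    obtain ⟨k, hk, rfl⟩ := hP1.surj y hy
    rw [hcs j hj, hcs k hk] at hxy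
    rw [← a6]
    have e1 := hcl1 j hj
    have e2 := hcl1 k hk
    have e3 := (hP1.start_eq_iff hi hj)
    have e4 := (hP1.start_eq_iff hi hk)
    have e5 := hP1.start_start hj
    have e6 := hP1.start_start hk
    have e7 := hP1.start_le j hj
    have e8 := hP1.start_le k hk
    split_ifs at hxy with h1 h2 h2
    · rw [e1.2 (by omega), e2.2 (by omega)]
    · rw [e1.2 (by omega)]
      have := (hcl1 (s1.arr 6 (s1.arr 5 k)) (by omega)).2 (by omega)
      omega
    · rw [e2.2 (by omega)]
      have := (hcl1 (s1.arr 6 (s1.arr 5 j)) (by omega)).2 (by omega)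
      omega
    · exact hxy
  · obtain ⟨j, hj, rfl⟩ := hP1.surj x hx
    have hn : ¬ (i < q ∧ q < e) := fun hc => by rw [if_pos hc] at h4'; omega
    rw [← a6, ← a7, hcs j hj, hce j hj]
    constructor
    · split_ifs with h'
      · rw [(hcl1 j hj).2 (by omega)]; omega
      · rfl
    · split_ifs with h'
      · rw [he1 j hj ((hcl1 j hj).2 (by omega))]; omega
      · rfl
  · obtain ⟨j, hj, rfl⟩ := hP1.surj x hx
    rw [← a6] at h ⊢
    rw [← a7, hcs j hj, hce j hj]
    have := hcl1 j hj
    rw [if_neg (by omega), if_neg (by omega)]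
    exact ⟨rfl, rfl⟩
  · rw [b5, harr, Function.comp_apply, hπ j]
    have := hcl j hj
    omega
  · obtain ⟨j, hj, rfl⟩ := hP1.surj x hx
    obtain ⟨k, hk, rfl⟩ := hP1.surj y hy
    rw [← a6] at h1 h2
    rw [hcs j hj, hcs k hk, h1, h2, ← hmat j hj, ← hmat k hk]
    have e1 := (hcl1 j hj).1 h1
    have e2 := (hcl1 k hk).1 h2
    by_cases f1 : q ≤ j <;> by_cases f2 : q ≤ k
    · simp only [f1, f2, e1, e2, and_self, if_true, hk2 j f1 e1.2, hk2 k f2 e2.2]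
    · simp only [f1, f2, e1, and_self, if_true, false_and, if_false, hk2 j f1 e1.2,
        hk1 k e2.1 (by omega)]
      simp; omega
    · simp only [f1, f2, e2, and_self, if_true, false_and, if_false, hk2 k f2 e2.2,
        hk1 j e1.1 (by omega)]
      simp; omega
    · simp only [f1, f2, false_and, if_false, hk1 j e1.1 (by omega), hk1 k e2.1 (by omega)]

theorem IsPart.start_eq_of_lt {n : ℕ} {σ cs ce : ℕ → ℕ} (h : IsPart n σ cs ce) {x y : ℕ}
    (hx : x < n) (hy : y < n) (h1 : cs y ≤ cs x) (h2 : cs x < ce y) : cs x = cs y := by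
  obtain ⟨i, hi, rfl⟩ := h.surj x hx
  obtain ⟨j, hj, rfl⟩ := h.surj y hy
  rw [← (h.start_start hi).1]
  exact h.start_eq j hj _ h1 h2

theorem IsPart.start_eq_of_mem {n : ℕ} {σ cs ce : ℕ → ℕ} (h : IsPart n σ cs ce) {x y k : ℕ}
    (hx : x < n) (hy : y < n) (h1 : cs x ≤ k) (h2 : k < ce x) (h3 : cs y ≤ k) (h4 : k < ce y) :
    cs x = cs y := by
  rcases le_total (cs x) (cs y) with h5 | h5
  · exact (h.start_eq_of_lt hy hx h5 (by omega)).symm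
  · exact h.start_eq_of_lt hx hy h5 (by omega)

/-- The state while the class `X` of `s₀` that starts at `p` is refined, after `v ∈ X` has been
separated. Arrays `8` and `9` hold for every `w` a range of positions outside of which the classes
are uniform with respect to `w`. -/
structure Refining (R : ℕ → ℕ → Prop) (n p v : ℕ) (s₀ s : Store) : Prop where
  mat : HasMatrix R n s
  part : HasPart n s
  refines : Refines n s₀ s
  out : ∀ x < n, s₀.arr 6 x ≠ p → s.arr 6 x = s₀.arr 6 x ∧ s.arr 7 x = s₀.arr 7 x
  out_order : ∀ j < n, s₀.arr 6 (s₀.arr 5 j) ≠ p → s.arr 5 j = s₀.arr 5 j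
  maximal : ∀ N, Mod R {x | x < n} N → (∀ x ∈ N, s₀.arr 6 x = p) → v ∉ N →
    ∀ a ∈ N, ∀ b ∈ N, s.arr 6 a = s.arr 6 b
  range : ∀ w < n, s₀.arr 6 w ≤ s.arr 8 w ∧ s.arr 8 w ≤ s.arr 6 w ∧ s.arr 7 w ≤ s.arr 9 w ∧
    s.arr 9 w ≤ s₀.arr 7 w
  boundary : ∀ w < n, ∀ x < n, (s.arr 6 x < s.arr 8 w → s.arr 7 x ≤ s.arr 8 w) ∧
    (s.arr 6 x < s.arr 9 w → s.arr 7 x ≤ s.arr 9 w)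
  uniform : ∀ w < n, ∀ x < n, ∀ y < n, s.arr 6 x = s.arr 6 y →
    s.arr 6 x < s.arr 8 w ∨ s.arr 9 w ≤ s.arr 6 x → cmp R w x = cmp R w y

theorem Refining.congr {R : ℕ → ℕ → Prop} {n p v : ℕ} {s₀ s s' : Store}
    (h : Refining R n p v s₀ s) (h0 : s'.reg 0 = s.reg 0) (h4 : s'.reg 4 = s.reg 4)
    (h2 : s'.arr 2 = s.arr 2) (h5 : s'.arr 5 = s.arr 5) (h6 : s'.arr 6 = s.arr 6)
    (h7 : s'.arr 7 = s.arr 7) (h8 : s'.arr 8 = s.arr 8) (h9 : s'.arr 9 = s.arr 9) :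
    Refining R n p v s₀ s' where
  mat := h.mat.congr h0 h2
  part := ⟨by rw [h5, h6, h7]; exact h.part.part, by rw [h4, h5, h6]; exact h.part.count⟩
  refines := h.refines.congr h4 h6 h7
  out := by rw [h6, h7]; exact h.out
  out_order := by rw [h5]; exact h.out_order
  maximal := by rw [h6]; exact h.maximal
  range := by rw [h6, h7, h8, h9]; exact h.range
  boundary := by rw [h6, h7, h8, h9]; exact h.boundary
  uniform := by rw [h6, h8, h9]; exact h.uniform

/-- Splitting by `w` never separates a module `N` that avoids `v`: `N` lies in one class, and if
this is the class being split, then `w` lies in another class, hence outside `N`, and does not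
distinguish its elements. -/
theorem Refining.split {R : ℕ → ℕ → Prop} {n p v : ℕ} {s₀ s s' : Store}
    (h : Refining R n p v s₀ s) (h₀ : HasPart n s₀) {w θ i : ℕ} (hw : w < n)
    (hiw : i ≠ s.arr 6 w) (hA : s.arr 8 w ≤ i) (hB : i < s.arr 9 w)
    (hP : HasPart n s') (hr : Refines n s s') (hS : SplitAt R n w θ i s s')
    (h0 : s'.reg 0 = s.reg 0) (h2 : s'.arr 2 = s.arr 2) (h8 : s'.arr 8 = s.arr 8)
    (h9 : s'.arr 9 = s.arr 9) : Refining R n p v s₀ s' := by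
  -- The class that is split belongs to `X`. It lies in the old class of `w`; were this not `X`, it
  -- would be unsplit so far, and the class at `i` would be the class of `w` itself.
  have hseg : ∀ x < n, s.arr 6 x = i → s₀.arr 6 x = p := by
    intro x hx hxi
    have h1 := h.range w hw
    have h2 := h.refines.start_le x hx
    have h3 := h.refines.end_le x hx
    have h4 := h.part.part.start_lt_end hx
    have h5 := h₀.part.start_eq_of_mem hx hw (k := i) (by omega) (by omega) (by omega) (by omega)
    by_contra hne
    have h6 := h.out w hw (h5 ▸ hne)
    have h7 := h.part.part.start_eq_of_lt hx hw (by omega) (by omega)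
    omega
  refine ⟨h.mat.congr h0 h2, hP, h.refines.trans hr, fun x hx hxp => ?_, fun j hj hjp => ?_,
    fun N hN hNp hv a ha b hb => ?_, fun x hx => ?_, fun y hy x hx => ?_,
    fun y hy x hx z hz hxz hr' => ?_⟩
  · have h1 := hS.out x hx fun h' => hxp (hseg x hx h')
    have h2 := h.out x hx hxp
    rw [h1.1, h1.2]
    exact h2
  · rw [hS.out_order j hj, h.out_order j hj hjp]
    intro h'
    exact hjp (h.out_order j hj hjp ▸ hseg _ (h.part.part.lt j hj) h')
  · have h1 := h.maximal N hN hNp hv a ha b hb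
    have han := hN.1 ha
    have hbn := hN.1 hb
    by_cases hai : s.arr 6 a = i
    · have hwN : w ∉ N := fun hwN => hiw (hai ▸ h.maximal N hN hNp hv a ha w hwN)
      rw [hS.iff a han b hbn hai (h1 ▸ hai), hN.2 a ha b hb w hw hwN]
    · rw [(hS.out a han hai).1, (hS.out b hbn (h1 ▸ hai)).1, h1]
  · have h1 := h.range x hx
    have h2 := hr.start_le x hx
    have h3 := hr.end_le x hx
    rw [h8, h9]
    omega
  · have h1 := h.boundary y hy x hx
    have h2 := hr.start_le x hx
    have h3 := hr.end_le x hx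
    rw [h8, h9]
    omega
  · rw [h8, h9] at hr'
    have h1 := h.boundary y hy x hx
    have h2 := hr.start_le x hx
    have h3 := hr.end_le x hx
    have h4 := hP.part.start_lt_end hx
    exact h.uniform y hy x hx z hz (hr.start_eq x hx z hz hxz) (by omega)

/-- Split all classes in the range of `reg 23`, except its own class. -/
def pivotCmd : Cmd :=
  set 30 (get 8 (var 23)) ;; set 31 (get 9 (var 23)) ;;
  whl (var 30) (var 31) (
    set 32 (get 7 (get 5 (var 30))) ;;
    -- The sum of the two truncated differences is zero exactly when the current class is the class
    -- of the pivot, which must not be split.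
    ite (var 30 - get 6 (var 23) + (get 6 (var 23) - var 30)) (lit 1) skip splitCmd ;;
    set 30 (var 32))

/-- The classes in the range of `w`, except its own class, are uniform with respect to the entries
below `θ` of row `w`. -/
def UniformBelow (R : ℕ → ℕ → Prop) (n w θ a b : ℕ) (s : Store) : Prop :=
  ∀ x < n, ∀ y < n, s.arr 6 x = s.arr 6 y → a ≤ s.arr 6 x → s.arr 6 x < b →
    s.arr 6 x ≠ s.arr 6 w → (cmp R w x < θ ↔ cmp R w y < θ)

/-- The pivot's own class is skipped in constant time, so the cost is proportional to the part of
the range outside it. This is exactly the part by which the range may be shortened afterwards. -/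
theorem pivotCmd_spec {R : ℕ → ℕ → Prop} {W n p v w θ : ℕ} {s₀ s : Store}
    (h : Refining R n p v s₀ s) (h₀ : HasPart n s₀) (h23 : s.reg 23 = w) (hw : w < n)
    (h25 : s.reg 25 = θ) (hnW : n * n < W) (hW2 : 2 ≤ W) :
    Tot W pivotCmd s fun s' t => Refining R n p v s₀ s' ∧ Refines n s s' ∧
      (s'.arr 6 w = s.arr 6 w ∧ s'.arr 7 w = s.arr 7 w) ∧
      UniformBelow R n w θ (s.arr 8 w) (s.arr 9 w) s' ∧
      t ≤ (s.arr 9 w - s.arr 8 w - (s.arr 7 w - s.arr 6 w)) * 31 + 13 := by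
  have hnW' : n < W := lt_of_le_of_lt (Nat.le_mul_self n) hnW
  have hrw := h.range w hw
  have hcw := h.part.part.start_lt_end hw
  have hBn : s.arr 9 w ≤ n := by
    obtain ⟨j, hj, hj'⟩ := h₀.part.surj w hw
    have := h₀.part.end_le j hj
    rw [hj'] at this
    omega
  simp only [pivotCmd, tot_seq, tot_set, fits_get, fits_var, true_and, eval_get, eval_var,
    Store.reg_setReg, Store.arr_setReg, Nat.reduceEqDiff, if_false, h23]
  refine (Tot.whl (fun s' => Refining R n p v s₀ s' ∧ Refines n s s' ∧
      (s'.arr 6 w = s.arr 6 w ∧ s'.arr 7 w = s.arr 7 w) ∧ s.arr 8 w ≤ s'.reg 30 ∧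
      s'.reg 30 ≤ s.arr 9 w ∧ (∀ x < n, s'.arr 6 x < s'.reg 30 → s'.arr 7 x ≤ s'.reg 30) ∧
      UniformBelow R n w θ (s.arr 8 w) (s'.reg 30) s')
    -- The summand `10` is reserved for the one visit to the pivot's own class; it is present as
    -- long as that class lies ahead.
    (fun s' => if s'.reg 30 ≤ s.arr 6 w then
      (s.arr 9 w - s'.reg 30 - (s.arr 7 w - s.arr 6 w)) * 31 + 10
      else (s.arr 9 w - s'.reg 30) * 31) (fun _ _ _ => by simp) ?_ ?_).mono ?_
  · rintro s1 ⟨hR, hr, ⟨hw6, hw7⟩, hA, hB, hb, hu⟩ hk hlt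
    have e31 : s1.reg 31 = s.arr 9 w := (hk.reg 31 rfl).trans (by simp)
    have e8 : s1.arr 8 = s.arr 8 := (hk.arr 8 rfl).trans (by simp)
    have e9 : s1.arr 9 = s.arr 9 := (hk.arr 9 rfl).trans (by simp)
    have e23 : s1.reg 23 = w := (hk.reg 23 rfl).trans (by simp [h23])
    have e25 : s1.reg 25 = θ := (hk.reg 25 rfl).trans (by simp [h25])
    simp only [eval_var, e31] at hlt
    generalize hi : s1.reg 30 = i at *
    have hin : i < n := by omega
    have hyn := hR.part.part.lt i hin
    have hys := hR.part.part.start_le i hin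
    have hye := hR.part.part.lt_end i hin
    have hyn' := hR.part.part.end_le i hin
    have hci : s1.arr 6 (s1.arr 5 i) = i := by
      have := hb _ hyn
      omega
    have hover : ∀ x < n, i ≤ s1.arr 6 x → s1.arr 6 x < s1.arr 7 (s1.arr 5 i) → s1.arr 6 x = i :=
      fun x hx h1 h2 => by
        rw [hR.part.part.start_eq_of_lt hx hyn (by omega) h2, hci]
    have hoverE : ∀ x < n, s1.arr 6 x = i → s1.arr 7 x = s1.arr 7 (s1.arr 5 i) := fun x hx h1 =>
      hR.part.part.end_eq_of_start_eq hx hyn (by omega)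
    have heB : s1.arr 7 (s1.arr 5 i) ≤ s.arr 9 w := by
      have := (hR.boundary w hw _ hyn).2
      rw [e9] at this
      omega
    have hb' : ∀ x < n, s1.arr 6 x < s1.arr 7 (s1.arr 5 i) →
        s1.arr 7 x ≤ s1.arr 7 (s1.arr 5 i) := fun x hx h1 => by
      by_cases h2 : s1.arr 6 x < i
      · have := hb x hx h2
        omega
      · rw [hoverE x hx (hover x hx (by omega) h1)]
    have hwn := hR.part.part.start_lt_end hw
    have hwe : s1.arr 7 w ≤ n := by
      obtain ⟨j, hj, hj'⟩ := hR.part.part.surj w hw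
      have := hR.part.part.end_le j hj
      rwa [hj'] at this
    simp only [tot_seq, tot_set, tot_ite, tot_skip, fits_get, fits_var, fits_add, fits_sub,
      fits_lit, eval_get, eval_add, eval_sub, eval_lit, eval_var, Store.reg_setReg,
      Store.arr_setReg, Nat.reduceEqDiff, if_false, if_true, true_and, hi, e23]
    refine ⟨⟨by omega, by omega, by omega⟩, by omega, fun hc => ?_, fun hc => ?_⟩
    · have hiw : i = s1.arr 6 w := by omega
      have hew := hoverE w hw hiw.symm
      refine ⟨⟨hR.congr (by simp) (by simp) rfl rfl rfl rfl rfl rfl, hr.congr (by simp) rfl rfl,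
        ⟨hw6, hw7⟩, by omega, by omega, hb', fun x hx y hy hxy h1 h2 h3 => ?_⟩, ?_⟩
      · refine hu x hx y hy hxy h1 ?_ h3
        simp only [Store.arr_setReg] at h2 h3
        by_contra h4
        have := hover x hx (by omega) h2
        omega
      · rw [if_neg (by omega), if_pos (by omega)]
        omega
    · have hiw : i ≠ s1.arr 6 w := by omega
      refine (splitCmd_spec (i := i) (w := w) (θ := θ)
        (s := s1.setReg 32 (s1.arr 7 (s1.arr 5 i))) (hR.mat.congr (by simp) rfl)
        ⟨hR.part.part, by simpa using hR.part.count⟩ hin hci (by simp [hi]) (by simp)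
        (by simp [e23]) hw (by simp [e25]) hnW).frame.mono ?_
      rintro s2 t2 ⟨⟨hP2, hr2, hS, hT⟩, hk2⟩
      have hr2' : Refines n s1 s2 := by
        obtain ⟨a, b, c, d, e⟩ := hr2
        simp only [Store.reg_setReg, Nat.reduceEqDiff, if_false] at d e
        exact ⟨a, b, c, d, e⟩
      have hS' : SplitAt R n w θ i s1 s2 := ⟨hS.out, hS.out_order, hS.iff⟩
      have f0 : s2.reg 0 = s1.reg 0 := (hk2.reg 0 rfl).trans (by simp)
      have f32 : s2.reg 32 = s1.arr 7 (s1.arr 5 i) := (hk2.reg 32 rfl).trans (by simp)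
      have hR2 := hR.split h₀ hw hiw (by rw [e8]; omega) (by rw [e9]; omega) hP2 hr2' hS' f0
        (hk2.arr 2 rfl) (hk2.arr 8 rfl) (hk2.arr 9 rfl)
      have hw2 := hS'.out w hw hiw.symm
      have hTb : t2 ≤ (s1.arr 7 (s1.arr 5 i) - i) * 11 + 12 := hT
      simp only [f32]
      refine ⟨⟨hR2.congr (by simp) (by simp) rfl rfl rfl rfl rfl rfl,
        (hr.trans hr2').congr (by simp) rfl rfl, ⟨by simpa [hw2] using hw6, by simpa [hw2] using hw7⟩,
        by omega, heB, fun x hx h1 => ?_, fun x hx y hy hxy h1 h2 h3 => ?_⟩, ?_⟩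
      · have h2 := hr2'.start_le x hx
        have h3 := hr2'.end_le x hx
        have h4 := hb' x hx (by omega)
        omega
      · simp only [Store.arr_setReg] at hxy h1 h2 h3
        have h4 := hr2'.start_eq x hx y hy hxy
        by_cases h5 : s1.arr 6 x = i
        · exact (hS'.iff x hx y hy h5 (h4 ▸ h5)).1 hxy
        · have h6 := hS'.out x hx h5
          refine hu x hx y hy h4 (by omega) ?_ (by omega)
          by_contra h7
          exact h5 (hover x hx (by omega) (by omega))
      · by_cases h1 : i ≤ s.arr 6 w
        · have h2 : s1.arr 7 (s1.arr 5 i) ≤ s.arr 6 w := by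
            by_contra h3
            exact hiw (hover w hw (by omega) (by omega)).symm
          rw [if_pos h2, if_pos h1]
          omega
        · rw [if_neg (by omega), if_neg h1]
          omega
  · simp only [Store.reg_setReg, Store.arr_setReg, Nat.reduceEqDiff, if_false, if_true]
    refine ⟨h.congr (by simp) (by simp) rfl rfl rfl rfl rfl rfl,
      (Refines.refl n s).congr (by simp) rfl rfl, by trivial, le_rfl, by omega,
      fun x hx => (h.boundary w hw x hx).1, fun x hx y hy _ h1 h2 => ?_⟩
    omega
  · rintro s' t ⟨⟨hR, hr, hw67, hA, hB, hb, hu⟩, hk, hnlt, hT⟩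
    have e31 : s'.reg 31 = s.arr 9 w := (hk.reg 31 rfl).trans (by simp)
    simp only [eval_var, e31] at hnlt
    have hi : s'.reg 30 = s.arr 9 w := by omega
    simp only [Store.reg_setReg, Nat.reduceEqDiff, if_false, if_true] at hT
    rw [if_pos hrw.2.1] at hT
    exact ⟨hR, hr, hw67, by rw [← hi]; exact hu, by omega⟩

/-- One pass of pivots; registers: `23` the pivot. -/
def sweepCmd : Cmd :=
  upto 23 0 (
    set 25 (lit 1) ;; pivotCmd ;; set 25 (lit 2) ;; pivotCmd ;;
    put 8 (var 23) (get 6 (var 23)) ;; put 9 (var 23) (get 7 (var 23)))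

/-- The total length of the ranges in arrays `8` and `9`. -/
def rangeSum (n : ℕ) (s : Store) : ℕ :=
  ∑ w ∈ Finset.range n, (s.arr 9 w - s.arr 8 w)

theorem rangeSum_eq_of_update {n w : ℕ} (hw : w < n) {s s' : Store}
    (h : ∀ x < n, x ≠ w → s'.arr 9 x - s'.arr 8 x = s.arr 9 x - s.arr 8 x) :
    rangeSum n s' + (s.arr 9 w - s.arr 8 w) = rangeSum n s + (s'.arr 9 w - s'.arr 8 w) := by
  unfold rangeSum
  rw [← Finset.add_sum_erase _ _ (Finset.mem_range.2 hw),
    ← Finset.add_sum_erase (Finset.range n) (fun w => s.arr 9 w - s.arr 8 w)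
      (Finset.mem_range.2 hw),
    Finset.sum_congr rfl fun x hx => h x (Finset.mem_range.1 (Finset.mem_of_mem_erase hx))
      (Finset.ne_of_mem_erase hx)]
  omega

/-- Uniformity with respect to the first threshold survives the splits made for the second one,
since the class of `w` itself is unchanged. -/
theorem UniformBelow.of_refines {R : ℕ → ℕ → Prop} {n w θ a b : ℕ} {s s' : Store}
    (h : UniformBelow R n w θ a b s) (hr : Refines n s s') (hP : HasPart n s')
    (ha : ∀ x < n, s.arr 6 x < a → s.arr 7 x ≤ a) (hw : w < n)
    (hw6 : s'.arr 6 w = s.arr 6 w) (hP0 : HasPart n s) (hw7 : s'.arr 7 w = s.arr 7 w) :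
    UniformBelow R n w θ a b s' := by
  intro x hx y hy hxy h1 h2 h3
  have h4 := hr.start_le x hx
  have h5 := hr.end_le x hx
  have h6 := hP.part.start_lt_end hx
  refine h x hx y hy (hr.start_eq x hx y hy hxy) ?_ (by omega) fun h7 => h3 ?_
  · by_contra h7
    have := ha x hx (by omega)
    omega
  · have h8 := hP0.part.end_eq_of_start_eq hx hw h7
    exact hP.part.start_eq_of_lt hx hw (by omega) (by omega)

/-- The thresholds `1` and `2` separate the three values of `cmp`, so after both passes the range of
`w` may shrink to its own class. The shrinking pays `62 = 2 * 31` per position. If no class is split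
during the whole sweep, the ranges set on the way are still the classes at the end. -/
theorem sweepCmd_spec {R : ℕ → ℕ → Prop} {W n p v : ℕ} {s₀ s : Store}
    (h : Refining R n p v s₀ s) (h₀ : HasPart n s₀) (h23 : s.reg 23 = 0) (hnW : n * n < W)
    (hW3 : 3 ≤ W) :
    Tot W sweepCmd s fun s' t => Refining R n p v s₀ s' ∧ Refines n s s' ∧
      (s'.reg 4 = s.reg 4 → ∀ w < n, s'.arr 8 w = s'.arr 6 w ∧ s'.arr 9 w = s'.arr 7 w) ∧
      t + rangeSum n s' * 62 ≤ rangeSum n s * 62 + n * 32 + 1 := by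
  have hnW' : n < W := lt_of_le_of_lt (Nat.le_mul_self n) hnW
  refine (Tot.upto_pot (N := n) (i₀ := 0) (fun i s' => Refining R n p v s₀ s' ∧ Refines n s s' ∧
      (s'.reg 4 = s.reg 4 → ∀ w < i, s'.arr 8 w = s'.arr 6 w ∧ s'.arr 9 w = s'.arr 7 w))
      (fun s' => rangeSum n s' * 62) 30 (fun _ _ => rfl) rfl rfl h23 h.mat.n_eq (Nat.zero_le _) hnW'
      ?_ ?_).mono ?_
  · rintro w s1 - hw ⟨hR, hr, hcl⟩ hk hw1 -
    simp only [tot_seq, tot_set, fits_lit, eval_lit]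
    have hs1 : Refining R n p v s₀ (s1.setReg 25 1) :=
      hR.congr (by simp) (by simp) rfl rfl rfl rfl rfl rfl
    refine ⟨by omega, (pivotCmd_spec (w := w) (θ := 1) hs1 h₀ (by simp [hw1]) hw (by simp) hnW
      (by omega)).frame.mono ?_⟩
    rintro s2 t2 ⟨⟨hR2, hr2, hw2, hu2, hT2⟩, hk2⟩
    have e2_8 : s2.arr 8 = s1.arr 8 := hk2.arr 8 rfl
    have e2_9 : s2.arr 9 = s1.arr 9 := hk2.arr 9 rfl
    have e2_23 : s2.reg 23 = w := (hk2.reg 23 rfl).trans (by simp [hw1])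
    have hr2' : Refines n s1 s2 := by
      obtain ⟨a, b, c, d, e⟩ := hr2
      simp only [Store.reg_setReg, Nat.reduceEqDiff, if_false] at d e
      exact ⟨a, b, c, d, e⟩
    simp only [Store.arr_setReg] at hw2 hu2 hT2
    have hs2 : Refining R n p v s₀ (s2.setReg 25 2) :=
      hR2.congr (by simp) (by simp) rfl rfl rfl rfl rfl rfl
    refine ⟨by omega, (pivotCmd_spec (w := w) (θ := 2) hs2 h₀ (by simp [e2_23]) hw (by simp) hnW
      (by omega)).frame.mono ?_⟩
    rintro s3 t3 ⟨⟨hR3, hr3, hw3, hu3, hT3⟩, hk3⟩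
    have e3_8 : s3.arr 8 = s1.arr 8 := (hk3.arr 8 rfl).trans e2_8
    have e3_9 : s3.arr 9 = s1.arr 9 := (hk3.arr 9 rfl).trans e2_9
    have e3_23 : s3.reg 23 = w := (hk3.reg 23 rfl).trans (by simp [e2_23])
    have hr3' : Refines n s2 s3 := by
      obtain ⟨a, b, c, d, e⟩ := hr3
      simp only [Store.reg_setReg, Nat.reduceEqDiff, if_false] at d e
      exact ⟨a, b, c, d, e⟩
    simp only [Store.arr_setReg, e2_8, e2_9] at hw3 hu3 hT3
    have hu2' := hu2.of_refines hr3' hR3.part (fun x hx => by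
      have := (hR2.boundary w hw x hx).1
      rwa [e2_8] at this) hw hw3.1 hR2.part hw3.2
    have hR4 := hr.trans (hr2'.trans hr3')
    simp only [tot_put, fits_get, fits_var, true_and, eval_var, eval_get, Store.reg_setArr,
      Store.arr_setArr, Nat.reduceEqDiff, if_false, e3_23]
    have hrg := hR3.range w hw
    have hcw := hR3.part.part.start_lt_end hw
    refine ⟨⟨⟨hR3.mat.congr (by simp) rfl, ⟨by simpa using hR3.part.part, by
        simpa using hR3.part.count⟩, hR3.refines.congr (by simp) (by simp) (by simp),
        by simpa using hR3.out, by simpa using hR3.out_order, by simpa using hR3.maximal,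
        fun x hx => ?_, fun x hx y hy => ?_, fun x hx y hy z hz => ?_⟩,
        hR4.congr (by simp) (by simp) (by simp), ?_⟩, ?_⟩
    · simp only [Store.arr_setArr, Store.arr_setReg, Nat.reduceEqDiff, if_false, if_true,
        Function.update_apply]
      have := hR3.range x hx
      split_ifs with hxw
      · subst hxw; omega
      · exact this
    · simp only [Store.arr_setArr, Store.arr_setReg, Nat.reduceEqDiff, if_false, if_true,
        Function.update_apply]
      split_ifs with hxw
      · have h1 := hR3.part.part.start_lt_end hy
        have h2 := @(hR3.part.part.start_eq_of_mem hy hw (k := s3.arr 6 w))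
        have h3 := hR3.part.part.start_eq_of_lt hy hw
        have h4 := hR3.part.part.end_eq_of_start_eq hy hw
        refine ⟨fun h5 => ?_, fun h5 => ?_⟩
        · by_contra h6
          have := h2 (by omega) (by omega) le_rfl hcw
          omega
        · by_contra h6
          by_cases h7 : s3.arr 6 y < s3.arr 6 w
          · have := h2 (by omega) (by omega) le_rfl hcw
            omega
          · have := h4 (h3 (by omega) h5)
            omega
      · exact hR3.boundary x hx y hy
    · simp only [Store.arr_setArr, Store.arr_setReg, Nat.reduceEqDiff, if_false, if_true,
        Function.update_apply]
      split_ifs with hxw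
      · subst hxw
        intro h1 h2
        by_cases h3 : s3.arr 6 y < s1.arr 8 x ∨ s1.arr 9 x ≤ s3.arr 6 y
        · exact hR3.uniform x hx y hy z hz h1 (by rw [e3_8, e3_9]; exact h3)
        -- Both comparisons are at most `2` and fall on the same side of `1` and of `2`, hence they
        -- are equal.
        · have h4 := hu2' y hy z hz h1 (by omega) (by omega) (by omega)
          have h5 := hu3 y hy z hz h1 (by omega) (by omega) (by omega)
          have h6 := cmp_le_two R x y
          have h7 := cmp_le_two R x z
          omega
      · exact hR3.uniform x hx y hy z hz
    · simp only [Store.arr_setArr, Store.arr_setReg, Store.reg_setReg, Store.reg_setArr,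
        Nat.reduceEqDiff, if_false, if_true, Function.update_apply]
      intro h1 x hx
      split_ifs with hxw
      · subst hxw; exact ⟨rfl, rfl⟩
      · have c1 := hr.count_le
        have c2 := hr2'.count_le
        have c3 := hr3'.count_le
        have h2 := hr2'.same (by omega) x (by omega)
        have h3 := hr3'.same (by omega) x (by omega)
        have h4 := hcl (by omega) x (by omega)
        rw [e3_8, e3_9, h3.1, h3.2, h2.1, h2.2]
        exact h4
    -- Neither pass changes the class of `w`, so the range sum drops by the length of the old range
    -- minus the length of this class.
    · have hs := rangeSum_eq_of_update hw (s := s1)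
        (s' := (s3.setArr 8 w (s3.arr 6 w)).setArr 9 w (s3.arr 7 w)) (fun x _ hx => by
          simp [Function.update_of_ne hx, e3_8, e3_9])
      simp only [Store.arr_setArr, Nat.reduceEqDiff, if_false, if_true, Function.update_self] at hs
      have e1 : s3.arr 7 w = s1.arr 7 w := hw3.2.trans hw2.2
      have e2 : s3.arr 6 w = s1.arr 6 w := hw3.1.trans hw2.1
      rw [e3_8, e3_9] at hrg
      rw [hw2.1, hw2.2] at hT3
      omega
  · exact ⟨h, Refines.refl n s, fun _ w hw => by omega⟩
  · rintro s' t ⟨⟨h1, h2, h3⟩, -, -, h4⟩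
    exact ⟨h1, h2, h3, by omega⟩

/-- Refine until the number of classes does not change; register `5` holds the number of classes
before the last pass. -/
def refineCmd : Cmd :=
  whl (var 5) (var 4) (set 5 (var 4) ;; set 23 (lit 0) ;; sweepCmd)

/-- All pivots have been used. -/
def Settled (n : ℕ) (s : Store) : Prop :=
  s.reg 5 = s.reg 4 ∧ ∀ w < n, s.arr 8 w = s.arr 6 w ∧ s.arr 9 w = s.arr 7 w

/-- Every round raises register `5` to the current number of classes, by at least one. So the fixed
cost `O(n)` of a sweep is charged to classes, and the rest of its cost to the range sum. The
hypothesis `hset` covers the case in which the loop is not entered at all. -/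
theorem refineCmd_spec {R : ℕ → ℕ → Prop} {W n p v : ℕ} {s₀ s : Store}
    (h : Refining R n p v s₀ s) (h₀ : HasPart n s₀) (hle : s.reg 5 ≤ s.reg 4)
    (hset : s.reg 5 = s.reg 4 → Settled n s) (hnW : n * n < W) (hW3 : 3 ≤ W) :
    Tot W refineCmd s fun s' t => Refining R n p v s₀ s' ∧ Refines n s s' ∧ Settled n s' ∧
      t + rangeSum n s' * 62 + (n - s'.reg 4) * (n * 32 + 4) ≤
        rangeSum n s * 62 + (n - s.reg 5) * (n * 32 + 4) + 1 := by
  refine (Tot.whl (fun s' => Refining R n p v s₀ s' ∧ Refines n s s' ∧ s'.reg 5 ≤ s'.reg 4 ∧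
    (s'.reg 5 = s'.reg 4 → Settled n s'))
    (fun s' => rangeSum n s' * 62 + (n - s'.reg 5) * (n * 32 + 4)) (fun _ _ _ => by simp) ?_
    ⟨h, Refines.refl n s, hle, hset⟩).mono ?_
  · rintro s1 ⟨hR, hr1, hle1, -⟩ hk hlt
    simp only [eval_var] at hlt
    simp only [tot_seq, tot_set, fits_lit, fits_var, eval_lit, eval_var, true_and]
    refine ⟨by omega, (sweepCmd_spec (s := (s1.setReg 5 (s1.reg 4)).setReg 23 0)
      (hR.congr (by simp) (by simp) rfl rfl rfl rfl rfl rfl) h₀ (by simp) hnW hW3).frame.mono ?_⟩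
    rintro s2 t2 ⟨⟨hR2, hr2, hcl, hT⟩, hk2⟩
    have e5 : s2.reg 5 = s1.reg 4 := (hk2.reg 5 rfl).trans (by simp)
    have hr2' : Refines n s1 s2 := by
      obtain ⟨a, b, c, d, e⟩ := hr2
      simp only [Store.reg_setReg, Nat.reduceEqDiff, if_false] at d e
      exact ⟨a, b, c, d, e⟩
    have h1 := hr2.count_le
    simp only [Store.reg_setReg, Nat.reduceEqDiff, if_false] at h1 hcl
    have h2 : s1.reg 4 ≤ n := by rw [hR.part.count]; exact numClasses_le _ _ _
    have h3 : rangeSum n ((s1.setReg 5 (s1.reg 4)).setReg 23 0) = rangeSum n s1 := rfl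
    rw [h3] at hT
    refine ⟨⟨hR2, hr1.trans hr2', by omega, fun h4 => ⟨h4, hcl (by omega)⟩⟩, ?_⟩
    rw [e5]
    have h4 : n - s1.reg 5 = (n - s1.reg 5 - 1) + 1 := by omega
    have h5 : (n - s1.reg 4) * (n * 32 + 4) ≤ (n - s1.reg 5 - 1) * (n * 32 + 4) :=
      Nat.mul_le_mul_right _ (by omega)
    rw [h4, add_mul]
    omega
  · rintro s' t ⟨⟨hR, hr1, hle1, hset1⟩, hk, hnlt, hT⟩
    simp only [eval_var] at hnlt
    have h4 : s'.reg 5 = s'.reg 4 := by omega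
    exact ⟨hR, hr1, hset1 h4, by rw [h4] at hT; omega⟩

/-! ### The levels of a quotient -/

/-- The set of vertices of the level `l`; array `11` holds the levels, array `12` their ends. -/
def levelSet (s : Store) (l : ℕ) : Set ℕ :=
  s.arr 11 '' Set.Ico (s.arr 12 l) (s.arr 12 (l + 1))

/-- The levels found so far: register `6` is their number, register `7` their total length. -/
structure HasLevels (R : ℕ → ℕ → Prop) (n : ℕ) (s : Store) : Prop where
  last : s.arr 12 (s.reg 6) = s.reg 7
  le_last : ∀ l ≤ s.reg 6, s.arr 12 l ≤ s.reg 7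
  lt_succ : ∀ l < s.reg 6, s.arr 12 l < s.arr 12 (l + 1)
  lt : ∀ j < s.reg 7, s.arr 11 j < n
  inj : ∀ l < s.reg 6, Set.InjOn (s.arr 11) (Set.Ico (s.arr 12 l) (s.arr 12 (l + 1)))
  tight : ∀ l < s.reg 6, Tight R {x | x < n} (levelSet s l)

theorem HasLevels.congr {R : ℕ → ℕ → Prop} {n : ℕ} {s s' : Store} (h : HasLevels R n s)
    (h6 : s'.reg 6 = s.reg 6) (h7 : s'.reg 7 = s.reg 7) (h11 : s'.arr 11 = s.arr 11)
    (h12 : s'.arr 12 = s.arr 12) : HasLevels R n s' := by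
  obtain ⟨a, b, c, d, e, f⟩ := h
  constructor <;> simp only [h6, h7, h11, h12, levelSet] <;> assumption

theorem levelSet_congr {s s' : Store} (h11 : s'.arr 11 = s.arr 11) (h12 : s'.arr 12 = s.arr 12) :
    levelSet s' = levelSet s := by
  unfold levelSet; rw [h11, h12]

/-- Append the level that consists of entry `0` and the entries from `reg 33` to `reg 8` of
array `10`. -/
def emitCmd : Cmd :=
  put 11 (var 7) (get 10 (lit 0)) ;; set 7 (var 7 + lit 1) ;; set 20 (var 33) ;;
  upto 20 8 (put 11 (var 7) (get 10 (var 20)) ;; set 7 (var 7 + lit 1)) ;;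
  set 6 (var 6 + lit 1) ;; put 12 (var 6) (var 7)

theorem emitCmd_spec {R : ℕ → ℕ → Prop} {W n a r : ℕ} {s : Store} (h : HasLevels R n s)
    (h33 : s.reg 33 = a) (h8 : s.reg 8 = r) (ha : 1 ≤ a) (har : a ≤ r)
    (hinj : Set.InjOn (s.arr 10) (Set.Iio r)) (hlt : ∀ j < r, s.arr 10 j < n)
    (hT : Tight R {x | x < n} (insert (s.arr 10 0) (s.arr 10 '' Set.Ico a r))) (hr0 : 0 < r)
    (hW : s.reg 7 + 1 + (r - a) < W) (hW' : s.reg 6 + 1 < W) (hrW : r < W) :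
    Tot W emitCmd s fun s' t => HasLevels R n s' ∧ s'.reg 6 = s.reg 6 + 1 ∧
      s'.reg 7 = s.reg 7 + 1 + (r - a) ∧ (∀ l < s.reg 6, levelSet s' l = levelSet s l) ∧
      levelSet s' (s.reg 6) = insert (s.arr 10 0) (s.arr 10 '' Set.Ico a r) ∧
      t ≤ (r - a) * 4 + 6 := by
  simp only [emitCmd, tot_seq, tot_set, tot_put, fits_var, fits_add, fits_get, fits_lit, true_and,
    eval_var, eval_add, eval_get, eval_lit, Store.reg_setReg, Store.reg_setArr, Store.arr_setReg,
    Store.arr_setArr, Nat.reduceEqDiff, if_false, if_true]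
  refine ⟨by omega, ⟨by omega, by omega⟩, (Tot.upto_const (N := r) (i₀ := a) (fun i s' =>
    s'.reg 7 = s.reg 7 + 1 + (i - a) ∧ (∀ j < s.reg 7, s'.arr 11 j = s.arr 11 j) ∧
    s'.arr 11 (s.reg 7) = s.arr 10 0 ∧
    ∀ j, a ≤ j → j < i → s'.arr 11 (s.reg 7 + 1 + (j - a)) = s.arr 10 j) 2 rfl rfl (by simp [h33])
    (by simp [h8]) har hrW ?_ ?_).mono ?_⟩
  · rintro i s1 hi1 hi2 ⟨h7, hA, hB, hC⟩ hk h20 -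
    have e10 : s1.arr 10 = s.arr 10 := (hk.arr 10 rfl).trans (by simp)
    simp only [tot_seq, tot_set, tot_put, fits_var, fits_add, fits_get, fits_lit, true_and,
      eval_var, eval_add, eval_get, eval_lit, Store.reg_setReg, Store.reg_setArr, Store.arr_setReg,
      Store.arr_setArr, Nat.reduceEqDiff, if_false, if_true, h7, h20, e10]
    refine ⟨⟨by omega, by omega⟩, ⟨by omega, fun j hj => ?_, ?_, fun j h1 h2 => ?_⟩, by omega⟩
    · rw [Function.update_of_ne (by omega), hA j hj]
    · rw [Function.update_of_ne (by omega), hB]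
    · by_cases hji : j = i
      · rw [hji, Function.update_self]
      · rw [Function.update_of_ne (by omega), hC j h1 (by omega)]
  · refine ⟨by simp, fun j hj => ?_, ?_, fun j h1 h2 => by omega⟩
    · simp [Function.update_of_ne (show j ≠ s.reg 7 by omega)]
    · simp
  · rintro s2 t2 ⟨⟨h7, hA, hB, hC⟩, hk, -, hTm⟩
    have e6 : s2.reg 6 = s.reg 6 := (hk.reg 6 rfl).trans (by simp)
    have e12 : s2.arr 12 = s.arr 12 := (hk.arr 12 rfl).trans (by simp)
    have hlast := h.last
    have hset : ∀ l < s.reg 6, levelSet ((s2.setReg 6 (s.reg 6 + 1)).setArr 12 (s.reg 6 + 1)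
        (s2.reg 7)) l = levelSet s l := by
      intro l hl
      have h1 := h.le_last (l + 1) hl
      simp only [levelSet, Store.arr_setArr, Store.arr_setReg, Nat.reduceEqDiff, if_false, if_true,
        e12, Function.update_of_ne (show l ≠ s.reg 6 + 1 by omega),
        Function.update_of_ne (show l + 1 ≠ s.reg 6 + 1 by omega)]
      refine Set.image_congr fun j hj => hA j ?_
      have := hj.2
      omega
    have hidx : ∀ j, s.reg 7 ≤ j → j < s.reg 7 + 1 + (r - a) → ∃ i, (i = 0 ∨ a ≤ i) ∧ i < r ∧
        s2.arr 11 j = s.arr 10 i ∧ (j = s.reg 7 ↔ i = 0) ∧ (i ≠ 0 → j = s.reg 7 + 1 + (i - a)) := by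
      intro j h1 h2
      by_cases hj : j = s.reg 7
      · exact ⟨0, Or.inl rfl, hr0, by rw [hj, hB], by simp [hj], by simp⟩
      · refine ⟨j - s.reg 7 - 1 + a, by omega, by omega, ?_, by omega, by omega⟩
        rw [← hC _ (by omega) (by omega)]
        congr 1
        omega
    have hnew : levelSet ((s2.setReg 6 (s.reg 6 + 1)).setArr 12 (s.reg 6 + 1) (s2.reg 7))
        (s.reg 6) = insert (s.arr 10 0) (s.arr 10 '' Set.Ico a r) := by
      simp only [levelSet, Store.arr_setArr, Store.arr_setReg, Nat.reduceEqDiff, if_false, if_true,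
        e12, Function.update_of_ne (show s.reg 6 ≠ s.reg 6 + 1 by omega), Function.update_self,
        hlast, h7]
      ext x
      simp only [Set.mem_image, Set.mem_Ico, Set.mem_insert_iff]
      constructor
      · rintro ⟨j, ⟨h1, h2⟩, rfl⟩
        obtain ⟨i, h3, h4, h5, -⟩ := hidx j h1 h2
        rcases h3 with rfl | h3
        · exact Or.inl h5
        · exact Or.inr ⟨i, ⟨h3, h4⟩, h5.symm⟩
      · rintro (rfl | ⟨j, ⟨h1, h2⟩, rfl⟩)
        · exact ⟨s.reg 7, ⟨le_rfl, by omega⟩, hB⟩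
        · exact ⟨_, ⟨by omega, by omega⟩, hC j h1 h2⟩
    simp only [fits_var, fits_add, fits_lit, true_and, eval_var, eval_add, eval_lit, e6,
      Store.reg_setReg, Store.reg_setArr, Nat.reduceEqDiff, if_false, if_true]
    refine ⟨⟨by omega, by omega⟩, ⟨?_, ?_, ?_, ?_, ?_, ?_⟩, h7, hset, hnew, by omega⟩
    · simp
    · intro l hl
      simp only [Store.reg_setArr, Store.reg_setReg, Store.arr_setArr, Store.arr_setReg, if_true,
        Nat.reduceEqDiff, if_false, e12] at hl ⊢
      by_cases hl' : l = s.reg 6 + 1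
      · rw [hl', Function.update_self]
      · rw [Function.update_of_ne hl']
        have := h.le_last l (by omega)
        omega
    · intro l hl
      simp only [Store.reg_setArr, Store.reg_setReg, Store.arr_setArr, Store.arr_setReg, if_true,
        Nat.reduceEqDiff, if_false, e12] at hl ⊢
      rw [Function.update_of_ne (by omega)]
      by_cases hl' : l = s.reg 6
      · rw [hl', Function.update_self]
        omega
      · rw [Function.update_of_ne (by omega)]
        exact h.lt_succ l (by omega)
    · intro j hj
      simp only [Store.reg_setArr, Store.reg_setReg, Store.arr_setArr, Store.arr_setReg, if_true,
        Nat.reduceEqDiff, if_false] at hj ⊢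
      by_cases hj' : j < s.reg 7
      · rw [hA j hj']; exact h.lt j hj'
      · obtain ⟨i, -, h4, h5, -⟩ := hidx j (by omega) (by omega)
        rw [h5]; exact hlt i h4
    · intro l hl
      simp only [Store.reg_setArr, Store.reg_setReg, Store.arr_setArr, Store.arr_setReg, if_true,
        Nat.reduceEqDiff, if_false, e12] at hl ⊢
      rw [Function.update_of_ne (show l ≠ s.reg 6 + 1 by omega)]
      by_cases hl' : l = s.reg 6
      · rw [hl', Function.update_self, hlast, h7]
        intro j hj j' hj' hjj
        obtain ⟨i, h3, h4, h5, h6, h7⟩ := hidx j hj.1 hj.2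
        obtain ⟨i', h3', h4', h5', h6', h7'⟩ := hidx j' hj'.1 hj'.2
        have : i = i' := hinj h4 h4' (by rw [← h5, ← h5', hjj])
        omega
      · rw [Function.update_of_ne (by omega)]
        have := h.le_last (l + 1) (by omega)
        intro j hj j' hj' hjj
        have h1 := hj.2
        have h2 := hj'.2
        rw [hA j (by omega), hA j' (by omega)] at hjj
        exact h.inj l (by omega) hj hj' hjj
    · intro l hl
      simp only [Store.reg_setArr, Store.reg_setReg, if_true] at hl
      by_cases hl' : l = s.reg 6
      · rw [hl', hnew]; exact hT
      · rw [hset l (by omega)]; exact h.tight l (by omega)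

/-- Exchange the entries `reg 34` and `reg 35` of array `a`. -/
def swapCmd (a : ℕ) : Cmd :=
  set 36 (get a (var 34)) ;; put a (var 34) (get a (var 35)) ;; put a (var 35) (var 36)

theorem swapCmd_spec {W a : ℕ} {s : Store} : Tot W (swapCmd a) s fun s' t =>
    s'.arr a = s.arr a ∘ Equiv.swap (s.reg 34) (s.reg 35) ∧ t = 3 := by
  simp only [swapCmd, tot_seq, tot_set, tot_put, fits_get, fits_var, true_and, eval_get, eval_var,
    Store.reg_setReg, Store.reg_setArr, Store.arr_setReg, Store.arr_setArr, Nat.reduceEqDiff,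
    if_false, if_true, comp_swap_eq, Nat.reduceAdd, and_self]

/-- Array `10` lists `r` distinct vertices. -/
structure HasList (n r : ℕ) (s : Store) : Prop where
  len : s.reg 8 = r
  inj : Set.InjOn (s.arr 10) (Set.Iio r)
  lt : ∀ j < r, s.arr 10 j < n

/-- Find in register `34` an entry that is maximal above entry `0`. -/
def topCmd : Cmd :=
  set 34 (lit 0) ;; set 20 (lit 1) ;;
  upto 20 8 (
    ite (lit 1) (get 2 (get 10 (var 34) * var 0 + get 10 (var 20))) (set 34 (var 20)) skip) ;;
  ite (var 34) (lit 1) (set 34 (lit 1)) skip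

/-- One scan suffices: the candidate starts at the root and only moves upwards, so by transitivity
everything found not to be above an earlier candidate is not above the present one either. -/
theorem topCmd_spec {R : ℕ → ℕ → Prop} [IsStrictOrder ℕ R] {W n r : ℕ} {s : Store}
    (hM : HasMatrix R n s) (hL : HasList n r s) (hr : 1 < r) (hrW : r < W) (hnW : n * n < W)
    (hroot : Rooted R (s.arr 10 0) (s.arr 10 '' Set.Iio r))
    (hmin : ∀ j < r, ¬ R (s.arr 10 j) (s.arr 10 0)) :
    Tot W topCmd s fun s' t => 1 ≤ s'.reg 34 ∧ s'.reg 34 < r ∧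
      (s.arr 10 '' Set.Iio r = {s.arr 10 0, s.arr 10 (s'.reg 34)} ∨
        R (s.arr 10 0) (s.arr 10 (s'.reg 34)) ∧
          ∀ j < r, ¬ R (s.arr 10 (s'.reg 34)) (s.arr 10 j)) ∧ t ≤ r * 4 + 5 := by
  simp only [topCmd, tot_seq, tot_set, fits_lit, eval_lit]
  refine ⟨by omega, by omega, (Tot.upto_const (N := r) (i₀ := 1) (fun i s' =>
    s'.reg 34 < r ∧ (s'.reg 34 = 0 ∨ R (s.arr 10 0) (s.arr 10 (s'.reg 34))) ∧
    ∀ j < i, ¬ R (s.arr 10 (s'.reg 34)) (s.arr 10 j)) 2 rfl rfl (by simp) (by simp [hL.len])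
    hr.le hrW ?_ ?_).mono ?_⟩
  · rintro i s1 hi1 hi2 ⟨h1, h2, h3⟩ hk h20 -
    have e10 : s1.arr 10 = s.arr 10 := (hk.arr 10 rfl).trans (by simp)
    have e2 : s1.arr 2 = s.arr 2 := (hk.arr 2 rfl).trans (by simp)
    have e0 : s1.reg 0 = n := (hk.reg 0 rfl).trans (by simp [hM.n_eq])
    have hc := hL.lt _ h1
    have hi := hL.lt _ hi2
    have hidx := mul_add_lt_mul hc hi
    have hidx' : s.arr 10 (s1.reg 34) * n < n * n := by nlinarith
    simp only [tot_ite, tot_set, tot_skip, fits_lit, fits_get, fits_add, fits_mul, fits_var,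
      eval_lit, eval_get, eval_add, eval_mul, eval_var, true_and, and_true, e10, e0, e2, h20,
      hM.mat _ hc _ hi, Store.reg_setReg, Nat.reduceEqDiff, if_false, if_true]
    refine ⟨by omega, ⟨by omega, by omega⟩, fun hlt => ⟨⟨hi2, Or.inr ?_, fun j hj => ?_⟩, by omega⟩,
      fun hlt => ⟨⟨h1, h2, fun j hj => ?_⟩, by omega⟩⟩
    · have h4 := cmp_le_two R (s.arr 10 (s1.reg 34)) (s.arr 10 i)
      have h5 : R (s.arr 10 (s1.reg 34)) (s.arr 10 i) := cmp_eq_two.1 (by omega)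
      rcases h2 with h2 | h2
      · rwa [h2] at h5
      · exact _root_.trans h2 h5
    · have h4 := cmp_le_two R (s.arr 10 (s1.reg 34)) (s.arr 10 i)
      have h5 : R (s.arr 10 (s1.reg 34)) (s.arr 10 i) := cmp_eq_two.1 (by omega)
      rcases Nat.lt_succ_iff_lt_or_eq.1 hj with hj | rfl
      · exact fun h6 => h3 j hj (_root_.trans h5 h6)
      · exact irrefl_of R _
    · rcases Nat.lt_succ_iff_lt_or_eq.1 hj with hj | rfl
      · exact h3 j hj
      · rw [← cmp_eq_two (R := R)]; omega
  · simp only [Store.reg_setReg, Nat.reduceEqDiff, if_false, if_true]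
    refine ⟨by omega, by simp, fun j hj => ?_⟩
    obtain rfl : j = 0 := by omega
    exact irrefl_of R _
  · rintro s1 t1 ⟨⟨h1, h2, h3⟩, -, -, hT⟩
    simp only [tot_ite, tot_set, tot_skip, fits_lit, fits_var, eval_lit, eval_var, true_and,
      Store.reg_setReg, if_true]
    refine ⟨by omega, fun h4 => ⟨by omega, by omega, by omega, Or.inl ?_, by omega⟩, fun h4 => ?_⟩
    · have h5 : s1.reg 34 = 0 := by omega
      rw [h5] at h3
      -- The candidate has never moved, so nothing is above the root, and by minimality nothing is
      -- below it. Then the other entries form a module that avoids the root, so there is only one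
      -- of them.
      have h6 : (s.arr 10 '' Set.Ico 1 r).Subsingleton := by
        refine hroot _ ⟨Set.image_mono fun j hj => hj.2, ?_⟩ ?_
        · rintro _ ⟨a, ha, rfl⟩ _ ⟨b, hb, rfl⟩ _ ⟨z, hz, rfl⟩ hzN
          have hz0 : z = 0 := by
            by_contra hz0
            exact hzN ⟨z, ⟨by omega, hz⟩, rfl⟩
          rw [hz0, cmp_eq_zero.2 ⟨h3 a ha.2, hmin a ha.2⟩, cmp_eq_zero.2 ⟨h3 b hb.2, hmin b hb.2⟩]
        · rintro ⟨a, ha, ha'⟩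
          have ha1 := ha.1
          have := hL.inj (show a ∈ Set.Iio r from ha.2) (show 0 ∈ Set.Iio r from by simp; omega) ha'
          omega
      ext x
      simp only [Set.mem_image, Set.mem_Iio, Set.mem_insert_iff, Set.mem_singleton_iff]
      constructor
      · rintro ⟨j, hj, rfl⟩
        by_cases hj0 : j = 0
        · exact Or.inl (by rw [hj0])
        · exact Or.inr (h6 ⟨j, ⟨by omega, hj⟩, rfl⟩ ⟨1, ⟨le_rfl, hr⟩, rfl⟩)
      · rintro (rfl | rfl)
        exacts [⟨0, by omega, rfl⟩, ⟨1, hr, rfl⟩]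
    · refine ⟨by omega, h1, Or.inr ⟨?_, h3⟩, by omega⟩
      rcases h2 with h2 | h2
      · omega
      · exact h2

theorem image_comp_perm {f : ℕ → ℕ} {π : Equiv.Perm ℕ} {A : Set ℕ} (h : ∀ j ∉ A, π j = j) :
    (f ∘ π) '' A = f '' A := by
  have : π '' A = A := by
    ext x
    constructor
    · rintro ⟨y, hy, rfl⟩
      by_contra hx
      have := π.injective (h _ hx)
      exact hx (by rw [this]; exact hy)
    · intro hx
      refine ⟨π.symm x, ?_, by simp⟩
      by_contra hy
      have := h _ hy
      simp only [Equiv.apply_symm_apply] at this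
      exact hy (this ▸ hx)
  rw [Set.image_comp, this]

theorem injOn_comp_perm {f : ℕ → ℕ} {π : Equiv.Perm ℕ} {A : Set ℕ} (hf : Set.InjOn f A)
    (h : ∀ j ∉ A, π j = j) : Set.InjOn (f ∘ π) A := by
  have hA : ∀ x ∈ A, π x ∈ A := fun x hx => by
    by_contra hc
    have := π.injective (h _ hc)
    exact hc (by rw [this]; exact hx)
  exact fun x hx y hy hxy => π.injective (hf (hA x hx) (hA y hy) hxy)

theorem HasList.permute {n r : ℕ} {s s' : Store} (h : HasList n r s) (h8 : s'.reg 8 = s.reg 8)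
    {π : Equiv.Perm ℕ} (hπ : ∀ j, r ≤ j → π j = j) (h10 : s'.arr 10 = s.arr 10 ∘ π) :
    HasList n r s' ∧ s'.arr 10 '' Set.Iio r = s.arr 10 '' Set.Iio r := by
  have hπ' : ∀ j ∉ Set.Iio r, π j = j := fun j hj => hπ j (by simpa using hj)
  have himg := image_comp_perm (f := s.arr 10) hπ'
  rw [← h10] at himg
  refine ⟨⟨h8.trans h.len, by rw [h10]; exact injOn_comp_perm h.inj hπ', fun j hj => ?_⟩, himg⟩
  have : s'.arr 10 j ∈ s.arr 10 '' Set.Iio r := himg ▸ ⟨j, hj, rfl⟩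
  obtain ⟨i, hi, hi'⟩ := this
  rw [← hi']
  exact h.lt i hi

/-- Collect behind position `reg 9` the entries of array `10` that force the last entry. -/
def growCmd : Cmd :=
  set 9 (var 8 - lit 1) ;; set 10 (var 8) ;;
  whl (var 9) (var 10) (
    set 10 (var 10 - lit 1) ;; set 23 (get 10 (var 10)) ;;
    set 24 (get 2 (var 23 * var 0 + get 10 (lit 0))) ;; set 25 (var 24 + lit 1) ;;
    set 20 (lit 1) ;; set 22 (lit 1) ;; set 21 (var 9) ;; partitionCmd 10 ;; set 9 (var 22))

/-- A search backwards from the top `u`. A processed entry `z` draws into the level every `x` that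
it does not relate to as it does to the root; when all entries of the level are processed, this is
the closure property of `IsLevel`. The partition starts at position `1`, so the root never joins.
Each entry is processed once, at a cost linear in `r`. -/
theorem growCmd_spec {R : ℕ → ℕ → Prop} [IsStrictOrder ℕ R] {W n r : ℕ} {s : Store}
    (hM : HasMatrix R n s) (hL : HasList n r s) (hr : 1 < r) (hrn : r ≤ n) (hnW : n * n < W)
    (hW4 : 4 ≤ W)
    (hroot : Rooted R (s.arr 10 0) (s.arr 10 '' Set.Iio r))
    (hmin : ∀ j < r, ¬ R (s.arr 10 j) (s.arr 10 0))
    (htop : s.arr 10 '' Set.Iio r = {s.arr 10 0, s.arr 10 (r - 1)} ∨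
      R (s.arr 10 0) (s.arr 10 (r - 1)) ∧ ∀ j < r, ¬ R (s.arr 10 (r - 1)) (s.arr 10 j)) :
    Tot W growCmd s fun s' t => ∃ π : Equiv.Perm ℕ, π 0 = 0 ∧ (∀ j, r ≤ j → π j = j) ∧
      s'.arr 10 = s.arr 10 ∘ π ∧ 1 ≤ s'.reg 9 ∧ s'.reg 9 < r ∧
      IsLevel R (s.arr 10 '' Set.Iio r) (s.arr 10 0) (s.arr 10 (r - 1))
        (s'.arr 10 '' Set.Ico (s'.reg 9) r) ∧ t ≤ (r - s'.reg 9) * (r * 8 + 11) + 3 := by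
  have hnW' : n < W := lt_of_le_of_lt (Nat.le_mul_self n) hnW
  simp only [growCmd, tot_seq, tot_set, fits_lit, fits_var, fits_sub, eval_var, eval_sub, eval_lit,
    true_and, Store.reg_setReg, Nat.reduceEqDiff, if_false, hL.len]
  refine ⟨⟨by omega, by omega⟩, (Tot.whl (fun s' => s'.reg 9 ≤ s'.reg 10 ∧ s'.reg 10 ≤ r ∧
    1 ≤ s'.reg 9 ∧ s'.reg 9 < r ∧
    (∃ π : Equiv.Perm ℕ, π 0 = 0 ∧ (∀ j, r - 1 ≤ j → π j = j) ∧ s'.arr 10 = s.arr 10 ∘ π) ∧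
    (∀ j, s'.reg 10 ≤ j → j < r → ∀ i < s'.reg 9,
      cmp R (s'.arr 10 j) (s'.arr 10 i) = cmp R (s'.arr 10 j) (s.arr 10 0)) ∧
    (∀ j, s'.reg 9 ≤ j → j < r → ∀ N, Mod R (s.arr 10 '' Set.Iio r) N → s.arr 10 0 ∈ N →
      s'.arr 10 j ∈ N → s.arr 10 (r - 1) ∈ N))
    -- The first summand counts the unprocessed entries of the level, the second the entries that
    -- may still join it.
    (fun s' => (s'.reg 10 - s'.reg 9) * (r * 8 + 11) + (s'.reg 9 - 1) * (r * 8 + 11))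
    (fun _ _ _ => by simp) ?_ ?_).mono ?_⟩
  · rintro s1 ⟨hA, hB, hC, hD, ⟨π, hπ0, hπ, h10⟩, hE, hF⟩ hk hlt
    simp only [eval_var] at hlt
    have e0 : s1.reg 0 = n := (hk.reg 0 rfl).trans (by simp [hM.n_eq])
    have e8 : s1.reg 8 = s.reg 8 := (hk.reg 8 rfl).trans (by simp)
    have e2 : s1.arr 2 = s.arr 2 := (hk.arr 2 rfl).trans (by simp)
    obtain ⟨hL1, himg⟩ := hL.permute e8 (fun j hj => hπ j (by omega)) h10
    have hv : s1.arr 10 0 = s.arr 10 0 := by rw [h10, Function.comp_apply, hπ0]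
    generalize hj : s1.reg 10 = j at *
    generalize hs : s1.reg 9 = a at *
    have hz := hL1.lt (j - 1) (by omega)
    have hv' := hL1.lt 0 (by omega)
    have hidx := mul_add_lt_mul hz hv'
    have hidx' : s1.arr 10 (j - 1) * n < n * n := by nlinarith
    have hmatz : ∀ i < r, s1.arr 2 (s1.arr 10 (j - 1) * n + s1.arr 10 i) =
        cmp R (s1.arr 10 (j - 1)) (s1.arr 10 i) := fun i hi => by
      rw [e2]; exact hM.mat _ hz _ (hL1.lt i hi)
    simp only [tot_seq, tot_set, fits_lit, fits_var, fits_sub, fits_add, fits_mul, fits_get,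
      eval_var, eval_sub, eval_lit, eval_add, eval_mul, eval_get, true_and, and_true,
      Store.reg_setReg, Store.arr_setReg, Nat.reduceEqDiff, if_false, if_true, hj, hs, e0]
    have hc2 := cmp_le_two R (s1.arr 10 (j - 1)) (s1.arr 10 0)
    rw [hmatz 0 (by omega)]
    refine ⟨⟨by omega, by omega⟩, ⟨by omega, by omega, by omega⟩, ⟨by omega, by omega⟩, by omega,
      by omega, (partitionCmd_spec (n := n) (lo := 1) (hi := a)
      (w := s1.arr 10 (j - 1)) rfl (by simp [e0]) (by simp) (by simp) (by simp) (by simp) hC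
      (by omega) hz hnW (fun i _ hi => by simpa using hL1.lt i (by omega))).frame.mono ?_⟩
    rintro s2 t2 ⟨⟨ρ, hρ, harr, hq1, hq2, hk1, hk2, hT⟩, hk'⟩
    have f10 : s2.reg 10 = j - 1 := (hk'.reg 10 rfl).trans (by simp)
    simp only [Store.arr_setReg, Store.reg_setReg, Nat.reduceEqDiff, if_false, if_true] at harr hk1 hk2
    generalize hq : s2.reg 22 = q at *
    have hρ0 : ρ 0 = 0 := hρ 0 (by omega)
    have hzz : s2.arr 10 (j - 1) = s1.arr 10 (j - 1) := by
      rw [harr, Function.comp_apply, hρ _ (by omega)]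
    have hsame : ∀ i, a ≤ i → s2.arr 10 i = s1.arr 10 i := fun i hi => by
      rw [harr, Function.comp_apply, hρ _ (by omega)]
    have hrho : ∀ i < a, ρ i < a := fun i hi => by
      by_cases h0 : 1 ≤ i
      · exact (mem_segment_of_fixes hρ h0 hi).2
      · rw [hρ i (by omega)]; exact hi
    have hmat2 : ∀ i < a, s1.arr 2 (s1.arr 10 (j - 1) * n + s2.arr 10 i) =
        cmp R (s1.arr 10 (j - 1)) (s2.arr 10 i) := fun i hi => by
      rw [harr, Function.comp_apply, hmatz _ (by have := hrho i hi; omega)]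
    simp only [fits_var, eval_var, true_and, Store.reg_setReg, Store.arr_setReg, Nat.reduceEqDiff,
      if_false, if_true, f10, hq]
    refine ⟨⟨by omega, by omega, by omega, by omega, ⟨π * ρ, ?_, fun i hi => ?_, ?_⟩, ?_, ?_⟩, ?_⟩
    · rw [Equiv.Perm.mul_apply, hρ0, hπ0]
    · rw [Equiv.Perm.mul_apply, hρ i (by omega), hπ i hi]
    · rw [harr, h10]; rfl
    · intro i h1 h2 l hl
      by_cases hij : i = j - 1
      · rw [hij, hzz]
        by_cases hl0 : l = 0
        · rw [hl0, harr, Function.comp_apply, hρ0, hv]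
        · have h3 := hk1 l (by omega) hl
          rw [hmat2 l (by omega), hv] at h3
          omega
      · rw [hsame i (by omega), harr, Function.comp_apply]
        exact hE i (by omega) h2 _ (hrho l (by omega))
    · intro i h1 h2 N hN hvN hiN
      by_cases hia : a ≤ i
      · rw [hsame i hia] at hiN
        exact hF i hia h2 N hN hvN hiN
      · have h3 := hk2 i h1 (by omega)
        rw [hmat2 i (by omega), hv] at h3
        refine hF (j - 1) (by omega) (by omega) N hN hvN ?_
        -- A module with `v` and the new entry contains `z`, since otherwise `z` would relate
        -- equally to both; and `z` is already known to force `u`.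
        by_contra hzN
        have h4 := hN.2 _ hiN _ hvN (s1.arr 10 (j - 1))
          (himg ▸ ⟨j - 1, by simp; omega, rfl⟩) hzN
        omega
    · have h1 : (a - 1) * 8 + 11 ≤ r * 8 + 11 := by omega
      have h2 : j - 1 - q + (q - 1) + 1 = j - a + (a - 1) := by omega
      calc _ ≤ (r * 8 + 11) + ((j - 1 - q) * (r * 8 + 11) + (q - 1) * (r * 8 + 11)) := by omega
        _ = (j - 1 - q + (q - 1) + 1) * (r * 8 + 11) := by ring
        _ = (j - a + (a - 1)) * (r * 8 + 11) := by rw [h2]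
        _ = _ := by ring
        _ ≤ _ := le_rfl
  · simp only [Store.reg_setReg, Store.arr_setReg, Nat.reduceEqDiff, if_false, if_true]
    refine ⟨by omega, le_rfl, by omega, by omega, ⟨1, by simp, by simp, by simp⟩,
      fun j h1 h2 => by omega, fun j h1 h2 N _ _ h3 => ?_⟩
    obtain rfl : j = r - 1 := by omega
    exact h3
  · rintro s2 t2 ⟨⟨hA, hB, hC, hD, ⟨π, hπ0, hπ, h10⟩, hE, hF⟩, hk, hnlt, hT⟩
    simp only [eval_var] at hnlt
    have h9 : s2.reg 10 = s2.reg 9 := by omega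
    have e8 : s2.reg 8 = s.reg 8 := (hk.reg 8 rfl).trans (by simp)
    obtain ⟨hL1, himg⟩ := hL.permute e8 (fun j hj => hπ j (by omega)) h10
    have hv : s2.arr 10 0 = s.arr 10 0 := by rw [h10, Function.comp_apply, hπ0]
    refine ⟨π, hπ0, fun j hj => hπ j (by omega), h10, hC, hD, ⟨hroot, ?_, ⟨0, by simp; omega, rfl⟩,
      ?_, ?_, ?_, ?_, ?_, ?_⟩, ?_⟩
    · rintro _ ⟨j, hj, rfl⟩
      exact hmin j hj
    · refine htop.imp_right fun h => ⟨h.1, ?_⟩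
      rintro _ ⟨j, hj, rfl⟩
      exact h.2 j hj
    · rw [← himg]
      exact Set.image_mono fun j hj => hj.2
    · exact ⟨r - 1, ⟨by omega, by omega⟩, by rw [h10, Function.comp_apply, hπ _ le_rfl]⟩
    · rintro ⟨j, hj, hj'⟩
      rw [← hv] at hj'
      have h1 := hj.1
      have h2 := hL1.inj (show j ∈ Set.Iio r from hj.2) (show 0 ∈ Set.Iio r by simp; omega) hj'
      omega
    · rintro _ ⟨j, hj, rfl⟩ x hx hxB
      rw [← himg] at hx
      obtain ⟨i, hi, rfl⟩ := hx
      refine hE j (by rw [h9]; exact hj.1) hj.2 i ?_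
      by_contra hc
      exact hxB ⟨i, ⟨by omega, hi⟩, rfl⟩
    · rintro _ ⟨j, hj, rfl⟩
      exact hF j hj.1 hj.2
    · simp only [Store.reg_setReg, Store.arr_setReg, Nat.reduceEqDiff, if_false, if_true, h9,
        Nat.sub_self, zero_mul, zero_add] at hT
      have h1 : r - (r - 1) + (r - 1 - 1) = (r - s2.reg 9) + (s2.reg 9 - 1) := by omega
      have h2 := congrArg (· * (r * 8 + 11)) h1
      simp only [add_mul] at h2
      omega

/-- Find in register `37` a position from `reg 9` on of an entry that is incomparable to entry `0`
and to all entries from `reg 9` on, or zero. -/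
def isolatedCmd : Cmd :=
  set 37 (lit 0) ;; set 38 (var 9) ;;
  upto 38 8 (
    set 39 (get 2 (get 10 (var 38) * var 0 + get 10 (lit 0))) ;; set 20 (var 9) ;;
    upto 20 8 (
      ite (lit 0) (get 2 (get 10 (var 38) * var 0 + get 10 (var 20))) (set 39 (lit 1)) skip) ;;
    ite (var 39) (lit 1) (set 37 (var 38)) skip)

theorem isolatedCmd_spec {R : ℕ → ℕ → Prop} {W n r a : ℕ} {s : Store}
    (hM : HasMatrix R n s) (hL : HasList n r s) (h9 : s.reg 9 = a) (ha : 1 ≤ a) (har : a < r)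
    (hrW : r < W) (hnW : n * n < W) :
    Tot W isolatedCmd s fun s' t =>
      (s'.reg 37 = 0 ∧ (∀ b ∈ s.arr 10 '' Set.Ico a r,
          ∃ y ∈ insert (s.arr 10 0) (s.arr 10 '' Set.Ico a r), cmp R b y ≠ 0) ∨
        a ≤ s'.reg 37 ∧ s'.reg 37 < r ∧
          ∀ y ∈ insert (s.arr 10 0) (s.arr 10 '' Set.Ico a r),
            cmp R (s.arr 10 (s'.reg 37)) y = 0) ∧
      t ≤ (r - a) * (r * 4 + 7) + 3 := by
  have hL0 := hL.lt 0 (by omega)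
  have hidx : ∀ i < r, ∀ j < r, s.arr 10 i * n < n * n ∧ s.arr 10 i * n + s.arr 10 j < n * n :=
    fun i hi j hj => ⟨by nlinarith [hL.lt i hi], mul_add_lt_mul (hL.lt i hi) (hL.lt j hj)⟩
  simp only [isolatedCmd, tot_seq, tot_set, fits_lit, fits_var, eval_var, eval_lit, true_and,
    Store.reg_setReg, Nat.reduceEqDiff, if_false, h9]
  refine ⟨by omega, (Tot.upto_const (N := r) (i₀ := a) (fun i s' =>
    s'.reg 37 = 0 ∧ (∀ i' ∈ Set.Ico a i, cmp R (s.arr 10 i') (s.arr 10 0) ≠ 0 ∨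
      ∃ j ∈ Set.Ico a r, cmp R (s.arr 10 i') (s.arr 10 j) ≠ 0) ∨
    a ≤ s'.reg 37 ∧ s'.reg 37 < r ∧ cmp R (s.arr 10 (s'.reg 37)) (s.arr 10 0) = 0 ∧
      ∀ j ∈ Set.Ico a r, cmp R (s.arr 10 (s'.reg 37)) (s.arr 10 j) = 0) (r * 4 + 5) rfl rfl
    (by simp) (by simp [hL.len]) har.le hrW ?_ ?_).mono ?_⟩
  · rintro i s1 hi1 hi2 hI hk h38 -
    have e10 : s1.arr 10 = s.arr 10 := (hk.arr 10 rfl).trans (by simp)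
    have e2 : s1.arr 2 = s.arr 2 := (hk.arr 2 rfl).trans (by simp)
    have e0 : s1.reg 0 = n := (hk.reg 0 rfl).trans (by simp [hM.n_eq])
    have e8 : s1.reg 8 = r := (hk.reg 8 rfl).trans (by simp [hL.len])
    have e9 : s1.reg 9 = a := (hk.reg 9 rfl).trans (by simp [h9])
    have h1 := hidx i hi2 0 (by omega)
    simp only [tot_seq, tot_set, fits_lit, fits_var, fits_get, fits_add, fits_mul, eval_var,
      eval_lit, eval_get, eval_add, eval_mul, true_and, and_true, Store.reg_setReg,
      Store.arr_setReg, Nat.reduceEqDiff, if_false, e10, e2, e0, e9, h38,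
      hM.mat _ (hL.lt i hi2) _ hL0]
    refine ⟨⟨by omega, by omega, by omega⟩, (Tot.upto_const (N := r) (i₀ := a) (fun j s' =>
      (s'.reg 39 = 0 ↔ cmp R (s.arr 10 i) (s.arr 10 0) = 0 ∧
        ∀ j' ∈ Set.Ico a j, cmp R (s.arr 10 i) (s.arr 10 j') = 0)) 2 rfl rfl (by simp)
      (by simp [e8]) har.le hrW ?_ ?_).frame.mono ?_⟩
    · rintro j s2 hj1 hj2 hJ hk2 h20 -
      have f10 : s2.arr 10 = s.arr 10 := (hk2.arr 10 rfl).trans (by simp [e10])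
      have f2 : s2.arr 2 = s.arr 2 := (hk2.arr 2 rfl).trans (by simp [e2])
      have f0 : s2.reg 0 = n := (hk2.reg 0 rfl).trans (by simp [e0])
      have f38 : s2.reg 38 = i := (hk2.reg 38 rfl).trans (by simp [h38])
      have h2 := hidx i hi2 j hj2
      simp only [tot_ite, tot_set, tot_skip, fits_lit, fits_var, fits_get, fits_add, fits_mul,
        eval_var, eval_lit, eval_get, eval_add, eval_mul, true_and, and_true, Store.reg_setReg,
        Store.arr_setReg, Nat.reduceEqDiff, if_false, if_true, f10, f2, f0, f38, h20,
        hM.mat _ (hL.lt i hi2) _ (hL.lt j hj2)]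
      refine ⟨by omega, ⟨lt_trans h2.1 hnW, lt_trans h2.2 hnW⟩, fun h3 => ⟨by omega, ?_, by omega⟩,
        fun h3 => ⟨?_, by omega⟩⟩
      · constructor
        · exact fun h => h.elim
        · rintro ⟨-, h5⟩
          have := h5 j ⟨hj1, by omega⟩
          omega
      · rw [hJ]
        refine and_congr_right fun _ => ⟨fun h j' hj' => ?_, fun h j' hj' => h j' ⟨hj'.1, by have := hj'.2; omega⟩⟩
        rcases Nat.lt_succ_iff_lt_or_eq.1 hj'.2 with h5 | rfl
        · exact h j' ⟨hj'.1, h5⟩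
        · omega
    · simp only [Store.reg_setReg, Nat.reduceEqDiff, if_false, if_true]
      refine ⟨fun h => ⟨h, fun j' hj' => ?_⟩, fun h => h.1⟩
      have := hj'.1
      have := hj'.2
      omega
    · rintro s2 t2 ⟨⟨hJ, -, -, hT⟩, hk2⟩
      have f38 : s2.reg 38 = i := (hk2.reg 38 rfl).trans (by simp [h38])
      have f37 : s2.reg 37 = s1.reg 37 := (hk2.reg 37 rfl).trans (by simp)
      simp only [tot_ite, tot_set, tot_skip, fits_lit, fits_var, eval_var, eval_lit, true_and,
        Store.reg_setReg, Nat.reduceEqDiff, if_false, if_true, f38, f37]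
      refine ⟨by omega, fun h2 => ⟨Or.inr ?_, by omega⟩, fun h2 => ⟨?_, by omega⟩⟩
      · have h3 := hJ.1 (by omega)
        exact ⟨hi1, hi2, h3⟩
      · refine hI.imp_left fun h3 => ⟨h3.1, fun i' hi' => ?_⟩
        rcases Nat.lt_succ_iff_lt_or_eq.1 hi'.2 with h5 | rfl
        · exact h3.2 i' ⟨hi'.1, h5⟩
        · have h6 : ¬ s2.reg 39 = 0 := by omega
          rw [hJ] at h6
          by_contra hc
          push Not at hc
          exact h6 ⟨hc.1, hc.2⟩
  · simp only [Store.reg_setReg, Nat.reduceEqDiff, if_false, if_true]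
    refine Or.inl ⟨trivial, fun i hi => ?_⟩
    have := hi.1
    have := hi.2
    omega
  · rintro s1 t1 ⟨hI, -, -, hT⟩
    refine ⟨hI.imp (fun h => ⟨h.1, ?_⟩) (fun h => ⟨h.1, h.2.1, ?_⟩), ?_⟩
    · rintro _ ⟨i, hi, rfl⟩
      rcases h.2 i hi with h1 | ⟨j, hj, h1⟩
      · exact ⟨_, Or.inl rfl, h1⟩
      · exact ⟨_, Or.inr ⟨j, hj, rfl⟩, h1⟩
    · rintro y (rfl | ⟨j, hj, rfl⟩)
      · exact h.2.2.1
      · exact h.2.2.2 j hj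
    · have h1 : r * 4 + 5 + 2 = r * 4 + 7 := rfl
      rw [h1] at hT
      omega

/-- Find a level of the entries of array `10` and move it to the positions from `reg 9` on; position
`reg 37` holds an isolated entry of the level, if there is one. -/
def levelCmd : Cmd :=
  topCmd ;; set 35 (var 8 - lit 1) ;; swapCmd 10 ;; growCmd ;; isolatedCmd

theorem levelCmd_spec {R : ℕ → ℕ → Prop} [IsStrictOrder ℕ R] {W n r : ℕ} {s : Store}
    (hM : HasMatrix R n s) (hL : HasList n r s) (hr : 1 < r) (hrn : r ≤ n) (hnW : n * n < W)
    (hW4 : 4 ≤ W) (hroot : Rooted R (s.arr 10 0) (s.arr 10 '' Set.Iio r))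
    (hmin : ∀ j < r, ¬ R (s.arr 10 j) (s.arr 10 0)) :
    Tot W levelCmd s fun s' t => HasList n r s' ∧
      s'.arr 10 '' Set.Iio r = s.arr 10 '' Set.Iio r ∧ s'.arr 10 0 = s.arr 10 0 ∧
      1 ≤ s'.reg 9 ∧ s'.reg 9 < r ∧
      (∃ u, IsLevel R (s.arr 10 '' Set.Iio r) (s.arr 10 0) u (s'.arr 10 '' Set.Ico (s'.reg 9) r)) ∧
      (s'.reg 37 = 0 ∧ (∀ b ∈ s'.arr 10 '' Set.Ico (s'.reg 9) r,
          ∃ y ∈ insert (s'.arr 10 0) (s'.arr 10 '' Set.Ico (s'.reg 9) r), cmp R b y ≠ 0) ∨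
        s'.reg 9 ≤ s'.reg 37 ∧ s'.reg 37 < r ∧
          ∀ y ∈ insert (s'.arr 10 0) (s'.arr 10 '' Set.Ico (s'.reg 9) r),
            cmp R (s'.arr 10 (s'.reg 37)) y = 0) ∧
      t ≤ (r - s'.reg 9) * (n * 16 + 33) := by
  have hnW' : n < W := lt_of_le_of_lt (Nat.le_mul_self n) hnW
  simp only [levelCmd, tot_seq]
  refine (topCmd_spec hM hL hr (by omega) hnW hroot hmin).frame.mono ?_
  rintro s1 t1 ⟨⟨h1, h2, h3, hT1⟩, hk1⟩
  have a10 : s1.arr 10 = s.arr 10 := hk1.arr 10 rfl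
  have a8 : s1.reg 8 = r := (hk1.reg 8 rfl).trans hL.len
  simp only [tot_set, fits_var, fits_sub, fits_lit, eval_var, eval_sub, eval_lit, true_and, a8]
  refine ⟨⟨by omega, by omega⟩, swapCmd_spec.frame.mono ?_⟩
  rintro s2 t2 ⟨⟨hb, hT2⟩, hk2⟩
  simp only [Store.reg_setReg, Store.arr_setReg, Nat.reduceEqDiff, if_false, if_true, a10] at hb
  have b8 : s2.reg 8 = r := (hk2.reg 8 rfl).trans (by simp [a8])
  have b0 : s2.reg 0 = s.reg 0 := (hk2.reg 0 rfl).trans (by simp [hk1.reg 0 rfl])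
  have b2 : s2.arr 2 = s.arr 2 := (hk2.arr 2 rfl).trans (by simp [hk1.arr 2 rfl])
  obtain ⟨hL2, himg⟩ := hL.permute (b8.trans hL.len.symm)
    (fun j hj => Equiv.swap_apply_of_ne_of_ne (by omega) (by omega)) hb
  have hv : s2.arr 10 0 = s.arr 10 0 := by
    rw [hb, Function.comp_apply, Equiv.swap_apply_of_ne_of_ne (by omega) (by omega)]
  have hu : s2.arr 10 (r - 1) = s.arr 10 (s1.reg 34) := by
    rw [hb, Function.comp_apply, Equiv.swap_apply_right]
  have hmem : ∀ j < r, ∃ i < r, s2.arr 10 j = s.arr 10 i := fun j hj => by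
    have : s2.arr 10 j ∈ s.arr 10 '' Set.Iio r := himg ▸ ⟨j, hj, rfl⟩
    obtain ⟨i, hi, hi'⟩ := this
    exact ⟨i, hi, hi'.symm⟩
  refine (growCmd_spec (hM.congr b0 b2) hL2 hr hrn hnW hW4 (by rw [hv, himg]; exact hroot)
    (fun j hj => ?_) ?_).frame.mono ?_
  · obtain ⟨i, hi, hi'⟩ := hmem j hj
    rw [hi', hv]
    exact hmin i hi
  · rw [himg, hv, hu]
    refine h3.imp_right fun h => ⟨h.1, fun j hj => ?_⟩
    obtain ⟨i, hi, hi'⟩ := hmem j hj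
    rw [hi']
    exact h.2 i hi
  rintro s3 t3 ⟨⟨π, hπ0, hπ, hc, h4, h5, h6, hT3⟩, hk3⟩
  have c8 : s3.reg 8 = s2.reg 8 := hk3.reg 8 rfl
  obtain ⟨hL3, himg3⟩ := hL2.permute c8 hπ hc
  have hv3 : s3.arr 10 0 = s.arr 10 0 := by rw [hc, Function.comp_apply, hπ0, hv]
  refine (isolatedCmd_spec (hM.congr ((hk3.reg 0 rfl).trans b0) ((hk3.arr 2 rfl).trans b2)) hL3 rfl
    h4 h5 (by omega) hnW).frame.mono ?_
  rintro s4 t4 ⟨⟨h7, hT4⟩, hk4⟩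
  have d10 : s4.arr 10 = s3.arr 10 := hk4.arr 10 rfl
  have d9 : s4.reg 9 = s3.reg 9 := hk4.reg 9 rfl
  have d8 : s4.reg 8 = s3.reg 8 := hk4.reg 8 rfl
  rw [himg, hv] at h6
  rw [d10, d9]
  refine ⟨⟨d8.trans hL3.len, by rw [d10]; exact hL3.inj, by rw [d10]; exact hL3.lt⟩,
    himg3.trans himg, hv3, h4, h5, ⟨_, h6⟩, h7, ?_⟩
  -- The level is non-empty. This allows the linear cost of finding the top to be charged to its
  -- entries as well.
  obtain ⟨g, hg⟩ : ∃ g, r - s3.reg 9 = g + 1 := ⟨r - s3.reg 9 - 1, by omega⟩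
  rw [hg] at hT3 hT4 ⊢
  have h8 : (g + 1) * (r * 8 + 11) ≤ (g + 1) * (n * 8 + 11) := Nat.mul_le_mul_left _ (by omega)
  have h9 : (g + 1) * (r * 4 + 7) ≤ (g + 1) * (n * 4 + 7) := Nat.mul_le_mul_left _ (by omega)
  have h10 : n ≤ (g + 1) * n := Nat.le_mul_of_pos_left _ (by omega)
  have e1 : (g + 1) * (n * 8 + 11) = (g + 1) * n * 8 + (g + 1) * 11 := by ring
  have e2 : (g + 1) * (n * 4 + 7) = (g + 1) * n * 4 + (g + 1) * 7 := by ring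
  have e3 : (g + 1) * (n * 16 + 33) = (g + 1) * n * 16 + (g + 1) * 33 := by ring
  omega

/-- Store the level found by `levelCmd` and remove it from the list. -/
def closeCmd : Cmd :=
  ite (lit 0) (var 37) (
    set 34 (var 37) ;; set 35 (var 8 - lit 1) ;; swapCmd 10 ;; set 33 (var 35) ;; emitCmd ;;
    set 8 (var 35)) skip ;;
  set 33 (var 9) ;; emitCmd ;; set 8 (var 9)

/-- An isolated entry is exchanged with the last one; then the pair formed by it and the root and
the rest of the level are stored separately. In both cases at most two levels arise, with at most `3
* (r - a)` entries in total, because `r - a ≥ 1`. -/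
theorem closeCmd_spec {R : ℕ → ℕ → Prop} [IsStrictOrder ℕ R] {W n r a u : ℕ} {s : Store}
    (hV : HasLevels R n s) (hL : HasList n r s) (h9 : s.reg 9 = a) (ha : 1 ≤ a) (har : a < r)
    (hrn : r ≤ n) (hnW : n < W)
    (hlev : IsLevel R (s.arr 10 '' Set.Iio r) (s.arr 10 0) u (s.arr 10 '' Set.Ico a r))
    (hiso : s.reg 37 = 0 ∧ (∀ b ∈ s.arr 10 '' Set.Ico a r,
          ∃ y ∈ insert (s.arr 10 0) (s.arr 10 '' Set.Ico a r), cmp R b y ≠ 0) ∨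
        a ≤ s.reg 37 ∧ s.reg 37 < r ∧
          ∀ y ∈ insert (s.arr 10 0) (s.arr 10 '' Set.Ico a r),
            cmp R (s.arr 10 (s.reg 37)) y = 0)
    (hW6 : s.reg 6 + 2 < W) (hW7 : s.reg 7 + 3 * r < W) :
    Tot W closeCmd s fun s' t => HasLevels R n s' ∧ HasList n a s' ∧
      s'.arr 10 '' Set.Iio a = s.arr 10 '' Set.Iio a ∧
      s'.arr 10 0 = s.arr 10 0 ∧ (∀ l < s.reg 6, levelSet s' l = levelSet s l) ∧
      s.reg 6 ≤ s'.reg 6 ∧ s'.reg 6 ≤ s.reg 6 + 2 ∧ s'.reg 7 ≤ s.reg 7 + 3 * (r - a) ∧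
      (∀ e, 1 ≤ e → (Realizable R e (insert (s.arr 10 0) (s.arr 10 '' Set.Ico a r)) ↔
        ∀ l, s.reg 6 ≤ l → l < s'.reg 6 → Realizable R e (levelSet s' l))) ∧
      t ≤ (r - a) * 4 + 28 := by
  have hfin : (s.arr 10 '' Set.Iio r).Finite := (Set.finite_Iio r).image _
  have hSU : s.arr 10 '' Set.Iio r ⊆ {x | x < n} := by
    rintro _ ⟨j, hj, rfl⟩
    exact hL.lt j hj
  simp only [closeCmd, tot_seq, tot_ite, tot_skip, tot_set, fits_lit, fits_var, eval_lit, eval_var,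
    true_and, fits_sub, eval_sub]
  refine ⟨by omega, fun h37 => ⟨⟨by omega, ?_⟩, ?_⟩, fun h37 => ?_⟩
  · simp [hL.len]; omega
  · have hiso := hiso.resolve_left (by omega)
    simp only [Store.reg_setReg, Nat.reduceEqDiff, if_false, hL.len]
    refine swapCmd_spec.frame.mono ?_
    rintro s1 t1 ⟨⟨hb, hT1⟩, hk1⟩
    generalize hq : s.reg 37 = q at *
    simp only [Store.reg_setReg, Store.arr_setReg, Nat.reduceEqDiff, if_false, if_true] at hb
    have b35 : s1.reg 35 = r - 1 := (hk1.reg 35 rfl).trans (by simp)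
    have b8 : s1.reg 8 = s.reg 8 := (hk1.reg 8 rfl).trans (by simp)
    have b6 : s1.reg 6 = s.reg 6 := (hk1.reg 6 rfl).trans (by simp)
    have b7 : s1.reg 7 = s.reg 7 := (hk1.reg 7 rfl).trans (by simp)
    have b9 : s1.reg 9 = a := (hk1.reg 9 rfl).trans (by simp [h9])
    have b11 : s1.arr 11 = s.arr 11 := hk1.arr 11 rfl
    have b12 : s1.arr 12 = s.arr 12 := hk1.arr 12 rfl
    have hfix : ∀ j ∉ Set.Ico a r, Equiv.swap q (r - 1) j = j := fun j hj => by
      simp only [Set.mem_Ico, not_and, not_lt] at hj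
      exact Equiv.swap_apply_of_ne_of_ne (by omega) (by omega)
    obtain ⟨hL1, -⟩ := hL.permute b8 (fun j hj => hfix j (by simp; omega)) hb
    have himg : s1.arr 10 '' Set.Ico a r = s.arr 10 '' Set.Ico a r := by
      rw [hb]; exact image_comp_perm hfix
    have hv : s1.arr 10 0 = s.arr 10 0 := by
      rw [hb, Function.comp_apply, hfix _ (by simp; omega)]
    have hlast : s1.arr 10 (r - 1) = s.arr 10 q := by
      rw [hb, Function.comp_apply, Equiv.swap_apply_right]
    have hlow : s1.arr 10 '' Set.Iio a = s.arr 10 '' Set.Iio a := by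
      refine Set.image_congr fun j hj => ?_
      have : j < a := hj
      rw [hb, Function.comp_apply, hfix j (by simp; omega)]
    have hpair : insert (s1.arr 10 0) (s1.arr 10 '' Set.Ico (r - 1) r) =
        {s.arr 10 0, s.arr 10 q} := by
      have : Set.Ico (r - 1) r = {r - 1} := by ext; simp; omega
      rw [this, Set.image_singleton, hv, hlast]
    have hrest : s1.arr 10 '' Set.Ico a (r - 1) = s1.arr 10 '' Set.Ico a r \ {s.arr 10 q} := by
      ext x
      simp only [Set.mem_image, Set.mem_Ico, Set.mem_sdiff, Set.mem_singleton_iff]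
      constructor
      · rintro ⟨j, hj, rfl⟩
        refine ⟨⟨j, by omega, rfl⟩, fun h => ?_⟩
        have := hL1.inj (show j ∈ Set.Iio r by simp; omega)
          (show r - 1 ∈ Set.Iio r by simp; omega) (h.trans hlast.symm)
        omega
      · rintro ⟨⟨j, hj, rfl⟩, hne⟩
        refine ⟨j, ⟨hj.1, ?_⟩, rfl⟩
        by_contra hc
        exact hne (by rw [← hlast, show j = r - 1 by omega])
    have hqB : s.arr 10 q ∈ s.arr 10 '' Set.Ico a r := ⟨q, ⟨hiso.1, hiso.2.1⟩, rfl⟩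
    simp only [fits_var, eval_var, true_and, b35]
    refine (emitCmd_spec (s := s1.setReg 33 (r - 1)) (a := r - 1) (r := r)
      (hV.congr (by simp [b6]) (by simp [b7]) (by simp [b11]) (by simp [b12])) (by simp)
      (by simp [b8, hL.len]) (by omega) (by omega) hL1.inj hL1.lt
      (by simp only [Store.arr_setReg]; rw [hpair]; exact tight_pair _ _ _ _) (by omega)
      (by simp [b7]; omega) (by simp [b6]; omega) (by omega)).frame.mono ?_
    rintro s2 t2 ⟨⟨hV2, c6, c7, hold2, hnew2, hT2⟩, hk2⟩
    have c35 : s2.reg 35 = r - 1 := (hk2.reg 35 rfl).trans (by simp [b35])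
    have c9 : s2.reg 9 = a := (hk2.reg 9 rfl).trans (by simp [b9])
    have c10 : s2.arr 10 = s1.arr 10 := hk2.arr 10 rfl
    simp only [Store.reg_setReg, Store.arr_setReg, Nat.reduceEqDiff, if_false, if_true, b6, b7]
      at c6 c7 hold2 hnew2
    simp only [fits_var, eval_var, true_and, Store.reg_setReg, Store.arr_setReg, Nat.reduceEqDiff,
      if_false, if_true, c35, c9]
    have hsub : insert (s.arr 10 0) (s.arr 10 '' Set.Ico a r \ {s.arr 10 q}) =
        insert (s1.arr 10 0) (s1.arr 10 '' Set.Ico a (r - 1)) := by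
      rw [hv, hrest, himg]
    refine (emitCmd_spec (s := (s2.setReg 8 (r - 1)).setReg 33 a) (a := a) (r := r - 1)
      (hV2.congr (by simp) (by simp) rfl rfl) (by simp)
      (by simp) ha (by omega) ?_ ?_ ?_ (by omega)
      (by simp [c7]; omega) (by simp [c6]; omega) (by omega)).frame.mono ?_
    · simp only [Store.arr_setReg, c10]
      exact hL1.inj.mono fun j (hj : j < r - 1) => show j < r by omega
    · simp only [Store.arr_setReg, c10]
      exact fun j hj => hL1.lt j (by omega)
    · simp only [Store.arr_setReg, c10, ← hsub]
      exact hlev.tight_diff hSU hqB hiso.2.2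
    rintro s3 t3 ⟨⟨hV3, d6, d7, hold3, hnew3, hT3⟩, hk3⟩
    have d9 : s3.reg 9 = a := (hk3.reg 9 rfl).trans (by simp [c9])
    have d10 : s3.arr 10 = s1.arr 10 := (hk3.arr 10 rfl).trans (by simp [c10])
    simp only [Store.reg_setReg, Store.arr_setReg, Nat.reduceEqDiff, if_false, if_true, c6, c7, c10]
      at d6 d7 hold3 hnew3
    have hls : ∀ s' : Store, ∀ x y, levelSet (s'.setReg x y) = levelSet s' := fun _ _ _ => rfl
    rw [d9]
    simp only [hls, Store.reg_setReg, Store.arr_setReg, Nat.reduceEqDiff, if_false, if_true, d6, d7,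
      d10] at hold3 hnew3 ⊢
    have hls1 : levelSet s1 = levelSet s := levelSet_congr b11 b12
    refine ⟨hV3.congr (by simp) (by simp) rfl rfl, ⟨by simp, ?_, ?_⟩, hlow, hv, ?_, by omega,
      by omega, by omega, fun e he => ?_, by omega⟩
    · simp only [Store.arr_setReg, d10]
      exact hL1.inj.mono fun j (hj : j < a) => show j < r by omega
    · simp only [Store.arr_setReg, d10]
      exact fun j hj => hL1.lt j (by omega)
    · intro l hl
      rw [hold3 l (by omega), hold2 l hl, hls, hls1]
    · rw [hlev.realizable_insert_iff hfin he hqB hiso.2.2]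
      rw [hpair] at hnew2
      rw [hsub, ← hnew3, ← hnew2, ← hold3 _ (Nat.lt_succ_self _)]
      constructor
      · rintro ⟨h1, h2⟩ l hl1 hl2
        rcases (by omega : l = s.reg 6 ∨ l = s.reg 6 + 1) with rfl | rfl
        exacts [h1, h2]
      · exact fun h => ⟨h _ le_rfl (by omega), h _ (by omega) (by omega)⟩
  · have hiso := hiso.resolve_right (by omega)
    have hfx : ∀ x y, (s.setReg x y).arr = s.arr := fun _ _ => rfl
    rw [h9]
    refine (emitCmd_spec (s := s.setReg 33 a) (a := a) (r := r)
      (hV.congr (by simp) (by simp) rfl rfl) (by simp)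
      (by simp [hL.len]) ha har.le hL.inj hL.lt (hlev.tight hSU hiso.2) (by omega)
      (by simp; omega) (by simp; omega) (by omega)).frame.mono ?_
    rintro s3 t3 ⟨⟨hV3, d6, d7, hold3, hnew3, hT3⟩, hk3⟩
    have d9 : s3.reg 9 = a := (hk3.reg 9 rfl).trans (by simp [h9])
    have d10 : s3.arr 10 = s.arr 10 := hk3.arr 10 rfl
    simp only [Store.reg_setReg, Store.arr_setReg, Nat.reduceEqDiff, if_false, if_true]
      at d6 d7 hold3 hnew3
    have hls : ∀ s' : Store, ∀ x y, levelSet (s'.setReg x y) = levelSet s' := fun _ _ _ => rfl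
    rw [d9]
    simp only [hls, Store.reg_setReg, Store.arr_setReg, Nat.reduceEqDiff, if_false, if_true, d6, d7,
      d10] at hold3 hnew3 ⊢
    refine ⟨hV3.congr (by simp) (by simp) rfl rfl, ⟨by simp, ?_, ?_⟩, trivial, trivial, hold3,
      by omega, by omega, by omega, fun e he => ?_, by omega⟩
    · simp only [Store.arr_setReg, d10]
      exact hL.inj.mono fun j (hj : j < a) => show j < r by omega
    · simp only [Store.arr_setReg, d10]
      exact fun j hj => hL.lt j (by omega)
    · rw [← hnew3]
      constructor
      · intro h1 l hl1 hl2
        obtain rfl : l = s.reg 6 := by omega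
        exact h1
      · exact fun h => h _ le_rfl (by omega)

/-- Decompose the restriction to the entries of array `10` into levels. -/
def quotCmd : Cmd :=
  whl (lit 1) (var 8) (levelCmd ;; closeCmd)

/-- What remains after a level has been removed is a module of the previous list, hence still rooted
at the same vertex. Every round removes an entry, which bounds the number of levels by `2 * (r -
1)`. At the end only the root is left, and a single point is realizable. -/
theorem quotCmd_spec {R : ℕ → ℕ → Prop} [IsStrictOrder ℕ R] {W n r : ℕ} {s : Store}
    (hM : HasMatrix R n s) (hV : HasLevels R n s) (hL : HasList n r s) (hr : 1 ≤ r) (hrn : r ≤ n)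
    (hnW : n * n < W) (hW4 : 4 ≤ W) (hroot : Rooted R (s.arr 10 0) (s.arr 10 '' Set.Iio r))
    (hmin : ∀ j < r, ¬ R (s.arr 10 j) (s.arr 10 0))
    (hW6 : s.reg 6 + 2 * r < W) (hW7 : s.reg 7 + 3 * r < W) :
    Tot W quotCmd s fun s' t => HasLevels R n s' ∧ (∀ l < s.reg 6, levelSet s' l = levelSet s l) ∧
      s.reg 6 ≤ s'.reg 6 ∧ s'.reg 6 ≤ s.reg 6 + 2 * (r - 1) ∧
      s'.reg 7 ≤ s.reg 7 + 3 * (r - 1) ∧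
      (∀ e, 1 ≤ e → (Realizable R e (s.arr 10 '' Set.Iio r) ↔
        ∀ l, s.reg 6 ≤ l → l < s'.reg 6 → Realizable R e (levelSet s' l))) ∧
      t ≤ (r - 1) * (n * 16 + 66) + 1 := by
  have hnW' : n < W := lt_of_le_of_lt (Nat.le_mul_self n) hnW
  refine (Tot.whl (fun s' => HasLevels R n s' ∧ HasList n (s'.reg 8) s' ∧ 1 ≤ s'.reg 8 ∧
    s'.reg 8 ≤ r ∧ s'.arr 10 0 = s.arr 10 0 ∧
    Rooted R (s.arr 10 0) (s'.arr 10 '' Set.Iio (s'.reg 8)) ∧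
    s'.arr 10 '' Set.Iio (s'.reg 8) ⊆ s.arr 10 '' Set.Iio r ∧
    (∀ l < s.reg 6, levelSet s' l = levelSet s l) ∧ s.reg 6 ≤ s'.reg 6 ∧
    s'.reg 6 + 2 * s'.reg 8 ≤ s.reg 6 + 2 * r ∧ s'.reg 7 + 3 * s'.reg 8 ≤ s.reg 7 + 3 * r ∧
    ∀ e, 1 ≤ e → (Realizable R e (s.arr 10 '' Set.Iio r) ↔
      Realizable R e (s'.arr 10 '' Set.Iio (s'.reg 8)) ∧
        ∀ l, s.reg 6 ≤ l → l < s'.reg 6 → Realizable R e (levelSet s' l)))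
    (fun s' => (s'.reg 8 - 1) * (n * 16 + 66)) ?_ ?_ ?_).mono ?_
  · rintro s' - -
    simp only [fits_lit, fits_var, and_true]
    omega
  · rintro s1 ⟨hV1, hL1, h1, h2, hv1, hroot1, hsub1, hold1, h3, h4, h5, hR1⟩ hk hlt
    simp only [eval_lit, eval_var] at hlt
    have hmin1 : ∀ j < s1.reg 8, ¬ R (s1.arr 10 j) (s1.arr 10 0) := fun j hj => by
      obtain ⟨i, hi, hi'⟩ := hsub1 ⟨j, hj, rfl⟩
      rw [← hi', hv1]
      exact hmin i hi
    rw [← hv1] at hroot1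
    rw [tot_seq]
    refine (levelCmd_spec (hM.congr (hk.reg 0 rfl) (hk.arr 2 rfl)) hL1 hlt (by omega) hnW hW4 hroot1
      hmin1).frame.mono ?_
    rintro s2 t2 ⟨⟨hL2, himg2, hv2, h6, h7, ⟨u, hlev⟩, hiso, hT2⟩, hk2⟩
    have c6 : s2.reg 6 = s1.reg 6 := hk2.reg 6 rfl
    have c7 : s2.reg 7 = s1.reg 7 := hk2.reg 7 rfl
    have c11 : s2.arr 11 = s1.arr 11 := hk2.arr 11 rfl
    have c12 : s2.arr 12 = s1.arr 12 := hk2.arr 12 rfl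
    have hls2 := levelSet_congr c11 c12
    rw [← himg2, ← hv2] at hlev
    refine (closeCmd_spec (hV1.congr c6 c7 c11 c12) hL2 rfl h6 h7 (by omega) hnW' hlev hiso
      (by omega) (by omega)).mono ?_
    rintro s3 t3 ⟨hV3, hL3, himg3, hv3, hold3, h8, h9, h10, hR3, hT3⟩
    generalize ha : s2.reg 9 = a at *
    have hd : s1.arr 10 '' Set.Iio (s1.reg 8) \ s2.arr 10 '' Set.Ico a (s1.reg 8) =
        s3.arr 10 '' Set.Iio a := by
      rw [himg3, ← himg2]
      have hu : Set.Iio (s1.reg 8) = Set.Iio a ∪ Set.Ico a (s1.reg 8) := by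
        ext; simp; omega
      ext x
      constructor
      · rintro ⟨⟨j, hj, rfl⟩, hx⟩
        refine ⟨j, ?_, rfl⟩
        by_contra hc
        exact hx ⟨j, ⟨by simpa using hc, hj⟩, rfl⟩
      · rintro ⟨j, hj, rfl⟩
        have hj' : j < a := hj
        refine ⟨⟨j, show j < _ by omega, rfl⟩, ?_⟩
        rintro ⟨i, hi, hij⟩
        have hi1 := hi.1
        have := hL2.inj (show i ∈ Set.Iio _ from hi.2) (show j ∈ Set.Iio _ from show j < _ by omega) hij
        omega
    have hmod := hlev.mod_diff
    rw [himg2, hd] at hmod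
    rw [hL3.len]
    refine ⟨⟨hV3, hL3, by omega, by omega, hv3.trans (hv2.trans hv1), ?_, hmod.1.trans hsub1, ?_,
      by omega, by omega, by omega, fun e he => ?_⟩, ?_⟩
    · rw [← hv1]; exact hroot1.subset hmod
    · intro l hl
      rw [hold3 l (by omega), hls2, hold1 l hl]
    · have h11 := hlev.realizable_iff ((Set.finite_Iio _).image _) he
      rw [himg2, hd] at h11
      rw [hR1 e he, h11, hR3 e he]
      constructor
      · rintro ⟨⟨k1, k2⟩, k3⟩
        refine ⟨k2, fun l hl1 hl2 => ?_⟩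
        by_cases hl : l < s1.reg 6
        · rw [hold3 l (by omega), hls2]; exact k3 l hl1 hl
        · exact k1 l (by omega) hl2
      · rintro ⟨k1, k2⟩
        refine ⟨⟨fun l hl1 hl2 => k2 l (by omega) hl2, k1⟩, fun l hl1 hl2 => ?_⟩
        have := k2 l hl1 (by omega)
        rwa [hold3 l (by omega), hls2] at this
    · have e1 : s1.reg 8 - 1 = (s1.reg 8 - a) + (a - 1) := by omega
      obtain ⟨g, hg⟩ : ∃ g, s1.reg 8 - a = g + 1 := ⟨s1.reg 8 - a - 1, by omega⟩
      rw [hg] at hT2 hT3 e1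
      rw [e1, add_mul]
      have e2 : (g + 1) * (n * 16 + 33) = (g + 1) * n * 16 + (g + 1) * 33 := by ring
      have e3 : (g + 1) * (n * 16 + 66) = (g + 1) * n * 16 + (g + 1) * 66 := by ring
      omega
  · rw [hL.len]
    refine ⟨hV, hL, hr, le_rfl, rfl, hroot, subset_rfl, fun _ _ => rfl, le_rfl, le_rfl, le_rfl,
      fun e he => ⟨fun h => ⟨h, fun l h1 h2 => by omega⟩, fun h => h.1⟩⟩
  · rintro s2 t2 ⟨⟨hV2, hL2, h1, h2, hv2, hroot2, hsub2, hold2, h3, h4, h5, hR2⟩, hk, hn, hT⟩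
    simp only [eval_lit, eval_var] at hn
    have h8 : s2.reg 8 = 1 := by omega
    rw [h8] at h4 h5 hT hR2
    rw [hL.len] at hT
    refine ⟨hV2, hold2, h3, by omega, by omega, fun e he => ?_, by omega⟩
    rw [hR2 e he]
    refine and_iff_right ?_
    have : s2.arr 10 '' Set.Iio 1 = {s2.arr 10 0} := by
      have : Set.Iio 1 = ({0} : Set ℕ) := by ext; simp
      rw [this, Set.image_singleton]
    rw [this]
    exact realizable_singleton he _

/-! ### Separating the vertices one by one: the decomposition algorithm -/

/-- Classes are modules. -/
def Stable (R : ℕ → ℕ → Prop) (n : ℕ) (s : Store) : Prop :=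
  ∀ w < n, ∀ x < n, ∀ y < n, s.arr 6 x = s.arr 6 y → s.arr 6 x ≠ s.arr 6 w → cmp R w x = cmp R w y

/-- Move to the start of a class of positions from `reg 2` to `reg 3` an entry of array `5` that is
minimal in the class. -/
def minCmd : Cmd :=
  set 3 (get 7 (get 5 (var 2))) ;; set 34 (var 2) ;; set 20 (var 2) ;;
  upto 20 3 (
    ite (lit 1) (get 2 (get 5 (var 20) * var 0 + get 5 (var 34))) (set 34 (var 20)) skip) ;;
  set 35 (var 2) ;; swapCmd 5

/-- The vertex to be separated must be minimal in its class, because a level is computed with a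
minimal root. As in the search for a top, a single scan with a candidate that only moves downwards
is enough. -/
theorem minCmd_spec {R : ℕ → ℕ → Prop} [IsStrictOrder ℕ R] {W n p : ℕ} {s : Store}
    (hM : HasMatrix R n s) (hP : HasPart n s) (hp : s.reg 2 = p) (hpn : p < n)
    (hcp : s.arr 6 (s.arr 5 p) = p) (hnW : n * n < W) (hW2 : 2 ≤ W) :
    Tot W minCmd s fun s' t => HasPart n s' ∧ s'.reg 3 = s.arr 7 (s.arr 5 p) ∧
      (∀ j < n, s.arr 6 (s'.arr 5 j) = s.arr 6 (s.arr 5 j)) ∧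
      (∀ j < n, s.arr 7 (s'.arr 5 j) = s.arr 7 (s.arr 5 j)) ∧
      (∀ j, p ≤ j → j < s'.reg 3 → ¬ R (s'.arr 5 j) (s'.arr 5 p)) ∧ t ≤ n * 4 + 8 := by
  have hnW' : n < W := lt_of_le_of_lt (Nat.le_mul_self n) hnW
  have hen := hP.part.end_le p hpn
  have hpe := hP.part.lt_end p hpn
  generalize he : s.arr 7 (s.arr 5 p) = e at *
  simp only [minCmd, tot_seq, tot_set, fits_var, fits_get, eval_var, eval_get, true_and, hp,
    Store.reg_setReg, Store.arr_setReg, Nat.reduceEqDiff, if_false, he]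
  refine (Tot.upto_const (N := e) (i₀ := p) (fun i s' => p ≤ s'.reg 34 ∧ s'.reg 34 < e ∧
    ∀ j, p ≤ j → j < i → ¬ R (s.arr 5 j) (s.arr 5 (s'.reg 34))) 2 rfl rfl (by simp) (by simp) hpe.le
    (by omega) ?_ ?_).mono ?_
  · rintro i s1 hi1 hi2 ⟨h1, h2, h3⟩ hk h20 -
    have e5 : s1.arr 5 = s.arr 5 := (hk.arr 5 rfl).trans (by simp)
    have e2 : s1.arr 2 = s.arr 2 := (hk.arr 2 rfl).trans (by simp)
    have e0 : s1.reg 0 = n := (hk.reg 0 rfl).trans (by simp [hM.n_eq])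
    have hi := hP.part.lt i (by omega)
    have hc := hP.part.lt (s1.reg 34) (by omega)
    have hidx := mul_add_lt_mul hi hc
    have hidx' : s.arr 5 i * n < n * n := by nlinarith
    simp only [tot_ite, tot_set, tot_skip, fits_lit, fits_get, fits_add, fits_mul, fits_var,
      eval_lit, eval_get, eval_add, eval_mul, eval_var, true_and, and_true, e5, e0, e2, h20,
      hM.mat _ hi _ hc, Store.reg_setReg, Nat.reduceEqDiff, if_false, if_true]
    refine ⟨by omega, ⟨by omega, by omega⟩, fun hlt => ⟨⟨hi1, hi2, fun j h4 h5 => ?_⟩, by omega⟩,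
      fun hlt => ⟨⟨h1, h2, fun j h4 h5 => ?_⟩, by omega⟩⟩
    · have h6 := cmp_le_two R (s.arr 5 i) (s.arr 5 (s1.reg 34))
      have h7 : R (s.arr 5 i) (s.arr 5 (s1.reg 34)) := cmp_eq_two.1 (by omega)
      rcases Nat.lt_succ_iff_lt_or_eq.1 h5 with hj | rfl
      · exact fun h8 => h3 j h4 hj (_root_.trans h8 h7)
      · exact irrefl_of R _
    · rcases Nat.lt_succ_iff_lt_or_eq.1 h5 with hj | rfl
      · exact h3 j h4 hj
      · rw [← cmp_eq_two (R := R)]; omega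
  · simp only [Store.reg_setReg, Nat.reduceEqDiff, if_false, if_true]
    exact ⟨le_rfl, hpe, fun j h1 h2 => by omega⟩
  · rintro s1 t1 ⟨⟨h1, h2, h3⟩, hk, -, hT⟩
    have e5 : s1.arr 5 = s.arr 5 := (hk.arr 5 rfl).trans (by simp)
    have e2 : s1.reg 2 = p := (hk.reg 2 rfl).trans (by simp [hp])
    have e3 : s1.reg 3 = e := (hk.reg 3 rfl).trans (by simp)
    have e4 : s1.reg 4 = s.reg 4 := (hk.reg 4 rfl).trans (by simp)
    have e6 : s1.arr 6 = s.arr 6 := (hk.arr 6 rfl).trans (by simp)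
    have e7 : s1.arr 7 = s.arr 7 := (hk.arr 7 rfl).trans (by simp)
    simp only [tot_set, fits_var, eval_var, true_and, e2]
    refine swapCmd_spec.frame.mono ?_
    rintro s2 t2 ⟨⟨hb, hT2⟩, hk2⟩
    simp only [Store.reg_setReg, Store.arr_setReg, Nat.reduceEqDiff, if_false, if_true, e5] at hb
    have hfix : ∀ j, j < s.arr 6 (s.arr 5 p) ∨ s.arr 7 (s.arr 5 p) ≤ j →
        Equiv.swap (s1.reg 34) p j = j := fun j hj => by
      rw [hcp, he] at hj
      exact Equiv.swap_apply_of_ne_of_ne (by omega) (by omega)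
    obtain ⟨hP2, hcl⟩ := hP.part.permute hpn hfix
    have f6 : s2.arr 6 = s.arr 6 := (hk2.arr 6 rfl).trans e6
    have f7 : s2.arr 7 = s.arr 7 := (hk2.arr 7 rfl).trans e7
    have f3 : s2.reg 3 = e := (hk2.reg 3 rfl).trans (by simp [e3])
    have f4 : s2.reg 4 = s.reg 4 := (hk2.reg 4 rfl).trans (by simp [e4])
    refine ⟨⟨by rw [hb, f6, f7]; exact hP2, ?_⟩, f3, ?_, ?_, ?_, ?_⟩
    · rw [f4, hP.count, hb, f6]
      unfold numClasses
      congr 1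
      refine Finset.filter_congr fun j hj => ?_
      rw [Function.comp_apply, (hcl j (Finset.mem_range.1 hj)).1]
    · intro j hj; rw [hb]; exact (hcl j hj).1
    · intro j hj; rw [hb]; exact (hcl j hj).2
    · intro j h4 h5
      rw [f3] at h5
      rw [hb, Function.comp_apply, Function.comp_apply, Equiv.swap_apply_right]
      by_cases h6 : j = s1.reg 34
      · rw [h6, Equiv.swap_apply_left]
        exact h3 p le_rfl hpe
      · by_cases h7 : j = p
        · rw [h7, Equiv.swap_apply_right]
          exact irrefl_of R _
        · rw [Equiv.swap_apply_of_ne_of_ne h6 h7]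
          exact h3 j h4 h5
    · have : (e - p) * 4 ≤ n * 4 := Nat.mul_le_mul_right _ (by omega)
      omega

/-- List in array `10` the first entries of the classes between the positions `reg 2` and `reg 3`. -/
def listCmd : Cmd :=
  set 8 (lit 0) ;; set 20 (var 2) ;;
  upto 20 3 (
    ite (get 6 (get 5 (var 20))) (var 20) skip
      (put 10 (var 8) (get 5 (var 20)) ;; set 8 (var 8 + lit 1)))

theorem listCmd_spec {W n p e : ℕ} {s : Store} (hP : HasPart n s) (hp : s.reg 2 = p)
    (he : s.reg 3 = e) (hpe : p < e) (hen : e ≤ n) (hcp : s.arr 6 (s.arr 5 p) = p) (hnW : n < W) :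
    Tot W listCmd s fun s' t => ∃ r, HasList n r s' ∧ 1 ≤ r ∧ r ≤ n ∧
      r = ((Finset.Ico p e).filter fun i => s.arr 6 (s.arr 5 i) = i).card ∧
      s'.arr 10 0 = s.arr 5 p ∧
      s'.arr 10 '' Set.Iio r = s.arr 5 '' {i | p ≤ i ∧ i < e ∧ s.arr 6 (s.arr 5 i) = i} ∧
      t ≤ n * 5 + 3 := by
  simp only [listCmd, tot_seq, tot_set, fits_lit, fits_var, eval_lit, eval_var, true_and,
    Store.reg_setReg, Nat.reduceEqDiff, if_false, hp]
  refine ⟨by omega, (Tot.upto_const (N := e) (i₀ := p) (fun i s' =>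
    HasList n (s'.reg 8) s' ∧
    s'.reg 8 = ((Finset.Ico p i).filter fun i => s.arr 6 (s.arr 5 i) = i).card ∧
    (p < i → 1 ≤ s'.reg 8 ∧ s'.arr 10 0 = s.arr 5 p) ∧
    s'.arr 10 '' Set.Iio (s'.reg 8) =
      s.arr 5 '' {i' | p ≤ i' ∧ i' < i ∧ s.arr 6 (s.arr 5 i') = i'}) 3 rfl rfl (by simp)
    (by simp [he]) hpe.le (by omega) ?_ ?_).mono ?_⟩
  · rintro i s1 hi1 hi2 ⟨hL, hc, h0, himg⟩ hk h20 -
    have e5 : s1.arr 5 = s.arr 5 := (hk.arr 5 rfl).trans (by simp)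
    have e6 : s1.arr 6 = s.arr 6 := (hk.arr 6 rfl).trans (by simp)
    have hci := hP.part.start_le i (by omega)
    have hico : Finset.Ico p (i + 1) = insert i (Finset.Ico p i) := by
      ext; simp only [Finset.mem_Ico, Finset.mem_insert]; omega
    simp only [tot_seq, tot_ite, tot_set, tot_put, tot_skip, fits_lit, fits_get, fits_add, fits_var,
      eval_lit, eval_get, eval_add, eval_var, true_and, and_true, e5, e6, h20,
      Store.reg_setReg, Store.arr_setReg, Store.reg_setArr, Store.arr_setArr, Nat.reduceEqDiff,
      if_false, if_true]
    refine ⟨fun hlt => ⟨⟨?_, ?_, ?_, ?_⟩, by omega⟩, fun hlt => ⟨⟨by omega, ?_⟩, ?_, by omega⟩⟩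
    · exact ⟨by simp, hL.inj, hL.lt⟩
    · rw [hico, Finset.filter_insert, if_neg (by omega), hc]
    · intro _
      refine h0 ?_
      by_contra hpi
      obtain rfl : i = p := by omega
      omega
    · rw [himg]
      congr 1
      ext j
      simp only [Set.mem_ofPred_eq]
      constructor
      · rintro ⟨h1, h2, h3⟩
        exact ⟨h1, by omega, h3⟩
      · rintro ⟨h1, h2, h3⟩
        refine ⟨h1, ?_, h3⟩
        by_contra hji
        obtain rfl : j = i := by omega
        omega
    · have : s1.reg 8 ≤ n := by
        rw [hc]
        refine (Finset.card_filter_le _ _).trans ?_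
        simp only [Nat.card_Ico]; omega
      have : s1.reg 8 ≤ i - p := by
        rw [hc]
        refine (Finset.card_filter_le _ _).trans ?_
        simp only [Nat.card_Ico]; omega
      omega
    · have hi : s.arr 6 (s.arr 5 i) = i := by omega
      have hnew : s.arr 5 i ∉ s1.arr 10 '' Set.Iio (s1.reg 8) := by
        rw [himg]
        rintro ⟨j, ⟨h1, h2, h3⟩, h4⟩
        have := hP.part.inj j (by omega) i (by omega) h4
        omega
      have hold : ∀ j < s1.reg 8, Function.update (s1.arr 10) (s1.reg 8) (s.arr 5 i) j =
          s1.arr 10 j := fun j hj => Function.update_of_ne (by omega) _ _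
      refine ⟨⟨by simp, ?_, ?_⟩, ?_, ?_, ?_⟩
      · simp only [Store.arr_setReg, Store.arr_setArr, if_true]
        intro a (ha : a < s1.reg 8 + 1) b (hb : b < s1.reg 8 + 1) hab
        by_cases ha' : a = s1.reg 8 <;> by_cases hb' : b = s1.reg 8
        · omega
        · rw [ha', Function.update_self, hold b (by omega)] at hab
          exact (hnew ⟨b, show b < _ by omega, hab.symm⟩).elim
        · rw [hb', Function.update_self, hold a (by omega)] at hab
          exact (hnew ⟨a, show a < _ by omega, hab⟩).elim
        · rw [hold a (by omega), hold b (by omega)] at hab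
          exact hL.inj (show a < _ by omega) (show b < _ by omega) hab
      · simp only [Store.arr_setReg, Store.arr_setArr, if_true]
        intro j hj
        by_cases hj' : j = s1.reg 8
        · rw [hj', Function.update_self]; exact hP.part.lt i (by omega)
        · rw [hold j (by omega)]; exact hL.lt j (by omega)
      · rw [hico, Finset.filter_insert, if_pos hi, Finset.card_insert_of_notMem (by simp), hc]
      · intro _
        refine ⟨by omega, ?_⟩
        by_cases hpi : p = i
        · have : s1.reg 8 = 0 := by rw [hc, hpi]; simp
          rw [this, Function.update_self, hpi]
        · have := h0 (by omega)
          rw [hold 0 (by omega), this.2]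
      · have h1 : Set.Iio (s1.reg 8 + 1) = insert (s1.reg 8) (Set.Iio (s1.reg 8)) := by
          ext; simp only [Set.mem_Iio, Set.mem_insert_iff]; omega
        have h2 : {i' | p ≤ i' ∧ i' < i + 1 ∧ s.arr 6 (s.arr 5 i') = i'} =
            insert i {i' | p ≤ i' ∧ i' < i ∧ s.arr 6 (s.arr 5 i') = i'} := by
          ext j
          simp only [Set.mem_ofPred_eq, Set.mem_insert_iff]
          constructor
          · rintro ⟨h1, h2, h3⟩
            by_cases hj : j = i
            · exact Or.inl hj
            · exact Or.inr ⟨h1, by omega, h3⟩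
          · rintro (rfl | ⟨h1, h2, h3⟩)
            · exact ⟨hi1, by omega, hi⟩
            · exact ⟨h1, by omega, h3⟩
        rw [h1, h2, Set.image_insert_eq, Set.image_insert_eq, Function.update_self, ← himg,
          Set.image_congr fun j (hj : j ∈ Set.Iio _) => hold j hj]
  · simp only [Store.reg_setReg, Nat.reduceEqDiff, if_false, if_true]
    refine ⟨⟨by simp, by simp, by simp⟩, by simp, by omega, ?_⟩
    have : {i' | p ≤ i' ∧ i' < p ∧ s.arr 6 (s.arr 5 i') = i'} = ∅ := by
      ext j; simp; omega
    simp [this]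
  · rintro s1 t1 ⟨⟨hL, hc, h0, himg⟩, hk, -, hT⟩
    have h1 := h0 hpe
    refine ⟨_, hL, h1.1, ?_, hc, h1.2, himg, ?_⟩
    · rw [hc]
      refine (Finset.card_filter_le _ _).trans ?_
      simp only [Nat.card_Ico]; omega
    · have : (e - p) * (3 + 2) ≤ n * 5 := Nat.mul_le_mul_right _ (by omega)
      omega

/-- Separate the first entry of the class from `reg 2` to `reg 3` and refine the partition. -/
def separateCmd : Cmd :=
  set 30 (var 2) ;; set 22 (var 2 + lit 1) ;; set 21 (var 3) ;; cutCmd ;; refineCmd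

/-- Before the cut, the range of every vertex is its class and the classes are modules. After the
cut, the ranges are still the old classes, so whatever may fail to be uniform lies inside the
ranges; this is the starting point for refinement. The class of `v` keeps the segment of length one
at `p`. -/
theorem separateCmd_spec {R : ℕ → ℕ → Prop} {W n p : ℕ} {s : Store}
    (hM : HasMatrix R n s) (hP : HasPart n s) (hS : Settled n s) (hSt : Stable R n s)
    (hp : s.reg 2 = p) (hpn : p < n) (hcp : s.arr 6 (s.arr 5 p) = p)
    (h3 : s.reg 3 = s.arr 7 (s.arr 5 p)) (hnW : n * n < W) (hW3 : 3 ≤ W) :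
    Tot W separateCmd s fun s' t => Refining R n p (s.arr 5 p) s s' ∧ Settled n s' ∧
      Stable R n s' ∧ s'.arr 5 p = s.arr 5 p ∧
      s'.arr 6 (s.arr 5 p) = p ∧ s'.arr 7 (s.arr 5 p) = p + 1 ∧
      t + rangeSum n s' * 62 + (n - s'.reg 4) * (n * 32 + 4) ≤
        rangeSum n s * 62 + (n - s.reg 4) * (n * 32 + 4) + n * 3 + 11 := by
  have hnW' : n < W := lt_of_le_of_lt (Nat.le_mul_self n) hnW
  have hen := hP.part.end_le p hpn
  have hpe := hP.part.lt_end p hpn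
  generalize he : s.arr 7 (s.arr 5 p) = e at *
  simp only [separateCmd, tot_seq, tot_set, fits_lit, fits_var, fits_add, eval_lit, eval_var,
    eval_add, true_and, Store.reg_setReg, Nat.reduceEqDiff, if_false, hp, h3]
  refine ⟨⟨by omega, by omega⟩, (cutCmd_spec (s := ((s.setReg 30 p).setReg 22 (p + 1)).setReg 21 e) (n := n) (i := p) (q := p + 1) hP.part hpn hcp
    (by omega) (by simp [he]; omega) (by simp) (by simp) (by simp [he]) hnW'
    (by simpa using hP.count)).frame.mono ?_⟩
  rintro s1 t1 ⟨⟨hP1, h6, h7, hc1, hc2, hT1⟩, hk1⟩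
  simp only [Store.arr_setReg, Store.reg_setReg, Nat.reduceEqDiff, if_false, he] at hP1 h6 h7 hc1 hc2 hT1
  have a5 : s1.arr 5 = s.arr 5 := hk1.arr 5 rfl
  have a2 : s1.arr 2 = s.arr 2 := hk1.arr 2 rfl
  have a8 : s1.arr 8 = s.arr 8 := hk1.arr 8 rfl
  have a9 : s1.arr 9 = s.arr 9 := hk1.arr 9 rfl
  have a0 : s1.reg 0 = s.reg 0 := (hk1.reg 0 rfl).trans (by simp)
  have ar5 : s1.reg 5 = s.reg 5 := (hk1.reg 5 rfl).trans (by simp)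
  have hP1' : HasPart n s1 := ⟨by rw [a5]; exact hP1, by rw [a5]; exact hc1⟩
  have hcl : ∀ j < n, s.arr 6 (s.arr 5 j) = p ↔ p ≤ j ∧ j < e := fun j hj => by
    have := hP.part.start_eq_iff hpn hj
    rwa [hcp, he] at this
  have hce : ∀ j < n, s.arr 6 (s.arr 5 j) = p → s.arr 7 (s.arr 5 j) = e := fun j hj h => by
    rw [← he]; exact hP.part.end_eq_of_start_eq (hP.part.lt j hj) (hP.part.lt p hpn) (by rw [h, hcp])
  have hr : Refines n s s1 := by
    refine ⟨fun x hx => ?_, fun x hx => ?_, fun x hx y hy => ?_, by rw [hc2]; omega, fun h x hx => ?_⟩ <;>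
      obtain ⟨i, hi, rfl⟩ := hP.part.surj x hx <;> have h8 := hcl i hi <;>
      have h10 := hP.part.start_le i hi <;> have h11 := hP.part.lt_end i hi <;> have h9 := hce i hi
    · rw [h6 i hi]
      split_ifs with hc <;> omega
    · rw [h7 i hi]
      split_ifs with hc <;> omega
    · obtain ⟨j, hj, rfl⟩ := hP.part.surj y hy
      have k8 := hcl j hj
      have k9 := hP.part.start_le j hj
      have k10 := hP.part.lt_end j hj
      rw [h6 i hi, h6 j hj]
      intro hij
      split_ifs at hij with hc hc' hc' <;> try omega
      · exfalso
        have h12 := hP.part.start_start hj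
        have h13 := hcl _ (show s.arr 6 (s.arr 5 j) < n by omega)
        omega
      · exfalso
        have h12 := hP.part.start_start hi
        have h13 := hcl _ (show s.arr 6 (s.arr 5 i) < n by omega)
        omega
    · have hcc : ¬ (p < p + 1 ∧ p + 1 < e) := by
        intro hcc; rw [hc2, if_pos hcc] at h; omega
      rw [h6 i hi, h7 i hi]
      split_ifs with g1 g2 g2 <;> constructor <;> omega
  have hlt : ∀ x < n, ∀ w < n, s.arr 6 x < s.arr 6 w → s.arr 7 x ≤ s.arr 6 w := by
    intro x hx w hw h
    by_contra hc
    have := hP.part.start_eq_of_lt hw hx h.le (by omega)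
    omega
  have hS2 := hS.2
  have hR : Refining R n p (s.arr 5 p) s s1 := by
    refine ⟨hM.congr a0 a2, hP1', hr, fun x hx hxp => ?_, fun j _ _ => by rw [a5],
      fun N hN hNp hvN a ha b hb => ?_, fun w hw => ?_, fun w hw x hx => ?_,
      fun w hw x hx y hy hxy h => ?_⟩
    · obtain ⟨i, hi, rfl⟩ := hP.part.surj x hx
      have h8 := hcl i hi
      rw [h6 i hi, h7 i hi, if_neg (by omega), if_neg (by omega)]
      exact ⟨rfl, rfl⟩
    -- A module in `X` that avoids `v` lies in the rest of `X`, which is one class so far, starting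
    -- at `p + 1`.
    · have key : ∀ c ∈ N, s1.arr 6 c = p + 1 := by
        intro c hc
        obtain ⟨i, hi, rfl⟩ := hP.part.surj c (hN.1 hc)
        have h8 := (hcl i hi).1 (hNp _ hc)
        have : i ≠ p := by rintro rfl; exact hvN hc
        rw [h6 i hi, if_pos (by omega)]
      rw [key a ha, key b hb]
    · rw [a8, a9, (hS2 w hw).1, (hS2 w hw).2]
      exact ⟨le_rfl, hr.start_le w hw, hr.end_le w hw, le_rfl⟩
    · rw [a8, a9, (hS2 w hw).1, (hS2 w hw).2]
      have h8 := hr.start_le x hx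
      have h9 := hr.end_le x hx
      refine ⟨fun h => h9.trans (hlt x hx w hw (by omega)), fun h => ?_⟩
      by_cases h10 : s.arr 6 x = s.arr 6 w
      · rw [hP.part.end_eq_of_start_eq hx hw h10] at h9
        exact h9
      · refine h9.trans ?_
        by_cases h11 : s.arr 6 x < s.arr 6 w
        · have := hlt x hx w hw h11
          have := hP.part.start_lt_end hw
          omega
        · exact absurd (hP.part.start_eq_of_lt hx hw (by omega) (by omega)) h10
    · rw [a8, a9, (hS2 w hw).1, (hS2 w hw).2] at h
      have h8 := hr.start_eq x hx y hy hxy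
      refine hSt w hw x hx y hy h8 fun h9 => ?_
      have h10 := hr.start_le x hx
      have h11 := hr.end_le x hx
      have h12 := hP1'.part.start_lt_end hx
      have h13 := hP.part.end_eq_of_start_eq hx hw h9
      omega
  have hcnt : s.reg 4 ≤ s1.reg 4 := hr.count_le
  refine (refineCmd_spec hR hP (by rw [ar5, hS.1]; exact hcnt) ?_ hnW hW3).mono ?_
  · intro h
    rw [ar5, hS.1] at h
    refine ⟨by rw [ar5, hS.1, h], fun w hw => ?_⟩
    rw [a8, a9, (hr.same h.symm w hw).1, (hr.same h.symm w hw).2]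
    exact hS2 w hw
  · rintro s2 t2 ⟨hR2, hr2, hS2', hT2⟩
    have hv : s.arr 5 p < n := hP.part.lt p hpn
    have k1 := hr2.start_le _ hv
    have k2 := hr2.end_le _ hv
    have k3 := hR2.part.part.start_lt_end hv
    rw [h6 p hpn, if_neg (by omega), hcp] at k1
    rw [h7 p hpn, if_pos (by omega)] at k2
    have k4 : s2.arr 6 (s.arr 5 p) = p := by omega
    have k5 : s2.arr 7 (s.arr 5 p) = p + 1 := by omega
    refine ⟨hR2, hS2', fun w hw x hx y hy hxy hxw => ?_, ?_, k4, k5, ?_⟩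
    · refine hR2.uniform w hw x hx y hy hxy ?_
      rw [(hS2'.2 w hw).1, (hS2'.2 w hw).2]
      by_contra hc
      exact hxw (hR2.part.part.start_eq_of_lt hx hw (by omega) (by omega))
    · obtain ⟨j, hj, hj'⟩ := hR2.part.part.surj _ hv
      have k6 := hR2.part.part.start_le j hj
      have k7 := hR2.part.part.lt_end j hj
      rw [hj', k4] at k6
      rw [hj', k5] at k7
      rw [← hj', show p = j by omega]
    · rw [show rangeSum n s1 = rangeSum n s by unfold rangeSum; rw [a8, a9], ar5, hS.1] at hT2
      have : (e - p) * 3 ≤ n * 3 := Nat.mul_le_mul_right _ (by omega)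
      omega

/-- The class of `x` in the partition of `s`. -/
def classSet (n : ℕ) (s : Store) (x : ℕ) : Set ℕ := {y | y < n ∧ s.arr 6 y = s.arr 6 x}

/-- The state of the decomposition after the positions below `p` have been separated. -/
structure Decomposing (R : ℕ → ℕ → Prop) (n p : ℕ) (s : Store) : Prop where
  mat : HasMatrix R n s
  part : HasPart n s
  settled : Settled n s
  stable : Stable R n s
  le : p ≤ n
  single : ∀ i < p, s.arr 6 (s.arr 5 i) = i ∧ s.arr 7 (s.arr 5 i) = i + 1
  levels : HasLevels R n s
  num : s.reg 6 + 2 ≤ 2 * s.reg 4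
  length : s.reg 7 + 3 ≤ 3 * s.reg 4
  realizable : ∀ e, 1 ≤ e → (Realizable R e {x | x < n} ↔
    (∀ l < s.reg 6, Realizable R e (levelSet s l)) ∧
      ∀ x < n, p ≤ s.arr 6 x → Realizable R e (classSet n s x))

/-- The positions below `p` are classes of their own, so a class cannot reach from below `p` to `p`.
-/
theorem Decomposing.start_eq {R : ℕ → ℕ → Prop} {n p : ℕ} {s : Store} (h : Decomposing R n p s)
    (hp : p < n) : s.arr 6 (s.arr 5 p) = p := by
  have h1 := h.part.part.start_le p hp
  by_contra hc
  have h2 := h.single _ (show s.arr 6 (s.arr 5 p) < p by omega)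
  have h3 := (h.part.part.start_start hp).2
  have h4 := h.part.part.lt_end p hp
  omega

section
variable {R : ℕ → ℕ → Prop} {n p v : ℕ} {s₀ s : Store}

/-- Positions outside the segment of `X` keep their entries, so the segment still lists `X`,
although in another order. -/
theorem Refining.mem_class_iff (h : Refining R n p v s₀ s) (h₀ : HasPart n s₀) (hp : p < n)
    (hcp : s₀.arr 6 (s₀.arr 5 p) = p) {j : ℕ} (hj : j < n) :
    s₀.arr 6 (s.arr 5 j) = p ↔ p ≤ j ∧ j < s₀.arr 7 (s₀.arr 5 p) := by
  have hcl : ∀ j < n, s₀.arr 6 (s₀.arr 5 j) = p ↔ p ≤ j ∧ j < s₀.arr 7 (s₀.arr 5 p) := fun j hj => by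
    have := h₀.part.start_eq_iff hp hj
    rwa [hcp] at this
  constructor
  · intro h1
    rw [← hcl j hj]
    by_contra h2
    rw [h.out_order j hj h2] at h1
    exact h2 h1
  · intro h1
    by_contra h2
    obtain ⟨i, hi, hi'⟩ := h₀.part.surj _ (h.part.part.lt j hj)
    have h3 := h.out_order i hi (by rw [hi']; exact h2)
    have h4 := h.part.part.inj i hi j hj (h3.trans hi')
    rw [← hcl j hj, ← h4, hi'] at h1
    exact h2 h1

/-- The class `X` is replaced by the classes inside it, whose number is the size of the quotient.
This is what lets new classes pay for the levels of the quotient. -/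
theorem Refining.count_eq (h : Refining R n p v s₀ s) (h₀ : HasPart n s₀) (hp : p < n)
    (hcp : s₀.arr 6 (s₀.arr 5 p) = p) :
    s.reg 4 + 1 = s₀.reg 4 + ((Finset.Ico p (s₀.arr 7 (s₀.arr 5 p))).filter
      fun i => s.arr 6 (s.arr 5 i) = i).card := by
  have hen := h₀.part.end_le p hp
  have hpe := h₀.part.lt_end p hp
  have hcl : ∀ j < n, s₀.arr 6 (s₀.arr 5 j) = p ↔ p ≤ j ∧ j < s₀.arr 7 (s₀.arr 5 p) := fun j hj => by
    have := h₀.part.start_eq_iff hp hj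
    rwa [hcp] at this
  rw [h.part.count, h₀.count]
  unfold numClasses
  have h1 : (Finset.range n).filter (fun i => s.arr 6 (s.arr 5 i) = i) =
      ((Finset.range n).filter fun i => s₀.arr 6 (s₀.arr 5 i) = i).erase p ∪
      (Finset.Ico p (s₀.arr 7 (s₀.arr 5 p))).filter fun i => s.arr 6 (s.arr 5 i) = i := by
    ext i
    simp only [Finset.mem_filter, Finset.mem_range, Finset.mem_union, Finset.mem_erase,
      Finset.mem_Ico]
    constructor
    · rintro ⟨hi, hi'⟩
      by_cases hc : s₀.arr 6 (s₀.arr 5 i) = p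
      · exact Or.inr ⟨(hcl i hi).1 hc, hi'⟩
      · rw [h.out_order i hi hc, (h.out _ (h₀.part.lt i hi) hc).1] at hi'
        exact Or.inl ⟨fun hip => hc (by rw [hi', hip]), hi, hi'⟩
    · rintro (⟨hip, hi, hi'⟩ | ⟨hi, hi'⟩)
      · have hc : s₀.arr 6 (s₀.arr 5 i) ≠ p := by omega
        rw [h.out_order i hi hc, (h.out _ (h₀.part.lt i hi) hc).1]
        exact ⟨hi, hi'⟩
      · exact ⟨by omega, hi'⟩
  rw [h1, Finset.card_union_of_disjoint, Finset.card_erase_of_mem (by simp [hp, hcp])]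
  · have : 0 < ((Finset.range n).filter fun i => s₀.arr 6 (s₀.arr 5 i) = i).card :=
      Finset.card_pos.2 ⟨p, by simp [hp, hcp]⟩
    omega
  · rw [Finset.disjoint_left]
    intro i hi hi'
    simp only [Finset.mem_filter, Finset.mem_range, Finset.mem_erase, Finset.mem_Ico] at hi hi'
    have := (hcl i hi.2.1).2 hi'.1
    omega

/-- The first vertex of the class of `x`. -/
def classRep (s : Store) (x : ℕ) : ℕ := s.arr 5 (s.arr 6 x)

theorem HasPart.classRep_eq (h : HasPart n s) {x : ℕ} (hx : x < n) : classRep s x < n ∧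
    s.arr 6 (classRep s x) = s.arr 6 x ∧ classRep s (classRep s x) = classRep s x := by
  obtain ⟨i, hi, rfl⟩ := h.part.surj x hx
  have h1 := h.part.start_start hi
  have h2 := h.part.start_le i hi
  refine ⟨h.part.lt _ (by omega), h1.1, ?_⟩
  unfold classRep
  rw [h1.1]

theorem Refining.image_classRep (h : Refining R n p v s₀ s) (h₀ : HasPart n s₀) (hp : p < n)
    (hcp : s₀.arr 6 (s₀.arr 5 p) = p) :
    s.arr 5 '' {i | p ≤ i ∧ i < s₀.arr 7 (s₀.arr 5 p) ∧ s.arr 6 (s.arr 5 i) = i} =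
      classRep s '' {x | x < n ∧ s₀.arr 6 x = p} := by
  have hen := h₀.part.end_le p hp
  ext x
  constructor
  · rintro ⟨i, ⟨h1, h2, h3⟩, rfl⟩
    refine ⟨s.arr 5 i, ⟨h.part.part.lt i (by omega), ?_⟩, by unfold classRep; rw [h3]⟩
    exact (h.mem_class_iff h₀ hp hcp (by omega)).2 ⟨h1, h2⟩
  · rintro ⟨y, ⟨hy, hyp⟩, rfl⟩
    obtain ⟨j, hj, rfl⟩ := h.part.part.surj y hy
    have h1 := (h.mem_class_iff h₀ hp hcp hj).1 hyp
    have h2 := h.refines.start_le _ hy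
    have h3 := h.part.part.start_le j hj
    exact ⟨_, ⟨by omega, by omega, (h.part.part.start_start hj).1⟩, rfl⟩

/-- Refinement keeps each module of `X` that avoids `v` inside a single class, and stability makes
the classes modules. These are the two premises of `rooted_image`. -/
theorem Refining.rooted_classRep [IsStrictOrder ℕ R] (h : Refining R n p v s₀ s) (hst : Stable R n s)
    (hst₀ : Stable R n s₀) (hv : classRep s v = v) :
    Rooted R v (classRep s '' {x | x < n ∧ s₀.arr 6 x = p}) := by
  refine rooted_image (U := {x | x < n}) ⟨fun x hx => hx.1, fun a ha b hb z hz hzN => ?_⟩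
    (fun x hx => ?_) (fun x hx => (h.part.classRep_eq hx.1).2.2) hv (fun x hx z hz hxz => ?_)
    fun N hN hNX hvN a ha b hb => ?_
  · exact hst₀ z hz a ha.1 b hb.1 (ha.2.trans hb.2.symm) fun h1 => hzN ⟨hz, h1 ▸ ha.2⟩
  · obtain ⟨h1, h2, -⟩ := h.part.classRep_eq hx.1
    exact ⟨h1, (h.refines.start_eq _ h1 _ hx.1 h2).trans hx.2⟩
  · obtain ⟨h1, h2, -⟩ := h.part.classRep_eq hx.1
    refine hst z hz x hx.1 _ h1 h2.symm fun h3 => hxz ⟨⟨hz, ?_⟩, ?_⟩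
    · exact (h.refines.start_eq _ hz _ hx.1 h3.symm).trans hx.2
    · unfold classRep; rw [h3]
  · unfold classRep
    rw [h.maximal N hN (fun x hx => (hNX hx).2) hvN a ha b hb]

theorem Refining.realizable_iff [IsStrictOrder ℕ R] (h : Refining R n p v s₀ s)
    (hst : Stable R n s) (e : ℕ) : Realizable R e {x | x < n ∧ s₀.arr 6 x = p} ↔
      Realizable R e (classRep s '' {x | x < n ∧ s₀.arr 6 x = p}) ∧
        ∀ x < n, s₀.arr 6 x = p → Realizable R e (classSet n s x) := by
  rw [realizable_iff_fibers ((Set.finite_lt_nat n).subset fun x hx => hx.1) (classRep s)]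
  · refine and_congr_right fun _ => ?_
    have hfib : ∀ x < n, s₀.arr 6 x = p →
        {y ∈ {x | x < n ∧ s₀.arr 6 x = p} | classRep s y = classRep s x} = classSet n s x := by
      intro x hx hxp
      ext y
      constructor
      · rintro ⟨⟨h1, h2⟩, h3⟩
        refine ⟨h1, ?_⟩
        rw [← (h.part.classRep_eq h1).2.1, h3, (h.part.classRep_eq hx).2.1]
      · rintro ⟨h1, h2⟩
        exact ⟨⟨h1, (h.refines.start_eq _ h1 _ hx h2).trans hxp⟩, by unfold classRep; rw [h2]⟩
    constructor
    · intro h1 x hx hxp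
      rw [← hfib x hx hxp]
      exact h1 _ ⟨x, ⟨hx, hxp⟩, rfl⟩
    · rintro h1 _ ⟨x, ⟨hx, hxp⟩, rfl⟩
      rw [hfib x hx hxp]
      exact h1 x hx hxp
  · rintro x ⟨hx, hxp⟩
    obtain ⟨h1, h2, -⟩ := h.part.classRep_eq hx
    exact ⟨h1, (h.refines.start_eq _ h1 _ hx h2).trans hxp⟩
  · rintro x ⟨hx, -⟩ y ⟨hy, -⟩ hxy
    obtain ⟨h1, h2, -⟩ := h.part.classRep_eq hx
    obtain ⟨h3, h4, -⟩ := h.part.classRep_eq hy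
    have hne : s.arr 6 x ≠ s.arr 6 y := fun h5 => hxy (by unfold classRep; rw [h5])
    rw [← cmp_eq_two (R := R), ← cmp_eq_two (R := R), hst x hx y hy _ h3 h4.symm hne.symm,
      cmp_comm (hst _ h3 x hx _ h1 h2.symm (by omega))]

/-- The class `X` is traded for its quotient and the classes inside it. Of these, the class of `v`
is a single point and imposes no condition, so only classes from position `p + 1` on remain. -/
theorem Refining.realizable_classes_iff [IsStrictOrder ℕ R] (h : Refining R n p v s₀ s)
    (h₀ : HasPart n s₀) (hst : Stable R n s) (hp : p < n) (hcp : s₀.arr 6 (s₀.arr 5 p) = p)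
    (hσ : s.arr 5 p = s₀.arr 5 p) (hc : s.arr 6 (s₀.arr 5 p) = p)
    (hc' : s.arr 7 (s₀.arr 5 p) = p + 1) {e : ℕ} (he : 1 ≤ e) :
    (∀ x < n, p ≤ s₀.arr 6 x → Realizable R e (classSet n s₀ x)) ↔
      Realizable R e (classRep s '' {x | x < n ∧ s₀.arr 6 x = p}) ∧
        ∀ x < n, p + 1 ≤ s.arr 6 x → Realizable R e (classSet n s x) := by
  have k1 := h.realizable_iff hst e
  have hv := h₀.part.lt p hp
  have hclass : ∀ x < n, s₀.arr 6 x = p → classSet n s₀ x = {x | x < n ∧ s₀.arr 6 x = p} := by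
    intro x hx hxp
    ext y
    simp only [classSet, Set.mem_ofPred_eq, hxp]
  have hclass' : ∀ x < n, s₀.arr 6 x ≠ p → classSet n s x = classSet n s₀ x := by
    intro x hx hxp
    ext y
    simp only [classSet, Set.mem_ofPred_eq]
    refine and_congr_right fun hy => ?_
    rw [(h.out x hx hxp).1]
    by_cases hyp : s₀.arr 6 y = p
    · constructor
      · intro h1
        have := h.refines.start_eq y hy x hx (by rw [h1, (h.out x hx hxp).1])
        exact absurd (this.symm.trans hyp) hxp
      · intro h1
        exact absurd (h1.symm.trans hyp) hxp
    · rw [(h.out y hy hyp).1]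
  constructor
  · intro k4
    have k5 := k4 (s₀.arr 5 p) hv hcp.ge
    rw [hclass _ hv hcp, k1] at k5
    refine ⟨k5.1, fun x hx hxp => ?_⟩
    by_cases hxc : s₀.arr 6 x = p
    · exact k5.2 x hx hxc
    · rw [hclass' x hx hxc]
      refine k4 x hx ?_
      rw [(h.out x hx hxc).1] at hxp
      omega
  · rintro ⟨k3, k4⟩ x hx hxp
    by_cases hxc : s₀.arr 6 x = p
    · rw [hclass x hx hxc, k1]
      refine ⟨k3, fun y hy hyp => ?_⟩
      by_cases hyv : s.arr 6 y = p
      · refine (realizable_singleton he (s₀.arr 5 p)).mono ?_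
        rintro z ⟨hz, hz'⟩
        rw [hyv] at hz'
        obtain ⟨j, hj, rfl⟩ := h.part.part.surj z hz
        have m1 := h.part.part.start_le j hj
        have m2 := h.part.part.lt_end j hj
        rw [h.part.part.end_eq_of_start_eq hz hv (hz'.trans hc.symm), hc'] at m2
        rw [hz'] at m1
        rw [show j = p by omega, hσ]
        rfl
      · refine k4 y hy ?_
        have := h.refines.start_le y hy
        omega
    · rw [← hclass' x hx hxc]
      refine k4 x hx ?_
      rw [(h.out x hx hxc).1]
      omega

end

/-- Separate one more vertex. -/
def stepCmd : Cmd := minCmd ;; separateCmd ;; listCmd ;; quotCmd ;; set 2 (var 2 + lit 1)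

-- Amortization: a step that creates `r - 1` classes lowers `n - s.reg 4` by as much. The weight `n
-- * 48 + 70` per class is the sum of `n * 32 + 4` for the sweeps of the refinement and `n * 16 +
-- 66` for the levels of the quotient. Pivoting is paid for by the range sum, and the linear rest
-- occurs once per vertex.
set_option maxHeartbeats 400000 in
theorem stepCmd_spec {R : ℕ → ℕ → Prop} [IsStrictOrder ℕ R] {W n p : ℕ} {s : Store}
    (h : Decomposing R n p s) (hp : s.reg 2 = p) (hpn : p < n) (hnW : n * n < W) (hnW3 : 3 * n < W)
    (hW4 : 4 ≤ W) : Tot W stepCmd s fun s' t => Decomposing R n (p + 1) s' ∧ s'.reg 2 = p + 1 ∧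
      t + (rangeSum n s' * 62 + (n - s'.reg 4) * (n * 48 + 70)) ≤
        rangeSum n s * 62 + (n - s.reg 4) * (n * 48 + 70) + n * 12 + 24 := by
  have hcp := h.start_eq hpn
  simp only [stepCmd, tot_seq]
  refine (minCmd_spec h.mat h.part hp hpn hcp hnW (by omega)).frame.mono ?_
  rintro s1 t1 ⟨⟨hP1, ha3, hcs1, hce1, hmin1, hT1⟩, hk1⟩
  have a0 : s1.reg 0 = s.reg 0 := hk1.reg 0 rfl
  have a2 : s1.reg 2 = p := (hk1.reg 2 rfl).trans hp
  have a4 : s1.reg 4 = s.reg 4 := hk1.reg 4 rfl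
  have a5 : s1.reg 5 = s.reg 5 := hk1.reg 5 rfl
  have a6 : s1.reg 6 = s.reg 6 := hk1.reg 6 rfl
  have a7 : s1.reg 7 = s.reg 7 := hk1.reg 7 rfl
  have b2 : s1.arr 2 = s.arr 2 := hk1.arr 2 rfl
  have b6 : s1.arr 6 = s.arr 6 := hk1.arr 6 rfl
  have b7 : s1.arr 7 = s.arr 7 := hk1.arr 7 rfl
  have b8 : s1.arr 8 = s.arr 8 := hk1.arr 8 rfl
  have b9 : s1.arr 9 = s.arr 9 := hk1.arr 9 rfl
  have b11 : s1.arr 11 = s.arr 11 := hk1.arr 11 rfl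
  have b12 : s1.arr 12 = s.arr 12 := hk1.arr 12 rfl
  have hM1 := h.mat.congr a0 b2
  have hSt1 : Stable R n s1 := by unfold Stable; rw [b6]; exact h.stable
  have hcp1 : s1.arr 6 (s1.arr 5 p) = p := by rw [b6, hcs1 p hpn, hcp]
  have he1 : s1.reg 3 = s1.arr 7 (s1.arr 5 p) := by rw [ha3, b7, hce1 p hpn]
  refine (separateCmd_spec (p := p) hM1 hP1 (by unfold Settled; rw [a5, a4, b6, b7, b8, b9]; exact h.settled)
    hSt1 a2 hpn hcp1 he1 hnW (by omega)).frame.mono ?_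
  rintro s2 t2 ⟨⟨hR2, hS2, hSt2, hσ2, hc2, hc2', hT2⟩, hk2⟩
  have d2 : s2.reg 2 = p := (hk2.reg 2 rfl).trans a2
  have d3 : s2.reg 3 = s1.arr 7 (s1.arr 5 p) := (hk2.reg 3 rfl).trans he1
  have d6 : s2.reg 6 = s.reg 6 := (hk2.reg 6 rfl).trans a6
  have d7 : s2.reg 7 = s.reg 7 := (hk2.reg 7 rfl).trans a7
  have d11 : s2.arr 11 = s.arr 11 := (hk2.arr 11 rfl).trans b11
  have d12 : s2.arr 12 = s.arr 12 := (hk2.arr 12 rfl).trans b12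
  have hcount := hR2.count_eq hP1 hpn hcp1
  have himgR := hR2.image_classRep hP1 hpn hcp1
  refine (listCmd_spec hR2.part d2 d3 (hP1.part.lt_end p hpn) (hP1.part.end_le p hpn)
    (by rw [hσ2, hc2]) (by nlinarith)).frame.mono ?_
  rintro s3 t3 ⟨⟨r, hL3, hr1, hrn, hrc, h30, himg3, hT3⟩, hk3⟩
  rw [← hrc] at hcount
  rw [himgR] at himg3
  have e2 : s3.arr 2 = s2.arr 2 := hk3.arr 2 rfl
  have e0 : s3.reg 0 = s2.reg 0 := hk3.reg 0 rfl
  have e6 : s3.reg 6 = s.reg 6 := (hk3.reg 6 rfl).trans d6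
  have e7 : s3.reg 7 = s.reg 7 := (hk3.reg 7 rfl).trans d7
  have e11 : s3.arr 11 = s.arr 11 := (hk3.arr 11 rfl).trans d11
  have e12 : s3.arr 12 = s.arr 12 := (hk3.arr 12 rfl).trans d12
  have hM3 := hR2.mat.congr e0 e2
  have hv : classRep s2 (s1.arr 5 p) = s1.arr 5 p := by unfold classRep; rw [hc2, hσ2]
  have hroot := hR2.rooted_classRep hSt2 hSt1 hv
  have hminX : ∀ x < n, s1.arr 6 x = p → ¬ R x (s1.arr 5 p) := by
    intro x hx hxp
    obtain ⟨i, hi, rfl⟩ := hP1.part.surj x hx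
    have := hP1.part.start_eq_iff hpn hi
    rw [hcp1] at this
    have := this.1 hxp
    exact hmin1 i this.1 (by rw [he1]; exact this.2)
  have hn4 : s2.reg 4 ≤ n := by rw [hR2.part.count]; exact numClasses_le _ _ _
  have hnum := h.num
  have hlen := h.length
  refine (quotCmd_spec hM3 (h.levels.congr e6 e7 e11 e12) hL3 hr1 hrn hnW hW4
    (by rw [h30, hσ2, himg3]; exact hroot) (fun j hj => ?_) (by omega) (by omega)).frame.mono ?_
  · have : s3.arr 10 j ∈ s3.arr 10 '' Set.Iio r := ⟨j, hj, rfl⟩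
    rw [himg3] at this
    obtain ⟨x, ⟨hx, hxp⟩, hx'⟩ := this
    rw [h30, hσ2, ← hx']
    obtain ⟨g1, g2, -⟩ := hR2.part.classRep_eq hx
    exact hminX _ g1 ((hR2.refines.start_eq _ g1 _ hx g2).trans hxp)
  rintro s4 t4 ⟨⟨hV4, hold4, hge4, hle4, hlp4, hR4, hT4⟩, hk4⟩
  have f0 : s4.reg 0 = s2.reg 0 := (hk4.reg 0 rfl).trans e0
  have f2 : s4.reg 2 = p := (hk4.reg 2 rfl).trans ((hk3.reg 2 rfl).trans d2)
  have f4 : s4.reg 4 = s2.reg 4 := (hk4.reg 4 rfl).trans (hk3.reg 4 rfl)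
  have f5 : s4.reg 5 = s2.reg 5 := (hk4.reg 5 rfl).trans (hk3.reg 5 rfl)
  have g2 : s4.arr 2 = s2.arr 2 := (hk4.arr 2 rfl).trans e2
  have g5 : s4.arr 5 = s2.arr 5 := (hk4.arr 5 rfl).trans (hk3.arr 5 rfl)
  have g6 : s4.arr 6 = s2.arr 6 := (hk4.arr 6 rfl).trans (hk3.arr 6 rfl)
  have g7 : s4.arr 7 = s2.arr 7 := (hk4.arr 7 rfl).trans (hk3.arr 7 rfl)
  have g8 : s4.arr 8 = s2.arr 8 := (hk4.arr 8 rfl).trans (hk3.arr 8 rfl)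
  have g9 : s4.arr 9 = s2.arr 9 := (hk4.arr 9 rfl).trans (hk3.arr 9 rfl)
  have hls3 : levelSet s3 = levelSet s := levelSet_congr e11 e12
  have hout : ∀ x < n, s1.arr 6 x ≠ p → s2.arr 6 x = s.arr 6 x ∧ s2.arr 7 x = s.arr 7 x := by
    intro x hx hxp
    have := hR2.out x hx hxp
    rwa [b6, b7] at this
  simp only [tot_set, fits_add, fits_var, fits_lit, eval_add, eval_var, eval_lit, true_and, f2]
  refine ⟨⟨by omega, by omega⟩, ⟨hR2.mat.congr (by simp [f0]) (by simp [g2]), ⟨?_, ?_⟩, ?_, ?_, hpn,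
    fun i hi => ?_, hV4.congr (by simp) (by simp) rfl rfl, ?_, ?_, fun e he => ?_⟩, by simp, ?_⟩
  · simp only [Store.arr_setReg, g5, g6, g7]; exact hR2.part.part
  · simp only [Store.arr_setReg, Store.reg_setReg, Nat.reduceEqDiff, if_false, f4, g5, g6]
    exact hR2.part.count
  · unfold Settled
    simp only [Store.arr_setReg, Store.reg_setReg, Nat.reduceEqDiff, if_false, f4, f5, g6, g7, g8, g9]
    exact hS2
  · unfold Stable
    simp only [Store.arr_setReg, g6]
    exact hSt2
  · simp only [Store.arr_setReg, g5, g6, g7]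
    by_cases hip : i = p
    · rw [hip, hσ2, hc2, hc2']
      exact ⟨rfl, rfl⟩
    · have k1 := h.single i (by omega)
      have k2 : s1.arr 6 (s1.arr 5 i) ≠ p := by rw [b6, hcs1 i (by omega)]; omega
      rw [hR2.out_order i (by omega) k2, (hout _ (hP1.part.lt i (by omega)) k2).1,
        (hout _ (hP1.part.lt i (by omega)) k2).2, hcs1 i (by omega), hce1 i (by omega)]
      exact k1
  · simp only [Store.reg_setReg, Nat.reduceEqDiff, if_false, f4]
    omega
  · simp only [Store.reg_setReg, Nat.reduceEqDiff, if_false, f4]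
    omega
  · have hls : ∀ x y, levelSet (s4.setReg x y) = levelSet s4 := fun _ _ => rfl
    have hcs : ∀ x, classSet n (s4.setReg 2 (p + 1)) x = classSet n s2 x := fun x => by
      simp only [classSet, Store.arr_setReg, g6]
    simp only [Store.reg_setReg, Store.arr_setReg, Nat.reduceEqDiff, if_false, hls, hcs, g6]
    have k1 := hR2.realizable_classes_iff hP1 hSt2 hpn hcp1 hσ2 hc2 hc2' he
    have k2 := hR4 e he
    rw [himg3, e6] at k2
    rw [e6] at hold4 hge4
    have k3 : ∀ x, classSet n s1 x = classSet n s x := fun x => by simp only [classSet, b6]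
    simp only [k3, b6] at k1
    rw [b6] at k2
    rw [h.realizable e he, k1, k2]
    constructor
    · rintro ⟨k4, k5, k6⟩
      refine ⟨fun l hl => ?_, k6⟩
      by_cases hl' : l < s.reg 6
      · rw [hold4 l hl', hls3]; exact k4 l hl'
      · exact k5 l (by omega) hl
    · rintro ⟨k4, k5⟩
      refine ⟨fun l hl => ?_, fun l hl1 hl2 => k4 l hl2, k5⟩
      have := k4 l (by omega)
      rwa [hold4 l hl, hls3] at this
  · have m1 : rangeSum n (s4.setReg 2 (p + 1)) = rangeSum n s2 := by
      unfold rangeSum; simp only [Store.arr_setReg, g8, g9]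
    have m2 : rangeSum n s1 = rangeSum n s := by unfold rangeSum; rw [b8, b9]
    rw [m2, a4] at hT2
    simp only [m1, Store.reg_setReg, Nat.reduceEqDiff, if_false, f4]
    have m3 : n - s.reg 4 = (n - s2.reg 4) + (r - 1) := by omega
    rw [m3] at hT2 ⊢
    have m4 : ∀ a, a * (n * 48 + 70) = a * (n * 32 + 4) + a * (n * 16 + 66) := fun a => by ring
    rw [m4 (n - s2.reg 4 + (r - 1)), m4 (n - s2.reg 4)]
    have m5 : (n - s2.reg 4 + (r - 1)) * (n * 16 + 66) =
      (n - s2.reg 4) * (n * 16 + 66) + (r - 1) * (n * 16 + 66) := by ring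
    omega

/-- The partition with one class. -/
def initCmd : Cmd :=
  set 20 (lit 0) ;;
  upto 20 0 (put 5 (var 20) (var 20) ;; put 6 (var 20) (lit 0) ;; put 7 (var 20) (var 0) ;;
    put 8 (var 20) (lit 0) ;; put 9 (var 20) (var 0)) ;;
  set 4 (lit 1) ;; set 5 (lit 1) ;; set 6 (lit 0) ;; set 7 (lit 0) ;; put 12 (lit 0) (lit 0) ;;
  set 2 (lit 0)

theorem initCmd_spec {R : ℕ → ℕ → Prop} {W n : ℕ} {s : Store} (hM : HasMatrix R n s) (hn : 1 ≤ n)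
    (hnW : n < W) : Tot W initCmd s fun s' t => Decomposing R n 0 s' ∧ s'.reg 2 = 0 ∧
      rangeSum n s' ≤ n * n ∧ t ≤ n * 7 + 8 := by
  simp only [initCmd, tot_seq, tot_set, fits_lit, eval_lit]
  refine ⟨by omega, (Tot.upto_const (N := n) (i₀ := 0) (fun i s' => ∀ j < i, s'.arr 5 j = j ∧
    s'.arr 6 j = 0 ∧ s'.arr 7 j = n ∧ s'.arr 8 j = 0 ∧ s'.arr 9 j = n) 5 rfl rfl (by simp)
    (by simp [hM.n_eq]) (by omega) hnW ?_ (by simp)).mono ?_⟩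
  · rintro i s1 - hi hI hk h20 h0
    simp only [tot_seq, tot_put, fits_lit, fits_var, eval_lit, eval_var, true_and, h20, h0,
      Store.reg_setArr]
    refine ⟨by omega, by omega, fun j hj => ?_, by omega⟩
    simp only [Store.arr_setReg, Store.arr_setArr, Nat.reduceEqDiff, if_false, if_true]
    by_cases hji : j = i
    · simp only [hji, Function.update_self, and_self]
    · simp only [Function.update_of_ne hji]
      exact hI j (by omega)
  · rintro s1 t1 ⟨hI, hk, -, hT⟩
    have e0 : s1.reg 0 = n := (hk.reg 0 rfl).trans (by simp [hM.n_eq])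
    have e2 : s1.arr 2 = s.arr 2 := (hk.arr 2 rfl).trans (by simp)
    simp only [tot_set, tot_put, fits_lit, eval_lit]
    have h5 : ∀ j < n, s1.arr 5 j = j := fun j hj => (hI j hj).1
    have h6 : ∀ j < n, s1.arr 6 j = 0 := fun j hj => (hI j hj).2.1
    have h7 : ∀ j < n, s1.arr 7 j = n := fun j hj => (hI j hj).2.2.1
    have h8 : ∀ j < n, s1.arr 8 j = 0 := fun j hj => (hI j hj).2.2.2.1
    have h9 : ∀ j < n, s1.arr 9 j = n := fun j hj => (hI j hj).2.2.2.2
    refine ⟨by omega, by omega, by omega, by omega, by omega, by omega, by omega,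
      ⟨hM.congr (by simp [e0, hM.n_eq]) (by simp [e2]), ⟨?_, ?_⟩, ?_, ?_, by omega, by omega, ?_,
      by simp, by simp, ?_⟩, by simp, ?_, by omega⟩
    · simp only [Store.arr_setReg, Store.arr_setArr, Nat.reduceEqDiff, if_false]
      constructor
      · intro i hi; rw [h5 i hi]; exact hi
      · intro i hi j hj hij; rwa [h5 i hi, h5 j hj] at hij
      · intro x hx; exact ⟨x, hx, h5 x hx⟩
      · intro i hi; rw [h5 i hi, h6 i hi]; omega
      · intro i hi; rw [h5 i hi, h7 i hi]; omega
      · intro i hi; rw [h5 i hi, h7 i hi]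
      · intro i hi j
        rw [h5 i hi, h6 i hi, h7 i hi]
        intro _ hj
        rw [h5 j hj, h6 j hj]
      · intro i hi j
        rw [h5 i hi, h6 i hi, h7 i hi]
        intro _ hj
        rw [h5 j hj, h7 j hj]
    · simp only [Store.reg_setReg, Store.reg_setArr, Store.arr_setReg, Store.arr_setArr,
        Nat.reduceEqDiff, if_false, if_true]
      unfold numClasses
      rw [Finset.filter_congr (q := fun i => i = 0) fun i hi => by
        rw [h5 i (Finset.mem_range.1 hi), h6 i (Finset.mem_range.1 hi), eq_comm],
        Finset.filter_eq' (Finset.range n) 0, if_pos (by simp; omega), Finset.card_singleton]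
    · unfold Settled
      simp only [Store.reg_setReg, Store.reg_setArr, Store.arr_setReg, Store.arr_setArr,
        Nat.reduceEqDiff, if_false, if_true, true_and]
      intro w hw
      rw [h6 w hw, h7 w hw, h8 w hw, h9 w hw]
      exact ⟨rfl, rfl⟩
    · intro w hw x hx y hy
      simp only [Store.arr_setReg, Store.arr_setArr, Nat.reduceEqDiff, if_false]
      rw [h6 w hw, h6 x hx]
      exact fun _ h => absurd rfl h
    · constructor <;> simp
    · intro e he
      simp only [Store.reg_setReg, Store.reg_setArr, Store.arr_setReg, Store.arr_setArr,
        Nat.reduceEqDiff, if_false, if_true, not_lt_zero, false_imp_iff, implies_true, true_and,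
        zero_le]
      have : ∀ x < n, classSet n ((((((((s1.setReg 4 1).setReg 5 1).setReg 6 0).setReg 7 0).setArr
          12 0 0).setReg 2 0))) x = {x | x < n} := by
        intro x hx
        ext y
        simp only [classSet, Store.arr_setReg, Store.arr_setArr, Nat.reduceEqDiff, if_false,
          Set.mem_ofPred_eq, h6 x hx]
        exact and_iff_left_of_imp fun hy => h6 y hy
      constructor
      · intro h x hx
        rw [this x hx]
        exact fun _ => h
      · intro h
        have := this 0 (by omega) ▸ h 0 (by omega)
        exact this trivial
    · unfold rangeSum
      simp only [Store.arr_setReg, Store.arr_setArr, Nat.reduceEqDiff, if_false]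
      rw [Finset.sum_congr rfl (g := fun _ => n) fun w hw => by
        rw [h8 w (Finset.mem_range.1 hw), h9 w (Finset.mem_range.1 hw), Nat.sub_zero]]
      simp

/-- Decompose the order into levels. -/
def decomposeCmd : Cmd := initCmd ;; whl (var 2) (var 0) stepCmd

/-- When all positions have been separated, no class is left to be tested, so realizability is a
condition on the levels alone. Each of the three summands of the initial potential is `O(n ^ 2)`. -/
theorem decomposeCmd_spec {R : ℕ → ℕ → Prop} [IsStrictOrder ℕ R] {W n : ℕ} {s : Store}
    (hM : HasMatrix R n s) (hn : 1 ≤ n) (hnW : n * n < W) (hnW3 : 3 * n < W) (hW4 : 4 ≤ W) :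
    Tot W decomposeCmd s fun s' t => HasLevels R n s' ∧ s'.reg 0 = n ∧ s'.reg 6 ≤ 2 * n ∧
      s'.reg 7 ≤ 3 * n ∧
      (∀ e, 1 ≤ e → (Realizable R e {x | x < n} ↔
        ∀ l < s'.reg 6, Realizable R e (levelSet s' l))) ∧ t ≤ 250 * (n * n) := by
  simp only [decomposeCmd, tot_seq]
  refine (initCmd_spec hM hn (by omega)).frame.mono ?_
  rintro s1 t1 ⟨⟨hD, h2, hr, hT1⟩, hk1⟩
  have e0 : s1.reg 0 = n := (hk1.reg 0 rfl).trans hM.n_eq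
  refine (Tot.whl (fun s' => s'.reg 0 = n ∧ Decomposing R n (s'.reg 2) s')
    (fun s' => rangeSum n s' * 62 + (n - s'.reg 4) * (n * 48 + 70) +
      (n - s'.reg 2) * (n * 12 + 25)) (fun _ _ _ => by simp) ?_ ⟨e0, h2 ▸ hD⟩).mono ?_
  · rintro s2 ⟨f0, hD2⟩ hk hlt
    simp only [eval_var, f0] at hlt
    refine (stepCmd_spec hD2 rfl hlt hnW hnW3 hW4).frame.mono ?_
    rintro s3 t3 ⟨⟨hD3, hp3, hT3⟩, hk3⟩
    refine ⟨⟨(hk3.reg 0 rfl).trans f0, hp3 ▸ hD3⟩, ?_⟩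
    have : n - s2.reg 2 = (n - s3.reg 2) + 1 := by omega
    rw [this, add_mul]
    omega
  · rintro s2 t2 ⟨⟨f0, hD2⟩, -, hlt, hT2⟩
    simp only [eval_var, f0] at hlt
    have h4 : s2.reg 4 ≤ n := by rw [hD2.part.count]; exact numClasses_le _ _ _
    have h5 := hD2.num
    have h6 := hD2.length
    refine ⟨hD2.levels, f0, by omega, by omega, fun e he => ?_, ?_⟩
    · rw [hD2.realizable e he]
      refine and_iff_left fun x hx hxp => ?_
      obtain ⟨i, hi, rfl⟩ := hD2.part.part.surj x hx
      have := hD2.part.part.start_le i hi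
      omega
    · have m1 : (n - s1.reg 4) * (n * 48 + 70) ≤ n * (n * 48 + 70) :=
        Nat.mul_le_mul_right _ (by omega)
      have m2 : (n - s1.reg 2) * (n * 12 + 25) ≤ n * (n * 12 + 25) :=
        Nat.mul_le_mul_right _ (by omega)
      have m3 : n ≤ n * n := Nat.le_mul_self n
      have m4 : n * (n * 48 + 70) = n * n * 48 + n * 70 := by ring
      have m5 : n * (n * 12 + 25) = n * n * 12 + n * 25 := by ring
      omega

/-! ### Enumeration of tuples of permutations by insertion codes -/

/-- The position of `i` after the elements `0, …, j - 1` have been inserted one after the other at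
the positions `c 0, …, c (j - 1)`. -/
def insertPos (c : ℕ → ℕ) : ℕ → ℕ → ℕ
  | 0, _ => 0
  | j + 1, i =>
    if i = j then c j else if c j < insertPos c j i + 1 then insertPos c j i + 1 else insertPos c j i

theorem insertPos_congr {c c' : ℕ → ℕ} {r : ℕ} (h : ∀ j < r, c j = c' j) (i : ℕ) :
    insertPos c r i = insertPos c' r i := by
  induction r with
  | zero => rfl
  | succ r ih =>
    simp only [insertPos, ih fun j hj => h j (by omega), h r (by omega)]

theorem insertPos_lt {c : ℕ → ℕ} {r : ℕ} (h : ∀ j < r, c j ≤ j) {i : ℕ} (hi : i < r) :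
    insertPos c r i < r := by
  induction r with
  | zero => omega
  | succ r ih =>
    have h1 := h r (by omega)
    simp only [insertPos]
    split_ifs with h2
    · omega
    · have := ih (fun j hj => h j (by omega)) (by omega)
      omega
    · have := ih (fun j hj => h j (by omega)) (by omega)
      omega

theorem insertPos_injOn (c : ℕ → ℕ) (r : ℕ) : Set.InjOn (insertPos c r) (Set.Iio r) := by
  induction r with
  | zero => simp
  | succ r ih =>
    intro i hi j hj hij
    simp only [Set.mem_Iio] at hi hj
    simp only [insertPos] at hij
    split_ifs at hij with h1 h2 h3 h4 h5 h6 h7 <;> try omega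
    all_goals exact ih (show i < r by omega) (show j < r by omega) (by omega)

/-- The insertion code of an injective function. -/
def rankCode (f : ℕ → ℕ) (j : ℕ) : ℕ := ((Finset.range j).filter fun i => f i < f j).card

theorem rankCode_le (f : ℕ → ℕ) (j : ℕ) : rankCode f j ≤ j :=
  (Finset.card_filter_le _ _).trans (by simp)

/-- The code of `j` is its rank among its predecessors, so insertion reproduces the ranks with
respect to `f`: inserting `r` moves `i` up exactly when `f r < f i`. -/
theorem insertPos_rankCode {f : ℕ → ℕ} {r : ℕ} (hf : Set.InjOn f (Set.Iio r)) {i : ℕ} (hi : i < r) :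
    insertPos (rankCode f) r i = ((Finset.range r).filter fun i' => f i' < f i).card := by
  induction r with
  | zero => omega
  | succ r ih =>
    simp only [insertPos]
    split_ifs with h1 h2
    · rw [h1, Finset.range_add_one, Finset.filter_insert, if_neg (lt_irrefl _), rankCode]
    all_goals
      have hi' : i < r := by omega
      rw [ih (hf.mono fun x (hx : x < r) => show x < r + 1 by omega) hi'] at h2 ⊢
      rw [Finset.range_add_one, Finset.filter_insert]
      have hne : f i ≠ f r := fun h => by
        have := hf (show i < r + 1 by omega) (show r < r + 1 by omega) h
        omega
    -- If `i` were below `r`, then the predecessors below `r` would include all those below `i` and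
    -- also `i` itself, so the code of `r` would exceed the rank of `i`.
    · have h3 : f r < f i := by
        by_contra h3
        have h4 : (Finset.range r).filter (fun i' => f i' < f i) ⊂
            (Finset.range r).filter fun i' => f i' < f r := by
          refine Finset.ssubset_iff_subset_ne.2 ⟨fun x => ?_, fun h => ?_⟩
          · simp only [Finset.mem_filter]
            exact fun hx => ⟨hx.1, by omega⟩
          · have : i ∈ (Finset.range r).filter fun i' => f i' < f r := by
              simp only [Finset.mem_filter, Finset.mem_range]; omega
            rw [← h] at this
            simp at this
        have h5 := Finset.card_lt_card h4
        unfold rankCode at h2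
        omega
      rw [if_pos h3, Finset.card_insert_of_notMem (by simp)]
    · rw [if_neg]
      intro h3
      refine h2 (Nat.lt_succ_of_le (Finset.card_le_card fun x => ?_))
      simp only [Finset.mem_filter]
      exact fun hx => ⟨hx.1, by omega⟩

theorem insertPos_rankCode_lt_iff {f : ℕ → ℕ} {r : ℕ} (hf : Set.InjOn f (Set.Iio r)) {i j : ℕ}
    (hi : i < r) (hj : j < r) :
    insertPos (rankCode f) r i < insertPos (rankCode f) r j ↔ f i < f j := by
  have key : ∀ a b, a < r → f a < f b → ((Finset.range r).filter fun i' => f i' < f a).card <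
      ((Finset.range r).filter fun i' => f i' < f b).card := by
    intro a b ha h
    refine Finset.card_lt_card (Finset.ssubset_iff_subset_ne.2 ⟨fun x => ?_, fun h' => ?_⟩)
    · simp only [Finset.mem_filter]
      exact fun hx => ⟨hx.1, by omega⟩
    · have : a ∈ (Finset.range r).filter fun i' => f i' < f b := by
        simp only [Finset.mem_filter, Finset.mem_range]; omega
      rw [← h'] at this
      simp at this
  rw [insertPos_rankCode hf hi, insertPos_rankCode hf hj]
  refine ⟨fun h => ?_, key i j hi⟩
  by_contra hc
  rcases (not_lt.1 hc).lt_or_eq with h1 | h1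
  · have := key j i hj h1
    omega
  · rw [h1] at h
    exact lt_irrefl _ h

/-- The part of a code that belongs to the dimension `D`. -/
def codeBlock (r : ℕ) (c : ℕ → ℕ) (D j : ℕ) : ℕ := c (D * r + j)

/-- The code describes `e` linear orders whose intersection is the restriction of `R`. -/
def GoodCode (R : ℕ → ℕ → Prop) (e r : ℕ) (L c : ℕ → ℕ) : Prop :=
  ∀ x < r, ∀ y < r, (R (L x) (L y) ↔
    ∀ D < e, insertPos (codeBlock r c D) r x < insertPos (codeBlock r c D) r y)

theorem block_lt {D e j r : ℕ} (hD : D < e) (hj : j < r) : D * r + j < e * r := by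
  have : (D + 1) * r ≤ e * r := Nat.mul_le_mul_right _ hD
  rw [add_mul] at this
  omega

/-- Only the order in which a coordinate function lists the elements matters, so it may be replaced
by the insertion positions of its rank code. The `e` codes are concatenated; digit `i` belongs to
the element `i % r` and has `i % r + 1` possible values. -/
theorem realizable_iff_goodCode {R : ℕ → ℕ → Prop} {e r : ℕ} {L : ℕ → ℕ}
    (hL : Set.InjOn L (Set.Iio r)) : Realizable R e (L '' Set.Iio r) ↔
      ∃ c, (∀ i < e * r, c i < i % r + 1) ∧ GoodCode R e r L c := by
  constructor
  · rintro ⟨f, hf1, hf2⟩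
    -- The empty level is treated separately since the digits are addressed by division by `r`.
    by_cases hr : r = 0
    · exact ⟨fun _ => 0, fun i _ => Nat.succ_pos _, fun x hx => by omega⟩
    classical
    refine ⟨fun i => if h : i / r < e then rankCode (fun j => f ⟨i / r, h⟩ (L j)) (i % r) else 0,
      fun i hi => ?_, fun x hx y hy => ?_⟩
    · dsimp only
      split_ifs
      · exact Nat.lt_succ_of_le (rankCode_le _ _)
      · omega
    · rw [hf2 _ ⟨x, hx, rfl⟩ _ ⟨y, hy, rfl⟩]
      have key : ∀ (D : ℕ) (hD : D < e), (insertPos (codeBlock r (fun i => if h : i / r < e then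
          rankCode (fun j => f ⟨i / r, h⟩ (L j)) (i % r) else 0) D) r x <
          insertPos (codeBlock r (fun i => if h : i / r < e then
          rankCode (fun j => f ⟨i / r, h⟩ (L j)) (i % r) else 0) D) r y ↔
          f ⟨D, hD⟩ (L x) < f ⟨D, hD⟩ (L y)) := by
        intro D hD
        have h1 : ∀ j < r, codeBlock r (fun i => if h : i / r < e then
            rankCode (fun j => f ⟨i / r, h⟩ (L j)) (i % r) else 0) D j =
            rankCode (fun j => f ⟨D, hD⟩ (L j)) j := by
          intro j hj
          have h2 : (D * r + j) / r = D := by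
            rw [mul_comm, Nat.mul_add_div (by omega), Nat.div_eq_of_lt hj, add_zero]
          have h3 : (D * r + j) % r = j := by
            rw [mul_comm, Nat.mul_add_mod, Nat.mod_eq_of_lt hj]
          simp only [codeBlock, h2, h3, hD, dif_pos]
        rw [insertPos_congr h1, insertPos_congr h1, insertPos_rankCode_lt_iff _ hx hy]
        intro a ha b hb hab
        exact hL ha hb (hf1 _ ⟨a, ha, rfl⟩ ⟨b, hb, rfl⟩ hab)
      exact ⟨fun h D hD => (key D hD).2 (h _), fun h D => (key D D.2).1 (h D D.2)⟩
  · rintro ⟨c, -, hc⟩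
    have hinv : ∀ x ∈ Set.Iio r, Function.invFunOn L (Set.Iio r) (L x) = x := fun x hx =>
      hL.leftInvOn_invFunOn hx
    refine ⟨fun D x => insertPos (codeBlock r c D) r (Function.invFunOn L (Set.Iio r) x),
      fun D => ?_, ?_⟩
    · rintro _ ⟨x, hx, rfl⟩ _ ⟨y, hy, rfl⟩ hxy
      simp only [hinv x hx, hinv y hy] at hxy
      rw [insertPos_injOn _ r hx hy hxy]
    · rintro _ ⟨x, hx, rfl⟩ _ ⟨y, hy, rfl⟩
      simp only [hinv x hx, hinv y hy]
      rw [hc x hx y hy]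
      exact ⟨fun h D => h D D.2, fun h D hD => h ⟨D, hD⟩⟩

/-- The value of the digits `c` with respect to the bases `b`. -/
def radixValue (b : ℕ → ℕ) (c : ℕ → ℕ) (N : ℕ) : ℕ :=
  ∑ i ∈ Finset.range N, c i * ∏ j ∈ Finset.range i, b j

theorem radixValue_lt {b c : ℕ → ℕ} {N : ℕ} (h : ∀ i < N, c i < b i) :
    radixValue b c N < ∏ j ∈ Finset.range N, b j := by
  induction N with
  | zero => simp [radixValue]
  | succ N ih =>
    have h1 := ih fun i hi => h i (by omega)
    have h2 := Nat.mul_le_mul_right (∏ j ∈ Finset.range N, b j) (h N (by omega))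
    unfold radixValue at h1 ⊢
    rw [Finset.sum_range_succ, Finset.prod_range_succ, mul_comm _ (b N)]
    rw [Nat.succ_mul] at h2
    omega

theorem radixValue_inj {b c c' : ℕ → ℕ} {N : ℕ} (h : ∀ i < N, c i < b i) (h' : ∀ i < N, c' i < b i)
    (heq : radixValue b c N = radixValue b c' N) : ∀ i < N, c i = c' i := by
  induction N with
  | zero => omega
  | succ N ih =>
    have h1 := radixValue_lt (N := N) fun i hi => h i (show i < N + 1 by omega)
    have h2 := radixValue_lt (N := N) fun i hi => h' i (show i < N + 1 by omega)
    have h3 : ∀ c, radixValue b c (N + 1) =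
        radixValue b c N + c N * ∏ j ∈ Finset.range N, b j := fun c => by
      unfold radixValue; rw [Finset.sum_range_succ]
    have h4 : 0 < ∏ j ∈ Finset.range N, b j := by omega
    rw [h3, h3] at heq
    have h5 : c N = c' N := by
      have := congrArg (· / ∏ j ∈ Finset.range N, b j) heq
      simpa only [Nat.add_mul_div_right _ _ h4, Nat.div_eq_of_lt h1, Nat.div_eq_of_lt h2, zero_add]
        using this
    rw [h5] at heq
    intro i hi
    rcases Nat.lt_succ_iff_lt_or_eq.1 hi with hi | rfl
    · exact ih (fun i hi => h i (by omega)) (fun i hi => h' i (by omega)) (by omega) i hi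
    · exact h5

theorem radixValue_update {b c : ℕ → ℕ} {N i v : ℕ} (hi : i < N) :
    radixValue b (Function.update c i v) N + c i * ∏ j ∈ Finset.range i, b j =
      radixValue b c N + v * ∏ j ∈ Finset.range i, b j := by
  unfold radixValue
  rw [← Finset.add_sum_erase _ _ (Finset.mem_range.2 hi),
    ← Finset.add_sum_erase (Finset.range N) (fun i => c i * _) (Finset.mem_range.2 hi),
    Function.update_self]
  rw [Finset.sum_congr rfl fun x hx => by
    rw [Function.update_of_ne (Finset.ne_of_mem_erase hx)]]
  omega

/-- Each of the `e` blocks contributes the bases `1, …, r`; the product is the number of codes. -/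
theorem prod_mod_succ (e r : ℕ) :
    ∏ i ∈ Finset.range (e * r), (i % r + 1) = (Nat.factorial r) ^ e := by
  induction e with
  | zero => simp
  | succ e ih =>
    rw [add_mul, one_mul, Finset.prod_range_add, ih, pow_succ]
    congr 1
    rw [← Finset.prod_range_add_one_eq_factorial]
    refine Finset.prod_congr rfl fun i hi => ?_
    rw [mul_comm, Nat.mul_add_mod, Nat.mod_eq_of_lt (Finset.mem_range.1 hi)]

/-! ### Exhaustive search for realizers of the levels -/

/-- Decode into array `15` the block of the code in array `13` that starts at `reg 47`. -/
def decodeBlockCmd : Cmd :=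
  set 41 (lit 0) ;;
  upto 41 45 (
    set 48 (get 13 (var 47 + var 41)) ;; set 42 (lit 0) ;;
    upto 42 41 (
      ite (var 48) (get 15 (var 47 + var 42) + lit 1)
        (put 15 (var 47 + var 42) (get 15 (var 47 + var 42) + lit 1)) skip) ;;
    put 15 (var 47 + var 41) (var 48))

theorem decodeBlockCmd_spec {W B r : ℕ} {s : Store} (h47 : s.reg 47 = B) (h45 : s.reg 45 = r)
    (hc : ∀ j < r, s.arr 13 (B + j) ≤ j) (hW : B + r + 1 < W) :
    Tot W decodeBlockCmd s fun s' t =>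
      (∀ i < r, s'.arr 15 (B + i) = insertPos (fun j => s.arr 13 (B + j)) r i) ∧
      (∀ i < B, s'.arr 15 i = s.arr 15 i) ∧ t ≤ r * (r * 4 + 6) + 2 := by
  simp only [decodeBlockCmd, tot_seq, tot_set, fits_lit, eval_lit]
  refine ⟨by omega, (Tot.upto_const (N := r) (i₀ := 0) (fun j s' =>
    (∀ i < j, s'.arr 15 (B + i) = insertPos (fun j => s.arr 13 (B + j)) j i) ∧
    ∀ i < B, s'.arr 15 i = s.arr 15 i) (r * 4 + 4) rfl rfl (by simp) (by simp [h45]) (by omega)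
    (by omega) ?_ (by simp)).mono ?_⟩
  · rintro j s1 - hj ⟨hA, hB⟩ hk h41 -
    have e47 : s1.reg 47 = B := (hk.reg 47 rfl).trans (by simp [h47])
    have e13 : s1.arr 13 = s.arr 13 := (hk.arr 13 rfl).trans (by simp)
    have hcj := hc j hj
    simp only [tot_seq, tot_set, fits_lit, fits_var, fits_get, fits_add, eval_var,
      eval_lit, eval_get, eval_add, true_and, and_true, Store.reg_setReg,
      Store.arr_setReg, Nat.reduceEqDiff, if_false, e47, e13, h41]
    refine ⟨by omega, by omega, (Tot.upto_const (N := j) (i₀ := 0) (fun i' s' =>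
      (∀ i < i', s'.arr 15 (B + i) = insertPos (fun j => s.arr 13 (B + j)) (j + 1) i) ∧
      (∀ i, i' ≤ i → i < j → s'.arr 15 (B + i) = insertPos (fun j => s.arr 13 (B + j)) j i) ∧
      ∀ i < B, s'.arr 15 i = s.arr 15 i) 2 rfl rfl (by simp) (by simp [h41]) (by omega)
      (by omega) ?_ ?_).frame.mono ?_⟩
    · rintro i s2 - hi ⟨hA2, hA3, hB2⟩ hk2 h42 -
      have f47 : s2.reg 47 = B := (hk2.reg 47 rfl).trans (by simp [e47])
      have f48 : s2.reg 48 = s.arr 13 (B + j) := (hk2.reg 48 rfl).trans (by simp)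
      have hlt := insertPos_lt (c := fun j => s.arr 13 (B + j)) (r := j)
        (fun j' hj' => hc j' (by omega)) hi
      have hval := hA3 i le_rfl hi
      have hnew : insertPos (fun j => s.arr 13 (B + j)) (j + 1) i =
          if s.arr 13 (B + j) < insertPos (fun j => s.arr 13 (B + j)) j i + 1 then
            insertPos (fun j => s.arr 13 (B + j)) j i + 1
          else insertPos (fun j => s.arr 13 (B + j)) j i := by
        simp only [insertPos, if_neg (show ¬ i = j by omega)]
      simp only [tot_ite, tot_put, tot_skip, fits_lit, fits_var, fits_get, fits_add,
        eval_var, eval_lit, eval_get, eval_add, true_and, and_true, f47, f48, h42, hval]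
      refine ⟨⟨by omega, by omega, by omega⟩, fun h1 => ⟨by omega, ⟨by omega, by omega, by omega⟩,
        ⟨fun i' hi' => ?_, fun i' h2 h3 => ?_, fun i' hi' => ?_⟩, by omega⟩,
        fun h1 => ⟨⟨fun i' hi' => ?_, fun i' h2 h3 => ?_, fun i' hi' => ?_⟩, by omega⟩⟩ <;>
        simp only [Store.arr_setReg, Store.arr_setArr, if_true]
      · by_cases h4 : i' = i
        · rw [h4, Function.update_self, hnew, if_pos h1]
        · rw [Function.update_of_ne (by omega), hA2 i' (by omega)]
      · rw [Function.update_of_ne (by omega), hA3 i' (by omega) h3]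
      · rw [Function.update_of_ne (by omega), hB2 i' hi']
      · by_cases h4 : i' = i
        · rw [h4, hval, hnew, if_neg h1]
        · exact hA2 i' (by omega)
      · exact hA3 i' (by omega) h3
      · exact hB2 i' hi'
    · simp only [Store.arr_setReg]
      exact ⟨fun i hi => by omega, fun i _ hi => hA i hi, hB⟩
    · rintro s2 t2 ⟨⟨⟨hA2, -, hB2⟩, -, -, hT2⟩, hk2⟩
      have f47 : s2.reg 47 = B := (hk2.reg 47 rfl).trans (by simp [e47])
      have f41 : s2.reg 41 = j := (hk2.reg 41 rfl).trans (by simp [h41])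
      have f48 : s2.reg 48 = s.arr 13 (B + j) := (hk2.reg 48 rfl).trans (by simp)
      simp only [tot_put, fits_var, fits_add, eval_var, eval_add, true_and, f47, f41, f48]
      refine ⟨by omega, ⟨fun i hi => ?_, fun i hi => ?_⟩, by omega⟩ <;>
        simp only [Store.arr_setReg, Store.arr_setArr, if_true]
      · by_cases h4 : i = j
        · rw [h4, Function.update_self]; simp only [insertPos, if_true]
        · rw [Function.update_of_ne (by omega), hA2 i (by omega)]
      · rw [Function.update_of_ne (by omega), hB2 i hi]
  · rintro s1 t1 ⟨⟨hA, hB⟩, -, -, hT⟩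
    refine ⟨hA, hB, ?_⟩
    have : r * 4 + 4 + 2 = r * 4 + 6 := rfl
    rw [this, Nat.sub_zero] at hT
    omega

/-- Decode the code in array `13` into the positions in array `15`. -/
def decodeCmd : Cmd :=
  set 40 (lit 0) ;; upto 40 46 (set 47 (var 40 * var 45) ;; decodeBlockCmd)

theorem decodeCmd_spec {W e r : ℕ} {s : Store} (h46 : s.reg 46 = e) (h45 : s.reg 45 = r)
    (hc : ∀ i < e * r, s.arr 13 i < i % r + 1) (hW : e * r + r + 1 < W) (heW : e < W) :
    Tot W decodeCmd s fun s' t =>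
      (∀ D < e, ∀ i < r, s'.arr 15 (D * r + i) = insertPos (codeBlock r (s.arr 13) D) r i) ∧
      t ≤ e * (r * (r * 4 + 6) + 5) + 2 := by
  simp only [decodeCmd, tot_seq, tot_set, fits_lit, eval_lit]
  refine ⟨by omega, (Tot.upto_const (N := e) (i₀ := 0) (fun D' s' =>
    ∀ D < D', ∀ i < r, s'.arr 15 (D * r + i) = insertPos (codeBlock r (s.arr 13) D) r i)
    (r * (r * 4 + 6) + 3) rfl rfl (by simp) (by simp [h46]) (by omega)
    heW ?_ (by simp)).mono ?_⟩
  · rintro D s1 - hD hI hk h40 -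
    have e45 : s1.reg 45 = r := (hk.reg 45 rfl).trans (by simp [h45])
    have e13 : s1.arr 13 = s.arr 13 := (hk.arr 13 rfl).trans (by simp)
    have hle : D * r ≤ e * r := Nat.mul_le_mul_right _ hD.le
    simp only [tot_seq, tot_set, fits_var, fits_mul, eval_var, eval_mul, true_and, h40, e45]
    refine ⟨by omega, (decodeBlockCmd_spec (s := s1.setReg 47 (D * r)) (B := D * r) (r := r)
      (by simp) (by simp [e45]) (fun j hj => ?_) (by omega)).mono ?_⟩
    · have h1 := hc _ (block_lt hD hj)
      rw [mul_comm D r, Nat.mul_add_mod, Nat.mod_eq_of_lt hj, mul_comm r D] at h1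
      simp only [Store.arr_setReg, e13]
      omega
    · rintro s2 t2 ⟨hA, hB, hT⟩
      simp only [Store.arr_setReg, e13] at hA hB
      refine ⟨fun D' hD' i hi => ?_, by omega⟩
      simp only [Store.arr_setReg]
      by_cases h : D' = D
      · rw [h]; exact hA i hi
      · rw [hB _ (block_lt (show D' < D by omega) hi), hI D' (by omega) i hi]
  · rintro s1 t1 ⟨hI, -, -, hT⟩
    refine ⟨hI, ?_⟩
    have : r * (r * 4 + 6) + 3 + 2 = r * (r * 4 + 6) + 5 := rfl
    rw [this, Nat.sub_zero] at hT
    omega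

/-- Set register `49` to zero if the positions in array `15` realize the level that starts at
`reg 44` in array `11`. -/
def verifyCmd : Cmd :=
  set 49 (lit 0) ;; set 41 (lit 0) ;;
  upto 41 45 (
    set 42 (lit 0) ;;
    upto 42 45 (
      set 50 (lit 1) ;; set 40 (lit 0) ;;
      upto 40 46 (
        ite (get 15 (var 40 * var 45 + var 41)) (get 15 (var 40 * var 45 + var 42)) skip
          (set 50 (lit 0))) ;;
      -- Truncated subtraction turns the comparison value `2` into `1` and the values `0` and `1`
      -- into `0`, so register `51` is the truth value of the relation and can be compared with
      -- register `50`.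
      set 51 (get 2 (get 11 (var 44 + var 41) * var 0 + get 11 (var 44 + var 42)) - lit 1) ;;
      ite (var 51) (var 50) (set 49 (lit 1)) skip ;;
      ite (var 50) (var 51) (set 49 (lit 1)) skip))

theorem verifyCmd_spec {R : ℕ → ℕ → Prop} {W n e r a : ℕ} {s : Store} (hM : HasMatrix R n s)
    (h46 : s.reg 46 = e) (h45 : s.reg 45 = r) (h44 : s.reg 44 = a)
    (hL : ∀ j < r, s.arr 11 (a + j) < n) (hnW : n * n < W) (hW : e * r < W) (heW : e < W)
    (hrW : a + r < W) (hW2 : 2 ≤ W) :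
    Tot W verifyCmd s fun s' t => s'.reg 49 ≤ 1 ∧
      (s'.reg 49 = 0 ↔ ∀ x < r, ∀ y < r, (R (s.arr 11 (a + x)) (s.arr 11 (a + y)) ↔
        ∀ D < e, s.arr 15 (D * r + x) < s.arr 15 (D * r + y))) ∧
      t ≤ r * (r * (e * 4 + 10) + 4) + 3 := by
  simp only [verifyCmd, tot_seq, tot_set, fits_lit, eval_lit]
  refine ⟨by omega, by omega, (Tot.upto_const (N := r) (i₀ := 0) (fun x' s' => s'.reg 49 ≤ 1 ∧
    (s'.reg 49 = 0 ↔ ∀ x < x', ∀ y < r, (R (s.arr 11 (a + x)) (s.arr 11 (a + y)) ↔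
        ∀ D < e, s.arr 15 (D * r + x) < s.arr 15 (D * r + y))))
    (r * (e * 4 + 10) + 2) rfl rfl (by simp) (by simp [h45]) (by omega)
    (by omega) ?_ (by simp)).mono ?_⟩
  · rintro x s1 - hx ⟨h49, hI⟩ hk h41 -
    have hkk := hk.arr
    have e45 : s1.reg 45 = r := (hk.reg 45 rfl).trans (by simp [h45])
    simp only [tot_seq, tot_set, fits_lit, eval_lit]
    refine ⟨by omega, (Tot.upto_const (N := r) (i₀ := 0) (fun y' s' => s'.reg 49 ≤ 1 ∧
      (s'.reg 49 = 0 ↔ (∀ x' < x, ∀ y < r, (R (s.arr 11 (a + x')) (s.arr 11 (a + y)) ↔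
        ∀ D < e, s.arr 15 (D * r + x') < s.arr 15 (D * r + y))) ∧
        ∀ y < y', (R (s.arr 11 (a + x)) (s.arr 11 (a + y)) ↔
        ∀ D < e, s.arr 15 (D * r + x) < s.arr 15 (D * r + y))))
      (e * 4 + 8) rfl rfl (by simp) (by simp [e45]) (by omega)
      (by omega) ?_ ?_).mono ?_⟩
    · rintro y s2 - hy ⟨k49, hJ⟩ hk2 h42 -
      have f45 : s2.reg 45 = r := (hk2.reg 45 rfl).trans (by simp [e45])
      have f46 : s2.reg 46 = e := (hk2.reg 46 rfl).trans (by simp [(hk.reg 46 rfl), h46])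
      have f41 : s2.reg 41 = x := (hk2.reg 41 rfl).trans (by simp [h41])
      have f15 : s2.arr 15 = s.arr 15 := (hk2.arr 15 rfl).trans ((hk.arr 15 rfl).trans (by simp))
      have f11 : s2.arr 11 = s.arr 11 := (hk2.arr 11 rfl).trans ((hk.arr 11 rfl).trans (by simp))
      have f2 : s2.arr 2 = s.arr 2 := (hk2.arr 2 rfl).trans ((hk.arr 2 rfl).trans (by simp))
      have f0 : s2.reg 0 = n := (hk2.reg 0 rfl).trans (by simp [(hk.reg 0 rfl), hM.n_eq])
      have f44 : s2.reg 44 = a := (hk2.reg 44 rfl).trans (by simp [(hk.reg 44 rfl), h44])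
      simp only [tot_seq, tot_set, fits_lit, eval_lit]
      refine ⟨by omega, by omega, (Tot.upto_const (N := e) (i₀ := 0) (fun D' s' =>
        s'.reg 50 ≤ 1 ∧ (s'.reg 50 = 1 ↔ ∀ D < D', s.arr 15 (D * r + x) < s.arr 15 (D * r + y)))
        2 rfl rfl (by simp) (by simp [f46]) (by omega) heW ?_ (by simp)).frame.mono ?_⟩
      · rintro D s3 - hD ⟨k50, hK⟩ hk3 h40 -
        have g45 : s3.reg 45 = r := (hk3.reg 45 rfl).trans (by simp [f45])
        have g41 : s3.reg 41 = x := (hk3.reg 41 rfl).trans (by simp [f41])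
        have g42 : s3.reg 42 = y := (hk3.reg 42 rfl).trans (by simp [h42])
        have g15 : s3.arr 15 = s.arr 15 := (hk3.arr 15 rfl).trans (by simp [f15])
        have h1 := block_lt hD hx
        have h2 := block_lt hD hy
        simp only [tot_ite, tot_skip, tot_set, fits_get, fits_add, fits_mul, fits_var, fits_lit,
          eval_get, eval_add, eval_mul, eval_var, eval_lit, true_and, g45, g41, g42, g15, h40,
          Store.reg_setReg, Nat.reduceEqDiff, if_false, if_true]
        refine ⟨⟨by omega, by omega⟩, ⟨by omega, by omega⟩, fun h3 => ⟨⟨k50, ?_⟩, by omega⟩,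
          fun h3 => ⟨by omega, ⟨by omega, ?_⟩, by omega⟩⟩
        · rw [hK]
          refine ⟨fun h D' hD' => ?_, fun h D' hD' => h D' (by omega)⟩
          by_cases h4 : D' = D
          · rw [h4]; exact h3
          · exact h D' (by omega)
        · refine ⟨fun h => False.elim (by simp at h), fun h => absurd (h D (by omega)) h3⟩
      · rintro s3 t3 ⟨⟨⟨k50, hK⟩, -, -, hT3⟩, hk3⟩
        have g42 : s3.reg 42 = y := (hk3.reg 42 rfl).trans (by simp [h42])
        have g41 : s3.reg 41 = x := (hk3.reg 41 rfl).trans (by simp [f41])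
        have g44 : s3.reg 44 = a := (hk3.reg 44 rfl).trans (by simp [f44])
        have g0 : s3.reg 0 = n := (hk3.reg 0 rfl).trans (by simp [f0])
        have g49 : s3.reg 49 = s2.reg 49 := (hk3.reg 49 rfl).trans (by simp)
        have g2 : s3.arr 2 = s.arr 2 := (hk3.arr 2 rfl).trans (by simp [f2])
        have g11 : s3.arr 11 = s.arr 11 := (hk3.arr 11 rfl).trans (by simp [f11])
        have h1 := mul_add_lt_mul (hL x hx) (hL y hy)
        have h1' : s.arr 11 (a + x) * n < n * n := by have := hL x hx; nlinarith
        have hc2 := cmp_le_two R (s.arr 11 (a + x)) (s.arr 11 (a + y))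
        have hc3 := @cmp_eq_two R (s.arr 11 (a + x)) (s.arr 11 (a + y))
        simp only [fits_get, fits_add, fits_mul, fits_sub, fits_var, fits_lit,
          eval_get, eval_add, eval_mul, eval_sub, eval_var, eval_lit, true_and, and_true, g42, g41,
          g44, g0, g2, g11, hM.mat _ (hL x hx) _ (hL y hy)]
        generalize hcc : cmp R (s.arr 11 (a + x)) (s.arr 11 (a + y)) = v at *
        -- Advances the invariant by one pair, where `b` stands for agreement at this pair. It is
        -- used with `False` when the two truth values differ, and with `True` when all pairs agree
        -- so far.
        have hstep : ∀ b : Prop, (b ↔ (R (s.arr 11 (a + x)) (s.arr 11 (a + y)) ↔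
            ∀ D < e, s.arr 15 (D * r + x) < s.arr 15 (D * r + y))) →
            ((s2.reg 49 = 0 ∧ b) ↔ (∀ x' < x, ∀ y < r, (R (s.arr 11 (a + x')) (s.arr 11 (a + y)) ↔
            ∀ D < e, s.arr 15 (D * r + x') < s.arr 15 (D * r + y))) ∧
            ∀ y' < y + 1, (R (s.arr 11 (a + x)) (s.arr 11 (a + y')) ↔
            ∀ D < e, s.arr 15 (D * r + x) < s.arr 15 (D * r + y'))) := by
          intro b hb
          rw [hJ, hb, and_assoc]
          refine and_congr_right fun _ => ⟨fun h y' hy' => ?_, fun h =>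
            ⟨fun y' hy' => h y' (by omega), h y (by omega)⟩⟩
          by_cases h4 : y' = y
          · rw [h4]; exact h.2
          · exact h.1 y' (by omega)
        rw [← hK, ← hc3] at hstep
        simp only [tot_seq, tot_ite, tot_set, tot_skip, fits_var, fits_lit, eval_var, eval_lit,
          true_and, Store.reg_setReg, Nat.reduceEqDiff, if_false, if_true, g49]
        refine ⟨⟨⟨by omega, by omega, by omega⟩, by omega, by omega⟩, fun h2 => ⟨by omega,
          fun h3 => ⟨by omega, ⟨by omega, ?_⟩, by omega⟩, fun h3 => ⟨⟨by omega, ?_⟩, by omega⟩⟩,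
          fun h2 => ⟨fun h3 => ⟨by omega, ⟨by omega, ?_⟩, by omega⟩,
            fun h3 => ⟨⟨k49, ?_⟩, by omega⟩⟩⟩
        · rw [← hstep False (iff_of_false id (by omega))]; simp
        · rw [← hstep False (iff_of_false id (by omega))]; simp
        · rw [← hstep False (iff_of_false id (by omega))]; simp
        · rw [← hstep True (iff_of_true trivial (by omega))]; simp
    · simp only [Store.reg_setReg, Nat.reduceEqDiff, if_false]
      refine ⟨h49, hI.trans ?_⟩
      simp
    · rintro s2 t2 ⟨⟨k49, hJ⟩, -, -, hT2⟩
      have h8 : e * 4 + 8 + 2 = e * 4 + 10 := rfl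
      rw [h8, Nat.sub_zero] at hT2
      refine ⟨⟨k49, ?_⟩, by omega⟩
      simp only [Store.reg_setReg, Nat.reduceEqDiff, if_false]
      rw [hJ]
      refine ⟨fun h x' hx' => ?_, fun h => ⟨fun x' hx' => h x' (by omega), h x (by omega)⟩⟩
      by_cases h4 : x' = x
      · rw [h4]; exact h.2
      · exact h.1 x' (by omega)
  · rintro s1 t1 ⟨⟨h49, hI⟩, -, -, hT⟩
    have h8 : r * (e * 4 + 10) + 2 + 2 = r * (e * 4 + 10) + 4 := rfl
    rw [h8, Nat.sub_zero] at hT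
    exact ⟨h49, hI, by omega⟩

/-- Initialize the code in array `13` and its bases in array `14`. -/
def initCodeCmd : Cmd :=
  set 43 (var 46 * var 45) ;; set 41 (lit 0) ;;
  upto 41 43 (
    put 13 (var 41) (lit 0) ;;
    -- The machine has no division; the base `i % r + 1` is obtained by copying the base `r`
    -- positions earlier.
    ite (var 41) (var 45) (put 14 (var 41) (var 41 + lit 1))
      (put 14 (var 41) (get 14 (var 41 - var 45))))

theorem initCodeCmd_spec {W e r : ℕ} {s : Store} (h46 : s.reg 46 = e) (h45 : s.reg 45 = r)
    (hr : 1 ≤ r) (hW : e * r + 1 < W) : Tot W initCodeCmd s fun s' t => s'.reg 43 = e * r ∧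
      (∀ i < e * r, s'.arr 13 i = 0 ∧ s'.arr 14 i = i % r + 1) ∧ t ≤ e * r * 5 + 3 := by
  simp only [initCodeCmd, tot_seq, tot_set, fits_mul, fits_var, fits_lit, eval_mul, eval_var,
    eval_lit, true_and, h45, h46]
  refine ⟨by omega, by omega, (Tot.upto_const (N := e * r) (i₀ := 0) (fun i s' =>
    ∀ j < i, s'.arr 13 j = 0 ∧ s'.arr 14 j = j % r + 1) 3 rfl rfl (by simp) (by simp) (by omega)
    (by omega) ?_ (by simp)).mono ?_⟩
  · rintro i s1 - hi hI hk h41 -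
    have e45 : s1.reg 45 = r := (hk.reg 45 rfl).trans (by simp [h45])
    simp only [tot_seq, tot_ite, tot_put, fits_var, fits_lit, fits_add, fits_sub, fits_get,
      eval_var, eval_lit, eval_add, eval_sub, eval_get, true_and, h41, e45, Store.reg_setArr,
      Store.arr_setArr, Nat.reduceEqDiff, if_false]
    refine ⟨by omega, fun h1 => ⟨⟨by omega, by omega⟩, fun j hj => ?_, by omega⟩,
      fun h1 => ⟨by omega, fun j hj => ?_, by omega⟩⟩ <;>
      simp only [Store.arr_setReg, Store.arr_setArr, Nat.reduceEqDiff, if_false, if_true] <;>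
      by_cases hji : j = i
    · rw [hji, Function.update_self, Function.update_self, Nat.mod_eq_of_lt h1]
      exact ⟨rfl, rfl⟩
    · rw [Function.update_of_ne hji, Function.update_of_ne hji]
      exact hI j (by omega)
    · rw [hji, Function.update_self, Function.update_self, (hI (i - r) (by omega)).2,
        ← Nat.mod_eq_sub_mod (by omega)]
      exact ⟨rfl, rfl⟩
    · rw [Function.update_of_ne hji, Function.update_of_ne hji]
      exact hI j (by omega)
  · rintro s1 t1 ⟨hI, hk, -, hT⟩
    exact ⟨(hk.reg 43 rfl).trans (by simp), hI, by omega⟩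

/-- Increment the code in array `13`; register `42` is the carry. -/
def incrementCmd : Cmd :=
  set 42 (lit 1) ;; set 41 (lit 0) ;;
  upto 41 43 (
    ite (lit 0) (var 42) (
      ite (get 13 (var 41) + lit 1) (get 14 (var 41))
        (put 13 (var 41) (get 13 (var 41) + lit 1) ;; set 42 (lit 0))
        (put 13 (var 41) (lit 0))) skip)

/-- Invariant: the value of the digits plus the carry, weighted by the product of the bases passed
so far, is the old value plus one. A final carry thus means that the last code has been passed. -/
theorem incrementCmd_spec {W N : ℕ} {s : Store} (h43 : s.reg 43 = N)
    (hb : ∀ i < N, s.arr 13 i < s.arr 14 i) (hbW : ∀ i < N, s.arr 14 i < W) (hNW : N < W)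
    (hW2 : 2 ≤ W) :
    Tot W incrementCmd s fun s' t => s'.reg 42 ≤ 1 ∧ (∀ i < N, s'.arr 13 i < s.arr 14 i) ∧
      radixValue (s.arr 14) (s'.arr 13) N + s'.reg 42 * ∏ j ∈ Finset.range N, s.arr 14 j =
        radixValue (s.arr 14) (s.arr 13) N + 1 ∧ t ≤ N * 6 + 3 := by
  simp only [incrementCmd, tot_seq, tot_set, fits_lit, eval_lit]
  refine ⟨by omega, by omega, (Tot.upto_const (N := N) (i₀ := 0) (fun i s' =>
    s'.reg 42 ≤ 1 ∧ (∀ j < N, s'.arr 13 j < s.arr 14 j) ∧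
    radixValue (s.arr 14) (s'.arr 13) N + s'.reg 42 * ∏ j ∈ Finset.range i, s.arr 14 j =
        radixValue (s.arr 14) (s.arr 13) N + 1) 4 rfl rfl (by simp) (by simp [h43]) (by omega)
    hNW ?_ ?_).mono ?_⟩
  · rintro i s1 - hi ⟨h1, h2, h3⟩ hk h41 -
    have e14 : s1.arr 14 = s.arr 14 := (hk.arr 14 rfl).trans (by simp)
    have h4 := h2 i hi
    have h5 := hbW i hi
    rw [Finset.prod_range_succ]
    simp only [tot_seq, tot_ite, tot_put, tot_set, tot_skip, fits_var, fits_lit, fits_add, fits_get,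
      eval_var, eval_lit, eval_add, eval_get, true_and, and_true, h41, e14, Store.reg_setArr,
      Store.arr_setArr, Nat.reduceEqDiff, if_false]
    refine ⟨by omega, fun h6 => ⟨⟨by omega, by omega⟩, fun h7 => ⟨⟨by omega, by omega⟩, by omega,
      ⟨?_, ?_, ?_⟩, by omega⟩, fun h7 => ⟨by omega, ⟨?_, ?_, ?_⟩, by omega⟩⟩,
      fun h6 => ⟨⟨?_, ?_, ?_⟩, by omega⟩⟩ <;>
      simp only [Store.reg_setReg, Store.arr_setReg, Store.reg_setArr, Store.arr_setArr,
        Nat.reduceEqDiff, if_false, if_true]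
    · omega
    · intro j hj
      by_cases hji : j = i
      · rw [hji, Function.update_self]; omega
      · rw [Function.update_of_ne hji]; exact h2 j hj
    · have h8 := radixValue_update (b := s.arr 14) (c := s1.arr 13) (v := s1.arr 13 i + 1) hi
      rw [show s1.reg 42 = 1 by omega] at h3
      rw [add_mul] at h8
      omega
    · exact h1
    · intro j hj
      by_cases hji : j = i
      · rw [hji, Function.update_self]; omega
      · rw [Function.update_of_ne hji]; exact h2 j hj
    · have h8 := radixValue_update (b := s.arr 14) (c := s1.arr 13) (v := 0) hi
      rw [show s1.reg 42 = 1 by omega] at h3 ⊢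
      rw [show s.arr 14 i = s1.arr 13 i + 1 by omega, mul_add, mul_comm _ (s1.arr 13 i)]
      omega
    · exact h1
    · exact h2
    · rw [show s1.reg 42 = 0 by omega] at h3 ⊢
      omega
  · simp only [Store.reg_setReg, Store.arr_setReg, Nat.reduceEqDiff, if_false, if_true]
    exact ⟨le_rfl, hb, by simp⟩
  · rintro s1 t1 ⟨⟨h1, h2, h3⟩, -, -, hT⟩
    exact ⟨h1, h2, h3, by omega⟩

/-- Set register `53` to one if the level that starts at `reg 44` in array `11` and has `reg 45`
elements is realizable in `reg 46` dimensions, and to zero otherwise. -/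
def searchCmd : Cmd :=
  initCodeCmd ;; set 52 (lit 1) ;; set 53 (lit 0) ;;
  whl (lit 0) (var 52) (
    decodeCmd ;; verifyCmd ;; ite (var 49) (lit 1) (set 53 (lit 1)) skip ;; incrementCmd ;;
    set 52 (lit 1 - var 42))

theorem GoodCode.congr {R : ℕ → ℕ → Prop} {e r : ℕ} {L c c' : ℕ → ℕ} (h : GoodCode R e r L c)
    (hc : ∀ i < e * r, c i = c' i) : GoodCode R e r L c' := by
  intro x hx y hy
  rw [h x hx y hy]
  refine forall_congr' fun D => forall_congr' fun hD => ?_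
  have : ∀ j < r, codeBlock r c D j = codeBlock r c' D j := fun j hj => hc _ (block_lt hD hj)
  rw [insertPos_congr this, insertPos_congr this]

/-- The value of the code grows by one in each round, so all codes with a smaller value have been
tested; after the overflow, these are all codes. There are at most `(r!) ^ e` rounds, each of at
most `68 * (e * r ^ 2)` steps. -/
theorem searchCmd_spec {R : ℕ → ℕ → Prop} {W n e r a : ℕ} {s : Store} (hM : HasMatrix R n s)
    (h46 : s.reg 46 = e) (h45 : s.reg 45 = r) (h44 : s.reg 44 = a) (he : 1 ≤ e) (hr : 1 ≤ r)
    (hL : ∀ j < r, s.arr 11 (a + j) < n)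
    (hinj : Set.InjOn (fun j => s.arr 11 (a + j)) (Set.Iio r)) (hnW : n * n < W)
    (hW : e * r + r + 1 < W) (heW : e < W) (hrW : a + r < W) :
    Tot W searchCmd s fun s' t => s'.reg 53 ≤ 1 ∧
      (s'.reg 53 = 1 ↔ Realizable R e ((fun j => s.arr 11 (a + j)) '' Set.Iio r)) ∧
      t ≤ 90 * (e * r ^ 2 * (Nat.factorial r) ^ e) := by
  have hW2 : 2 ≤ W := by omega
  rw [realizable_iff_goodCode hinj]
  simp only [searchCmd, tot_seq]
  refine (initCodeCmd_spec h46 h45 hr (by omega)).frame.mono ?_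
  rintro s1 t1 ⟨⟨h43, hinit, hT1⟩, hk1⟩
  simp only [tot_set, fits_lit, eval_lit]
  have htot : ∏ j ∈ Finset.range (e * r), s1.arr 14 j = (Nat.factorial r) ^ e := by
    rw [← prod_mod_succ]
    exact Finset.prod_congr rfl fun i hi => (hinit i (Finset.mem_range.1 hi)).2
  have hr2 : r ≤ r ^ 2 := by nlinarith
  have her : e * r ≤ e * r ^ 2 := Nat.mul_le_mul_left _ hr2
  have her1 : e ≤ e * r := Nat.le_mul_of_pos_right _ hr
  have hrer : r ≤ e * r := Nat.le_mul_of_pos_left _ he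
  have hr2er : r ^ 2 ≤ e * r ^ 2 := Nat.le_mul_of_pos_left _ he
  refine ⟨by omega, by omega, (Tot.whl (fun s' => (∀ i < e * r, s'.arr 13 i < s1.arr 14 i) ∧
    s'.reg 52 ≤ 1 ∧ s'.reg 53 ≤ 1 ∧
    (s'.reg 53 = 1 → ∃ c, (∀ i < e * r, c i < i % r + 1) ∧
      GoodCode R e r (fun j => s.arr 11 (a + j)) c) ∧
    ∀ c, (∀ i < e * r, c i < i % r + 1) → GoodCode R e r (fun j => s.arr 11 (a + j)) c →
      s'.reg 52 = 0 ∨ radixValue (s1.arr 14) c (e * r) <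
        radixValue (s1.arr 14) (s'.arr 13) (e * r) → s'.reg 53 = 1)
    (fun s' => s'.reg 52 * (((Nat.factorial r) ^ e - radixValue (s1.arr 14) (s'.arr 13) (e * r)) *
      (68 * (e * r ^ 2)))) ?_ ?_ ?_).mono ?_⟩
  · intro s' _ _
    simp only [fits_lit, fits_var, and_true]
    omega
  · rintro s2 ⟨hc, h52, h53, hs1, hs2⟩ hk hlt
    simp only [eval_lit, eval_var] at hlt
    have h52' : s2.reg 52 = 1 := by omega
    have f45 : s2.reg 45 = r := (hk.reg 45 rfl).trans (by simp [hk1.reg 45 rfl, h45])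
    have f46 : s2.reg 46 = e := (hk.reg 46 rfl).trans (by simp [hk1.reg 46 rfl, h46])
    have f44 : s2.reg 44 = a := (hk.reg 44 rfl).trans (by simp [hk1.reg 44 rfl, h44])
    have f43 : s2.reg 43 = e * r := (hk.reg 43 rfl).trans (by simp [h43])
    have f0 : s2.reg 0 = s.reg 0 := (hk.reg 0 rfl).trans (by simp [hk1.reg 0 rfl])
    have f2 : s2.arr 2 = s.arr 2 := (hk.arr 2 rfl).trans (by simp [hk1.arr 2 rfl])
    have f11 : s2.arr 11 = s.arr 11 := (hk.arr 11 rfl).trans (by simp [hk1.arr 11 rfl])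
    have f14 : s2.arr 14 = s1.arr 14 := (hk.arr 14 rfl).trans (by simp)
    have hc' : ∀ i < e * r, s2.arr 13 i < i % r + 1 := fun i hi => by
      rw [← (hinit i hi).2]; exact hc i hi
    simp only [tot_seq]
    refine (decodeCmd_spec f46 f45 hc' hW heW).frame.mono ?_
    rintro s3 t3 ⟨⟨hdec, hT3⟩, hk3⟩
    have g11 : s3.arr 11 = s.arr 11 := (hk3.arr 11 rfl).trans f11
    refine (verifyCmd_spec (hM.congr ((hk3.reg 0 rfl).trans f0) ((hk3.arr 2 rfl).trans f2))
      ((hk3.reg 46 rfl).trans f46) ((hk3.reg 45 rfl).trans f45) ((hk3.reg 44 rfl).trans f44)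
      (by rw [g11]; exact hL) hnW (by omega) heW hrW hW2).frame.mono ?_
    rintro s4 t4 ⟨⟨h49, hver, hT4⟩, hk4⟩
    have hgood : s4.reg 49 = 0 ↔ GoodCode R e r (fun j => s.arr 11 (a + j)) (s2.arr 13) := by
      rw [hver, g11]
      refine forall_congr' fun x => forall_congr' fun hx => forall_congr' fun y =>
        forall_congr' fun hy => iff_congr Iff.rfl ?_
      refine forall_congr' fun D => forall_congr' fun hD => ?_
      rw [hdec D hD x hx, hdec D hD y hy]
    have k13 : s4.arr 13 = s2.arr 13 := (hk4.arr 13 rfl).trans (hk3.arr 13 rfl)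
    have k14 : s4.arr 14 = s1.arr 14 := (hk4.arr 14 rfl).trans ((hk3.arr 14 rfl).trans f14)
    have k43 : s4.reg 43 = e * r := (hk4.reg 43 rfl).trans ((hk3.reg 43 rfl).trans f43)
    have k53 : s4.reg 53 = s2.reg 53 := (hk4.reg 53 rfl).trans (hk3.reg 53 rfl)
    have hmid : Tot W (ite (var 49) (lit 1) (set 53 (lit 1)) skip) s4 fun s5 t5 =>
        (s5.reg 53 ≤ 1 ∧ (s5.reg 53 = 1 ↔ s2.reg 53 = 1 ∨
          GoodCode R e r (fun j => s.arr 11 (a + j)) (s2.arr 13))) ∧ t5 ≤ 2 := by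
      simp only [tot_ite, tot_set, tot_skip, fits_var, fits_lit, eval_var, eval_lit, true_and,
        Store.reg_setReg, if_true, k53, ← hgood]
      exact ⟨by omega, fun h => ⟨by omega, ⟨le_rfl, by simp; omega⟩, by omega⟩,
        fun h => ⟨⟨h53, by omega⟩, by omega⟩⟩
    refine hmid.frame.mono ?_
    rintro s5 t5 ⟨⟨⟨h53', hfound⟩, hT5⟩, hk5⟩
    have l13 : s5.arr 13 = s2.arr 13 := (hk5.arr 13 rfl).trans k13
    have l14 : s5.arr 14 = s1.arr 14 := (hk5.arr 14 rfl).trans k14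
    refine (incrementCmd_spec (N := e * r) ((hk5.reg 43 rfl).trans k43) (by rw [l13, l14]; exact hc)
      (fun i hi => ?_) (by omega) hW2).frame.mono ?_
    · rw [l14, (hinit i hi).2]
      have := Nat.mod_lt i (show r > 0 by omega)
      omega
    rintro s6 t6 ⟨⟨h42, hb6, hval, hT6⟩, hk6⟩
    rw [l14] at hb6 hval
    rw [l13, htot] at hval
    have m53 : s6.reg 53 = s5.reg 53 := hk6.reg 53 rfl
    simp only [tot_set, fits_sub, fits_lit, fits_var, eval_sub, eval_lit, eval_var, true_and,
      Store.reg_setReg, Store.arr_setReg, Nat.reduceEqDiff, if_false, if_true, m53]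
    have hV0 := radixValue_lt hc
    have hV1 := radixValue_lt hb6
    rw [htot] at hV0 hV1
    refine ⟨⟨by omega, by omega⟩, ⟨hb6, by omega, h53', fun h => ?_, fun c hcv hcg h => ?_⟩, ?_⟩
    · rcases hfound.1 h with h | h
      · exact hs1 h
      · exact ⟨_, hc', h⟩
    · rw [hfound]
      have hcv' : ∀ i < e * r, c i < s1.arr 14 i := fun i hi => by
        rw [(hinit i hi).2]; exact hcv i hi
      have hVc := radixValue_lt hcv'
      rw [htot] at hVc
      -- A code covered after the round was covered before or is the current one. Without overflow
      -- the value has grown by one; with overflow the current value was the largest possible.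
      have h7 : radixValue (s1.arr 14) c (e * r) < radixValue (s1.arr 14) (s2.arr 13) (e * r) ∨
          radixValue (s1.arr 14) c (e * r) = radixValue (s1.arr 14) (s2.arr 13) (e * r) := by
        rcases (by omega : s6.reg 42 = 0 ∨ s6.reg 42 = 1) with h8 | h8 <;> rw [h8] at hval
        · rw [zero_mul] at hval; omega
        · rw [one_mul] at hval; omega
      rcases h7 with h7 | h7
      · exact Or.inl (hs2 c hcv hcg (Or.inr h7))
      · exact Or.inr (hcg.congr (radixValue_inj hcv' hc h7))
    · have hcost : t3 + (t4 + (t5 + (t6 + 1))) + 1 ≤ 68 * (e * r ^ 2) := by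
        have q1 : e * (r * (r * 4 + 6) + 5) = e * r ^ 2 * 4 + e * r * 6 + e * 5 := by ring
        have q2 : r * (r * (e * 4 + 10) + 4) = e * r ^ 2 * 4 + r ^ 2 * 10 + r * 4 := by ring
        omega
      rw [h52', one_mul]
      obtain ⟨g, hg⟩ : ∃ g, (Nat.factorial r) ^ e - radixValue (s1.arr 14) (s2.arr 13) (e * r) =
          g + 1 := ⟨_, (Nat.succ_pred_eq_of_pos (by omega)).symm⟩
      rw [hg, add_mul, one_mul]
      rcases (by omega : s6.reg 42 = 0 ∨ s6.reg 42 = 1) with h8 | h8 <;> rw [h8] at hval ⊢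
      · rw [zero_mul] at hval
        rw [Nat.sub_zero, one_mul, show (Nat.factorial r) ^ e -
          radixValue (s1.arr 14) (s6.arr 13) (e * r) = g by omega]
        omega
      · rw [Nat.sub_self, zero_mul]
        omega
  · simp only [Store.reg_setReg, Store.arr_setReg, Nat.reduceEqDiff, if_false, if_true]
    refine ⟨fun i hi => ?_, le_rfl, by omega, by simp, fun c hc hg h => ?_⟩
    · rw [(hinit i hi).1, (hinit i hi).2]; omega
    · have h0 : radixValue (s1.arr 14) (s1.arr 13) (e * r) = 0 :=
        Finset.sum_eq_zero fun i hi => by rw [(hinit i (Finset.mem_range.1 hi)).1, zero_mul]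
      rw [h0] at h
      simp at h
  · rintro s2 t2 ⟨⟨hc, h52, h53, hs1, hs2⟩, hk, hlt, hT⟩
    simp only [eval_lit, eval_var] at hlt
    refine ⟨h53, ⟨hs1, fun ⟨c, hcv, hcg⟩ => hs2 c hcv hcg (Or.inl (by omega))⟩, ?_⟩
    simp only [Store.reg_setReg, Store.arr_setReg, Nat.reduceEqDiff, if_false, if_true, one_mul]
      at hT
    have hfac : 1 ≤ (Nat.factorial r) ^ e := Nat.one_le_pow _ _ (Nat.factorial_pos r)
    have q1 : ((Nat.factorial r) ^ e - radixValue (s1.arr 14) (s1.arr 13) (e * r)) *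
        (68 * (e * r ^ 2)) ≤ (Nat.factorial r) ^ e * (68 * (e * r ^ 2)) :=
      Nat.mul_le_mul_right _ (Nat.sub_le _ _)
    have q2 : (Nat.factorial r) ^ e * (68 * (e * r ^ 2)) =
      68 * (e * r ^ 2 * (Nat.factorial r) ^ e) := by ring
    have q3 : e * r ^ 2 ≤ e * r ^ 2 * (Nat.factorial r) ^ e := Nat.le_mul_of_pos_right _ hfac
    omega

theorem levelSet_eq_image {s : Store} {l : ℕ} : levelSet s l =
    (fun j => s.arr 11 (s.arr 12 l + j)) '' Set.Iio (s.arr 12 (l + 1) - s.arr 12 l) := by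
  ext x
  constructor
  · rintro ⟨j, hj, rfl⟩
    have h1 := hj.1
    have h2 := hj.2
    refine ⟨j - s.arr 12 l, Set.mem_Iio.2 (by omega), ?_⟩
    simp only
    congr 1
    omega
  · rintro ⟨j, hj, rfl⟩
    have : j < _ := hj
    exact ⟨_, ⟨by omega, by omega⟩, rfl⟩

theorem HasLevels.injOn {R : ℕ → ℕ → Prop} {n : ℕ} {s : Store} (h : HasLevels R n s) {l : ℕ}
    (hl : l < s.reg 6) : Set.InjOn (fun j => s.arr 11 (s.arr 12 l + j))
      (Set.Iio (s.arr 12 (l + 1) - s.arr 12 l)) := by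
  intro i hi j hj hij
  simp only [Set.mem_Iio] at hi hj
  have := h.inj l hl (show _ ∈ Set.Ico _ _ from ⟨Nat.le_add_right _ _, by omega⟩)
    (show _ ∈ Set.Ico _ _ from ⟨Nat.le_add_right _ _, by omega⟩) hij
  omega

/-- Set register `54` to one if all levels are realizable in `reg 46` dimensions. -/
def levelsCmd : Cmd :=
  set 54 (lit 1) ;; set 55 (lit 0) ;;
  upto 55 6 (
    set 44 (get 12 (var 55)) ;; set 45 (get 12 (var 55 + lit 1) - get 12 (var 55)) ;;
    searchCmd ;; ite (var 53) (lit 1) (set 54 (lit 0)) skip)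

theorem levelsCmd_spec {R : ℕ → ℕ → Prop} {W n e k : ℕ} {s : Store} (hM : HasMatrix R n s)
    (hV : HasLevels R n s) (h46 : s.reg 46 = e) (he : 1 ≤ e)
    (hk : ∀ l < s.reg 6, s.arr 12 (l + 1) - s.arr 12 l ≤ k) (hnW : n * n < W)
    (hW : e * n + n + 1 < W) (heW : e < W) (h7 : s.reg 7 < W) (h6 : s.reg 6 < W) :
    Tot W levelsCmd s fun s' t => s'.reg 54 ≤ 1 ∧
      (s'.reg 54 = 1 ↔ ∀ l < s.reg 6, Realizable R e (levelSet s l)) ∧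
      t ≤ s.reg 6 * (90 * (e * k ^ 2 * (Nat.factorial k) ^ e) + 6) + 3 := by
  have hW2 : 2 ≤ W := by omega
  simp only [levelsCmd, tot_seq, tot_set, fits_lit, eval_lit]
  refine ⟨by omega, by omega, (Tot.upto_const (N := s.reg 6) (i₀ := 0) (fun l' s' =>
    s'.reg 54 ≤ 1 ∧ (s'.reg 54 = 1 ↔ ∀ l < l', Realizable R e (levelSet s l)))
    (90 * (e * k ^ 2 * (Nat.factorial k) ^ e) + 4) rfl rfl (by simp) (by simp) (by omega)
    (by omega) ?_ (by simp)).mono ?_⟩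
  · rintro l s1 - hl ⟨h54, hI⟩ hk1 h55 -
    have f0 : s1.reg 0 = s.reg 0 := (hk1.reg 0 rfl).trans (by simp)
    have f46 : s1.reg 46 = e := (hk1.reg 46 rfl).trans (by simp [h46])
    have f2 : s1.arr 2 = s.arr 2 := (hk1.arr 2 rfl).trans (by simp)
    have f11 : s1.arr 11 = s.arr 11 := (hk1.arr 11 rfl).trans (by simp)
    have f12 : s1.arr 12 = s.arr 12 := (hk1.arr 12 rfl).trans (by simp)
    have h8 := hV.lt_succ l hl
    have h9 := hV.le_last (l + 1) hl
    have h10 := hk l hl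
    simp only [tot_seq, tot_set, fits_add, fits_sub, fits_get, fits_var, fits_lit, eval_add,
      eval_sub, eval_get, eval_var, eval_lit, true_and, h55, f12, Store.reg_setReg,
      Store.arr_setReg, Nat.reduceEqDiff, if_false]
    generalize hr : s.arr 12 (l + 1) - s.arr 12 l = r at *
    have hinj := hV.injOn hl
    rw [hr] at hinj
    have hL : ∀ j < r, s.arr 11 (s.arr 12 l + j) < n := fun j hj => hV.lt _ (by omega)
    have hrn : r ≤ n := by
      have h11 : ((Finset.range r).image fun j => s.arr 11 (s.arr 12 l + j)) ⊆ Finset.range n := by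
        intro x hx
        obtain ⟨j, hj, rfl⟩ := Finset.mem_image.1 hx
        exact Finset.mem_range.2 (hL j (Finset.mem_range.1 hj))
      have h12 := Finset.card_le_card h11
      rwa [Finset.card_image_of_injOn (by simpa using hinj), Finset.card_range,
        Finset.card_range] at h12
    have hern : e * r ≤ e * n := Nat.mul_le_mul_left _ hrn
    refine ⟨⟨by omega, by omega⟩, (searchCmd_spec (s := (s1.setReg 44 (s.arr 12 l)).setReg 45 r)
      (e := e) (r := r) (a := s.arr 12 l) (hM.congr (by simp [f0]) (by simp [f2]))
      (by simp [f46]) (by simp) (by simp) he (by omega) (by simpa [f11] using hL)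
      (by simpa [f11] using hinj) hnW (by omega) heW (by omega)).frame.mono ?_⟩
    rintro s2 t2 ⟨⟨h53, hreal, hT2⟩, hk2⟩
    simp only [Store.arr_setReg, f11] at hreal
    rw [← hr, ← levelSet_eq_image] at hreal
    have g54 : s2.reg 54 = s1.reg 54 := (hk2.reg 54 rfl).trans (by simp)
    simp only [tot_ite, tot_set, tot_skip, fits_var, fits_lit, eval_var, eval_lit, true_and,
      Store.reg_setReg, Nat.reduceEqDiff, if_false, if_true, g54]
    have hT : 90 * (e * r ^ 2 * (Nat.factorial r) ^ e) ≤ 90 * (e * k ^ 2 * (Nat.factorial k) ^ e) := by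
      have := Nat.factorial_le h10
      gcongr
    refine ⟨by omega, fun h => ⟨by omega, ⟨by omega, ?_⟩, by omega⟩, fun h => ⟨⟨h54, ?_⟩, by omega⟩⟩
    · refine iff_of_false (by simp) fun h' => ?_
      have := hreal.2 (h' l (by omega))
      omega
    · rw [hI]
      refine ⟨fun h' l' hl' => ?_, fun h' l' hl' => h' l' (by omega)⟩
      by_cases h11 : l' = l
      · rw [h11]; exact hreal.1 (by omega)
      · exact h' l' (by omega)
  · rintro s1 t1 ⟨⟨h54, hI⟩, -, -, hT⟩
    have h8 : 90 * (e * k ^ 2 * (Nat.factorial k) ^ e) + 4 + 2 =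
      90 * (e * k ^ 2 * (Nat.factorial k) ^ e) + 6 := rfl
    rw [h8, Nat.sub_zero] at hT
    exact ⟨h54, hI, by omega⟩

/-- Put one into register `0` if all levels are realizable in `d` dimensions, but not in `d - 1 ≥ 1`
dimensions. -/
def answerCmd (d : ℕ) : Cmd :=
  set 46 (lit d) ;; levelsCmd ;; set 56 (var 54) ;;
  -- The answer is the truncated difference of the two test results, which is `1` only for success
  -- in `d` and failure in `d - 1` dimensions. For `d = 1` the second test is omitted: the levels
  -- say nothing about zero dimensions, where a drawing exists only without vertices.
  ite (lit 1) (lit d) (set 46 (lit (d - 1)) ;; levelsCmd ;; set 0 (var 56 - var 54)) (set 0 (var 56))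

theorem answerCmd_spec {R : ℕ → ℕ → Prop} {W n d k : ℕ} {s : Store} (hM : HasMatrix R n s)
    (hV : HasLevels R n s) (hd : 1 ≤ d) (hk1 : 1 ≤ k)
    (hk : ∀ l < s.reg 6, s.arr 12 (l + 1) - s.arr 12 l ≤ k) (hnW : n * n < W)
    (hW : d * n + n + 1 < W) (hdW : d < W) (h7 : s.reg 7 < W) (h6 : s.reg 6 < W)
    (h6n : s.reg 6 ≤ 2 * n) (hn : 1 ≤ n) :
    Tot W (answerCmd d) s fun s' t => ((∀ l < s.reg 6, Realizable R d (levelSet s l)) ∧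
        ¬ (2 ≤ d ∧ ∀ l < s.reg 6, Realizable R (d - 1) (levelSet s l)) → s'.reg 0 = 1) ∧
      (¬ ((∀ l < s.reg 6, Realizable R d (levelSet s l)) ∧
        ¬ (2 ≤ d ∧ ∀ l < s.reg 6, Realizable R (d - 1) (levelSet s l))) → s'.reg 0 = 0) ∧
      t ≤ 500 * (n * d * k ^ 2 * (Nat.factorial k) ^ d) := by
  have hls : ∀ (s : Store) x y, levelSet (s.setReg x y) = levelSet s := fun _ _ _ => rfl
  have hbound : ∀ e ≤ d, s.reg 6 * (90 * (e * k ^ 2 * (Nat.factorial k) ^ e) + 6) + 3 ≤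
      200 * (n * d * k ^ 2 * (Nat.factorial k) ^ d) := by
    intro e he
    have hf := Nat.factorial_pos k
    have h1 : e * k ^ 2 * (Nat.factorial k) ^ e ≤ d * k ^ 2 * (Nat.factorial k) ^ d := by
      have : (Nat.factorial k) ^ e ≤ (Nat.factorial k) ^ d := Nat.pow_le_pow_right hf he
      gcongr
    have h2 : 1 ≤ d * k ^ 2 * (Nat.factorial k) ^ d :=
      Nat.mul_pos (Nat.mul_pos hd (pow_pos hk1 2)) (pow_pos hf d)
    have h3 : n * d * k ^ 2 * (Nat.factorial k) ^ d = n * (d * k ^ 2 * (Nat.factorial k) ^ d) := by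
      ring
    rw [h3]
    generalize d * k ^ 2 * (Nat.factorial k) ^ d = T at *
    have h4 : s.reg 6 * (90 * (e * k ^ 2 * (Nat.factorial k) ^ e) + 6) ≤ 2 * n * (90 * T + 6) := by
      gcongr
    have h5 : n ≤ n * T := Nat.le_mul_of_pos_right _ h2
    have h6 : 2 * n * (90 * T + 6) = 180 * (n * T) + 12 * n := by ring
    omega
  have hpos : 1 ≤ n * d * k ^ 2 * (Nat.factorial k) ^ d := by
    have hf := Nat.factorial_pos k
    exact Nat.mul_pos (Nat.mul_pos (Nat.mul_pos hn hd) (pow_pos hk1 2)) (pow_pos hf d)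
  simp only [answerCmd, tot_seq, tot_set, fits_lit, fits_var, eval_lit, eval_var, true_and]
  refine ⟨hdW, (levelsCmd_spec (s := s.setReg 46 d) (k := k) (hM.congr (by simp) rfl)
    (hV.congr (by simp) (by simp) rfl rfl) (by simp) hd (by simpa using hk) hnW (by omega) hdW
    (by simpa using h7) (by simpa using h6)).frame.mono ?_⟩
  rintro s1 t1 ⟨⟨h54, hok, hT1⟩, hk1⟩
  have hb1 := hbound d le_rfl
  simp only [Store.reg_setReg, Nat.reduceEqDiff, if_false, hls] at hok hT1
  simp only [tot_ite, tot_seq, tot_set, fits_lit, fits_var, eval_lit, eval_var, true_and]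
  refine ⟨by omega, hdW, fun h2 => ⟨by omega, ?_⟩, fun h2 => ?_⟩
  · have e0 : s1.reg 0 = s.reg 0 := (hk1.reg 0 rfl).trans (by simp)
    have e6 : s1.reg 6 = s.reg 6 := (hk1.reg 6 rfl).trans (by simp)
    have e7 : s1.reg 7 = s.reg 7 := (hk1.reg 7 rfl).trans (by simp)
    have e2 : s1.arr 2 = s.arr 2 := (hk1.arr 2 rfl).trans (by simp)
    have e11 : s1.arr 11 = s.arr 11 := (hk1.arr 11 rfl).trans (by simp)
    have e12 : s1.arr 12 = s.arr 12 := (hk1.arr 12 rfl).trans (by simp)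
    have hdn : (d - 1) * n ≤ d * n := Nat.mul_le_mul_right _ (by omega)
    refine (levelsCmd_spec (s := (s1.setReg 56 (s1.reg 54)).setReg 46 (d - 1)) (n := n) (R := R)
      (e := d - 1) (k := k)
      (hM.congr (by simp [e0]) (by simp [e2])) (hV.congr (by simp [e6]) (by simp [e7])
      (by simp [e11]) (by simp [e12])) (by simp) (by omega) (by simpa [e6, e12] using hk) hnW
      (by omega) (by omega) (by simpa [e7] using h7) (by simpa [e6] using h6)).frame.mono ?_
    rintro s2 t2 ⟨⟨k54, hok2, hT2⟩, hk2⟩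
    have hb2 := hbound (d - 1) (by omega)
    have k56 : s2.reg 56 = s1.reg 54 := (hk2.reg 56 rfl).trans (by simp)
    simp only [Store.reg_setReg, Nat.reduceEqDiff, if_false, hls, e6, levelSet_congr e11 e12]
      at hok2 hT2
    simp only [fits_sub, fits_var, eval_sub, eval_var, true_and, Store.reg_setReg, if_true, k56,
      ← hok, ← hok2]
    exact ⟨by omega, by omega, by omega, by omega⟩
  · simp only [Store.reg_setReg, Nat.reduceEqDiff, if_false, if_true, ← hok]
    exact ⟨by omega, by omega, by omega⟩

/-! ### The transitive closure -/

theorem mul_add_inj {n x y x' y' : ℕ} (hy : y < n) (hy' : y' < n)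
    (h : x * n + y = x' * n + y') : x = x' ∧ y = y' := by
  have h1 : (x * n + y) / n = x := by
    rw [mul_comm, Nat.mul_add_div (by omega), Nat.div_eq_of_lt hy, add_zero]
  have h2 : (x' * n + y') / n = x' := by
    rw [mul_comm, Nat.mul_add_div (by omega), Nat.div_eq_of_lt hy', add_zero]
  have h3 : x = x' := by rw [← h1, ← h2, h]
  subst h3
  exact ⟨rfl, by omega⟩

theorem cmp_congr {P P' : ℕ → ℕ → Prop} {x y x' y' : ℕ} (h1 : P x y ↔ P' x' y')
    (h2 : P y x ↔ P' y' x') : cmp P x y = cmp P' x' y' := by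
  by_cases h3 : P x y <;> by_cases h4 : P y x <;>
    simp [cmp, h3, h4, h1.symm, h2.symm]

theorem HasMatrix.congr_rel {P P' : ℕ → ℕ → Prop} {n : ℕ} {s : Store} (h : HasMatrix P n s)
    (hP : ∀ x < n, ∀ y < n, (P x y ↔ P' x y)) : HasMatrix P' n s :=
  ⟨h.n_eq, fun x hx y hy => by rw [h.mat x hx y hy, cmp_congr (hP x hx y hy) (hP y hy x hx)]⟩

theorem HasMatrix.add_pair {P : ℕ → ℕ → Prop} {n u y : ℕ} {s : Store} (h : HasMatrix P n s)
    (hu : u < n) (hy : y < n) (huy : u ≠ y) (hP : ¬ P y u) :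
    HasMatrix (fun x z => P x z ∨ x = u ∧ z = y) n
      ((s.setArr 2 (u * n + y) 2).setArr 2 (y * n + u) 1) := by
  refine ⟨h.n_eq, fun x hx z hz => ?_⟩
  simp only [Store.arr_setArr, if_true]
  by_cases h1 : x * n + z = y * n + u
  · obtain ⟨rfl, rfl⟩ := mul_add_inj hz hu h1
    rw [Function.update_self]
    simp [cmp, hP, huy.symm]
  · rw [Function.update_of_ne h1]
    by_cases h2 : x * n + z = u * n + y
    · obtain ⟨rfl, rfl⟩ := mul_add_inj hz hy h2
      rw [Function.update_self]
      simp [cmp]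
    · rw [Function.update_of_ne h2, h.mat x hx z hz]
      refine cmp_congr ⟨Or.inl, ?_⟩ ⟨Or.inl, ?_⟩
      · rintro (h3 | ⟨rfl, rfl⟩)
        exacts [h3, absurd rfl h2]
      · rintro (h3 | ⟨rfl, rfl⟩)
        exacts [h3, absurd rfl h1]

/-- Add to the relation in array `2` the pairs that begin with the edge from `reg 13` to `reg 14`. -/
def extendCmd : Cmd :=
  put 2 (var 13 * var 0 + var 14) (lit 2) ;; put 2 (var 14 * var 0 + var 13) (lit 1) ;;
  set 15 (lit 0) ;;
  upto 15 0 (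
    ite (lit 1) (get 2 (var 14 * var 0 + var 15)) (
      put 2 (var 13 * var 0 + var 15) (lit 2) ;; put 2 (var 15 * var 0 + var 13) (lit 1)) skip)

/-- The row of `h` is already complete by `hPh`, so everything that is reached from `u` through the
edge to `h` is found by reading this row once. Each new pair also requires the mirrored entry of the
comparison matrix. -/
theorem extendCmd_spec {R P : ℕ → ℕ → Prop} [IsStrictOrder ℕ R] {W n u h : ℕ} {s : Store}
    (hM : HasMatrix P n s) (h13 : s.reg 13 = u) (h14 : s.reg 14 = h) (hu : u < n) (hh : h < n)
    (huh : R u h) (hPR : ∀ x z, P x z → R x z) (hPh : ∀ z, R h z → P h z) (hnW : n * n < W)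
    (hW3 : 3 ≤ W) : Tot W extendCmd s fun s' t =>
      HasMatrix (fun x z => P x z ∨ x = u ∧ (z = h ∨ R h z)) n s' ∧ t ≤ n * 5 + 4 := by
  have hne : ∀ {a b}, R a b → a ≠ b := fun hab h' => irrefl_of R _ (h' ▸ hab)
  have hnW' : n < W := lt_of_le_of_lt (Nat.le_mul_self n) hnW
  have i1 := mul_add_lt_mul hu hh
  have i2 := mul_add_lt_mul hh hu
  simp only [extendCmd, tot_seq, tot_put, tot_set, fits_lit, fits_add, fits_mul, fits_var, eval_lit,
    eval_add, eval_mul, eval_var, true_and, hM.n_eq, h13, h14, Store.reg_setArr]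
  refine ⟨⟨by omega, by omega⟩, by omega, ⟨by omega, by omega⟩, by omega, by omega,
    (Tot.upto_const (N := n) (i₀ := 0) (fun y s' =>
      HasMatrix (fun x z => P x z ∨ x = u ∧ (z = h ∨ z < y ∧ R h z)) n s') 3 rfl rfl (by simp)
      (by simp [hM.n_eq]) (by omega) hnW' ?_ ?_).mono ?_⟩
  · rintro y s1 - hy hI hk h15 h0
    have e13 : s1.reg 13 = u := (hk.reg 13 rfl).trans (by simp [h13])
    have e14 : s1.reg 14 = h := (hk.reg 14 rfl).trans (by simp [h14])
    have i3 := mul_add_lt_mul hh hy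
    have i4 := mul_add_lt_mul hu hy
    have i5 := mul_add_lt_mul hy hu
    simp only [tot_seq, tot_ite, tot_put, tot_skip, fits_lit, fits_get, fits_add, fits_mul, fits_var,
      eval_lit, eval_get, eval_add, eval_mul, eval_var, true_and, and_true, e13, e14, h15, h0,
      hI.mat _ hh _ hy, Store.reg_setArr]
    refine ⟨by omega, ⟨by omega, by omega⟩, fun h1 => ⟨⟨by omega, by omega⟩, by omega,
      ⟨by omega, by omega⟩, by omega, ?_, by omega⟩, fun h1 => ⟨?_, by omega⟩⟩
    · have h2 : R h y := by
        have h3 : cmp (fun x z => P x z ∨ x = u ∧ (z = h ∨ z < y ∧ R h z)) h y = 2 := by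
          have := cmp_le_two (fun x z => P x z ∨ x = u ∧ (z = h ∨ z < y ∧ R h z)) h y
          omega
        rcases cmp_eq_two.1 h3 with h4 | ⟨h4, -⟩
        · exact hPR _ _ h4
        · exact absurd h4.symm (hne huh)
      have huy : R u y := _root_.trans huh h2
      refine ((hI.add_pair hu hy (hne huy) ?_).congr_rel ?_).congr (by simp) rfl
      · rintro (h4 | ⟨h4, -⟩)
        · exact asymm_of R huy (hPR _ _ h4)
        · exact hne huy h4.symm
      · intro x _ z _
        constructor
        · rintro ((h4 | ⟨h4, h5 | ⟨h5, h6⟩⟩) | ⟨h4, h5⟩)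
          · exact Or.inl h4
          · exact Or.inr ⟨h4, Or.inl h5⟩
          · exact Or.inr ⟨h4, Or.inr ⟨by omega, h6⟩⟩
          · exact Or.inr ⟨h4, Or.inr ⟨by omega, h5 ▸ h2⟩⟩
        · rintro (h4 | ⟨h4, h5 | ⟨h5, h6⟩⟩)
          · exact Or.inl (Or.inl h4)
          · exact Or.inl (Or.inr ⟨h4, Or.inl h5⟩)
          · rcases Nat.lt_succ_iff_lt_or_eq.1 h5 with h7 | h7
            · exact Or.inl (Or.inr ⟨h4, Or.inr ⟨h7, h6⟩⟩)
            · exact Or.inr ⟨h4, h7⟩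
    · refine (hI.congr_rel fun x _ z _ => ?_).congr (by simp) rfl
      refine or_congr_right (and_congr_right fun _ => or_congr_right
        ⟨fun h2 => ⟨by omega, h2.2⟩, fun h2 => ⟨?_, h2.2⟩⟩)
      rcases Nat.lt_succ_iff_lt_or_eq.1 h2.1 with h7 | rfl
      · exact h7
      · have h3 : cmp (fun x' z' => P x' z' ∨ x' = u ∧ (z' = h ∨ z' < z ∧ R h z')) h z = 2 :=
          cmp_eq_two.2 (Or.inl (hPh _ h2.2))
        omega
  · refine ((hM.add_pair hu hh (hne huh) ?_).congr_rel ?_).congr (by simp) rfl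
    · exact fun h4 => asymm_of R huh (hPR _ _ h4)
    · intro x _ z _
      simp
  · rintro s1 t1 ⟨hI, -, -, hT⟩
    refine ⟨⟨hI.n_eq, fun x hx y hy => (hI.mat x hx y hy).trans (cmp_congr ?_ ?_)⟩, by omega⟩
    all_goals
      refine or_congr_right (and_congr_right fun _ => or_congr_right (and_iff_right ?_))
      assumption

/-- Arrays `0` and `1` hold the tails and heads of `m` edges on `n` vertices whose transitive closure
is `R`. -/
structure Generates (R : ℕ → ℕ → Prop) (n m : ℕ) (tl hd : ℕ → ℕ) : Prop where
  tail_lt : ∀ i < m, tl i < n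
  head_lt : ∀ i < m, hd i < n
  rel_iff : ∀ x y, R x y ↔ ∃ i < m, tl i = x ∧ (y = hd i ∨ R (hd i) y)

/-- Take a vertex in `U` from which the fewest vertices of `U` are reachable. A successor in `U`
would reach fewer, because it does not reach itself. -/
theorem Generates.exists_sink {R : ℕ → ℕ → Prop} [IsStrictOrder ℕ R] {n m : ℕ} {tl hd : ℕ → ℕ}
    (h : Generates R n m tl hd) {U : ℕ → Prop} (hU : ∃ u < n, U u) :
    ∃ u < n, U u ∧ ∀ i < m, tl i = u → ¬ U (hd i) := by
  classical
  obtain ⟨u₀, h1, h2⟩ := hU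
  obtain ⟨u, hu, hmin⟩ := ((Finset.range n).filter U).exists_min_image
    (fun u => ((Finset.range n).filter fun v => U v ∧ R u v).card) ⟨u₀, by simp [h1, h2]⟩
  simp only [Finset.mem_filter, Finset.mem_range] at hu hmin
  refine ⟨u, hu.1, hu.2, fun i hi hti hUi => ?_⟩
  have hR : R u (hd i) := (h.rel_iff _ _).2 ⟨i, hi, hti, Or.inl rfl⟩
  refine absurd (hmin _ ⟨h.head_lt i hi, hUi⟩) (not_le.2 (Finset.card_lt_card ?_))
  refine Finset.ssubset_iff_of_subset (fun v => ?_) |>.2 ⟨hd i, ?_, ?_⟩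
  · simp only [Finset.mem_filter, Finset.mem_range]
    exact fun ⟨h3, h4, h5⟩ => ⟨h3, h4, _root_.trans hR h5⟩
  · simp [h.head_lt i hi, hUi, hR]
  · simp [irrefl_of R]

/-- Find a vertex that is not marked in array `3`, but all its out-neighbours are. -/
def sinkCmd : Cmd :=
  set 11 (lit 0) ;; upto 11 0 (put 4 (var 11) (get 3 (var 11))) ;;
  (set 12 (lit 0) ;; upto 12 1 (
    ite (get 3 (get 1 (var 12))) (lit 1) (put 4 (get 0 (var 12)) (lit 1)) skip)) ;;
  (set 11 (lit 0) ;; set 13 (lit 0) ;; upto 11 0 (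
    ite (get 4 (var 11)) (lit 1) (set 13 (var 11)) skip))

theorem sinkCmd_spec {R : ℕ → ℕ → Prop} [IsStrictOrder ℕ R] {W n m : ℕ} {s : Store}
    (hG : Generates R n m (s.arr 0) (s.arr 1)) (h0 : s.reg 0 = n) (h1 : s.reg 1 = m) (hn : n < W)
    (hm : m < W) (hW : 2 ≤ W) (h01 : ∀ x < n, s.arr 3 x ≤ 1) (hU : ∃ x < n, s.arr 3 x = 0) :
    Tot W sinkCmd s fun s' t => s'.reg 13 < n ∧ s.arr 3 (s'.reg 13) = 0 ∧
      (∀ i < m, s.arr 0 i = s'.reg 13 → s.arr 3 (s.arr 1 i) = 1) ∧ t ≤ 7 * n + 4 * m + 7 := by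
  obtain ⟨u, hu, hu0, huh⟩ := hG.exists_sink hU
  simp only [sinkCmd, tot_seq, tot_set, fits_lit, eval_lit, true_and]
  refine ⟨by omega, (Tot.upto_const (N := n) (i₀ := 0) (fun i s' => ∀ x < i, s'.arr 4 x = s.arr 3 x) 1
    rfl rfl (by simp) (by simp [h0]) (by omega) hn ?_ (by simp)).mono ?_⟩
  · rintro i s1 - hi hI hk h11 -
    have e3 : s1.arr 3 = s.arr 3 := hk.arr 3 rfl
    simp only [tot_put, fits_var, fits_get, eval_var, eval_get, true_and, h11, e3]
    refine ⟨fun x hx => ?_, le_rfl⟩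
    simp only [Store.arr_setReg, Store.arr_setArr, if_true]
    rcases Nat.lt_succ_iff_lt_or_eq.1 hx with hx | rfl
    · rw [Function.update_of_ne (by omega), hI x hx]
    · rw [Function.update_self]
  rintro s1 t1 ⟨hI1, hk1, -, ht1⟩
  refine ⟨by omega, (Tot.upto_const (N := m) (i₀ := 0) (fun i s' => ∀ x < n, s'.arr 4 x = 0 ↔
    s.arr 3 x = 0 ∧ ∀ j < i, s.arr 0 j = x → s.arr 3 (s.arr 1 j) = 1) 2
    rfl rfl (by simp) ?_ (by omega) hm ?_ ?_).mono ?_⟩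
  · simp only [Store.reg_setReg, Nat.reduceEqDiff, if_false]
    exact (hk1.reg 1 rfl).trans (by simp [h1])
  · rintro i s2 - hi hI hk h12 -
    have e3 : s2.arr 3 = s.arr 3 := (hk.arr 3 rfl).trans (hk1.arr 3 rfl)
    have e1 : s2.arr 1 = s.arr 1 := (hk.arr 1 rfl).trans (hk1.arr 1 rfl)
    have e0 : s2.arr 0 = s.arr 0 := (hk.arr 0 rfl).trans (hk1.arr 0 rfl)
    simp only [tot_put, tot_ite, tot_skip, fits_var, fits_get, fits_lit, eval_lit, eval_var, eval_get,
      true_and, h12, e3, e1, e0]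
    refine ⟨by omega, fun h3 => ⟨by omega, fun x hx => ?_, by omega⟩, fun h3 => ⟨fun x hx => ?_, by omega⟩⟩
    · simp only [Store.arr_setReg, Store.arr_setArr, if_true]
      by_cases hxi : x = s.arr 0 i
      · rw [hxi, Function.update_self]
        refine iff_of_false (by omega) fun h4 => ?_
        have := h4.2 i (by omega) rfl
        omega
      · rw [Function.update_of_ne hxi, hI x hx]
        refine and_congr_right fun _ => ⟨fun h4 j hj hjx => ?_, fun h4 j hj => h4 j (by omega)⟩
        rcases Nat.lt_succ_iff_lt_or_eq.1 hj with hj | rfl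
        exacts [h4 j hj hjx, absurd hjx.symm hxi]
    · simp only [Store.arr_setReg]
      rw [hI x hx]
      refine and_congr_right fun _ => ⟨fun h4 j hj hjx => ?_, fun h4 j hj => h4 j (by omega)⟩
      rcases Nat.lt_succ_iff_lt_or_eq.1 hj with hj | rfl
      · exact h4 j hj hjx
      · have := h01 _ (hG.head_lt j hi)
        omega
  · intro x hx
    simp only [Store.arr_setReg]
    rw [hI1 x hx]
    simp
  rintro s2 t2 ⟨hI2, hk2, -, ht2⟩
  refine ⟨by omega, by omega, (Tot.upto_const (N := n) (i₀ := 0) (fun i s' =>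
    (∃ x < i, s2.arr 4 x = 0) → s'.reg 13 < n ∧ s2.arr 4 (s'.reg 13) = 0) 2
    rfl rfl (by simp) ?_ (by omega) hn ?_ (by simp)).mono ?_⟩
  · simp only [Store.reg_setReg, Nat.reduceEqDiff, if_false]
    exact (hk2.reg 0 rfl).trans ((hk1.reg 0 rfl).trans (by simp [h0]))
  · rintro i s3 - hi hI hk h11 -
    have e4 : s3.arr 4 = s2.arr 4 := hk.arr 4 rfl
    simp only [tot_set, tot_ite, tot_skip, fits_var, fits_get, fits_lit, eval_lit, eval_var, eval_get,
      true_and, h11, e4, Store.reg_setReg, Nat.reduceEqDiff, if_false, if_true]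
    refine ⟨by omega, fun h3 => ⟨fun _ => ⟨hi, by omega⟩, by omega⟩,
      fun h3 => ⟨fun ⟨x, hx, hx0⟩ => hI ⟨x, ?_, hx0⟩, by omega⟩⟩
    rcases Nat.lt_succ_iff_lt_or_eq.1 hx with hx | rfl
    · exact hx
    · omega
  rintro s3 t3 ⟨hI3, hk3, -, ht3⟩
  have huh' : ∀ i < m, s.arr 0 i = u → s.arr 3 (s.arr 1 i) = 1 := fun i hi hiu => by
    have := huh i hi hiu
    have := h01 _ (hG.head_lt i hi)
    omega
  obtain ⟨h3, h4⟩ := hI3 ⟨u, hu, (hI2 u hu).2 ⟨hu0, huh'⟩⟩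
  obtain ⟨h5, h6⟩ := (hI2 _ h3).1 h4
  exact ⟨h3, h5, h6, by omega⟩

/-- Add to the relation in array `2` the pairs that begin with `reg 13`, and mark this vertex. -/
def addVertexCmd : Cmd :=
  set 12 (lit 0) ;; upto 12 1 (
    ite ((get 0 (var 12) - var 13) + (var 13 - get 0 (var 12))) (lit 1)
      (set 14 (get 1 (var 12)) ;; extendCmd) skip) ;;
  put 3 (var 13) (lit 1)

/-- All out-neighbours of `u` are marked, so their rows are complete, and extending along each edge
that leaves `u` completes the row of `u`. Only these edges incur the linear cost; every other edge
costs a test. -/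
theorem addVertexCmd_spec {R : ℕ → ℕ → Prop} [IsStrictOrder ℕ R] {W n m u : ℕ} {s : Store}
    (hG : Generates R n m (s.arr 0) (s.arr 1)) (h1 : s.reg 1 = m) (hm : m < W) (hW : 3 ≤ W)
    (hnW : n * n < W) (hM : HasMatrix (fun x z => R x z ∧ s.arr 3 x = 1) n s) (h13 : s.reg 13 = u)
    (hu : u < n) (hu0 : s.arr 3 u = 0) (huh : ∀ i < m, s.arr 0 i = u → s.arr 3 (s.arr 1 i) = 1) :
    Tot W addVertexCmd s fun s' t => s'.arr 3 = Function.update (s.arr 3) u 1 ∧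
      HasMatrix (fun x z => R x z ∧ s'.arr 3 x = 1) n s' ∧
      t ≤ 4 * m + ((Finset.range m).filter fun i => s.arr 0 i = u).card * (5 * n + 4) + 3 := by
  have hnW' : n < W := lt_of_le_of_lt (Nat.le_mul_self n) hnW
  simp only [addVertexCmd, tot_seq, tot_set, fits_lit, eval_lit, true_and]
  refine ⟨by omega, (Tot.upto (N := m) (i₀ := 0) (fun i s' => HasMatrix (fun x z =>
      (R x z ∧ s.arr 3 x = 1) ∨ x = u ∧ ∃ j < i, s.arr 0 j = u ∧ (z = s.arr 1 j ∨ R (s.arr 1 j) z)) n s')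
    (fun i => 2 + if s.arr 0 i = u then 5 * n + 4 else 0)
    rfl rfl (by simp) (by simp [h1]) (by omega) hm ?_ ?_).mono ?_⟩
  · rintro i s1 - hi hI hk h12 -
    have e0 : s1.arr 0 = s.arr 0 := hk.arr 0 rfl
    have e1 : s1.arr 1 = s.arr 1 := hk.arr 1 rfl
    have e13 : s1.reg 13 = u := (hk.reg 13 rfl).trans (by simp [h13])
    have hti := hG.tail_lt i hi
    have hhi := hG.head_lt i hi
    simp only [tot_seq, tot_set, tot_ite, tot_skip, fits_var, fits_get, fits_lit, fits_add, fits_sub,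
      eval_lit, eval_var, eval_get, eval_add, eval_sub, true_and, h12, e0, e1, e13]
    refine ⟨by omega, by omega, fun h2 => ?_, fun h2 => ?_⟩
    · have hiu : s.arr 0 i = u := by omega
      set s2 := s1.setReg 14 (s.arr 1 i)
      refine (extendCmd_spec (s := s2) (R := R) (u := u) (h := s.arr 1 i) (hI.congr rfl rfl) e13
        (show (s1.setReg 14 (s.arr 1 i)).reg 14 = s.arr 1 i by simp) hu hhi ((hG.rel_iff _ _).2 ⟨i, hi, hiu, Or.inl rfl⟩) ?_
        (fun z hz => Or.inl ⟨hz, huh i hi hiu⟩) hnW hW).mono ?_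
      · rintro x z (h3 | ⟨rfl, j, hj, h4, h5⟩)
        · exact h3.1
        · exact (hG.rel_iff _ _).2 ⟨j, by omega, h4, h5⟩
      · rintro s2 t2 ⟨h3, h4⟩
        rw [if_pos hiu]
        refine ⟨(h3.congr_rel fun x _ z _ => ?_).congr (by simp) rfl, by omega⟩
        constructor
        · rintro ((h5 | ⟨h5, j, hj, h6⟩) | ⟨h5, h6⟩)
          · exact Or.inl h5
          · exact Or.inr ⟨h5, j, by omega, h6⟩
          · exact Or.inr ⟨h5, i, by omega, hiu, h6⟩
        · rintro (h5 | ⟨h5, j, hj, h6⟩)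
          · exact Or.inl (Or.inl h5)
          · rcases Nat.lt_succ_iff_lt_or_eq.1 hj with hj | rfl
            · exact Or.inl (Or.inr ⟨h5, j, hj, h6⟩)
            · exact Or.inr ⟨h5, h6.2⟩
    · have hiu : s.arr 0 i ≠ u := by omega
      rw [if_neg hiu]
      refine ⟨(hI.congr_rel fun x _ z _ => ?_).congr (by simp) rfl, by omega⟩
      refine or_congr_right (and_congr_right fun _ => ⟨fun ⟨j, hj, h6⟩ => ⟨j, by omega, h6⟩, ?_⟩)
      rintro ⟨j, hj, h6⟩
      rcases Nat.lt_succ_iff_lt_or_eq.1 hj with hj | rfl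
      · exact ⟨j, hj, h6⟩
      · exact absurd h6.1 hiu
  · refine (hM.congr_rel fun x _ z _ => ?_).congr (by simp) rfl
    simp
  rintro s1 t1 ⟨hI, hk, -, ht⟩
  have e13 : s1.reg 13 = u := (hk.reg 13 rfl).trans (by simp [h13])
  have e3 : s1.arr 3 = s.arr 3 := hk.arr 3 rfl
  simp only [tot_put, fits_var, fits_lit, eval_var, eval_lit, true_and, e13, Store.arr_setArr, if_true, e3]
  refine ⟨by omega, (hI.congr_rel fun x _ z _ => ?_).congr (by simp) rfl, ?_⟩
  · by_cases hxu : x = u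
    · subst hxu
      simp only [hu0, Function.update_self, and_true, true_and, zero_ne_one, and_false, false_or]
      exact (hG.rel_iff _ _).symm
    · simp [hxu]
  · have h2 : ∑ i ∈ Finset.Ico 0 m, ((2 + if s.arr 0 i = u then 5 * n + 4 else 0) + 2) =
        4 * m + ((Finset.range m).filter fun i => s.arr 0 i = u).card * (5 * n + 4) := by
      rw [← Finset.range_eq_Ico, Finset.sum_add_distrib, Finset.sum_add_distrib, ← Finset.sum_filter]
      simp only [Finset.sum_const, smul_eq_mul, Finset.card_range]
      omega
    omega

/-- Compute the comparison matrix of the transitive closure in array `2`. -/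
def closureCmd : Cmd :=
  set 10 (lit 0) ;; upto 10 0 (sinkCmd ;; addVertexCmd)

/-- Vertices are added in reverse topological order. The potential counts the edges with an unmarked
tail: each edge pays for one linear extension, namely when its tail is marked. Searching for the
next sink costs `O(n + m)` for each vertex. -/
theorem closureCmd_spec {R : ℕ → ℕ → Prop} [IsStrictOrder ℕ R] {W n m : ℕ} {s : Store}
    (hG : Generates R n m (s.arr 0) (s.arr 1)) (h0 : s.reg 0 = n) (h1 : s.reg 1 = m)
    (h2 : s.arr 2 = fun _ => 0) (h3 : s.arr 3 = fun _ => 0) (hm : m < W) (hnW : n * n < W)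
    (hW : 3 ≤ W) :
    Tot W closureCmd s fun s' t => HasMatrix R n s' ∧
      t ≤ m * (5 * n + 4) + n * (7 * n + 8 * m + 12) + 2 := by
  have hnW' : n < W := lt_of_le_of_lt (Nat.le_mul_self n) hnW
  simp only [closureCmd, tot_seq, tot_set, fits_lit, eval_lit, true_and]
  refine ⟨by omega, (Tot.upto_pot (N := n) (i₀ := 0) (fun i s' => (∀ x < n, s'.arr 3 x ≤ 1) ∧
      HasMatrix (fun x z => R x z ∧ s'.arr 3 x = 1) n s' ∧
      ((Finset.range n).filter fun x => s'.arr 3 x = 0).card + i = n)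
    (fun s' => ((Finset.range m).filter fun i => s'.arr 3 (s'.arr 0 i) = 0).card * (5 * n + 4))
    (7 * n + 8 * m + 10) (fun _ _ => rfl)
    rfl rfl (by simp) (by simp [h0]) (by omega) hnW' ?_ ?_).mono ?_⟩
  · rintro i s1 - hi ⟨h01, hM, hcard⟩ hk h10 hn
    have e0 : s1.arr 0 = s.arr 0 := hk.arr 0 rfl
    have e1 : s1.arr 1 = s.arr 1 := hk.arr 1 rfl
    have f1 : s1.reg 1 = m := (hk.reg 1 rfl).trans (by simp [h1])
    rw [← e0, ← e1] at hG
    have hU : ∃ x < n, s1.arr 3 x = 0 := by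
      have : 0 < ((Finset.range n).filter fun x => s1.arr 3 x = 0).card := by omega
      obtain ⟨x, hx⟩ := Finset.card_pos.1 this
      simp only [Finset.mem_filter, Finset.mem_range] at hx
      exact ⟨x, hx⟩
    simp only [tot_seq]
    refine (sinkCmd_spec hG hn f1 hnW' hm (by omega) h01 hU).frame.mono ?_
    rintro s2 t2 ⟨⟨k1, k2, k3, k4⟩, hk2⟩
    have e3 : s2.arr 3 = s1.arr 3 := hk2.arr 3 rfl
    have e0' : s2.arr 0 = s1.arr 0 := hk2.arr 0 rfl
    have e1' : s2.arr 1 = s1.arr 1 := hk2.arr 1 rfl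
    rw [← e0', ← e1'] at hG
    rw [← e0', ← e1', ← e3] at k3
    rw [← e3] at k2
    refine (addVertexCmd_spec (u := s2.reg 13) hG ((hk2.reg 1 rfl).trans f1) hm hW hnW ?_ rfl k1 k2
      k3).frame.mono ?_
    · rw [e3]
      exact hM.congr (hk2.reg 0 rfl) (hk2.arr 2 rfl)
    rintro s3 t3 ⟨⟨l1, l2, l3⟩, hk3⟩
    have e0'' : s3.arr 0 = s2.arr 0 := hk3.arr 0 rfl
    refine ⟨⟨fun x hx => ?_, l2.congr (by simp) rfl, ?_⟩, ?_⟩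
    · simp only [Store.arr_setReg, l1, e3]
      by_cases hxu : x = s2.reg 13
      · simp [hxu]
      · simpa [hxu] using h01 x hx
    · have : (Finset.range n).filter (fun x => s1.arr 3 x = 0) =
          insert (s2.reg 13) ((Finset.range n).filter fun x => s3.arr 3 x = 0) := by
        ext x
        by_cases hxu : x = s2.reg 13
        · rw [e3] at k2
          simp [hxu, k1, k2]
        · simp [l1, e3, hxu]
      rw [this, Finset.card_insert_of_notMem (by simp [l1])] at hcard
      change ((Finset.range n).filter fun x => s3.arr 3 x = 0).card + (i + 1) = n
      omega
    · have : (Finset.range m).filter (fun i => s1.arr 3 (s1.arr 0 i) = 0) =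
          (Finset.range m).filter (fun i => s3.arr 3 (s3.arr 0 i) = 0) ∪
          (Finset.range m).filter fun i => s2.arr 0 i = s2.reg 13 := by
        ext j
        simp only [Finset.mem_union, Finset.mem_filter, Finset.mem_range, ← and_or_left]
        refine and_congr_right fun _ => ?_
        rw [e0'', ← e0', l1, ← e3]
        by_cases hxu : s2.arr 0 j = s2.reg 13
        · simp [hxu, k2]
        · simp [hxu]
      rw [this, Finset.card_union_of_disjoint, add_mul]
      · omega
      · rw [Finset.disjoint_filter]
        rintro j - h4 h5
        rw [e0'', h5, l1, Function.update_self] at h4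
        simp at h4
  · simp only [Store.arr_setReg, h3]
    refine ⟨by simp, ⟨by simp [h0], fun x _ y _ => ?_⟩, by simp⟩
    simp [h2, cmp]
  · rintro s1 t1 ⟨⟨h01, hM, hcard⟩, hk, -, ht⟩
    have h4 : ((Finset.range n).filter fun x => s1.arr 3 x = 0).card = 0 := by omega
    rw [Finset.card_eq_zero, Finset.filter_eq_empty_iff] at h4
    refine ⟨hM.congr_rel fun x hx z _ => and_iff_left ?_, ?_⟩
    · have := h4 (Finset.mem_range.2 hx)
      have := h01 x hx
      omega
    · have h5 : ((Finset.range m).filter fun i => s.arr 3 (s.arr 0 i) = 0).card * (5 * n + 4) ≤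
          m * (5 * n + 4) :=
        Nat.mul_le_mul_right _ ((Finset.card_filter_le _ _).trans (by simp))
      have h6 : t1 ≤ ((Finset.range m).filter fun i => s.arr 3 (s.arr 0 i) = 0).card * (5 * n + 4) +
          n * (7 * n + 8 * m + 12) + 1 := (Nat.le_add_right _ _).trans ht
      omega

/-! ### Drawings -/

section Drawings
variable {V : Type*} {G : Digraph V}

theorem WeakDrawing.below_of_reaches {d : ℕ} (Γ : WeakDrawing G d) {u v : V} (h : Reaches G u v) :
    Γ.Below u v := fun D => by
  induction h with
  | single h => exact Γ.topological D _ _ h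
  | tail _ h ih => exact ih.trans (Γ.topological D _ _ h)

/-- `G` has an `e`-dimensional dominance drawing. -/
def HasDrawing (G : Digraph V) (e : ℕ) : Prop :=
  ∃ Γ : WeakDrawing G e, Γ.IsDominance

/-- The missing dimensions are copies of the last one, which exists because `e ≥ 1`. -/
theorem HasDrawing.mono {e d : ℕ} (h : HasDrawing G e) (he : 1 ≤ e) (hed : e ≤ d) : HasDrawing G d := by
  obtain ⟨Γ, hΓ⟩ := h
  have hlt : ∀ D : ℕ, min D (e - 1) < e := fun D => by omega
  refine ⟨⟨fun D => Γ.coord ⟨min D (e - 1), hlt D⟩, fun D => Γ.injective _,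
    fun D => Γ.topological _⟩, fun u v => ⟨fun h => (hΓ u v).1 fun D => ?_, fun h D =>
    Γ.below_of_reaches h _⟩⟩
  have := h ⟨D, D.2.trans_le hed⟩
  have hD : (⟨min (D : ℕ) (e - 1), hlt D⟩ : Fin e) = D := Fin.ext (by simp; omega)
  simpa [hD] using this

/-- By monotonicity, minimality has to be checked only at `d - 1`. Monotonicity fails to start at
zero, but a drawing without dimensions forces the vertex set to be empty, and then drawings exist in
every dimension. -/
theorem hasDominanceDimension_iff (hG : IsDAG G) {d : ℕ} (hd : 1 ≤ d) :
    HasDominanceDimension G d ↔ HasDrawing G d ∧ ¬ HasDrawing G (d - 1) := by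
  constructor
  · rintro ⟨h1, h2⟩
    refine ⟨h1, fun h => ?_⟩
    have := h2 h
    omega
  · rintro ⟨h1, h2⟩
    refine ⟨h1, fun e (he : HasDrawing G e) => ?_⟩
    by_contra! hlt
    rcases Nat.eq_zero_or_pos e with rfl | he0
    · obtain ⟨Γ, hΓ⟩ := he
      have : IsEmpty V := ⟨fun v => hG v ((hΓ v v).1 fun D => D.elim0)⟩
      exact h2 ⟨⟨fun _ => isEmptyElim, fun _ => isEmptyElim, fun _ => isEmptyElim⟩,
        isEmptyElim⟩
    · exact h2 (he.mono he0 (by omega))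

theorem not_hasDrawing_zero [Nonempty V] (hG : IsDAG G) : ¬ HasDrawing G 0 := fun ⟨_, hΓ⟩ =>
  hG (Classical.arbitrary V) ((hΓ _ _).1 fun D => D.elim0)

theorem hasDominanceDimension_zero_iff (hG : IsDAG G) : HasDominanceDimension G 0 ↔ IsEmpty V := by
  constructor
  · intro h
    by_contra hV
    rw [not_isEmpty_iff] at hV
    exact not_hasDrawing_zero hG h.1
  · intro hV
    exact ⟨⟨⟨fun _ => isEmptyElim, fun _ => isEmptyElim, fun _ => isEmptyElim⟩, isEmptyElim⟩,
      fun _ _ => Nat.zero_le _⟩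

variable [Fintype V]

-- The number of ancestors increases along edges, and an enumeration of the vertices breaks ties.
-- The existence of some weak drawing matters because the infimum over an empty set would also be
-- `0` in `minFips`.
open Classical in
theorem nonempty_weakDrawing (hG : IsDAG G) (d : ℕ) : Nonempty (WeakDrawing G d) := by
  let e := Fintype.equivFin V
  refine ⟨⟨fun _ v => (Finset.univ.filter fun w => Reaches G w v).card * Fintype.card V + e v,
    fun _ u v h => e.injective (Fin.ext (mul_add_inj (e u).2 (e v).2 h).2), fun _ u v h => ?_⟩⟩
  have hlt : (Finset.univ.filter fun w => Reaches G w u).card <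
      (Finset.univ.filter fun w => Reaches G w v).card := by
    refine Finset.card_lt_card ((Finset.ssubset_iff_of_subset fun w => ?_).2 ⟨u, ?_, ?_⟩)
    · simp only [Finset.mem_filter, Finset.mem_univ, true_and]
      exact fun hw => Relation.TransGen.tail hw h
    · simp only [Finset.mem_filter, Finset.mem_univ, true_and]
      exact Relation.TransGen.single h
    · simpa using hG u
  have h1 := Nat.mul_le_mul_right (Fintype.card V) (Nat.succ_le_of_lt hlt)
  rw [Nat.succ_mul] at h1
  have := (e u).2
  change _ < _
  omega

theorem minFips_eq_zero_iff (hG : IsDAG G) (d : ℕ) : minFips G d = 0 ↔ HasDrawing G d := by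
  have hfips : ∀ Γ : WeakDrawing G d, Γ.fips.ncard = 0 ↔ Γ.IsDominance := fun Γ => by
    rw [Set.ncard_eq_zero (Set.toFinite _), Set.eq_empty_iff_forall_notMem]
    constructor
    · intro h u v
      refine ⟨fun h1 => ?_, Γ.below_of_reaches⟩
      by_contra h2
      exact h (u, v) ⟨h1, h2⟩
    · rintro h ⟨u, v⟩ ⟨h1, h2⟩
      exact h2 ((h u v).1 h1)
  have := nonempty_weakDrawing hG d
  rw [minFips, Nat.sInf_eq_zero, or_iff_left (Set.range_nonempty _).ne_empty]
  simp only [Set.mem_range, hfips, HasDrawing]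

theorem hasDominanceDimension_iff_minFips (hG : IsDAG G) {d : ℕ} (hd : 1 ≤ d) :
    HasDominanceDimension G d ↔ minFips G d = 0 ∧ minFips G (d - 1) ≠ 0 := by
  rw [hasDominanceDimension_iff hG hd, Ne, minFips_eq_zero_iff hG, minFips_eq_zero_iff hG]

end Drawings

/-! ### The degrees of the modular decomposition tree -/

section Degree
variable {V : Type*} {G : Digraph V}

theorem isTreeNode_singleton (v : V) : IsTreeNode G {v} := by
  refine ⟨⟨Finset.singleton_nonempty v, fun v₁ h₁ v₂ h₂ => ?_⟩, fun N _ => ?_⟩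
  · rw [Finset.mem_singleton.1 h₁, Finset.mem_singleton.1 h₂]
    exact fun _ _ => ⟨Iff.rfl, Iff.rfl⟩
  · by_cases h : v ∈ N
    · exact Or.inl (Finset.singleton_subset_iff.2 h)
    · exact Or.inr (Or.inr (Finset.disjoint_singleton_left.2 h))

variable [Fintype V]

theorem isTreeNode_univ [Nonempty V] : IsTreeNode G Finset.univ :=
  ⟨⟨Finset.univ_nonempty, fun _ _ _ _ u hu => absurd (Finset.mem_univ u) hu⟩,
    fun N _ => Or.inr (Or.inl (Finset.subset_univ N))⟩

theorem exists_isChild {M : Finset V} (hM : 2 ≤ M.card) {v : V} (hv : v ∈ M) :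
    ∃ N, IsChild G M N ∧ v ∈ N := by
  have h : IsTreeNode G {v} ∧ {v} ⊂ M := by
    refine ⟨isTreeNode_singleton v, Finset.ssubset_iff_subset_ne.2
      ⟨Finset.singleton_subset_iff.2 hv, ?_⟩⟩
    rintro rfl
    simp at hM
  obtain ⟨N, hN, hN'⟩ := Set.Finite.exists_le_maximal
    (s := {N : Finset V | IsTreeNode G N ∧ N ⊂ M}) (Set.toFinite _) h
  exact ⟨N, hN', Finset.singleton_subset_iff.1 hN⟩

open Classical in
theorem card_children_le {M : Finset V} (hM : IsTreeNode G M) :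
    (Finset.univ.filter (IsChild G M)).card ≤ maxDegree G := by
  unfold maxDegree
  exact Finset.le_sup (f := fun M => (Finset.univ.filter (IsChild G M)).card) (by simpa using hM)

/-- Take a strong module of least size that contains `L`. Its elements lie in children; a child with
two elements of `L` would contain `L` by hypothesis and would be a smaller strong module. So
distinct elements of `L` lie in distinct children. -/
theorem card_le_maxDegree {L : Finset V} (hL : 2 ≤ L.card)
    (h : ∀ M, IsModule G M → ∀ a ∈ L, ∀ b ∈ L, a ∈ M → b ∈ M → a ≠ b → L ⊆ M) :
    L.card ≤ maxDegree G := by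
  classical
  obtain ⟨a, -⟩ := Finset.card_pos.1 (show 0 < L.card by omega)
  have : Nonempty V := ⟨a⟩
  obtain ⟨H, hH, hmin⟩ := ((Finset.univ : Finset (Finset V)).filter
    fun M => IsTreeNode G M ∧ L ⊆ M).exists_min_image Finset.card
    ⟨Finset.univ, by simp [isTreeNode_univ]⟩
  simp only [Finset.mem_filter, Finset.mem_univ, true_and] at hH hmin
  have hH2 := hL.trans (Finset.card_le_card hH.2)
  choose! f hf hvf using fun v (hv : v ∈ L) => exists_isChild (G := G) hH2 (hH.2 hv)
  refine le_trans (Finset.card_le_card_of_injOn f (fun v hv => ?_) fun a ha b hb hab => ?_)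
    (card_children_le hH.1)
  · simpa using hf v hv
  · by_contra hne
    have hN := (hf a ha).1
    have hsub := h _ hN.1.1 a ha b hb (hvf a ha) (hab ▸ hvf b hb) hne
    exact absurd (hmin _ ⟨hN.1, hsub⟩) (not_le.2 (Finset.card_lt_card hN.2))

/-- Any two vertices satisfy the hypothesis of `card_le_maxDegree` trivially. -/
theorem two_le_maxDegree (hV : 2 ≤ Fintype.card V) : 2 ≤ maxDegree G := by
  classical
  obtain ⟨L, -, hL⟩ := Finset.exists_subset_card_eq (s := (Finset.univ : Finset V)) (n := 2) (by simpa)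
  obtain ⟨x, y, hxy, rfl⟩ := Finset.card_eq_two.1 hL
  rw [← hL]
  refine card_le_maxDegree hL.ge fun M _ a ha b hb haM hbM hab => ?_
  simp only [Finset.mem_insert, Finset.mem_singleton] at ha hb
  intro z hz
  simp only [Finset.mem_insert, Finset.mem_singleton] at hz
  grind

/-- The complement of `z` is a module. A strong module that contains `z` must not overlap it, so it
is `{z}` or the whole vertex set. -/
theorem isChild_of_isolated (hV : 2 ≤ Fintype.card V) {z : V}
    (hz : ∀ u, ¬ G.Adj z u ∧ ¬ G.Adj u z) : IsChild G Finset.univ {z} := by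
  classical
  have hr : ∀ u, ¬ Reaches G z u ∧ ¬ Reaches G u z := fun u => by
    constructor
    · intro h
      obtain ⟨w, hw, -⟩ := Relation.TransGen.head'_iff.1 h
      exact (hz w).1 hw
    · intro h
      obtain ⟨w, -, hw⟩ := Relation.TransGen.tail'_iff.1 h
      exact (hz w).2 hw
  refine ⟨⟨isTreeNode_singleton z, Finset.ssubset_iff_subset_ne.2 ⟨Finset.subset_univ _, ?_⟩⟩,
    fun N hN hzN => ?_⟩
  · intro h
    have := congrArg Finset.card h
    simp at this
    omega
  · have hzN' : z ∈ N := Finset.singleton_subset_iff.1 hzN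
    have hm : IsModule G (Finset.univ.erase z) := by
      refine ⟨Finset.card_pos.1 ?_, fun v₁ _ v₂ _ u hu => ?_⟩
      · rw [Finset.card_erase_of_mem (Finset.mem_univ z), Finset.card_univ]
        omega
      · obtain rfl : u = z := by simpa using hu
        simp [hr]
    rcases hN.1.2 _ hm with h | h | h
    · exact absurd (h hzN') (Finset.notMem_erase z _)
    · refine absurd (Finset.eq_univ_iff_forall.2 fun w => ?_) hN.2.ne
      by_cases hw : w = z
      · exact hw ▸ hzN'
      · exact h (Finset.mem_erase.2 ⟨hw, Finset.mem_univ w⟩)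
    · intro w hw
      by_contra hwz
      exact Finset.disjoint_left.1 h hw
        (Finset.mem_erase.2 ⟨fun h' => hwz (Finset.mem_singleton.2 h'), Finset.mem_univ w⟩)

/-- A vertex is an end of one of the `m` edges, which accounts for at most `2 m` vertices, or
isolated; isolated vertices are distinct children of the root. -/
theorem card_le_edges_add_maxDegree (hV : 2 ≤ Fintype.card V) {es : List (V × V)}
    (hes : ∀ u v, G.Adj u v → (u, v) ∈ es) : Fintype.card V ≤ 2 * es.length + maxDegree G := by
  classical
  have : Nonempty V := Fintype.card_pos_iff.1 (by omega)
  have h1 : (Finset.univ : Finset V) ⊆ (es.map Prod.fst ++ es.map Prod.snd).toFinset ∪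
      Finset.univ.filter fun z => ∀ u, ¬ G.Adj z u ∧ ¬ G.Adj u z := by
    intro z _
    by_cases hz : ∀ u, ¬ G.Adj z u ∧ ¬ G.Adj u z
    · exact Finset.mem_union_right _ (by simpa using hz)
    · push Not at hz
      obtain ⟨u, hu⟩ := hz
      refine Finset.mem_union_left _ ?_
      simp only [List.mem_toFinset, List.mem_append, List.mem_map]
      by_cases h : G.Adj z u
      · exact Or.inl ⟨_, hes _ _ h, rfl⟩
      · exact Or.inr ⟨_, hes _ _ (hu h), rfl⟩
  have h2 := (Finset.card_le_card h1).trans (Finset.card_union_le _ _)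
  have h3 := List.toFinset_card_le (es.map Prod.fst ++ es.map Prod.snd)
  have h4 : (Finset.univ.filter fun z => ∀ u, ¬ G.Adj z u ∧ ¬ G.Adj u z).card ≤ maxDegree G := by
    refine le_trans (Finset.card_le_card_of_injOn (fun z => {z}) (fun z hz => ?_)
      fun a _ b _ hab => Finset.singleton_injective hab) (card_children_le (G := G) isTreeNode_univ)
    simpa using isChild_of_isolated hV (by simpa using hz)
  simp only [Finset.card_univ, List.length_append, List.length_map] at h2 h3
  omega

end Degree

/-! ### The program -/

section Rel
variable {n : ℕ} {G : Digraph (Fin n)}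

/-- The reachability relation, on natural numbers. -/
def reachRel (G : Digraph (Fin n)) (x y : ℕ) : Prop :=
  ∃ (hx : x < n) (hy : y < n), Reaches G ⟨x, hx⟩ ⟨y, hy⟩

theorem reachRel_coe {u v : Fin n} : reachRel G u v ↔ Reaches G u v :=
  ⟨fun ⟨_, _, h⟩ => h, fun h => ⟨u.2, v.2, h⟩⟩

theorem IsDAG.isStrictOrder (hG : IsDAG G) : IsStrictOrder ℕ (reachRel G) where
  irrefl := fun _ ⟨_, _, h⟩ => hG _ h
  trans := fun _ _ _ ⟨hx, _, h⟩ ⟨_, hz, h'⟩ => ⟨hx, hz, Relation.TransGen.trans h h'⟩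

/-- The coordinates of a realizer increase along edges automatically, since edges are paths. -/
theorem realizable_reachRel (e : ℕ) : Realizable (reachRel G) e {x | x < n} ↔ HasDrawing G e := by
  constructor
  · rintro ⟨c, hc, h⟩
    have h' : ∀ u v : Fin n, (∀ D, c D u < c D v) ↔ Reaches G u v := fun u v =>
      (h u u.2 v v.2).symm.trans reachRel_coe
    exact ⟨⟨fun D v => c D v, fun D u v huv => Fin.ext (hc D u.2 v.2 huv),
      fun D u v huv => (h' u v).2 (Relation.TransGen.single huv) D⟩, h'⟩
  · rintro ⟨Γ, hΓ⟩
    refine ⟨fun D x => if hx : x < n then Γ.coord D ⟨x, hx⟩ else 0, fun D x hx y hy hxy => ?_,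
      fun x hx y hy => ?_⟩
    · simp only [Set.mem_ofPred_eq] at hx hy
      simp only [hx, hy, dif_pos] at hxy
      exact congrArg Fin.val (Γ.injective D hxy)
    · simp only [Set.mem_ofPred_eq] at hx hy
      simp only [hx, hy, dif_pos]
      rw [show reachRel G x y ↔ Reaches G ⟨x, hx⟩ ⟨y, hy⟩ from reachRel_coe (u := ⟨x, hx⟩) (v := ⟨y, hy⟩)]
      exact (hΓ _ _).symm

theorem generates_inputStore {es : List (Fin n × Fin n)} (hes : ListsEdges G es) :
    Generates (reachRel G) n es.length ((inputStore n es).arr 0) ((inputStore n es).arr 1) := by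
  have h0 : ∀ i (hi : i < es.length), (inputStore n es).arr 0 i = es[i].1 := fun i hi => by
    simp [inputStore, hi]
  have h1 : ∀ i (hi : i < es.length), (inputStore n es).arr 1 i = es[i].2 := fun i hi => by
    simp [inputStore, hi]
  refine ⟨fun i hi => h0 i hi ▸ Fin.is_lt _, fun i hi => h1 i hi ▸ Fin.is_lt _, fun x y => ?_⟩
  constructor
  · rintro ⟨hx, hy, h⟩
    obtain ⟨w, hw, hwy⟩ := Relation.TransGen.head'_iff.1 h
    obtain ⟨i, hi, hiw⟩ := List.mem_iff_getElem.1 ((hes.2 _ _).2 hw)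
    refine ⟨i, hi, by rw [h0 i hi, hiw], ?_⟩
    rw [h1 i hi, hiw]
    rcases Relation.reflTransGen_iff_eq_or_transGen.1 hwy with h2 | h2
    · exact Or.inl (congrArg Fin.val h2)
    · exact Or.inr ⟨w.2, hy, h2⟩
  · rintro ⟨i, hi, rfl, h⟩
    have hadj : G.Adj es[i].1 es[i].2 := (hes.2 _ _).1 (List.getElem_mem hi)
    rw [h1 i hi] at h
    rw [h0 i hi]
    rcases h with rfl | h
    · exact reachRel_coe.2 (Relation.TransGen.single hadj)
    · obtain ⟨_, hy, h⟩ := h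
      exact ⟨Fin.is_lt _, hy, Relation.TransGen.head hadj h⟩

theorem mod_of_isModule (hG : IsDAG G) {M : Finset (Fin n)} (hM : IsModule G M) :
    Mod (reachRel G) {x | x < n} ((↑) '' (M : Set (Fin n))) := by
  have := hG.isStrictOrder
  refine ⟨fun x => ?_, fun a ha b hb z hz hzM => ?_⟩
  · rintro ⟨v, -, rfl⟩
    exact v.2
  · obtain ⟨a, ha, rfl⟩ := ha
    obtain ⟨b, hb, rfl⟩ := hb
    have h := hM.2 a ha b hb ⟨z, hz⟩ fun h => hzM ⟨_, h, rfl⟩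
    have h1 := reachRel_coe (G := G) (u := ⟨z, hz⟩) (v := a)
    have h2 := reachRel_coe (G := G) (u := ⟨z, hz⟩) (v := b)
    have h3 := reachRel_coe (G := G) (u := a) (v := ⟨z, hz⟩)
    have h4 := reachRel_coe (G := G) (u := b) (v := ⟨z, hz⟩)
    exact cmp_congr (h1.trans (h.2.trans h2.symm))
      (h3.trans (h.1.trans h4.symm))

/-- Modules of `G` become modules of the relation on natural numbers, so tightness supplies the
hypothesis of `card_le_maxDegree`. Sets with fewer than two elements are covered by
`two_le_maxDegree`. -/
theorem Tight.card_le (hG : IsDAG G) (hn : 2 ≤ n) {r : ℕ} {f : ℕ → ℕ} (hf : ∀ j < r, f j < n)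
    (hinj : Set.InjOn f (Set.Iio r)) (h : Tight (reachRel G) {x | x < n} (f '' Set.Iio r)) :
    r ≤ maxDegree G := by
  classical
  rcases Nat.lt_or_ge r 2 with hr | hr
  · have := two_le_maxDegree (G := G) (by simpa using hn)
    omega
  let L : Finset (Fin n) := Finset.univ.filter fun v => (v : ℕ) ∈ f '' Set.Iio r
  have hL : L.card = r := by
    have : L.image Fin.val = (Finset.range r).image f := by
      ext x
      simp only [L, Finset.mem_image, Finset.mem_filter, Finset.mem_univ, true_and, Set.mem_image,
        Set.mem_Iio, Finset.mem_range]
      constructor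
      · rintro ⟨v, h, rfl⟩
        exact h
      · rintro ⟨j, hj, rfl⟩
        exact ⟨⟨f j, hf j hj⟩, ⟨j, hj, rfl⟩, rfl⟩
    rw [← Finset.card_image_of_injective L Fin.val_injective, this, Finset.card_image_of_injOn,
      Finset.card_range]
    simpa using hinj
  rw [← hL]
  refine card_le_maxDegree (hL ▸ hr) fun M hM a ha b hb haM hbM hab => fun v hv => ?_
  simp only [L, Finset.mem_filter, Finset.mem_univ, true_and] at ha hb hv
  obtain ⟨w, hw, hwv⟩ := h _ (mod_of_isModule hG hM) a ha b hb ⟨a, haM, rfl⟩ ⟨b, hbM, rfl⟩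
    (fun h => hab (Fin.ext h)) hv
  exact Fin.ext hwv ▸ hw

end Rel

/-! ### The decision procedure and its running time -/

/-- Decide whether the dominance dimension is `d`, for `d ≥ 1`. -/
def dimensionCmd (d : ℕ) : Cmd :=
  ite (var 0) (lit 2)
    -- Without vertices the dimension is `0`, and register `0` already holds the answer `0` for `d ≥
    -- 1`. With one vertex the dimension is `1`, and `2 - d` is `1` for `d = 1` and `0` for larger
    -- `d`.
    (ite (var 0) (lit 1) skip (set 0 (lit (2 - d))))
    (closureCmd ;; decomposeCmd ;; answerCmd d)

/-- With `b = n + m + 2 ≥ 2`, the power `b ^ d ≥ d + 1` absorbs the factor `d`, and `b ^ 4` leaves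
room for `n * n` and the linear terms. -/
theorem word_bounds {n m d : ℕ} : (n + m + 2) ^ (d + 4) ≥ 16 ∧ n * n < (n + m + 2) ^ (d + 4) ∧
    m < (n + m + 2) ^ (d + 4) ∧ 3 * n < (n + m + 2) ^ (d + 4) ∧
    d * n + n + 1 < (n + m + 2) ^ (d + 4) ∧ d < (n + m + 2) ^ (d + 4) := by
  set b := n + m + 2 with hb
  have hb2 : 2 ≤ b := by omega
  have h1 : d + 1 ≤ b ^ d := Nat.lt_pow_self hb2
  have h2 : b ^ (d + 4) = b ^ d * (b * b * (b * b)) := by ring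
  have h3 : 4 ≤ b * b := Nat.mul_le_mul hb2 hb2
  have h4 : (d + 1) * (b * b * 4) ≤ b ^ (d + 4) := by
    rw [h2]
    exact Nat.mul_le_mul h1 (Nat.mul_le_mul_left _ h3)
  have h5 : 1 * (b * b * 4) ≤ (d + 1) * (b * b * 4) := Nat.mul_le_mul_right _ (by omega)
  have h6 : n * n ≤ b * b := Nat.mul_le_mul (by omega) (by omega)
  have h7 : 2 * b ≤ b * b := Nat.mul_le_mul_right _ hb2
  have h8 : (d + 1) * (n + 1) ≤ (d + 1) * (b * b * 4) := Nat.mul_le_mul_left _ (by omega)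
  have h9 : (d + 1) * 1 ≤ (d + 1) * (b * b * 4) := Nat.mul_le_mul_left _ (by omega)
  have h10 : (d + 1) * (n + 2) ≤ (d + 1) * (b * b * 4) := Nat.mul_le_mul_left _ (by omega)
  have h11 : (d + 1) * (n + 2) = d * n + n + (2 * d + 2) := by ring
  exact ⟨by omega, by omega, by omega, by omega, by omega, by omega⟩

theorem dimensionCmd_spec {n d : ℕ} {G : Digraph (Fin n)} (hG : IsDAG G) {es : List (Fin n × Fin n)}
    (hes : ListsEdges G es) (hd : 1 ≤ d) :
    Tot ((n + es.length + 2) ^ (d + 4)) (dimensionCmd d) (inputStore n es) fun s' t =>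
      (HasDominanceDimension G d → s'.reg 0 = 1) ∧ (¬ HasDominanceDimension G d → s'.reg 0 = 0) ∧
      t ≤ 800 * (n * es.length + n * d * maxDegree G ^ 2 * (Nat.factorial (maxDegree G)) ^ d + 1) := by
  have hR := hG.isStrictOrder
  obtain ⟨hW16, hnW, hmW, h3nW, hdnW, hdW⟩ := word_bounds (n := n) (m := es.length) (d := d)
  set W := (n + es.length + 2) ^ (d + 4) with hWdef
  set m := es.length with hm
  have hr0 : (inputStore n es).reg 0 = n := rfl
  rw [hasDominanceDimension_iff hG hd]
  simp only [dimensionCmd, tot_ite, tot_seq, tot_set, tot_skip, fits_var, fits_lit, eval_var, eval_lit,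
    true_and, hr0, Store.reg_setReg, if_true]
  refine ⟨by omega, fun hn2 => ⟨by omega, fun hn1 => ?_, fun hn1 => ⟨by omega, ?_⟩⟩, fun hn2 => ?_⟩
  · obtain rfl : n = 0 := by omega
    have hE : ∀ e, HasDrawing G e := fun e =>
      ⟨⟨fun _ => isEmptyElim, fun _ => isEmptyElim, fun _ => isEmptyElim⟩, isEmptyElim⟩
    exact ⟨fun h => absurd (hE _) h.2, fun _ => rfl, by omega⟩
  · obtain rfl : n = 1 := by omega
    have h1 : HasDrawing G 1 := ⟨⟨fun _ _ => 0, fun _ _ _ _ => Subsingleton.elim _ _,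
      fun _ u v h => absurd (Relation.TransGen.single h) (Subsingleton.elim u v ▸ hG u)⟩,
      fun u v => iff_of_false (fun h => absurd (h 0) (lt_irrefl _)) (Subsingleton.elim u v ▸ hG u)⟩
    refine ⟨fun h => ?_, fun h => ?_, by omega⟩
    · rcases Nat.lt_or_ge 1 d with hd1 | hd1
      · exact absurd (h1.mono le_rfl (by omega)) h.2
      · omega
    · rcases Nat.lt_or_ge 1 d with hd1 | hd1
      · omega
      · obtain rfl : d = 1 := by omega
        exact absurd ⟨h1, not_hasDrawing_zero hG⟩ h
  · have hcard : 2 ≤ Fintype.card (Fin n) := by simpa using by omega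
    have hk2 := two_le_maxDegree (G := G) hcard
    have hnk := card_le_edges_add_maxDegree hcard fun u v => (hes.2 u v).2
    set k := maxDegree G with hk
    rw [Fintype.card_fin] at hnk
    have : Nonempty (Fin n) := ⟨⟨0, by omega⟩⟩
    refine (closureCmd_spec (n := n) (m := m) (generates_inputStore hes) rfl rfl rfl rfl hmW hnW
      (by omega)).mono ?_
    rintro s1 t1 ⟨hM, ht1⟩
    refine (decomposeCmd_spec hM (by omega) hnW h3nW (by omega)).frame.mono ?_
    rintro s2 t2 ⟨⟨hV, k0, k6, k7, hreal, ht2⟩, hk2⟩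
    refine (answerCmd_spec (k := k) (hM.congr (k0.trans hM.n_eq.symm) (hk2.arr 2 rfl)) hV hd (by omega)
      (fun l hl => ?_) hnW hdnW hdW (by omega) (by omega) k6 (by omega)).mono ?_
    · refine Tight.card_le hG (by omega) (f := fun j => s2.arr 11 (s2.arr 12 l + j)) (fun j hj => ?_)
        (hV.injOn hl) (levelSet_eq_image ▸ hV.tight l hl)
      have := hV.le_last (l + 1) hl
      exact hV.lt _ (by omega)
    rintro s3 t3 ⟨l1, l2, l3⟩
    rw [← hreal d hd, realizable_reachRel] at l1 l2
    have hcond : (2 ≤ d ∧ ∀ l < s2.reg 6, Realizable (reachRel G) (d - 1) (levelSet s2 l)) ↔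
        HasDrawing G (d - 1) := by
      rcases Nat.lt_or_ge 1 d with hd1 | hd1
      · rw [← hreal (d - 1) (by omega), realizable_reachRel]
        exact and_iff_right hd1
      · obtain rfl : d = 1 := by omega
        exact iff_of_false (by omega) (not_hasDrawing_zero hG)
    rw [hcond] at l1 l2
    refine ⟨l1, l2, ?_⟩
    -- Because `d` and `k` are positive, a summand `n * k` is covered by the cost of the search.
    have e1 : k ≤ d * k ^ 2 * (Nat.factorial k) ^ d := by
      calc k = 1 * (k * 1) * 1 := by ring
        _ ≤ d * k ^ 2 * (Nat.factorial k) ^ d := by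
          rw [sq]
          exact Nat.mul_le_mul (Nat.mul_le_mul hd (Nat.mul_le_mul_left _ (by omega)))
            (Nat.pow_pos (Nat.factorial_pos k))
    have e2 := Nat.mul_le_mul_left n e1
    have e3 : n * (d * k ^ 2 * (Nat.factorial k) ^ d) = n * d * k ^ 2 * (Nat.factorial k) ^ d := by ring
    rw [e3] at e2
    -- The quadratic costs of the closure and the decomposition are absorbed here: `n * n ≤ 2 * (n *
    -- m) + n * k`.
    have e4 := Nat.mul_le_mul_left n hnk
    have e5 : n * (2 * m + k) = 2 * (n * m) + n * k := by ring
    rw [e5] at e4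
    have e6 : m * (5 * n + 4) + n * (7 * n + 8 * m + 12) = 13 * (n * m) + 4 * m + 7 * (n * n) + 12 * n := by
      ring
    have e7 : 2 * m ≤ n * m := Nat.mul_le_mul_right _ (by omega)
    have e8 : 2 * n ≤ n * n := Nat.mul_le_mul_right _ (by omega)
    generalize n * d * k ^ 2 * (Nat.factorial k) ^ d = X at *
    omega

/-- Decide whether there are no vertices. -/
def emptyCmd : Cmd :=
  ite (var 0) (lit 1) (set 0 (lit 1)) (set 0 (lit 0))

theorem sim_inputStore {n c : ℕ} (hc : 1 ≤ c) (es : List (Fin n × Fin n)) :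
    Sim ((n + es.length + 2) ^ c) (inputStore n es) (inputStore n es) := by
  have hW : n + es.length + 2 ≤ (n + es.length + 2) ^ c := Nat.le_self_pow (by omega) _
  have hlt : ∀ (f : Fin n × Fin n → Fin n) i,
      (es.map fun e => (f e : ℕ)).getD i 0 < n + es.length + 2 := by
    intro f i
    rw [List.getD_eq_getElem?_getD, List.getElem?_map]
    cases es[i]? with
    | none => simp
    | some e =>
      change (f e : ℕ) < _
      omega
  refine ⟨fun _ _ => rfl, rfl, rfl, fun x => ?_, fun a i => ?_⟩
  · match x with
    | 0 => change n < _; omega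
    | 1 => change es.length < _; omega
    | x + 2 => change 0 < _; omega
  · match a with
    | 0 => exact (hlt Prod.fst i).trans_le hW
    | 1 => exact (hlt Prod.snd i).trans_le hW
    | a + 2 => change 0 < _; omega

theorem decides_of_tot {c : Cmd} {b : ℕ} {Q : ∀ {n : ℕ}, Digraph (Fin n) → Prop} {T T' : ℕ → ℕ → ℕ → ℕ}
    (hw : c.wf) (hb : 1 ≤ b) (hT : ∀ n m k, 50 * T n m k ≤ T' n m k)
    (h : ∀ (n : ℕ) (G : Digraph (Fin n)), IsDAG G → ∀ es : List (Fin n × Fin n), ListsEdges G es →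
      Tot ((n + es.length + 2) ^ b) c (inputStore n es) fun s' t =>
        (Q G → s'.reg 0 = 1) ∧ (¬ Q G → s'.reg 0 = 0) ∧ t ≤ T n es.length (maxDegree G)) :
    Decides c.code b Q T' := by
  intro n G hG es hes
  obtain ⟨s, t, hc, h1, h2, h3⟩ := h n G hG es hes
  obtain ⟨s₁, t₁, k1, k2, k3⟩ := Cmd.code_correct hc hw (sim_inputStore hb es)
  refine ⟨s₁, t₁, k1, k3.trans ((Nat.mul_le_mul_left 50 h3).trans (hT _ _ _)), ?_⟩
  rw [k2.reg 0 (by omega)]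
  exact ⟨h1, h2⟩

theorem decides_dimension (d : ℕ) : ∃ (P : Prog) (c : ℕ),
    Decides P c (fun G => HasDominanceDimension G d)
      (fun n m k => 40000 * (n * m + n * d * k ^ 2 * (Nat.factorial k) ^ d + 1)) := by
  rcases Nat.eq_zero_or_pos d with rfl | hd
  -- Dimension zero means that there are no vertices, which is tested in constant time. For `d ≥ 1`
  -- the constant `40000` is `50 * 800`, where `50` comes from the translation to the word RAM.
  · refine ⟨emptyCmd.code, 1, decides_of_tot (T := fun _ _ _ => 2) rfl le_rfl ?_ ?_⟩
    · intro n m k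
      omega
    · intro n G hG es hes
      have hr0 : (inputStore n es).reg 0 = n := rfl
      rw [hasDominanceDimension_zero_iff hG]
      simp only [emptyCmd, tot_ite, tot_set, fits_var, fits_lit, eval_var, eval_lit, true_and, hr0,
        Store.reg_setReg, if_true, pow_one]
      refine ⟨by omega, fun hn => ⟨by omega, fun _ => trivial, fun h => ?_, le_rfl⟩,
        fun hn => ⟨by omega, fun h => ?_, fun _ => trivial, le_rfl⟩⟩
      · obtain rfl : n = 0 := by omega
        exact absurd (inferInstance : IsEmpty (Fin 0)) h
      · exact (h.false ⟨0, by omega⟩).elim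
  · refine ⟨(dimensionCmd d).code, d + 4, decides_of_tot
      (T := fun n m k => 800 * (n * m + n * d * k ^ 2 * (Nat.factorial k) ^ d + 1)) rfl (by omega) ?_
      fun n G hG es hes => dimensionCmd_spec hG hes hd⟩
    intro n m k
    omega

end DomDim

theorem mainTheorem2 :
    (∃ C : ℕ, ∀ d : ℕ, ∃ (P : DomDim.Prog) (c : ℕ),
      DomDim.Decides P c (fun G => DomDim.HasDominanceDimension G d)
        (fun n m k => C * (n * m + n * d * k ^ 2 * (Nat.factorial k) ^ d + 1))) ∧
    (∃ (C : ℕ) (P : DomDim.Prog) (c : ℕ),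
      DomDim.Decides P c (fun G => DomDim.HasDominanceDimension G 3)
        (fun n m k => C * (n * m + n * k ^ 2 * (Nat.factorial k) ^ 3 + 1))) ∧
    (∀ (V : Type) [Fintype V] (G : Digraph V), DomDim.IsDAG G → ∀ d : ℕ, 1 ≤ d →
      (DomDim.HasDominanceDimension G d ↔
        DomDim.minFips G d = 0 ∧ DomDim.minFips G (d - 1) ≠ 0)) := by
  refine ⟨⟨40000, DomDim.decides_dimension⟩, ?_, fun V _ G hG d hd =>
    DomDim.hasDominanceDimension_iff_minFips hG hd⟩
  obtain ⟨P, c, h⟩ := DomDim.decides_dimension 3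
  -- The constant `120000 = 3 * 40000` absorbs the factor `d = 3`.
  refine ⟨120000, P, c, fun n G hG es hes => ?_⟩
  obtain ⟨s, t, h1, h2, h3⟩ := h n G hG es hes
  refine ⟨s, t, h1, h2.trans ?_, h3⟩
  have : n * 3 * DomDim.maxDegree G ^ 2 * (Nat.factorial (DomDim.maxDegree G)) ^ 3 =
      3 * (n * DomDim.maxDegree G ^ 2 * (Nat.factorial (DomDim.maxDegree G)) ^ 3) := by ring
  beta_reduce
  rw [this]
  generalize n * DomDim.maxDegree G ^ 2 * (Nat.factorial (DomDim.maxDegree G)) ^ 3 = X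
  omega
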